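/- **Analytic data.** Fix a finite ordered list of singular points $p_1,\dots,p_r$ with prescribed Katz invariants and consider rank 2 differential modules on $\mathbb P^1$ with trivial second exterior power; all solution spaces get unimodular bases. The affine variety $AnalyticData$ consists of: (i) at a regular singular point (Katz invariant $0$) a matrix $\gamma_j\in SL_2(\mathbb C)$, and $top_j=\gamma_j$; (ii) at an unramified irregular point of Katz invariant $k\in\mathbb Z_{\ge1}$, with eigenvalues $\pm q$, a formal monodromy $\gamma_j=\mathrm{diag}(\alpha,\alpha^{-1})$ on a basis of $V(p_j)=V_q\oplus V_{-q}$ and $2k$ Stokes constants $c_1,\dots,c_{2k}$; (iii) at a ramified point of Katz invariant $k\in\frac12+\mathbb Z_{\ge0}$ the formal monodromy $\gamma_j=\begin{pmatrix}0&-1\\1&0\end{pmatrix}$ on a normalised basis and $2k$ Stokes constants $c_1,\dots,c_{2k}$; in cases (ii), (iii) $top_j=\gamma_j\begin{pmatrix}1&0\\c_1&1\end{pmatrix}\begin{pmatrix}1&c_2\\0&1\end{pmatrix}\begin{pmatrix}1&0\\c_3&1\end{pmatrix}\cdots$ ($2k$ Stokes factors); (iv) links $L_j\in SL_2(\mathbb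 C)$, $L_j:W\to V(p_j)$; subject to $\prod_{j=1}^r L_j^{-1}top_jL_j=1$. The group $G$ of unimodular base changes of $W$ and of the $V(p_j)$ (arbitrary at regular singular points, preserving $V_q\oplus V_{-q}$ at unramified irregular points, trivial at ramified points, where the basis is normalised) acts on it. The monodromy space is the categorical quotient $\mathcal R=AnalyticData/\!/G$, i.e. the affine variety whose coordinate ring is the ring of $G$-invariant regular functions. It is mapped to a parameter space $\mathcal P$ by traces $s$ (or $a$) of monodromies at regular singular points and eigenvalues $\alpha,\beta$ (for PV $s_3$, for PIV $s_2$) of formal monodromies at unramified irregular points. Analytic data are *reducible* if some line in $W$ is mapped by every $L_j$ to a line that is stable under $\gamma_j$ and the Stokes maps and, at an irregular point, is one of $V_q,V_{-q}$. They are *resonant* if at some regular singular point the trace of the monodromy is $\pm2$ (local exponents $\pm\theta/2$ with $\theta\in\mathbb Z$). **Theorem.** For each of the ten families below (Katz invariants at the singular points $0,1,\infty,t$; "$-$": not singular), $\mathcal R$ is isomorphic over $\mathcal P$ to the family $F=0$ of affine surfaces in $\mathbb C^3\times\mathcal P$; that is, $\mathbb C[\mathcal P][x_1,x_2,x_3]/(F)$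 is the ring of invariants, by explicit invariant functions $x_i$: * PVI $(0,0,0,0)$: $x_1x_2x_3+x_1^2+x_2^2+x_3^2-s_1x_1-s_2x_2-s_3x_3+s_4$, $s_i=a_ia_4+a_ja_k$ for cyclic $(i,j,k)$, $s_4=a_1a_2a_3a_4+\sum a_i^2-4$, $(a_1,\dots,a_4)\in\mathcal P=\mathbb C^4$; * PV $(0,0,1)$: $x_1x_2x_3+x_1^2+x_2^2-(s_1+s_2s_3)x_1-(s_2+s_1s_3)x_2-s_3x_3+s_3^2+s_1s_2s_3+1$, $s_1,s_2\in\mathbb C$, $s_3\in\mathbb C^*$; * PV$_{deg}$ $(0,0,1/2)$: $x_1x_2x_3+x_1^2+x_2^2+s_0x_1+s_1x_2+1$, $s_0,s_1\in\mathbb C$; * PIII(D6) $(1,-,1)$: $x_1x_2x_3+x_1^2+x_2^2+(1+\alpha\beta)x_1+(\alpha+\beta)x_2+\alpha\beta$, $\alpha,\beta\in\mathbb C^*$; * PIII(D7) $(1/2,-,1)$: $x_1x_2x_3+x_1^2+x_2^2+\alpha x_1+x_2$, $\alpha\in\mathbb C^*$; * PIII(D8) $(1/2,-,1/2)$: $x_1x_2x_3+x_1^2-x_2^2-1$;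 * PIV $(0,-,2)$: $x_1x_2x_3+x_1^2-(s_2^2+s_1s_2)x_1-s_2^2x_2-s_2^2x_3+s_2^2+s_1s_2^3$, $s_1\in\mathbb C$, $s_2\in\mathbb C^*$; * PIIFN $(0,-,3/2)$: $x_1x_2x_3+x_1-x_2+x_3+s$, $s\in\mathbb C$; * PII $(-,-,3)$: $x_1x_2x_3-x_1-\alpha x_2-x_3+\alpha+1$, $\alpha\in\mathbb C^*$; * PI $(-,-,5/2)$: $x_1x_2x_3+x_1+x_2+1$. Every fibre is an affine cubic surface whose part at infinity is the triangle $x_1x_2x_3=0$. For all ten families, the fibre over $p\in\mathcal P$ is singular if and only if $p$ is the parameter of some resonant or some reducible analytic data. For the nine families other than PVI, the singular locus of the total space $\mathcal R$ is the image of the reducible analytic data, and the singular points of all fibres, with their types ($A_n$: local equation $x^2+y^2+z^{n+1}=0$), are as follows ($\varepsilon,\delta\in\{1,-1\}$). *PV.* The singular locus of $\mathcal R$ is $\{(x;s)=(u,v,uv+u^{-1}v^{-1};\,u+u^{-1},v+v^{-1},uv)\mid u,v\in\mathbb C^*\}$. Resonance is $s_1=\pm2$ or $s_2=\pm2$; reducibility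 is $R_1:=(s_3+s_3^{-1})^2-s_1s_2(s_3+s_3^{-1})+s_1^2+s_2^2-4=0$. Fibres: - $s_1,s_2\ne\pm2$, $R_1\ne0$: non-singular. - $s_1=2\varepsilon$, $s_2\neq\pm2$: one point $(\varepsilon,\varepsilon s_3,\varepsilon s_2)$, type $A_1$, if $R_1\ne0$; one point $(\varepsilon,\varepsilon s_3,s_3+s_3^{-1})$, type $A_2$, if $R_1=0$. - $s_1\ne\pm2$, $s_2=2\delta$: one point $(\delta s_3,\delta,\delta s_1)$, type $A_1$, if $R_1\neq0$; one point $(\delta s_3,\delta,s_3+s_3^{-1})$, type $A_2$, if $R_1=0$. - $s_1=2\varepsilon$, $s_2=2\delta$: two points $(\varepsilon,\varepsilon s_3,2\varepsilon\delta)$, $(\delta s_3,\delta,2\varepsilon\delta)$, type $A_1+A_1$, if $R_1\ne0$; one point $(\varepsilon,\delta,2\varepsilon\delta)$, type $A_3$, if $R_1=0$. - $s_1,s_2\ne\pm2$, $R_1=0$, $s_3\neq\pm1$: then $s_2s_3\ne s_1$ and there is one point $\left(\frac{s_3^2-1}{s_2s_3-s_1},\frac{s_3(s_2s_3-s_1)}{s_3^2-1},s_3+s_3^{-1}\right)$,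 type $A_1$. - $s_1,s_2\ne\pm2$, $R_1=0$, $s_3=\varepsilon$: then $s_2=\varepsilon s_1$ and there are two points $(\alpha,\varepsilon\beta,2\varepsilon)$, $(\beta,\varepsilon\alpha,2\varepsilon)$, type $A_1+A_1$, where $\alpha+\beta=s_1$, $\alpha\beta=1$. *PV$_{deg}$.* No reducible data; resonance is $s_0=\pm2$ or $s_1=\pm2$. Non-singular fibres for $s_0,s_1\neq\pm2$; one $A_1$ point $(-\varepsilon,0,\varepsilon s_1)$ for $s_0=2\varepsilon$, $s_1\ne\pm2$; one $A_1$ point $(0,-\delta,\delta s_0)$ for $s_0\neq\pm2$, $s_1=2\delta$; both of these, type $A_1+A_1$, for $s_0=2\varepsilon$, $s_1=2\delta$. *PIII(D6).* The singular locus of $\mathcal R$ consists of the lines $\alpha=\beta$, $x=(0,-\alpha,\alpha+\alpha^{-1})$ and $\alpha=\beta^{-1}$, $x=(-1,0,\alpha+\alpha^{-1})$; reducibility is $\alpha=\beta^{\pm1}$. The singular points of the fibres are the points of these lines, all of type $A_1$ (none for $\alpha\ne\beta^{\pm1}$, two for $\alpha=\beta=\pm1$, else one). *PIII(D7), PIII(D8),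 PI.* No reducible data, no singular fibres. *PIV.* The singular locus of $\mathcal R$ is $s_1=s_2+s_2^{-1}$, $x=(s_2^2,1,1)$; resonance is $s_1=\pm2$; reducibility is $s_2^2-s_1s_2+1=0$. Outside these divisors the fibres are non-singular. For $s_1=2\varepsilon$, $s_2\neq\varepsilon$: one point $(\varepsilon s_2,\varepsilon s_2,\varepsilon s_2)$, type $A_1$. For $s_1=s_2+s_2^{-1}$, $s_2\neq\pm1$: one point $(s_2^2,1,1)$, type $A_1$. For $(s_1,s_2)=(2\varepsilon,\varepsilon)$: one point $(1,1,1)$, type $A_2$. *PIIFN.* No reducible data; resonance is $s=\pm2$. One $A_1$ point $(-\varepsilon,\varepsilon,-\varepsilon)$ for $s=2\varepsilon$; otherwise non-singular. *PII.* The only singular point of $\mathcal R$ is $\alpha=1$, $x=(1,1,1)$; reducibility is $\alpha=1$. The fibre over $\alpha=1$ has the single singular point $(1,1,1)$, of type $A_1$; the others are non-singular. -/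

import Mathlib

open MvPolynomial

noncomputable section

/-! ### Analytic data of rank two differential modules on the projective line -/

/-- The formal types, at a singular point, of a rank two differential module with trivial second
exterior power. `regular`: Katz invariant `0`. `unramified r`: eigenvalues `±q`, Katz invariant
`r`. `ramified m`: eigenvalues `±q` exchanged by the formal monodromy, Katz invariant `m + 1/2`. -/
inductive PointType
  | regular
  | unramified (r : ℕ)
  | ramified (m : ℕ)

/-- The number of Stokes maps: twice the Katz invariant. -/
def PointType.numStokes : PointType → ℕ
  | .regular => 0
  | .unramified r => 2 * r
  | .ramified m => 2 * m + 1

/-- `SL₂(ℂ)`. All solution spaces are given unimodular bases, since the second exterior power of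
the module is trivial. -/
abbrev SL2 := Matrix.SpecialLinearGroup (Fin 2) ℂ

/-- The matrix `(1 0; c 1)`. -/
def lowerSL (c : ℂ) : SL2 := ⟨!![1, 0; c, 1], by simp⟩

/-- The matrix `(1 c; 0 1)`. -/
def upperSL (c : ℂ) : SL2 := ⟨!![1, c; 0, 1], by simp⟩

/-- The matrix `(0 -1; 1 0)`: `e₁ ↦ e₂`, `e₂ ↦ -e₁`. -/
def weylSL : SL2 := ⟨!![0, -1; 1, 0], by simp⟩

/-- The Stokes matrices are alternately lower and upper triangular. -/
def stokesMatrix (k : ℕ) (c : ℂ) : SL2 := if Even k then lowerSL c else upperSL c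

/-- Shape of the formal monodromy on a basis `e₁, e₂` adapted to `V = V_q ⊕ V_{-q}`. At a
ramified point the basis is normalised by `γ e₁ = e₂`, `γ e₂ = -e₁`. -/
def PointType.IsFormalMonodromy : PointType → SL2 → Prop
  | .regular, _ => True
  | .unramified _, γ => γ 0 1 = 0 ∧ γ 1 0 = 0
  | .ramified _, γ => γ = weylSL

/-- The admissible unimodular changes of basis of the formal solution space. At a regular singular
point: all of them. At an unramified irregular point: those that preserve `V = V_q ⊕ V_{-q}`. At a
ramified point the normalised basis is kept. -/
def PointType.IsAdmissible : PointType → SL2 → Prop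
  | .regular, _ => True
  | .unramified _, σ => σ 0 1 = 0 ∧ σ 1 0 = 0
  | .ramified _, σ => σ = 1

/-- Local analytic data: the formal monodromy and the constants in the Stokes matrices. -/
structure LocalData (τ : PointType) where
  formal : SL2
  isFormal : τ.IsFormalMonodromy formal
  stokes : Fin τ.numStokes → ℂ

/-- The `k`-th Stokes map. -/
def LocalData.stokesMap {τ : PointType} (d : LocalData τ) (k : Fin τ.numStokes) : SL2 :=
  stokesMatrix k (d.stokes k)

/-- The topological monodromy: formal monodromy times the product of the Stokes maps. -/
def LocalData.top {τ : PointType} (d : LocalData τ) : SL2 :=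
  d.formal * (List.ofFn fun k => d.stokesMap k).prod

/-- The variety of analytic data: local data at each singular point `p_j`, links
`L_j : W → V(p_j)` from the solution space `W` at a base point, and the monodromy relation. -/
structure AnalyticData {r : ℕ} (τ : Fin r → PointType) where
  loc : ∀ j, LocalData (τ j)
  link : Fin r → SL2
  relation : (List.ofFn fun j => (link j)⁻¹ * (loc j).top * link j).prod = 1

namespace AnalyticData

variable {r : ℕ} {τ : Fin r → PointType}

/-- The monodromy around `p_j`, acting on `W`. -/
def monodromy (x : AnalyticData τ) (j : Fin r) : SL2 :=
  (x.link j)⁻¹ * (x.loc j).top * x.link j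

/-- The monodromy around `p_j`, transported to the formal solution space `V(p_i)`. -/
def monodromyAt (x : AnalyticData τ) (i j : Fin r) : SL2 :=
  x.link i * x.monodromy j * (x.link i)⁻¹

/-- The link `V(p_i) → V(p_j)`. -/
def linkFrom (x : AnalyticData τ) (i j : Fin r) : SL2 := x.link j * (x.link i)⁻¹

/-- Two analytic data are in the same orbit of the group of unimodular changes of basis of `W` and
admissible changes of basis of all `V(p_j)`. -/
def Equivalent (x y : AnalyticData τ) : Prop :=
  ∃ (σ : SL2) (ρ : Fin r → SL2), ∀ j,
    (τ j).IsAdmissible (ρ j) ∧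
    ρ j * x.link j = y.link j * σ ∧
    ρ j * (x.loc j).formal = (y.loc j).formal * ρ j ∧
    ∀ k, ρ j * (x.loc j).stokesMap k = (y.loc j).stokesMap k * ρ j

variable (τ) in
/-- The ring of regular functions on the affine variety of analytic data: it is generated by the
entries of the formal monodromies, of the Stokes maps and of the links. -/
def regularFunctions : Subalgebra ℂ (AnalyticData τ → ℂ) :=
  Algebra.adjoin ℂ
    ({f | ∃ j a b, f = fun x => (x.loc j).formal a b} ∪
     {f | ∃ j k, f = fun x => (x.loc j).stokes k} ∪
     {f | ∃ j a b, f = fun x => x.link j a b})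

variable (τ) in
/-- The coordinate ring of the monodromy space, i.e. of the categorical quotient
`AnalyticData // G`: the invariant regular functions. -/
def invariantRing : Subalgebra ℂ (AnalyticData τ → ℂ) where
  carrier := {f | f ∈ regularFunctions τ ∧ ∀ x y, Equivalent x y → f x = f y}
  mul_mem' := fun hf hg =>
    ⟨mul_mem hf.1 hg.1, fun x y h => congrArg₂ (· * ·) (hf.2 x y h) (hg.2 x y h)⟩
  add_mem' := fun hf hg =>
    ⟨add_mem hf.1 hg.1, fun x y h => congrArg₂ (· + ·) (hf.2 x y h) (hg.2 x y h)⟩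
  algebraMap_mem' := fun c => ⟨Subalgebra.algebraMap_mem _ c, fun _ _ _ => rfl⟩

/-- The analytic data are reducible: there is a line `ℂ v ⊆ W` whose image in each `V(p_j)` is
stable under the formal monodromy and the Stokes maps and, at an irregular point, is compatible
with the decomposition `V = V_q ⊕ V_{-q}`. -/
def IsReducible (x : AnalyticData τ) : Prop :=
  ∃ v : Fin 2 → ℂ, v ≠ 0 ∧ ∀ j,
    (∃ c : ℂ, ((x.loc j).formal * x.link j).1.mulVec v = c • (x.link j).1.mulVec v) ∧
    (∀ k, ∃ c : ℂ, ((x.loc j).stokesMap k * x.link j).1.mulVec v = c • (x.link j).1.mulVec v) ∧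
    (τ j ≠ .regular → (x.link j).1.mulVec v 0 = 0 ∨ (x.link j).1.mulVec v 1 = 0)

/-- Resonance: at some regular singular point the local exponents `±θ/2` satisfy `θ ∈ ℤ`, i.e.
the trace `2 cos (π θ)` of the local monodromy is `2` or `-2`. -/
def IsResonant (x : AnalyticData τ) : Prop :=
  ∃ j, τ j = .regular ∧ ((x.loc j).formal.1.trace = 2 ∨ (x.loc j).formal.1.trace = -2)

end AnalyticData

/-! ### Singularities of affine hypersurfaces and surfaces -/

/-- `a` is a singular point of the affine hypersurface `f = 0`. -/
def IsSingularPoint {σ : Type*} (f : MvPolynomial σ ℂ) (a : σ → ℂ) : Prop :=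
  eval a f = 0 ∧ ∀ i, eval a (pderiv i f) = 0

/-- The surface `f = 0` has at `a` a singularity of type `A_n`: its completed local ring at `a` is
isomorphic to that of `x² + y² + z^(n+1) = 0` at the origin. -/
def HasTypeA (n : ℕ) (f : MvPolynomial (Fin 3) ℂ) (a : Fin 3 → ℂ) : Prop :=
  Nonempty
    ((MvPowerSeries (Fin 3) ℂ ⧸ Ideal.span
        {((aeval (fun i => X i + C (a i)) f : MvPolynomial (Fin 3) ℂ) :
          MvPowerSeries (Fin 3) ℂ)}) ≃ₐ[ℂ]
      (MvPowerSeries (Fin 3) ℂ ⧸ Ideal.span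
        {((X 0 ^ 2 + X 1 ^ 2 + X 2 ^ (n + 1) : MvPolynomial (Fin 3) ℂ) :
          MvPowerSeries (Fin 3) ℂ)}))

/-- The singular points of the surface `f = 0` are exactly the (distinct) points listed in `l`,
and each of them is of the type `A_n` with the index `n` listed with it. -/
def HasSingularities (f : MvPolynomial (Fin 3) ℂ) (l : List ((Fin 3 → ℂ) × ℕ)) : Prop :=
  (l.map Prod.fst).Nodup ∧
  (∀ a, IsSingularPoint f a ↔ a ∈ l.map Prod.fst) ∧
  ∀ q ∈ l, HasTypeA q.2 f q.1

/-- The projective closure of `f = 0` is a cubic surface whose part at infinity is the triangle of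
lines `x₁x₂x₃ = 0`. -/
def IsCubicWithThreeLinesAtInfinity (f : MvPolynomial (Fin 3) ℂ) : Prop :=
  f.totalDegree = 3 ∧ homogeneousComponent 3 f = X 0 * X 1 * X 2

/-! ### The families of cubic surfaces -/

/-- A family of rank two modules (given by the types of its singular points) together with a
parameter space `P ⊆ ℂ^k` (some of the parameters are units), a family of affine surfaces over `P`,
and functions on the analytic data that are to be the parameters and the coordinates. -/
structure MonodromyFamily where
  numPoints : ℕ
  type : Fin numPoints → PointType
  numParams : ℕ
  units : Finset (Fin numParams)
  equation : MvPolynomial (Fin numParams ⊕ Fin 3) ℂ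
  param : AnalyticData type → Fin numParams → ℂ
  coord : AnalyticData type → Fin 3 → ℂ

namespace MonodromyFamily

/-- The parameter space `P = ℂ^a × (ℂ*)^b`. -/
def parameterSpace (D : MonodromyFamily) : Set (Fin D.numParams → ℂ) :=
  {p | ∀ i ∈ D.units, p i ≠ 0}

/-- The coordinate ring of the total space of the family of surfaces over `P`:
`ℂ[s, x₁, x₂, x₃] / (F)` with the units among the parameters `s` inverted. -/
abbrev TotalRing (D : MonodromyFamily) : Type :=
  Localization.Away
    (Ideal.Quotient.mk (Ideal.span {D.equation}) (∏ i ∈ D.units, X (Sum.inl i)))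

/-- The class of a polynomial in the coordinate ring of the total space. -/
def toTotalRing (D : MonodromyFamily) (f : MvPolynomial (Fin D.numParams ⊕ Fin 3) ℂ) :
    D.TotalRing :=
  algebraMap _ D.TotalRing (Ideal.Quotient.mk (Ideal.span {D.equation}) f)

/-- The fibre over `p`, as a polynomial in `x₁, x₂, x₃`. -/
def fibre (D : MonodromyFamily) (p : Fin D.numParams → ℂ) : MvPolynomial (Fin 3) ℂ :=
  aeval (Sum.elim (fun i => C (p i)) X) D.equation

/-- The family of surfaces is the monodromy space: its coordinate ring is, via the given parameters
and coordinates, the ring of invariants of the analytic data. -/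
def IsMonodromySpace (D : MonodromyFamily) : Prop :=
  ∃ e : D.TotalRing ≃ₐ[ℂ] AnalyticData.invariantRing D.type,
    (∀ i, (e (D.toTotalRing (X (Sum.inl i))) : AnalyticData D.type → ℂ) =
      fun x => D.param x i) ∧
    (∀ i, (e (D.toTotalRing (X (Sum.inr i))) : AnalyticData D.type → ℂ) =
      fun x => D.coord x i)

/-- Reducible analytic data with parameter `p` exist. -/
def ReducibleAt (D : MonodromyFamily) (p : Fin D.numParams → ℂ) : Prop :=
  ∃ x : AnalyticData D.type, D.param x = p ∧ x.IsReducible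

/-- Resonant analytic data with parameter `p` exist. -/
def ResonantAt (D : MonodromyFamily) (p : Fin D.numParams → ℂ) : Prop :=
  ∃ x : AnalyticData D.type, D.param x = p ∧ x.IsResonant

/-- The variable of the `i`-th parameter. -/
abbrev S {k : ℕ} (i : Fin k) : MvPolynomial (Fin k ⊕ Fin 3) ℂ := X (Sum.inl i)

/-- The `i`-th coordinate of affine three space. -/
abbrev Y {k : ℕ} (i : Fin 3) : MvPolynomial (Fin k ⊕ Fin 3) ℂ := X (Sum.inr i)

/-- `(0,0,0,0)`; parameters: the traces `a₁, …, a₄` of the monodromies `M₁, …, M₄`;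
`x₁ = tr(M₂M₃)`, `x₂ = tr(M₁M₃)`, `x₃ = tr(M₁M₂)`. -/
abbrev PVI : MonodromyFamily where
  numPoints := 4
  type := ![.regular, .regular, .regular, .regular]
  numParams := 4
  units := ∅
  equation := Y 0 * Y 1 * Y 2 + Y 0 ^ 2 + Y 1 ^ 2 + Y 2 ^ 2
    - (S 0 * S 3 + S 1 * S 2) * Y 0 - (S 1 * S 3 + S 2 * S 0) * Y 1
    - (S 2 * S 3 + S 0 * S 1) * Y 2
    + (S 0 * S 1 * S 2 * S 3 + S 0 ^ 2 + S 1 ^ 2 + S 2 ^ 2 + S 3 ^ 2 - 4)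
  param x := fun j => (x.loc j).formal.1.trace
  coord x := ![(x.monodromy 1 * x.monodromy 2).1.trace,
    (x.monodromy 0 * x.monodromy 2).1.trace, (x.monodromy 0 * x.monodromy 1).1.trace]

/-- `(0,0,1)`; `s₁, s₂`: traces of the monodromies `M₁, M₂` at the regular singular points; `s₃`:
eigenvalue of the formal monodromy at `∞`. On a basis of `V_q ⊕ V_{-q}` at `∞`, `x₁` and `x₂` are
the lower right entries of `M₁` and `M₂`, and `x₃ = tr(M₁M₂)`. -/
abbrev PV : MonodromyFamily where
  numPoints := 3
  type := ![.regular, .regular, .unramified 1]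
  numParams := 3
  units := {2}
  equation := Y 0 * Y 1 * Y 2 + Y 0 ^ 2 + Y 1 ^ 2
    - (S 0 + S 1 * S 2) * Y 0 - (S 1 + S 0 * S 2) * Y 1 - S 2 * Y 2
    + S 2 ^ 2 + S 0 * S 1 * S 2 + 1
  param x := ![(x.loc 0).formal.1.trace, (x.loc 1).formal.1.trace, (x.loc 2).formal 0 0]
  coord x := ![x.monodromyAt 2 0 1 1, x.monodromyAt 2 1 1 1,
    (x.monodromyAt 2 0 * x.monodromyAt 2 1).1.trace]

/-- `(0,0,1/2)`; parameters: the traces of the monodromies at the regular singular points. -/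
abbrev PVdeg : MonodromyFamily where
  numPoints := 3
  type := ![.regular, .regular, .ramified 0]
  numParams := 2
  units := ∅
  equation := Y 0 * Y 1 * Y 2 + Y 0 ^ 2 + Y 1 ^ 2 + S 0 * Y 0 + S 1 * Y 1 + 1
  param x := ![(x.loc 0).formal.1.trace, (x.loc 1).formal.1.trace]
  coord x := ![-x.monodromyAt 2 1 0 1, -x.monodromyAt 2 1 0 0,
    -(x.loc 2).stokes (0 : Fin 1)]

/-- `(1,-,1)`; parameters `α, β`: eigenvalues of the formal monodromies at `0` and `∞`. -/
abbrev PIIID6 : MonodromyFamily where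
  numPoints := 2
  type := ![.unramified 1, .unramified 1]
  numParams := 2
  units := {0, 1}
  equation := Y 0 * Y 1 * Y 2 + Y 0 ^ 2 + Y 1 ^ 2 + (1 + S 0 * S 1) * Y 0 + (S 0 + S 1) * Y 1
    + S 0 * S 1
  param x := ![(x.loc 0).formal 0 0, (x.loc 1).formal 0 0]
  coord x :=
    let L := x.linkFrom 0 1
    let M := (x.loc 0).top
    ![-(L 0 0 * L 1 1), M 1 0 * L 0 1 * L 1 1 + M 0 0 * L 0 1 * L 1 0, M.1.trace]

/-- `(1/2,-,1)`; parameter `α`: eigenvalue of the formal monodromy at `∞`. -/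
abbrev PIIID7 : MonodromyFamily where
  numPoints := 2
  type := ![.ramified 0, .unramified 1]
  numParams := 1
  units := {0}
  equation := Y 0 * Y 1 * Y 2 + Y 0 ^ 2 + Y 1 ^ 2 + S 0 * Y 0 + Y 1
  param x := ![(x.loc 1).formal 0 0]
  coord x :=
    let L := x.linkFrom 0 1
    ![L 0 0 * L 1 0, L 0 1 * L 1 0, -(x.loc 0).stokes (0 : Fin 1)]

/-- `(1/2,-,1/2)`; no parameters. -/
abbrev PIIID8 : MonodromyFamily where
  numPoints := 2
  type := ![.ramified 0, .ramified 0]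
  numParams := 0
  units := ∅
  equation := Y 0 * Y 1 * Y 2 + Y 0 ^ 2 - Y 1 ^ 2 - 1
  param _ := ![]
  coord x :=
    let L := x.linkFrom 0 1
    ![-(Complex.I * L 1 1), L 0 1, -(Complex.I * (x.loc 0).stokes (0 : Fin 1))]

/-- `(0,-,2)`; `s₁`: trace of the monodromy at `0`; `s₂`: eigenvalue of the formal monodromy at
`∞`. With Stokes constants `a₁, …, a₄`: `x₁ = a₁a₄ + s₂²`, `x₂ = a₁a₂ + 1`, `x₃ = a₃a₄ + 1`. -/
abbrev PIV : MonodromyFamily where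
  numPoints := 2
  type := ![.regular, .unramified 2]
  numParams := 2
  units := {1}
  equation := Y 0 * Y 1 * Y 2 + Y 0 ^ 2 - (S 1 ^ 2 + S 0 * S 1) * Y 0 - S 1 ^ 2 * Y 1
    - S 1 ^ 2 * Y 2 + S 1 ^ 2 + S 0 * S 1 ^ 3
  param x := ![(x.loc 0).formal.1.trace, (x.loc 1).formal 0 0]
  coord x :=
    let a : Fin 4 → ℂ := (x.loc 1).stokes
    ![a 0 * a 3 + (x.loc 1).formal 0 0 ^ 2, a 0 * a 1 + 1, a 2 * a 3 + 1]

/-- `(0,-,3/2)`; parameter `s`: trace of the monodromy at `0`; the coordinates are the Stokes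
constants. -/
abbrev PIIFN : MonodromyFamily where
  numPoints := 2
  type := ![.regular, .ramified 1]
  numParams := 1
  units := ∅
  equation := Y 0 * Y 1 * Y 2 + Y 0 - Y 1 + Y 2 + S 0
  param x := ![(x.loc 0).formal.1.trace]
  coord x :=
    let a : Fin 3 → ℂ := (x.loc 1).stokes
    ![a 0, a 1, a 2]

/-- `(-,-,3)`; parameter `α`: eigenvalue of the formal monodromy. With Stokes constants
`b₁, …, b₆`: `x₁ = b₃b₄ + 1`, `x₂ = b₄b₅ + 1`, `x₃ = b₅b₆ + 1`. -/
abbrev PII : MonodromyFamily where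
  numPoints := 1
  type := ![.unramified 3]
  numParams := 1
  units := {0}
  equation := Y 0 * Y 1 * Y 2 - Y 0 - S 0 * Y 1 - Y 2 + S 0 + 1
  param x := ![(x.loc 0).formal 0 0]
  coord x :=
    let b : Fin 6 → ℂ := (x.loc 0).stokes
    ![b 2 * b 3 + 1, b 3 * b 4 + 1, b 4 * b 5 + 1]

/-- `(-,-,5/2)`; no parameters. With Stokes constants `a₁, …, a₅`: `(x₁, x₂, x₃) = (a₃, a₅, a₄)`. -/
abbrev PI : MonodromyFamily where
  numPoints := 1
  type := ![.ramified 2]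
  numParams := 0
  units := ∅
  equation := Y 0 * Y 1 * Y 2 + Y 0 + Y 1 + 1
  param _ := ![]
  coord x :=
    let a : Fin 5 → ℂ := (x.loc 0).stokes
    ![a 2, a 4, a 3]

/-- The nine families with an irregular singularity. -/
def irregularFamilies : List MonodromyFamily :=
  [PV, PVdeg, PIIID6, PIIID7, PIIID8, PIV, PIIFN, PII, PI]

/-- The ten families. -/
def allFamilies : List MonodromyFamily := PVI :: irregularFamilies

end MonodromyFamily

/-- The polynomial defining the reducible divisor of the parameter space of `PV`. -/
def reducibleDivisorPV (s₁ s₂ s₃ : ℂ) : ℂ :=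
  (s₃ + s₃⁻¹) ^ 2 - s₁ * s₂ * (s₃ + s₃⁻¹) + s₁ ^ 2 + s₂ ^ 2 - 4

end

/-! For each family there are two problems: computing a ring of invariants and analysing an explicit
cubic.

Invariants. `isMonodromySpace_of` reduces the isomorphism to the following: the parameters and
coordinates are invariant, satisfy `F = 0`, satisfy no relation outside the ideal `(F)`, and
generate the invariants together with the inverses of the units. For generation, base changes are
used to trivialise one chosen link and all links at regular singular points. An invariant is
therefore a polynomial in the monodromies seen from `V(p_i)`, the remaining links, the formal
monodromies and the Stokes constants (`invariant_mem`), and the monodromy relation eliminates some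
of these. A ramified point leaves no group acting. An unramified irregular point leaves a torus, and
by `torus_invariant_mem` its invariants are generated by the generators of weight zero and the
products of two generators of opposite weights. Traces, determinants and formal eigenvalues express
these products by parameters and coordinates. The cubic is then the tautological relation between
the products, typically `(pq)(rs) = (ps)(rq)`. If no torus is present, the cubic is a determinant,
trace or matrix relation.

That there are no further relations follows from the Nullstellensatz (`dvd_of_vanishing`). `F` is
irreducible because it is linear in some variable with coprime coefficients, and a non-empty open
part of `F = 0` lifts to explicit analytic data.

PVI needs the classical ring of invariants of three matrices in `SL₂` under conjugation. It consists
of the `g₀ + g₁ T` with `g₀, g₁` polynomials in the traces of the `M_i` and the `M_iM_j`, where `T =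
tr(M₁M₂M₃)` satisfies Fricke's quadratic equation; that equation is the PVI cubic
(`mem_traceAlgebra_of_invariant`). To prove this, an invariant is restricted to triples with `M₁ =
diag(u, u⁻¹)`. The torus computation shows that it has the form `P + Qu` after multiplication by a
power of `u - u⁻¹`, and averaging over the Weyl element `u ↦ u⁻¹` removes `u`. The remaining
denominator, a power of `a₁² - 4`, is cancelled: `1` and `T` stay independent over the polynomials
in the traces even on each hyperplane `a₁ = c`.

Singularities. Singular points are found by solving the gradient equations. The nine cubics other
than PVI are linear in `x₃`, so at a singular point the local equation is `z(xy + qx + py) + Q(x,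
y)` with `Q` a quadratic form. Taking `xy + qx + py` as a coordinate and absorbing its multiples
into `z` leaves the restriction of `Q` to the curve `xy + qx + py = 0`. If this restriction vanishes
to order `n + 1`, the type is `A_n` (`hasTypeA_of_restriction`). For PVI only the existence of
singular points is needed; it is read off from a product of two quadratic polynomials in `x₃`.

Reducible data are triangular at each irregular point, so the products of opposite off-diagonal
entries vanish. This determines all parameters and coordinates of such data. -/

noncomputable section

/-! ### Entries, determinants and traces of unimodular matrices -/

namespace SL2

theorem mul_entry (A B : SL2) (i j : Fin 2) :
    (A * B) i j = A i 0 * B 0 j + A i 1 * B 1 j := by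
  simp [Matrix.mul_apply, Fin.sum_univ_two]

@[simp] theorem inv_entry₀₀ (A : SL2) : A⁻¹ 0 0 = A 1 1 := by
  simp [Matrix.SpecialLinearGroup.coe_inv, Matrix.adjugate_fin_two]

@[simp] theorem inv_entry₀₁ (A : SL2) : A⁻¹ 0 1 = -A 0 1 := by
  simp [Matrix.SpecialLinearGroup.coe_inv, Matrix.adjugate_fin_two]

@[simp] theorem inv_entry₁₀ (A : SL2) : A⁻¹ 1 0 = -A 1 0 := by
  simp [Matrix.SpecialLinearGroup.coe_inv, Matrix.adjugate_fin_two]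

@[simp] theorem inv_entry₁₁ (A : SL2) : A⁻¹ 1 1 = A 0 0 := by
  simp [Matrix.SpecialLinearGroup.coe_inv, Matrix.adjugate_fin_two]

theorem det_entry (A : SL2) : A 0 0 * A 1 1 - A 0 1 * A 1 0 = 1 := by
  rw [← Matrix.det_fin_two]; exact A.2

theorem trace_entry (A : SL2) : A.1.trace = A 0 0 + A 1 1 := Matrix.trace_fin_two _

@[simp] theorem one_entry (i j : Fin 2) : (1 : SL2) i j = if i = j then 1 else 0 := by
  simp [Matrix.one_apply]

theorem ext_entries {A B : SL2} (h₁ : A 0 0 = B 0 0) (h₂ : A 0 1 = B 0 1) (h₃ : A 1 0 = B 1 0)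
    (h₄ : A 1 1 = B 1 1) : A = B := by
  ext i j
  fin_cases i <;> fin_cases j <;> assumption

theorem eq_iff_entries {A B : SL2} : A = B ↔
    A 0 0 = B 0 0 ∧ A 0 1 = B 0 1 ∧ A 1 0 = B 1 0 ∧ A 1 1 = B 1 1 :=
  ⟨fun h => by simp [h], fun h => ext_entries h.1 h.2.1 h.2.2.1 h.2.2.2⟩

theorem trace_conj (g A : SL2) : (g * A * g⁻¹).1.trace = A.1.trace := by
  rw [Matrix.SpecialLinearGroup.coe_mul, Matrix.trace_mul_comm,
    ← Matrix.SpecialLinearGroup.coe_mul, ← mul_assoc, inv_mul_cancel, one_mul]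

/-- The matrix with given entries. -/
def mk (a b c d : ℂ) (h : a * d - b * c = 1) : SL2 := ⟨!![a, b; c, d], by simpa using h⟩

section
variable (a b c d : ℂ) (h : a * d - b * c = 1)
@[simp] theorem mk_entry₀₀ : mk a b c d h 0 0 = a := rfl
@[simp] theorem mk_entry₀₁ : mk a b c d h 0 1 = b := rfl
@[simp] theorem mk_entry₁₀ : mk a b c d h 1 0 = c := rfl
@[simp] theorem mk_entry₁₁ : mk a b c d h 1 1 = d := rfl
@[simp] theorem lower_entry₀₀ : lowerSL c 0 0 = 1 := rfl
@[simp] theorem lower_entry₀₁ : lowerSL c 0 1 = 0 := rfl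
@[simp] theorem lower_entry₁₀ : lowerSL c 1 0 = c := rfl
@[simp] theorem lower_entry₁₁ : lowerSL c 1 1 = 1 := rfl
@[simp] theorem upper_entry₀₀ : upperSL c 0 0 = 1 := rfl
@[simp] theorem upper_entry₀₁ : upperSL c 0 1 = c := rfl
@[simp] theorem upper_entry₁₀ : upperSL c 1 0 = 0 := rfl
@[simp] theorem upper_entry₁₁ : upperSL c 1 1 = 1 := rfl
@[simp] theorem weyl_entry₀₀ : weylSL 0 0 = 0 := rfl
@[simp] theorem weyl_entry₀₁ : weylSL 0 1 = -1 := rfl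
@[simp] theorem weyl_entry₁₀ : weylSL 1 0 = 1 := rfl
@[simp] theorem weyl_entry₁₁ : weylSL 1 1 = 0 := rfl
end

/-- The diagonal matrix with entries `t, t⁻¹`. -/
def diag (t : ℂ) (h : t ≠ 0) : SL2 := mk t 0 0 t⁻¹ (by field_simp; simp)

section
variable (t : ℂ) (h : t ≠ 0)
@[simp] theorem diag_entry₀₀ : diag t h 0 0 = t := rfl
@[simp] theorem diag_entry₀₁ : diag t h 0 1 = 0 := rfl
@[simp] theorem diag_entry₁₀ : diag t h 1 0 = 0 := rfl
@[simp] theorem diag_entry₁₁ : diag t h 1 1 = t⁻¹ := rfl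
end

theorem conj_prod {n : ℕ} (g : SL2) (f : Fin n → SL2) :
    (List.ofFn fun k => g * f k * g⁻¹).prod = g * (List.ofFn f).prod * g⁻¹ := by
  have := map_list_prod (MulAut.conj g) (List.ofFn f)
  rw [List.map_ofFn] at this
  exact this.symm

end SL2

open SL2

/-- Used to prove equalities of Stokes constants as equalities of Stokes maps, on which base changes
act simply by conjugation. -/
theorem stokesMatrix_injective (k : ℕ) : Function.Injective (stokesMatrix k) := by
  intro c c' h
  unfold stokesMatrix at h
  split_ifs at h
  · exact congrArg (fun A : SL2 => A 1 0) h
  · exact congrArg (fun A : SL2 => A 0 1) h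

/-! ### The action of the base changes on analytic data -/

namespace LocalData

/-- Change of basis of the formal solution space. -/
def conj {τ : PointType} (d : LocalData τ) (ρ : SL2) (h : τ.IsAdmissible ρ) : LocalData τ where
  formal := ρ * d.formal * ρ⁻¹
  isFormal := by
    have hd := d.isFormal
    match τ, d, h, hd with
    | .regular, d, h, hd => trivial
    | .unramified r, d, h, hd =>
      obtain ⟨h₁, h₂⟩ := h
      obtain ⟨h₃, h₄⟩ := hd
      constructor <;>
      simp [-Matrix.SpecialLinearGroup.coe_mul, mul_entry, inv_entry₀₁, inv_entry₁₀, h₁, h₂, h₃, h₄]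
    | .ramified m, d, h, hd =>
      have h : ρ = 1 := h
      have hd : d.formal = weylSL := hd
      show ρ * d.formal * ρ⁻¹ = weylSL
      simp [h, hd]
  -- An admissible conjugation keeps a Stokes matrix unipotent and triangular of the same kind
  -- (`stokesMap_conj`), so its off-diagonal entry carries all the information.
  stokes k := if Even k.1 then (ρ * d.stokesMap k * ρ⁻¹) 1 0 else (ρ * d.stokesMap k * ρ⁻¹) 0 1

variable {τ : PointType} (d : LocalData τ) (ρ : SL2) (h : τ.IsAdmissible ρ)

/-- There are no Stokes maps at a regular point, `ρ` is trivial at a ramified point, and at an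
unramified point `ρ` is diagonal, so that it normalises both unipotent groups. -/
theorem stokesMap_conj (k : Fin τ.numStokes) :
    (d.conj ρ h).stokesMap k = ρ * d.stokesMap k * ρ⁻¹ := by
  match τ, d, h, k with
  | .regular, d, h, k => exact k.elim0
  | .unramified r, d, h, k =>
    obtain ⟨h₁, h₂⟩ := h
    have hdet := det_entry ρ
    rw [h₁] at hdet
    by_cases hk : Even k.1 <;>
    apply ext_entries <;>
    simp [-Matrix.SpecialLinearGroup.coe_mul, stokesMap, stokesMatrix, conj, hk, mul_entry,
      inv_entry₀₀, inv_entry₁₁, inv_entry₀₁, inv_entry₁₀, h₁, h₂] <;>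
    linear_combination -hdet
  | .ramified m, d, h, k =>
    have h : ρ = 1 := h
    subst h
    by_cases hk : Even k.1 <;> simp [stokesMap, stokesMatrix, conj, hk]

theorem top_conj : (d.conj ρ h).top = ρ * d.top * ρ⁻¹ := by
  unfold top
  simp_rw [stokesMap_conj, conj_prod]
  show ρ * d.formal * ρ⁻¹ * _ = _
  group

theorem ext' {d e : LocalData τ} (h₁ : d.formal = e.formal) (h₂ : ∀ k, d.stokesMap k = e.stokesMap k) :
    d = e := by
  cases d; cases e
  simp only [mk.injEq]
  exact ⟨h₁, funext fun k => stokesMatrix_injective _ (h₂ k)⟩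

end LocalData

namespace AnalyticData

variable {r : ℕ} {τ : Fin r → PointType}

/-- The action of the group of changes of bases. -/
def act (x : AnalyticData τ) (σ : SL2) (ρ : Fin r → SL2) (h : ∀ j, (τ j).IsAdmissible (ρ j)) :
    AnalyticData τ where
  loc j := (x.loc j).conj (ρ j) (h j)
  link j := ρ j * x.link j * σ⁻¹
  relation := by
    have : ∀ j, (ρ j * x.link j * σ⁻¹)⁻¹ * ((x.loc j).conj (ρ j) (h j)).top *
        (ρ j * x.link j * σ⁻¹) = σ * ((x.link j)⁻¹ * (x.loc j).top * x.link j) * σ⁻¹ := by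
      intro j
      rw [LocalData.top_conj]
      group
    simp_rw [this, conj_prod, x.relation]
    simp

section
variable (x : AnalyticData τ) (σ : SL2) (ρ : Fin r → SL2) (h : ∀ j, (τ j).IsAdmissible (ρ j))

theorem equivalent_act : Equivalent x (x.act σ ρ h) := by
  refine ⟨σ, ρ, fun j => ⟨h j, ?_, ?_, fun k => ?_⟩⟩
  · simp [act]
  · simp [act, LocalData.conj]
  · show _ = ((x.loc j).conj (ρ j) (h j)).stokesMap k * _
    simp [LocalData.stokesMap_conj]

@[simp] theorem link_act (j : Fin r) : (x.act σ ρ h).link j = ρ j * x.link j * σ⁻¹ := rfl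

@[simp] theorem loc_act (j : Fin r) : (x.act σ ρ h).loc j = (x.loc j).conj (ρ j) (h j) := rfl

theorem monodromy_act (j : Fin r) : (x.act σ ρ h).monodromy j = σ * x.monodromy j * σ⁻¹ := by
  simp only [monodromy, link_act, loc_act, LocalData.top_conj]
  group

theorem monodromyAt_act (i j : Fin r) :
    (x.act σ ρ h).monodromyAt i j = ρ i * x.monodromyAt i j * (ρ i)⁻¹ := by
  simp only [monodromyAt, monodromy_act, link_act]
  group

theorem linkFrom_act (i j : Fin r) :
    (x.act σ ρ h).linkFrom i j = ρ j * x.linkFrom i j * (ρ i)⁻¹ := by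
  simp only [linkFrom, link_act]
  group

end

theorem ext_data {x y : AnalyticData τ} (h₁ : x.loc = y.loc) (h₂ : x.link = y.link) : x = y := by
  cases x; cases y
  simp only at h₁ h₂
  subst h₁ h₂
  rfl

/-- The intertwining relations can be solved for the second datum because the base changes are
invertible. Equivalence classes are thus orbits of an explicit action. -/
theorem Equivalent.exists_eq_act {x y : AnalyticData τ} (hxy : Equivalent x y) :
    ∃ σ ρ h, y = x.act σ ρ h := by
  obtain ⟨σ, ρ, H⟩ := hxy
  refine ⟨σ, ρ, fun j => (H j).1, ?_⟩
  have h₁ : y.loc = (x.act σ ρ fun j => (H j).1).loc := by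
    funext j
    refine LocalData.ext' ?_ fun k => ?_
    · rw [eq_comm]; exact mul_inv_eq_of_eq_mul (H j).2.2.1
    · rw [loc_act, LocalData.stokesMap_conj, eq_comm]
      exact mul_inv_eq_of_eq_mul ((H j).2.2.2 k)
  have h₂ : y.link = (x.act σ ρ fun j => (H j).1).link := by
    funext j
    rw [link_act, eq_comm]
    exact mul_inv_eq_of_eq_mul (H j).2.1
  exact ext_data h₁ h₂

/-- Invariance becomes a statement about one datum and one group element, so it can be checked by
computing `act`. -/
theorem mem_invariantRing_iff (f : AnalyticData τ → ℂ) :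
    f ∈ invariantRing τ ↔ f ∈ regularFunctions τ ∧ ∀ x σ ρ h, f (act x σ ρ h) = f x := by
  refine ⟨fun hf => ⟨hf.1, fun x σ ρ h => (hf.2 _ _ (equivalent_act x σ ρ h)).symm⟩,
    fun hf => ⟨hf.1, fun x y hxy => ?_⟩⟩
  obtain ⟨σ, ρ, h, rfl⟩ := hxy.exists_eq_act
  exact (hf.2 x σ ρ h).symm

/-! ### Matrices of functions -/

/-- All entries of a matrix valued function lie in the given algebra of functions. -/
def EntriesIn {Z : Type*} (A : Subalgebra ℂ (Z → ℂ)) (m : Z → SL2) : Prop :=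
  ∀ a b, (fun z => m z a b) ∈ A

section
variable {Z : Type*} {A : Subalgebra ℂ (Z → ℂ)} {m n : Z → SL2}

theorem EntriesIn.mul (hm : EntriesIn A m) (hn : EntriesIn A n) :
    EntriesIn A (fun z => m z * n z) := by
  intro a b
  simp_rw [mul_entry]
  exact A.add_mem (A.mul_mem (hm a 0) (hn 0 b)) (A.mul_mem (hm a 1) (hn 1 b))

theorem EntriesIn.inv (hm : EntriesIn A m) : EntriesIn A (fun z => (m z)⁻¹) := by
  intro a b
  fin_cases a <;> fin_cases b
  · simpa only [Fin.zero_eta, inv_entry₀₀] using hm 1 1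
  · simp only [Fin.zero_eta, Fin.mk_one, inv_entry₀₁]; exact A.neg_mem (hm 0 1)
  · simp only [Fin.zero_eta, Fin.mk_one, inv_entry₁₀]; exact A.neg_mem (hm 1 0)
  · simpa only [Fin.mk_one, inv_entry₁₁] using hm 0 0

theorem EntriesIn.trace (hm : EntriesIn A m) : (fun z => (m z).1.trace) ∈ A := by
  simp_rw [trace_entry]
  exact A.add_mem (hm 0 0) (hm 1 1)

theorem const_mem (A : Subalgebra ℂ (Z → ℂ)) (c : ℂ) : (fun _ => c) ∈ A := A.algebraMap_mem c

theorem entriesIn_const (A : Subalgebra ℂ (Z → ℂ)) (g : SL2) : EntriesIn A (fun _ => g) :=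
  fun a b => const_mem A (g a b)

theorem entriesIn_stokesMatrix (k : ℕ) {c : Z → ℂ} (hc : c ∈ A) :
    EntriesIn A (fun z => stokesMatrix k (c z)) := by
  intro a b
  unfold stokesMatrix
  split_ifs <;> fin_cases a <;> fin_cases b <;>
    first | exact hc | exact const_mem A 1 | exact const_mem A 0

theorem entriesIn_prod {N : ℕ} (m : Fin N → Z → SL2) (hm : ∀ k, EntriesIn A (m k)) :
    EntriesIn A (fun z => (List.ofFn fun k => m k z).prod) := by
  induction N with
  | zero => simpa using entriesIn_const A 1
  | succ N ih =>
    simp_rw [List.ofFn_succ, List.prod_cons]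
    exact (hm 0).mul (ih _ fun k => hm k.succ)

end

theorem formal_mem (j : Fin r) : EntriesIn (regularFunctions τ) (fun x => (x.loc j).formal) :=
  fun a b => Algebra.subset_adjoin (Or.inl (Or.inl ⟨j, a, b, rfl⟩))

theorem stokes_mem (j : Fin r) (k) : (fun x => (x.loc j).stokes k) ∈ regularFunctions τ :=
  Algebra.subset_adjoin (Or.inl (Or.inr ⟨j, k, rfl⟩))

theorem link_mem (j : Fin r) : EntriesIn (regularFunctions τ) (fun x => x.link j) :=
  fun a b => Algebra.subset_adjoin (Or.inr ⟨j, a, b, rfl⟩)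

theorem top_mem (j : Fin r) : EntriesIn (regularFunctions τ) (fun x => (x.loc j).top) :=
  (formal_mem j).mul (entriesIn_prod _ fun k => entriesIn_stokesMatrix _ (stokes_mem j k))

theorem monodromy_mem (j : Fin r) : EntriesIn (regularFunctions τ) (fun x => x.monodromy j) :=
  ((link_mem j).inv.mul (top_mem j)).mul (link_mem j)

theorem monodromyAt_mem (i j : Fin r) :
    EntriesIn (regularFunctions τ) (fun x => x.monodromyAt i j) :=
  ((link_mem i).mul (monodromy_mem j)).mul (link_mem i).inv

theorem linkFrom_mem (i j : Fin r) : EntriesIn (regularFunctions τ) (fun x => x.linkFrom i j) :=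
  (link_mem j).mul (link_mem i).inv

/-- A regular function pulls back to an algebra that contains the pullbacks of the generators. -/
theorem pullback_mem {Z : Type*} (A : Subalgebra ℂ (Z → ℂ)) (N : Z → AnalyticData τ)
    (h₁ : ∀ j, EntriesIn A (fun z => ((N z).loc j).formal))
    (h₂ : ∀ j k, (fun z => ((N z).loc j).stokes k) ∈ A)
    (h₃ : ∀ j, EntriesIn A (fun z => (N z).link j))
    {f : AnalyticData τ → ℂ} (hf : f ∈ regularFunctions τ) : (fun z => f (N z)) ∈ A := by
  unfold regularFunctions at hf
  induction hf using Algebra.adjoin_induction with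
  | mem g hg =>
    rcases hg with (⟨j, a, b, rfl⟩ | ⟨j, k, rfl⟩) | ⟨j, a, b, rfl⟩
    · exact h₁ j a b
    · exact h₂ j k
    · exact h₃ j a b
  | algebraMap c => exact A.algebraMap_mem c
  | add f g _ _ hf hg => exact A.add_mem hf hg
  | mul f g _ _ hf hg => exact A.mul_mem hf hg

end AnalyticData

/-- A Laurent polynomial that is constant on `ℂ*` equals its constant term. -/
theorem eq_sum_of_laurent_const {κ : Type*} (s : Finset κ) (n : κ → ℤ) (c : κ → ℂ) {K : ℂ}
    (h : ∀ t : ℂ, t ≠ 0 → ∑ l ∈ s, c l * t ^ n l = K) : K = ∑ l ∈ s with n l = 0, c l := by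
  let N : ℕ := ∑ l ∈ s, (n l).natAbs
  have hN : ∀ l ∈ s, (n l).natAbs ≤ N := fun l hl =>
    Finset.single_le_sum (f := fun l => (n l).natAbs) (fun _ _ => Nat.zero_le _) hl
  let P : Polynomial ℂ :=
    ∑ l ∈ s, Polynomial.C (c l) * Polynomial.X ^ (n l + N).toNat -
      Polynomial.C K * Polynomial.X ^ N
  -- `P` is the given relation multiplied by `t ^ N` to clear negative exponents. It vanishes on the
  -- infinite set `ℂ*`, and its coefficient of degree `N` is the claim.
  have hP : P = 0 := by
    refine Polynomial.eq_zero_of_infinite_isRoot P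
      ((Set.finite_singleton (0 : ℂ)).infinite_compl.mono fun t ht => ?_)
    have ht : t ≠ 0 := ht
    have : ∀ l ∈ s, c l * t ^ (n l + N).toNat = (c l * t ^ n l) * t ^ N := by
      intro l hl
      have h₁ := hN l hl
      have h₂ : (((n l + N).toNat : ℕ) : ℤ) = n l + N := Int.toNat_of_nonneg (by omega)
      rw [← zpow_natCast, h₂, zpow_add₀ ht, zpow_natCast, mul_assoc]
    simp only [Set.mem_ofPred_eq, Polynomial.IsRoot, P, Polynomial.eval_sub, Polynomial.eval_mul,
      Polynomial.eval_finsetSum, Polynomial.eval_C, Polynomial.eval_pow, Polynomial.eval_X]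
    rw [Finset.sum_congr rfl this, ← Finset.sum_mul, h t ht, sub_self]
  have hc : P.coeff N = 0 := by rw [hP, Polynomial.coeff_zero]
  simp only [P, Polynomial.coeff_sub, Polynomial.finsetSum_coeff, Polynomial.coeff_C_mul,
    Polynomial.coeff_X_pow, if_true, mul_one] at hc
  rw [← sub_eq_zero.1 hc, Finset.sum_filter]
  refine Finset.sum_congr rfl fun l hl => ?_
  have h₁ := hN l hl
  by_cases h0 : n l = 0
  · simp [h0]
  · rw [if_neg h0, if_neg (by omega), mul_zero]

/-- Invariants of a torus acting on generators with weights `-1, 0, 1`: an invariant polynomial is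
a polynomial in the generators of weight `0` and the products of generators of opposite
weights. -/
theorem torus_invariant_mem {Z ι : Type*} (g : ι → Z → ℂ) (w : ι → ℤ)
    (hw : ∀ i, w i = 0 ∨ w i = 1 ∨ w i = -1) {m : ℤ} (hm : m ≠ 0)
    (act : ∀ t : ℂ, t ≠ 0 → Z → Z)
    (hact : ∀ i t ht z, g i (act t ht z) = t ^ (m * w i) * g i z)
    (B : Subalgebra ℂ (Z → ℂ)) (h₀ : ∀ i, w i = 0 → g i ∈ B)
    (h₁ : ∀ i j, w i = 1 → w j = -1 → g i * g j ∈ B)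
    {f : Z → ℂ} (hf : f ∈ Algebra.adjoin ℂ (Set.range g)) (hinv : ∀ t ht z, f (act t ht z) = f z) :
    f ∈ B := by
  -- Strong induction on the length of a monomial of total weight zero: either a factor of weight
  -- `0` splits off, or factors of weights `1` and `-1` both occur and are split off as a pair.
  have hmono : ∀ l : Multiset ι, (l.map w).sum = 0 → (l.map g).prod ∈ B := by
    intro l
    induction hl : Multiset.card l using Nat.strong_induction_on generalizing l with
    | _ n ih =>
      intro hsum
      by_cases hz : ∃ i ∈ l, w i = 0
      · obtain ⟨i, hi, hwi⟩ := hz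
        obtain ⟨l', rfl⟩ := Multiset.exists_cons_of_mem hi
        rw [Multiset.map_cons, Multiset.prod_cons]
        refine B.mul_mem (h₀ i hwi) (ih _ ?_ l' rfl ?_)
        · rw [← hl]; simp
        · simpa [hwi] using hsum
      · push Not at hz
        by_cases hp : ∃ i ∈ l, w i = 1
        · by_cases hm : ∃ j ∈ l, w j = -1
          · obtain ⟨i, hi, hwi⟩ := hp
            obtain ⟨j, hj, hwj⟩ := hm
            obtain ⟨l', rfl⟩ := Multiset.exists_cons_of_mem hi
            have hj' : j ∈ l' := by
              rcases Multiset.mem_cons.1 hj with rfl | h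
              · omega
              · exact h
            obtain ⟨l'', rfl⟩ := Multiset.exists_cons_of_mem hj'
            rw [Multiset.map_cons, Multiset.prod_cons, Multiset.map_cons, Multiset.prod_cons,
              ← mul_assoc]
            refine B.mul_mem (h₁ i j hwi hwj) (ih _ ?_ l'' rfl ?_)
            · rw [← hl]; simp
            · simpa [hwi, hwj] using hsum
          · exfalso
            push Not at hm
            have : ∀ i ∈ l, w i = 1 := fun i hi => by
              rcases hw i with h | h | h
              · exact absurd h (hz i hi)
              · exact h
              · exact absurd h (hm i hi)
            rw [Multiset.map_congr rfl this] at hsum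
            obtain ⟨i, hi, -⟩ := hp
            have := Multiset.card_pos_iff_exists_mem.2 ⟨i, hi⟩
            simp at hsum
            simp [hsum] at hi
        · push Not at hp
          have : ∀ i ∈ l, w i = -1 := fun i hi => by
            rcases hw i with h | h | h
            · exact absurd h (hz i hi)
            · exact absurd h (hp i hi)
            · exact h
          rw [Multiset.map_congr rfl this] at hsum
          simp at hsum
          simp [hsum]
  -- decomposition into weight components
  have hdec : ∃ (s : Finset (Multiset ι)) (c : Multiset ι → ℂ),
      f = ∑ l ∈ s, c l • (l.map g).prod := by
    have : f ∈ Submodule.span ℂ (Submonoid.closure (Set.range g) : Set (Z → ℂ)) := by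
      rw [← Algebra.adjoin_eq_span]; exact hf
    have h' : (Submonoid.closure (Set.range g) : Set (Z → ℂ)) ⊆
        Set.range (fun l : Multiset ι => (l.map g).prod) := by
      intro y hy
      induction hy using Submonoid.closure_induction with
      | mem x hx => obtain ⟨i, rfl⟩ := hx; exact ⟨{i}, by simp⟩
      | one => exact ⟨0, by simp⟩
      | mul x y _ _ hx hy =>
        obtain ⟨l, rfl⟩ := hx
        obtain ⟨m, rfl⟩ := hy
        exact ⟨l + m, by simp⟩
    obtain ⟨c, hc⟩ := (Finsupp.mem_span_range_iff_exists_finsupp).1 (Submodule.span_mono h' this)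
    exact ⟨c.support, c, hc.symm⟩
  obtain ⟨s, c, hs⟩ := hdec
  -- The torus multiplies a monomial by `t` to the power `m` times its weight. Since `f` is constant
  -- along each orbit, the Laurent polynomial in `t` so obtained equals its constant term, which
  -- collects the monomials of weight zero.
  have key : f = ∑ l ∈ s with (l.map w).sum = 0, c l • (l.map g).prod := by
    funext z
    have hprod : ∀ (l : Multiset ι) t ht, (l.map g).prod (act t ht z) =
        t ^ (m * (l.map w).sum) * (l.map g).prod z := by
      intro l t ht
      induction l using Multiset.induction_on with
      | empty => simp
      | cons i l ih =>
        simp only [Multiset.map_cons, Multiset.prod_cons, Multiset.sum_cons, Pi.mul_apply, ih,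
          hact, mul_add, zpow_add₀ ht]
        ring
    rw [Finset.sum_apply]
    simp only [Pi.smul_apply, smul_eq_mul]
    have hfil : ∀ l ∈ s, ((l.map w).sum = 0 ↔ m * (l.map w).sum = 0) := fun l _ => by simp [hm]
    rw [Finset.filter_congr hfil]
    refine eq_sum_of_laurent_const s (fun l => m * (l.map w).sum) _ fun t ht => ?_
    rw [← hinv t ht z]
    conv_rhs => rw [hs]
    rw [Finset.sum_apply]
    refine Finset.sum_congr rfl fun l _ => ?_
    rw [Pi.smul_apply, hprod, smul_eq_mul]
    ring
  rw [key]
  exact B.sum_mem fun l hl => B.smul_mem (hmono l (Finset.mem_filter.1 hl).2) _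

end

noncomputable section

/-! ### The coordinate ring of the monodromy space -/

/-- A polynomial that vanishes on a non-empty open part of an irreducible hypersurface is a
multiple of its equation. -/
theorem dvd_of_vanishing {σ : Type*} [Finite σ] {F h g : MvPolynomial σ ℂ} (hF : Irreducible F)
    {b : σ → ℂ} (hb : eval b F = 0) (hbh : eval b h ≠ 0)
    (hv : ∀ p, eval p F = 0 → eval p h ≠ 0 → eval p g = 0) : F ∣ g := by
  have hprime : (Ideal.span {F}).IsPrime := (Ideal.span_singleton_prime hF.ne_zero).2 hF.prime
  -- `h * g` vanishes on all of `F = 0`, and the ideal `(F)` is prime, hence radical, so the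
  -- Nullstellensatz applies. The point `b` then excludes `F ∣ h`.
  have hmem : h * g ∈ Ideal.span {F} := by
    rw [← hprime.radical, ← vanishingIdeal_zeroLocus_eq_radical (K := ℂ)]
    intro p hp
    have hp' : eval p F = 0 := by
      have := hp F (Ideal.mem_span_singleton_self F)
      exact this
    show eval p (h * g) = 0
    rw [map_mul]
    by_cases hh : eval p h = 0
    · simp [hh]
    · simp [hv p hp' hh]
  rcases hF.prime.dvd_or_dvd (Ideal.mem_span_singleton.1 hmem) with ⟨k, rfl⟩ | hd
  · simp [hb] at hbh
  · exact hd

/-- Irreducibility of a polynomial that is linear in one of the variables. -/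
theorem irreducible_of_linear {σ : Type*} {F A B : MvPolynomial σ ℂ} (i : σ)
    (hF : F = A * X i + B) (hA : A ∈ supported ℂ {i}ᶜ) (hB : B ∈ supported ℂ {i}ᶜ)
    (hrel : IsRelPrime A B) (hA0 : A ≠ 0) : Irreducible F := by
  rw [hF]
  rw [mem_supported] at hA hB
  exact irreducible_mul_X_add A B i hA0 (fun h => hA h rfl) (fun h => hB h rfl) hrel

/-- A point on `A = 0` with `B ≠ 0` shows that `A` does not divide `B`, which suffices for
irreducible `A`. -/
theorem isRelPrime_of_eval {σ : Type*} {A B : MvPolynomial σ ℂ} (hA : Irreducible A) (b : σ → ℂ)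
    (h₁ : eval b A = 0) (h₂ : eval b B ≠ 0) : IsRelPrime A B :=
  (hA.isRelPrime_iff_not_dvd).2 fun ⟨k, hk⟩ => h₂ (by rw [hk, map_mul, h₁, zero_mul])

theorem irreducible_X {σ : Type*} (i : σ) : Irreducible (X i : MvPolynomial σ ℂ) :=
  X_prime.irreducible

theorem X_mem_supported_compl {σ : Type*} {i j : σ} (h : j ≠ i) :
    (X j : MvPolynomial σ ℂ) ∈ supported ℂ ({i}ᶜ : Set σ) :=
  (X_mem_supported).2 h

theorem C_mem_supported {σ : Type*} (s : Set σ) (c : ℂ) :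
    (C c : MvPolynomial σ ℂ) ∈ supported ℂ s :=
  (supported ℂ s).algebraMap_mem c

namespace MonodromyFamily

/-- A criterion for a family of surfaces to be the monodromy space. -/
theorem isMonodromySpace_of (D : MonodromyFamily)
    (hparam : ∀ i, (fun x => D.param x i) ∈ AnalyticData.invariantRing D.type)
    (hcoord : ∀ i, (fun x => D.coord x i) ∈ AnalyticData.invariantRing D.type)
    (hunit : ∀ i ∈ D.units, ∀ x, D.param x i ≠ 0)
    (hinv : ∀ i ∈ D.units, (fun x => (D.param x i)⁻¹) ∈ AnalyticData.regularFunctions D.type)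
    (hF : ∀ x, eval (Sum.elim (D.param x) (D.coord x)) D.equation = 0)
    (hker : ∀ g, (∀ x, eval (Sum.elim (D.param x) (D.coord x)) g = 0) → D.equation ∣ g)
    (hgen : ∀ A : Subalgebra ℂ (AnalyticData D.type → ℂ), (∀ i, (fun x => D.param x i) ∈ A) →
      (∀ i, (fun x => D.coord x i) ∈ A) →
      (∀ i ∈ D.units, (fun x => (D.param x i)⁻¹) ∈ A) →
      ∀ f ∈ AnalyticData.invariantRing D.type, f ∈ A) : D.IsMonodromySpace := by
  classical
  let I := AnalyticData.invariantRing D.type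
  let φ₀ : MvPolynomial (Fin D.numParams ⊕ Fin 3) ℂ →ₐ[ℂ] I :=
    aeval (Sum.elim (fun i => ⟨_, hparam i⟩) (fun i => ⟨_, hcoord i⟩))
  have hφ₀ : ∀ g x, (φ₀ g : AnalyticData D.type → ℂ) x =
      eval (Sum.elim (D.param x) (D.coord x)) g := by
    intro g x
    let ev : I →ₐ[ℂ] ℂ := (Pi.evalAlgHom ℂ (fun _ : AnalyticData D.type => ℂ) x).comp I.val
    have : ev.comp φ₀ = aeval (Sum.elim (D.param x) (D.coord x)) := by
      ext i
      rcases i with i | i <;> simp [ev, φ₀]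
    have h2 := DFunLike.congr_fun this g
    exact h2
  have hφF : ∀ g ∈ Ideal.span {D.equation}, φ₀ g = 0 := by
    intro g hg
    obtain ⟨k, rfl⟩ := Ideal.mem_span_singleton.1 hg
    apply Subtype.ext
    funext x
    rw [hφ₀, map_mul, hF, zero_mul]
    rfl
  let φ₁ : (MvPolynomial (Fin D.numParams ⊕ Fin 3) ℂ ⧸ Ideal.span {D.equation}) →ₐ[ℂ] I :=
    Ideal.Quotient.liftₐ _ φ₀ hφF
  have hφ₁ : ∀ g, φ₁ (Ideal.Quotient.mk _ g) = φ₀ g := fun g => rfl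
  set u := Ideal.Quotient.mk (Ideal.span {D.equation})
    (∏ i ∈ D.units, (X (Sum.inl i) : MvPolynomial (Fin D.numParams ⊕ Fin 3) ℂ)) with hu
  -- The inverse of an invariant is invariant, so only its regularity had to be assumed.
  have hinvI : ∀ i ∈ D.units, (fun x => (D.param x i)⁻¹) ∈ I := fun i hi =>
    ⟨hinv i hi, fun x y hxy => congrArg (·⁻¹) ((hparam i).2 x y hxy)⟩
  have hunit' : ∀ i ∈ D.units, IsUnit (φ₀ (X (Sum.inl i))) := by
    intro i hi
    refine IsUnit.of_mul_eq_one (⟨_, hinvI i hi⟩ : I) (Subtype.ext (funext fun x => ?_))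
    show (φ₀ (X (Sum.inl i)) : AnalyticData D.type → ℂ) x * (D.param x i)⁻¹ = 1
    rw [hφ₀]
    simp [hunit i hi x]
  have hu1 : IsUnit (φ₁ u) := by
    rw [hu, hφ₁, map_prod]
    exact (Submonoid.prod_mem (IsUnit.submonoid I) fun i hi => hunit' i hi)
  have hpow : ∀ y : Submonoid.powers u, IsUnit (φ₁ y) := by
    rintro ⟨_, n, rfl⟩
    simpa using hu1.pow n
  let e : D.TotalRing →ₐ[ℂ] I := IsLocalization.liftAlgHom (M := Submonoid.powers u) hpow
  have he : ∀ g, e (D.toTotalRing g) = φ₀ g := by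
    intro g
    show IsLocalization.lift hpow (algebraMap _ _ (Ideal.Quotient.mk _ g)) = _
    rw [IsLocalization.lift_eq]
    exact hφ₁ g
  -- After clearing the denominator, an element of the kernel comes from a polynomial that vanishes
  -- on all analytic data, hence from a multiple of the equation.
  have hinj : Function.Injective e := by
    rw [injective_iff_map_eq_zero]
    intro z hz
    obtain ⟨⟨r, s⟩, hrs⟩ := IsLocalization.surj (Submonoid.powers u) z
    obtain ⟨g, rfl⟩ := Ideal.Quotient.mk_surjective r
    have h1 : φ₀ g = 0 := by
      have := congrArg e hrs
      rw [map_mul, hz, zero_mul] at this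
      rw [← he]
      exact this.symm
    have h2 : Ideal.Quotient.mk (Ideal.span {D.equation}) g = 0 := by
      rw [Ideal.Quotient.eq_zero_iff_mem, Ideal.mem_span_singleton]
      refine hker g fun x => ?_
      rw [← hφ₀, h1]
      rfl
    simp only [h2, map_zero] at hrs
    exact (IsUnit.mul_left_eq_zero (IsLocalization.map_units _ s)).1 hrs
  -- The image of `e` is a subalgebra containing the parameters, the coordinates and the inverses of
  -- the units, so `hgen` applies to it.
  have hsurj : Function.Surjective e := by
    let A : Subalgebra ℂ (AnalyticData D.type → ℂ) := (I.val.comp e).range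
    intro f
    have hf : (f : AnalyticData D.type → ℂ) ∈ A := by
      refine hgen A (fun i => ⟨D.toTotalRing (X (Sum.inl i)), ?_⟩)
        (fun i => ⟨D.toTotalRing (X (Sum.inr i)), ?_⟩) (fun i hi => ?_) f f.2
      · funext x
        show (e _ : AnalyticData D.type → ℂ) x = _
        rw [he, hφ₀]
        simp
      · funext x
        show (e _ : AnalyticData D.type → ℂ) x = _
        rw [he, hφ₀]
        simp
      -- Only the product of the units is inverted in `TotalRing`; each factor divides it and is
      -- therefore a unit too.
      · have hul : IsUnit (D.toTotalRing (X (Sum.inl i))) := by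
          have : IsUnit (D.toTotalRing (∏ i ∈ D.units, X (Sum.inl i))) :=
            IsLocalization.map_units D.TotalRing (⟨u, Submonoid.mem_powers u⟩ : Submonoid.powers u)
          exact isUnit_of_dvd_unit (map_dvd (algebraMap _ D.TotalRing)
            (map_dvd (Ideal.Quotient.mk (Ideal.span {D.equation}))
              (Finset.dvd_prod_of_mem (fun i => X (Sum.inl i)) hi))) this
        obtain ⟨w, hw⟩ := hul.exists_right_inv
        refine ⟨w, ?_⟩
        funext x
        show (e w : AnalyticData D.type → ℂ) x = _
        have h1 := congrArg (fun z : D.TotalRing => (e z : AnalyticData D.type → ℂ) x) hw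
        simp only [map_mul, map_one] at h1
        have h2 : (e (D.toTotalRing (X (Sum.inl i))) : AnalyticData D.type → ℂ) x *
          (e w : AnalyticData D.type → ℂ) x = 1 := h1
        rw [he, hφ₀] at h2
        simp only [eval_X, Sum.elim_inl] at h2
        exact eq_inv_of_mul_eq_one_right h2
    obtain ⟨z, hz⟩ := hf
    exact ⟨z, Subtype.ext hz⟩
  refine ⟨AlgEquiv.ofBijective e ⟨hinj, hsurj⟩, fun i => ?_, fun i => ?_⟩
  · funext x
    show (e _ : AnalyticData D.type → ℂ) x = _
    rw [he, hφ₀]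
    simp
  · funext x
    show (e _ : AnalyticData D.type → ℂ) x = _
    rw [he, hφ₀]
    simp

end MonodromyFamily

/-! ### Formal equivalence of power series -/

/-- The completed local rings of `f = 0` and `g = 0` at the origin are isomorphic. -/
def FormalEquiv (f g : MvPowerSeries (Fin 3) ℂ) : Prop :=
  Nonempty ((MvPowerSeries (Fin 3) ℂ ⧸ Ideal.span {f}) ≃ₐ[ℂ]
    (MvPowerSeries (Fin 3) ℂ ⧸ Ideal.span {g}))

namespace FormalEquiv

variable {f g h : MvPowerSeries (Fin 3) ℂ}

theorem symm : FormalEquiv f g → FormalEquiv g f := fun ⟨e⟩ => ⟨e.symm⟩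

theorem trans : FormalEquiv f g → FormalEquiv g h → FormalEquiv f h :=
  fun ⟨e⟩ ⟨e'⟩ => ⟨e.trans e'⟩

theorem of_eq (hfg : f = g) : FormalEquiv f g := hfg ▸ ⟨AlgEquiv.refl⟩

theorem unit_mul {u : MvPowerSeries (Fin 3) ℂ} (hu : IsUnit u) : FormalEquiv (u * f) f :=
  ⟨Ideal.quotientEquivAlgOfEq ℂ (Ideal.span_singleton_mul_left_unit hu f)⟩

theorem of_algEquiv (e : MvPowerSeries (Fin 3) ℂ ≃ₐ[ℂ] MvPowerSeries (Fin 3) ℂ) :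
    FormalEquiv f (e f) :=
  ⟨Ideal.quotientEquivAlg _ _ e (by rw [Ideal.map_span]; simp)⟩

/-- Substitutions inverse to each other on the variables are inverse automorphisms of the ring of
power series. -/
theorem subst {a b : Fin 3 → MvPowerSeries (Fin 3) ℂ} (ha : MvPowerSeries.HasSubst a)
    (hb : MvPowerSeries.HasSubst b)
    (hab : ∀ i, (b i).subst a = MvPowerSeries.X i) (hba : ∀ i, (a i).subst b = MvPowerSeries.X i) :
    FormalEquiv f (f.subst a) := by
  have h₁ : ∀ f : MvPowerSeries (Fin 3) ℂ, (f.subst a).subst b = f := fun f => by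
    rw [MvPowerSeries.subst_comp_subst_apply ha hb, funext hba]
    exact congrFun MvPowerSeries.subst_self f
  have h₂ : ∀ f : MvPowerSeries (Fin 3) ℂ, (f.subst b).subst a = f := fun f => by
    rw [MvPowerSeries.subst_comp_subst_apply hb ha, funext hab]
    exact congrFun MvPowerSeries.subst_self f
  have := of_algEquiv (f := f) (AlgEquiv.ofAlgHom (MvPowerSeries.substAlgHom (R := ℂ) ha)
    (MvPowerSeries.substAlgHom hb) (AlgHom.ext fun f => by simp [h₂])
    (AlgHom.ext fun f => by simp [h₁]))
  simpa using this

end FormalEquiv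

/-- The power series that do not involve the `i`-th variable. -/
def withoutVar (i : Fin 3) : Subalgebra ℂ (MvPowerSeries (Fin 3) ℂ) where
  -- Independence of `X i` is taken in the form in which it is used: a substitution that fixes all
  -- other variables fixes the series.
  carrier := {h | ∀ s : Fin 3 → MvPowerSeries (Fin 3) ℂ, MvPowerSeries.HasSubst s →
    (∀ j, j ≠ i → s j = MvPowerSeries.X j) → h.subst s = h}
  mul_mem' := fun ha hb s hs hsj => by rw [MvPowerSeries.subst_mul hs, ha s hs hsj, hb s hs hsj]
  add_mem' := fun ha hb s hs hsj => by rw [MvPowerSeries.subst_add hs, ha s hs hsj, hb s hs hsj]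
  algebraMap_mem' := fun c s hs hsj => by
    rw [← MvPowerSeries.coe_substAlgHom hs]; exact AlgHom.commutes _ c

theorem X_mem_withoutVar {i j : Fin 3} (h : j ≠ i) : MvPowerSeries.X j ∈ withoutVar i :=
  fun s hs hsj => by rw [MvPowerSeries.subst_X hs, hsj j h]

/-- The substituted inverse is again an inverse of `u`, and inverses are unique. -/
theorem mem_withoutVar_of_mul_eq_one {i : Fin 3} {u v : MvPowerSeries (Fin 3) ℂ}
    (hu : u ∈ withoutVar i) (huv : u * v = 1) : v ∈ withoutVar i := by
  intro s hs hsj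
  have h₁ : u * v.subst s = 1 := by
    have := congrArg (MvPowerSeries.subst s) huv
    rw [MvPowerSeries.subst_mul hs, hu s hs hsj, ← MvPowerSeries.coe_substAlgHom hs, map_one] at this
    rwa [MvPowerSeries.coe_substAlgHom hs] at this
  calc v.subst s = (u * v) * v.subst s := by rw [huv, one_mul]
    _ = v * (u * v.subst s) := by ring
    _ = v := by rw [h₁, mul_one]

/-- The substitution `X i ↦ u X i + h`, where `u` and `h` do not involve `X i`. -/
def shear (i : Fin 3) (u h : MvPowerSeries (Fin 3) ℂ) : Fin 3 → MvPowerSeries (Fin 3) ℂ :=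
  Function.update MvPowerSeries.X i (u * MvPowerSeries.X i + h)

theorem hasSubst_shear (i : Fin 3) (u : MvPowerSeries (Fin 3) ℂ) {h : MvPowerSeries (Fin 3) ℂ}
    (h0 : MvPowerSeries.constantCoeff h = 0) : MvPowerSeries.HasSubst (shear i u h) := by
  refine MvPowerSeries.hasSubst_of_constantCoeff_zero fun j => ?_
  by_cases hj : j = i
  · subst hj; simp [shear, h0]
  · simp [shear, hj]

/-- The inverse is the shear `X i ↦ v X i - v h`; the series `u`, `v`, `h` pass unchanged through
both substitutions. -/
theorem FormalEquiv.shear {i : Fin 3} {u v h : MvPowerSeries (Fin 3) ℂ} (hu : u ∈ withoutVar i)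
    (huv : u * v = 1) (hh : h ∈ withoutVar i) (h0 : MvPowerSeries.constantCoeff h = 0)
    {f : MvPowerSeries (Fin 3) ℂ} : FormalEquiv f (f.subst (shear i u h)) := by
  have hv := mem_withoutVar_of_mul_eq_one hu huv
  have ha := hasSubst_shear i u h0
  have hb := hasSubst_shear i v (h := -(v * h)) (by simp [h0])
  have hs : ∀ u h : MvPowerSeries (Fin 3) ℂ, ∀ j, j ≠ i → _root_.shear i u h j = MvPowerSeries.X j :=
    fun u h j hj => by simp [_root_.shear, hj]
  have hi : ∀ u h : MvPowerSeries (Fin 3) ℂ, _root_.shear i u h i = u * MvPowerSeries.X i + h :=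
    fun u h => by simp [_root_.shear]
  refine FormalEquiv.subst ha hb (fun j => ?_) (fun j => ?_)
  · by_cases hj : j = i
    · subst hj
      rw [hi, MvPowerSeries.subst_add ha, MvPowerSeries.subst_mul ha, hv _ ha (hs _ _),
        MvPowerSeries.subst_X ha, hi, (withoutVar j).neg_mem ((withoutVar j).mul_mem hv hh) _ ha
        (hs _ _)]
      linear_combination MvPowerSeries.X j * huv
    · rw [hs _ _ j hj, MvPowerSeries.subst_X ha, hs _ _ j hj]
  · by_cases hj : j = i
    · subst hj
      rw [hi, MvPowerSeries.subst_add hb, MvPowerSeries.subst_mul hb, hu _ hb (hs _ _),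
        MvPowerSeries.subst_X hb, hi, hh _ hb (hs _ _)]
      linear_combination (MvPowerSeries.X j - h) * huv
    · rw [hs _ _ j hj, MvPowerSeries.subst_X hb, hs _ _ j hj]

end

noncomputable section

/-! ### Singularities of type `A_n` -/

/-- The hyperbolic and the elliptic form of the `A_n` singularity. -/
theorem formalEquiv_hyperbolic (n : ℕ) :
    FormalEquiv (MvPowerSeries.X 2 * MvPowerSeries.X 0 + MvPowerSeries.X 1 ^ n)
      (MvPowerSeries.X 0 ^ 2 + MvPowerSeries.X 1 ^ 2 + MvPowerSeries.X 2 ^ n) := by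
  let x : Fin 3 → MvPowerSeries (Fin 3) ℂ := MvPowerSeries.X
  let c : ℂ → MvPowerSeries (Fin 3) ℂ := algebraMap ℂ _
  have hI : c Complex.I * c Complex.I = -1 := by
    rw [← map_mul, Complex.I_mul_I, map_neg, map_one]
  have h12 : c (1 / 2) * 2 = 1 := by
    have : (2 : MvPowerSeries (Fin 3) ℂ) = c 2 := (map_ofNat (algebraMap ℂ _) 2).symm
    rw [this, ← map_mul]
    norm_num [c]
  have hc : ∀ (i : Fin 3) (a : ℂ), c a ∈ withoutVar i := fun i a => (withoutVar i).algebraMap_mem a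
  have hcs : ∀ (a : ℂ) {s : Fin 3 → MvPowerSeries (Fin 3) ℂ} (hs : MvPowerSeries.HasSubst s),
      MvPowerSeries.substAlgHom (R := ℂ) hs (c a) = c a := fun a s hs => AlgHom.commutes _ a
  -- `X² + Y² = (X + iY)(X - iY)`
  have step₁ : FormalEquiv (x 0 ^ 2 + x 1 ^ 2 + x 2 ^ n)
      (x 0 ^ 2 + 2 * c Complex.I * x 0 * x 1 + x 2 ^ n) := by
    have h0 : MvPowerSeries.constantCoeff (c Complex.I * x 1) = 0 := by simp [x]
    refine (FormalEquiv.shear (i := 0) (u := 1) (v := 1) (h := c Complex.I * x 1) (one_mem _)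
      (one_mul 1) ((withoutVar 0).mul_mem (hc _ _) (X_mem_withoutVar (by decide))) h0).trans
      (FormalEquiv.of_eq ?_)
    have hs := hasSubst_shear 0 1 h0
    rw [← MvPowerSeries.coe_substAlgHom hs]
    simp only [map_add, map_pow, x, MvPowerSeries.substAlgHom_X hs]
    simp only [shear, Function.update_self, ne_eq, Fin.reduceEq, not_false_eq_true,
      Function.update_of_ne]
    linear_combination MvPowerSeries.X 1 ^ 2 * hI
  -- The substitution `y ↦ (i/2)(x - y)` turns `x² + 2ixy` into `xy`.
  have step₂ : FormalEquiv (x 0 ^ 2 + 2 * c Complex.I * x 0 * x 1 + x 2 ^ n)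
      (x 1 * x 0 + x 2 ^ n) := by
    have h0 : MvPowerSeries.constantCoeff (c Complex.I * c (1 / 2) * x 0) = 0 := by simp [x]
    refine (FormalEquiv.shear (i := 1) (u := -(c Complex.I * c (1 / 2)))
      (v := 2 * c Complex.I) (h := c Complex.I * c (1 / 2) * x 0)
      ((withoutVar 1).neg_mem ((withoutVar 1).mul_mem (hc _ _) (hc _ _))) ?_
      ((withoutVar 1).mul_mem ((withoutVar 1).mul_mem (hc _ _) (hc _ _))
        (X_mem_withoutVar (by decide))) h0).trans (FormalEquiv.of_eq ?_)
    · linear_combination -2 * c (1 / 2) * hI + h12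
    · have hs := hasSubst_shear 1 (-(c Complex.I * c (1 / 2))) h0
      rw [← MvPowerSeries.coe_substAlgHom hs]
      simp only [map_add, map_pow, map_mul, x, MvPowerSeries.substAlgHom_X hs, hcs,
        map_ofNat]
      simp only [shear, Function.update_self, ne_eq, Fin.reduceEq, not_false_eq_true,
        Function.update_of_ne]
      linear_combination (2 * c (1 / 2) * MvPowerSeries.X 0 * (MvPowerSeries.X 0
        - MvPowerSeries.X 1)) * hI + (MvPowerSeries.X 0 * MvPowerSeries.X 1
        - MvPowerSeries.X 0 ^ 2) * h12
  have step₃ : FormalEquiv (x 1 * x 0 + x 2 ^ n) (x 2 * x 0 + x 1 ^ n) := by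
    have hs : MvPowerSeries.HasSubst ![x 0, x 2, x 1] :=
      MvPowerSeries.hasSubst_of_constantCoeff_zero fun i => by fin_cases i <;> simp [x]
    refine (FormalEquiv.subst hs hs (fun i => ?_) (fun i => ?_)).trans (FormalEquiv.of_eq ?_)
    · fin_cases i <;> simp [x, MvPowerSeries.subst_X hs]
    · fin_cases i <;> simp [x, MvPowerSeries.subst_X hs]
    · rw [← MvPowerSeries.coe_substAlgHom hs]
      simp only [map_add, map_mul, map_pow, x, MvPowerSeries.substAlgHom_X hs]
      simp
  exact ((step₁.trans step₂).trans step₃).symm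

/-- The type of the singularity of `z (xy + qx + py) + ex² + mxy + ty²` for `q ≠ 0`. It is read off
from the restriction of the quadratic form to the curve `xy + qx + py = 0`. -/
theorem formalEquiv_of_restriction {e m t p q : ℂ} (hq : q ≠ 0) (k : ℕ)
    {W : MvPowerSeries (Fin 3) ℂ} (hW : W ∈ withoutVar 0) (hW0 : MvPowerSeries.constantCoeff W ≠ 0)
    (hrestr : algebraMap ℂ _ e * algebraMap ℂ _ p ^ 2
      - algebraMap ℂ _ m * algebraMap ℂ _ p * (algebraMap ℂ _ q + MvPowerSeries.X 1)
      + algebraMap ℂ _ t * (algebraMap ℂ _ q + MvPowerSeries.X 1) ^ 2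
        = MvPowerSeries.X 1 ^ k * W) :
    FormalEquiv (MvPowerSeries.X 2 * (MvPowerSeries.X 0 * MvPowerSeries.X 1
        + algebraMap ℂ _ q * MvPowerSeries.X 0 + algebraMap ℂ _ p * MvPowerSeries.X 1)
        + algebraMap ℂ _ e * MvPowerSeries.X 0 ^ 2
        + algebraMap ℂ _ m * MvPowerSeries.X 0 * MvPowerSeries.X 1
        + algebraMap ℂ _ t * MvPowerSeries.X 1 ^ 2)
      (MvPowerSeries.X 0 ^ 2 + MvPowerSeries.X 1 ^ 2 + MvPowerSeries.X 2 ^ (k + 2)) := by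
  let x : Fin 3 → MvPowerSeries (Fin 3) ℂ := MvPowerSeries.X
  let c : ℂ → MvPowerSeries (Fin 3) ℂ := algebraMap ℂ _
  have hc : ∀ (i : Fin 3) (a : ℂ), c a ∈ withoutVar i := fun i a => (withoutVar i).algebraMap_mem a
  have hcs : ∀ (a : ℂ) {s : Fin 3 → MvPowerSeries (Fin 3) ℂ} (hs : MvPowerSeries.HasSubst s),
      MvPowerSeries.substAlgHom (R := ℂ) hs (c a) = c a := fun a s hs => AlgHom.commutes _ a
  have hcc : ∀ a : ℂ, MvPowerSeries.constantCoeff (c a) = a := fun a => by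
    simp [c, MvPowerSeries.algebraMap_apply]
  obtain ⟨v, hv⟩ : ∃ v, (c q + x 1) * v = 1 := by
    refine ⟨(c q + x 1)⁻¹, MvPowerSeries.mul_inv_cancel _ ?_⟩
    simpa [hcc, x] using hq
  have hqx : ∀ i : Fin 3, (1 : Fin 3) ≠ i → c q + x 1 ∈ withoutVar i := fun i hi =>
    (withoutVar i).add_mem (hc _ _) (X_mem_withoutVar hi)
  have hvi : ∀ i : Fin 3, (1 : Fin 3) ≠ i → v ∈ withoutVar i := fun i hi =>
    mem_withoutVar_of_mul_eq_one (hqx i hi) hv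
  have hv0 : MvPowerSeries.constantCoeff v ≠ 0 := fun h => by
    have := congrArg MvPowerSeries.constantCoeff hv
    rw [map_mul, h, mul_zero, map_one] at this
    exact zero_ne_one this
  have hrestr : c e * c p ^ 2 - c m * c p * (c q + x 1) + c t * (c q + x 1) ^ 2 = x 1 ^ k * W :=
    hrestr
  -- `xy + qx + py` becomes the new first coordinate: `x` is replaced by `(x - py)/(q + y)`, where
  -- `q + y` is a unit because `q ≠ 0`.
  have step₁ : FormalEquiv
      (x 2 * (x 0 * x 1 + c q * x 0 + c p * x 1) + c e * x 0 ^ 2 + c m * x 0 * x 1 + c t * x 1 ^ 2)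
      (x 2 * x 0 + c e * (v * (x 0 - c p * x 1)) ^ 2 + c m * (v * (x 0 - c p * x 1)) * x 1
        + c t * x 1 ^ 2) := by
    have h0 : MvPowerSeries.constantCoeff (-(v * c p * x 1)) = 0 := by simp [x]
    refine (FormalEquiv.shear (i := 0) (u := v) (v := c q + x 1) (h := -(v * c p * x 1))
      (hvi 0 (by decide)) (by rw [mul_comm]; exact hv)
      ((withoutVar 0).neg_mem ((withoutVar 0).mul_mem
        ((withoutVar 0).mul_mem (hvi 0 (by decide)) (hc _ _)) (X_mem_withoutVar (by decide))))
      h0).trans (FormalEquiv.of_eq ?_)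
    have hs := hasSubst_shear 0 v h0
    rw [← MvPowerSeries.coe_substAlgHom hs]
    simp only [map_add, map_pow, map_mul, hcs, x, MvPowerSeries.substAlgHom_X hs]
    simp only [shear, Function.update_self, ne_eq, Fin.reduceEq, not_false_eq_true,
      Function.update_of_ne]
    linear_combination (x 2 * (x 0 - c p * x 1)) * hv
  -- All multiples of `x` in the quadratic form are absorbed by a shear of `z`. What is left is the
  -- form at `x = 0`, that is, its restriction to the original curve, which `hrestr` evaluates.
  have step₂ : FormalEquiv
      (x 2 * x 0 + c e * (v * (x 0 - c p * x 1)) ^ 2 + c m * (v * (x 0 - c p * x 1)) * x 1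
        + c t * x 1 ^ 2)
      (x 2 * x 0 + x 1 ^ 2 * (v ^ 2 * (x 1 ^ k * W))) := by
    set H := c e * v ^ 2 * (x 0 - 2 * (c p * x 1)) + c m * v * x 1 with hH
    have h0 : MvPowerSeries.constantCoeff (-H) = 0 := by simp [hH, x]
    have hv2 := hvi 2 (by decide)
    have h2 : (2 : MvPowerSeries (Fin 3) ℂ) ∈ withoutVar 2 := by
      have : (2 : MvPowerSeries (Fin 3) ℂ) = c 2 := (map_ofNat (algebraMap ℂ _) 2).symm
      rw [this]; exact hc _ _
    have hx : ∀ j : Fin 3, j ≠ 2 → x j ∈ withoutVar 2 := fun j hj => X_mem_withoutVar hj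
    have hHm : -H ∈ withoutVar 2 := by
      refine neg_mem (add_mem (mul_mem (mul_mem (hc _ _) (pow_mem hv2 2)) (sub_mem (hx 0 (by decide))
        (mul_mem h2 (mul_mem (hc _ _) (hx 1 (by decide))))))
        (mul_mem (mul_mem (hc _ _) hv2) (hx 1 (by decide))))
    refine (FormalEquiv.shear (i := 2) (u := 1) (v := 1) (h := -H) (one_mem _) (one_mul 1) hHm
      h0).trans (FormalEquiv.of_eq ?_)
    have hs := hasSubst_shear 2 1 h0
    have hvs : MvPowerSeries.substAlgHom hs v = v := by
      rw [MvPowerSeries.coe_substAlgHom]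
      exact hv2 _ hs fun j hj => by simp [shear, hj]
    rw [← MvPowerSeries.coe_substAlgHom hs, ← hrestr]
    simp only [map_add, map_pow, map_mul, map_sub, hcs, hvs, x, MvPowerSeries.substAlgHom_X hs]
    simp only [shear, Function.update_self, ne_eq, Fin.reduceEq, not_false_eq_true,
      Function.update_of_ne]
    rw [hH]
    linear_combination (x 1 ^ 2 * (c m * c p * v - c t * (1 + (c q + x 1) * v))) * hv
  -- The unit `U = v²W` is moved in front of the equation by rescaling `x` by `U`, and is then
  -- dropped since it does not change the ideal.
  have step₃ : FormalEquiv (x 2 * x 0 + x 1 ^ 2 * (v ^ 2 * (x 1 ^ k * W)))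
      (x 2 * x 0 + x 1 ^ (k + 2)) := by
    set U := v ^ 2 * W with hU
    have hU0 : MvPowerSeries.constantCoeff U ≠ 0 := by
      rw [hU, map_mul, map_pow]
      exact mul_ne_zero (pow_ne_zero 2 hv0) hW0
    have hUm : U ∈ withoutVar 0 := mul_mem (pow_mem (hvi 0 (by decide)) 2) hW
    have hUi := MvPowerSeries.mul_inv_cancel U hU0
    have h0 : MvPowerSeries.constantCoeff (0 : MvPowerSeries (Fin 3) ℂ) = 0 := map_zero _
    refine (FormalEquiv.shear (i := 0) (u := U) (v := U⁻¹) (h := 0) hUm hUi (zero_mem _) h0).trans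
      ((FormalEquiv.of_eq ?_).trans (FormalEquiv.unit_mul (u := U)
        (IsUnit.of_mul_eq_one _ hUi)))
    have hs := hasSubst_shear 0 U h0
    have hUs : MvPowerSeries.substAlgHom hs U = U := by
      rw [MvPowerSeries.coe_substAlgHom]
      exact hUm _ hs fun j hj => by simp [shear, hj]
    have : x 2 * x 0 + x 1 ^ 2 * (v ^ 2 * (x 1 ^ k * W)) = x 2 * x 0 + x 1 ^ (k + 2) * U := by
      rw [hU]; ring
    rw [this, ← MvPowerSeries.coe_substAlgHom hs]
    simp only [map_add, map_pow, map_mul, hUs, x, MvPowerSeries.substAlgHom_X hs]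
    simp only [shear, Function.update_self, ne_eq, Fin.reduceEq, not_false_eq_true,
      Function.update_of_ne]
    ring
  exact ((step₁.trans step₂).trans step₃).trans (formalEquiv_hyperbolic (k + 2))

/-! ### Cubic surfaces with a triangle of lines at infinity -/

/-- The cubic `x₁x₂x₃ + ex₁² + tx₂² + gx₃² + Ax₁ + Bx₂ + Cx₃ + D`. -/
def triangleCubic (e t g A B C' D : ℂ) : MvPolynomial (Fin 3) ℂ :=
  X 0 * X 1 * X 2 + (C e * X 0 ^ 2 + C t * X 1 ^ 2 + C g * X 2 ^ 2)
    + (C A * X 0 + C B * X 1 + C C' * X 2) + C D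

theorem eq_triangleCubic {f : MvPolynomial (Fin 3) ℂ} {e t g A B C' D : ℂ}
    (h : ∀ b : Fin 3 → ℂ, eval b f = b 0 * b 1 * b 2 + (e * b 0 ^ 2 + t * b 1 ^ 2 + g * b 2 ^ 2)
      + (A * b 0 + B * b 1 + C' * b 2) + D) : f = triangleCubic e t g A B C' D := by
  apply MvPolynomial.funext
  intro b
  rw [h b]
  simp [triangleCubic]

section

variable {e t g A B C' D : ℂ}

theorem isCubic_triangleCubic :
    IsCubicWithThreeLinesAtInfinity (triangleCubic e t g A B C' D) := by
  have h3 : (X 0 * X 1 * X 2 : MvPolynomial (Fin 3) ℂ) ∈ homogeneousSubmodule (Fin 3) ℂ 3 :=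
    ((isHomogeneous_X ℂ 0).mul (isHomogeneous_X ℂ 1)).mul (isHomogeneous_X ℂ 2)
  have hsq : ∀ (c : ℂ) (i : Fin 3), (C c * X i ^ 2).IsHomogeneous 2 := fun c i => by
    simpa using (isHomogeneous_C (Fin 3) c).mul ((isHomogeneous_X ℂ i).pow 2)
  have hl : ∀ (c : ℂ) (i : Fin 3), (C c * X i).IsHomogeneous 1 := fun c i => by
    simpa using (isHomogeneous_C (Fin 3) c).mul (isHomogeneous_X ℂ i)
  have h2 : (C e * X 0 ^ 2 + C t * X 1 ^ 2 + C g * X 2 ^ 2 : MvPolynomial (Fin 3) ℂ) ∈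
      homogeneousSubmodule (Fin 3) ℂ 2 := ((hsq e 0).add (hsq t 1)).add (hsq g 2)
  have h1 : (C A * X 0 + C B * X 1 + C C' * X 2 : MvPolynomial (Fin 3) ℂ) ∈
      homogeneousSubmodule (Fin 3) ℂ 1 := ((hl A 0).add (hl B 1)).add (hl C' 2)
  have h0 : (C D : MvPolynomial (Fin 3) ℂ) ∈ homogeneousSubmodule (Fin 3) ℂ 0 :=
    isHomogeneous_C _ _
  have hcomp : homogeneousComponent 3 (triangleCubic e t g A B C' D) = X 0 * X 1 * X 2 := by
    unfold triangleCubic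
    rw [map_add, map_add, map_add, homogeneousComponent_of_mem h3, homogeneousComponent_of_mem h2,
      homogeneousComponent_of_mem h1, homogeneousComponent_of_mem h0]
    simp
  refine ⟨le_antisymm ?_ ?_, hcomp⟩
  · unfold triangleCubic
    refine (totalDegree_add _ _).trans (max_le ((totalDegree_add _ _).trans (max_le
      ((totalDegree_add _ _).trans (max_le ?_ ?_)) ?_)) ?_)
    · exact IsHomogeneous.totalDegree_le h3
    · exact (IsHomogeneous.totalDegree_le h2).trans (by norm_num)
    · exact (IsHomogeneous.totalDegree_le h1).trans (by norm_num)
    · simp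
  · by_contra hlt
    rw [homogeneousComponent_eq_zero _ _ (not_le.1 hlt)] at hcomp
    have := congrArg (eval fun _ => (1 : ℂ)) hcomp
    simp at this

theorem isSingularPoint_triangleCubic (a : Fin 3 → ℂ) :
    IsSingularPoint (triangleCubic e t g A B C' D) a ↔
      a 0 * a 1 * a 2 + (e * a 0 ^ 2 + t * a 1 ^ 2 + g * a 2 ^ 2)
        + (A * a 0 + B * a 1 + C' * a 2) + D = 0 ∧
      a 1 * a 2 + 2 * e * a 0 + A = 0 ∧ a 0 * a 2 + 2 * t * a 1 + B = 0 ∧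
      a 0 * a 1 + 2 * g * a 2 + C' = 0 := by
  unfold IsSingularPoint
  rw [Fin.forall_fin_succ, Fin.forall_fin_two]
  have hX : ∀ i j : Fin 3, pderiv i (X j : MvPolynomial (Fin 3) ℂ) = if i = j then 1 else 0 := by
    intro i j
    rw [pderiv_X, Pi.single_apply]
    simp [eq_comm]
  refine and_congr ?_ (and_congr ?_ (and_congr ?_ ?_))
  · simp [triangleCubic]
  all_goals
    simp only [triangleCubic, map_add, Derivation.leibniz, Derivation.leibniz_pow, pderiv_C, hX]
    simp
    constructor <;> intro h <;> linear_combination h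

/-- The type of a singular point of a triangle cubic that is linear in `x₃`. -/
theorem hasTypeA_of_restriction (a : Fin 3 → ℂ)
    (hs : IsSingularPoint (triangleCubic e t 0 A B C' D) a) (hq : a 1 ≠ 0) (k : ℕ)
    (w₀ w₁ w₂ : ℂ) (hw₀ : w₀ ≠ 0)
    (hrestr : ∀ y : ℂ, e * a 0 ^ 2 - a 2 * a 0 * (a 1 + y) + t * (a 1 + y) ^ 2
      = y ^ k * (w₀ + w₁ * y + w₂ * y ^ 2)) :
    HasTypeA (k + 1) (triangleCubic e t 0 A B C' D) a := by
  rw [isSingularPoint_triangleCubic] at hs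
  obtain ⟨h₀, h₁, h₂, h₃⟩ := hs
  -- Taylor expansion at a singular point: the constant and linear terms vanish. The coefficient of
  -- `xy` is `a 2`, and the cubic term is `xyz`.
  have hpoly : (aeval (fun i => X i + C (a i)) (triangleCubic e t 0 A B C' D) :
      MvPolynomial (Fin 3) ℂ) = X 2 * (X 0 * X 1 + C (a 1) * X 0 + C (a 0) * X 1)
        + C e * X 0 ^ 2 + C (a 2) * X 0 * X 1 + C t * X 1 ^ 2 := by
    apply MvPolynomial.funext
    intro b
    simp [triangleCubic]
    linear_combination h₀ + b 0 * h₁ + b 1 * h₂ + b 2 * h₃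
  have hrestr' : (C e * C (a 0) ^ 2 + C t * (C (a 1) + X 1) ^ 2 : MvPolynomial (Fin 3) ℂ) =
      X 1 ^ k * (C w₀ + C w₁ * X 1 + C w₂ * X 1 ^ 2) + C (a 2) * C (a 0) * (C (a 1) + X 1) := by
    apply MvPolynomial.funext
    intro b
    have := hrestr (b 1)
    simp only [map_add, map_mul, map_pow, eval_C, eval_X]
    linear_combination this
  have hcoe := congrArg (fun f : MvPolynomial (Fin 3) ℂ => (f : MvPowerSeries (Fin 3) ℂ)) hrestr'
  simp only [coe_add, coe_mul, coe_pow, coe_C, coe_X] at hcoe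
  have hX1 : (MvPowerSeries.X 1 : MvPowerSeries (Fin 3) ℂ) ∈ withoutVar 0 :=
    X_mem_withoutVar (by decide)
  have key := formalEquiv_of_restriction (e := e) (m := a 2) (t := t) (p := a 0) hq k
    (W := algebraMap ℂ _ w₀ + algebraMap ℂ _ w₁ * MvPowerSeries.X 1
      + algebraMap ℂ _ w₂ * MvPowerSeries.X 1 ^ 2)
    (add_mem (add_mem ((withoutVar 0).algebraMap_mem _)
      (mul_mem ((withoutVar 0).algebraMap_mem _) hX1))
      (mul_mem ((withoutVar 0).algebraMap_mem _) (pow_mem hX1 2)))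
    (by simpa [MvPowerSeries.algebraMap_apply] using hw₀)
    (by simp only [MvPowerSeries.algebraMap_apply, Algebra.algebraMap_self, RingHom.id_apply]
        linear_combination hcoe)
  simp only [MvPowerSeries.algebraMap_apply, Algebra.algebraMap_self, RingHom.id_apply] at key
  have e₁ : ((X 2 * (X 0 * X 1 + C (a 1) * X 0 + C (a 0) * X 1) + C e * X 0 ^ 2
      + C (a 2) * X 0 * X 1 + C t * X 1 ^ 2 : MvPolynomial (Fin 3) ℂ) :
      MvPowerSeries (Fin 3) ℂ) = MvPowerSeries.X 2 * (MvPowerSeries.X 0 * MvPowerSeries.X 1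
        + MvPowerSeries.C (a 1) * MvPowerSeries.X 0 + MvPowerSeries.C (a 0) * MvPowerSeries.X 1)
        + MvPowerSeries.C e * MvPowerSeries.X 0 ^ 2
        + MvPowerSeries.C (a 2) * MvPowerSeries.X 0 * MvPowerSeries.X 1
        + MvPowerSeries.C t * MvPowerSeries.X 1 ^ 2 := by
    simp only [coe_add, coe_mul, coe_pow, coe_C, coe_X]
  have e₂ : ((X 0 ^ 2 + X 1 ^ 2 + X 2 ^ (k + 1 + 1) : MvPolynomial (Fin 3) ℂ) :
      MvPowerSeries (Fin 3) ℂ) =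
        MvPowerSeries.X 0 ^ 2 + MvPowerSeries.X 1 ^ 2 + MvPowerSeries.X 2 ^ (k + 2) := by
    simp only [coe_add, coe_pow, coe_X]
  unfold HasTypeA
  rw [hpoly, e₁, e₂]
  exact key

/-- The type of a singular point of a triangle cubic with `x₂ ≠ 0` and non-degenerate restriction. -/
theorem hasTypeA_one_of_ne_zero (a : Fin 3 → ℂ)
    (hs : IsSingularPoint (triangleCubic e t 0 A B C' D) a) (hq : a 1 ≠ 0)
    (h : e * a 0 ^ 2 - a 2 * a 0 * a 1 + t * a 1 ^ 2 ≠ 0) :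
    HasTypeA 1 (triangleCubic e t 0 A B C' D) a :=
  hasTypeA_of_restriction a hs hq 0 _ (2 * t * a 1 - a 2 * a 0) t h fun y => by ring

/-- The criterion via restriction assumes that the second coordinate is non-zero; exchanging `x₁`
and `x₂` makes it available when only the first one is. -/
theorem hasTypeA_swap {n : ℕ} (a : Fin 3 → ℂ)
    (h : HasTypeA n (triangleCubic t e 0 B A C' D) ![a 1, a 0, a 2]) :
    HasTypeA n (triangleCubic e t 0 A B C' D) a := by
  let x : Fin 3 → MvPowerSeries (Fin 3) ℂ := MvPowerSeries.X
  have hs : MvPowerSeries.HasSubst ![x 1, x 0, x 2] :=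
    MvPowerSeries.hasSubst_of_constantCoeff_zero fun i => by fin_cases i <;> simp [x]
  have key : FormalEquiv
      ((aeval (fun i => X i + C (a i)) (triangleCubic e t 0 A B C' D) : MvPolynomial (Fin 3) ℂ) :
        MvPowerSeries (Fin 3) ℂ)
      ((aeval (fun i => X i + C ((![a 1, a 0, a 2] : Fin 3 → ℂ) i))
        (triangleCubic t e 0 B A C' D) : MvPolynomial (Fin 3) ℂ) : MvPowerSeries (Fin 3) ℂ) := by
    refine (FormalEquiv.subst hs hs (fun i => ?_) (fun i => ?_)).trans (FormalEquiv.of_eq ?_)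
    · fin_cases i <;> simp [x, MvPowerSeries.subst_X hs]
    · fin_cases i <;> simp [x, MvPowerSeries.subst_X hs]
    · rw [MvPowerSeries.subst_coe]
      have hx : ![x 1, x 0, x 2] = fun i => (((![X 1, X 0, X 2] : Fin 3 → MvPolynomial (Fin 3) ℂ) i :
          MvPolynomial (Fin 3) ℂ) : MvPowerSeries (Fin 3) ℂ) := by
        funext i
        fin_cases i <;> simp [x]
      have hcoe : ∀ (b : Fin 3 → MvPolynomial (Fin 3) ℂ) (p : MvPolynomial (Fin 3) ℂ),
          aeval (fun i => (b i : MvPowerSeries (Fin 3) ℂ)) p =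
            ((aeval b p : MvPolynomial (Fin 3) ℂ) : MvPowerSeries (Fin 3) ℂ) := by
        intro b p
        have : (aeval fun i => (b i : MvPowerSeries (Fin 3) ℂ)) =
            (coeToMvPowerSeries.algHom ℂ).comp (aeval b) := by
          ext1 i
          simp
        rw [this]
        simp
      rw [hx, hcoe]
      congr 1
      apply MvPolynomial.funext
      intro b
      simp [triangleCubic]
      ring
  exact key.trans h

theorem isSingularPoint_swap (a : Fin 3 → ℂ)
    (h : IsSingularPoint (triangleCubic e t 0 A B C' D) a) :
    IsSingularPoint (triangleCubic t e 0 B A C' D) ![a 1, a 0, a 2] := by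
  rw [isSingularPoint_triangleCubic] at h ⊢
  obtain ⟨h₀, h₁, h₂, h₃⟩ := h
  refine ⟨?_, ?_, ?_, ?_⟩ <;> simp only [Matrix.cons_val]
  · linear_combination h₀
  · linear_combination h₂
  · linear_combination h₁
  · linear_combination h₃

/-- A singular point with non-degenerate restriction is of type `A₁`. -/
theorem hasTypeA_one (a : Fin 3 → ℂ)
    (hs : IsSingularPoint (triangleCubic e t 0 A B C' D) a)
    (h : e * a 0 ^ 2 - a 2 * a 0 * a 1 + t * a 1 ^ 2 ≠ 0) :
    HasTypeA 1 (triangleCubic e t 0 A B C' D) a := by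
  by_cases hq : a 1 = 0
  · have hp : a 0 ≠ 0 := fun hp => h (by rw [hp, hq]; ring)
    refine hasTypeA_swap a (hasTypeA_one_of_ne_zero _ (isSingularPoint_swap a hs) hp ?_)
    intro h'
    apply h
    simp only [Matrix.cons_val] at h'
    linear_combination h'
  · exact hasTypeA_one_of_ne_zero a hs hq h

/-- With `(p, q, m) = a`, the restricted form is `(ep² - mpq + tq²) + (2tq - mp)y + ty²`, up to the
factor `y²` and a unit. Here its order in `y` is one. -/
theorem hasTypeA_two (a : Fin 3 → ℂ)
    (hs : IsSingularPoint (triangleCubic e t 0 A B C' D) a) (hq : a 1 ≠ 0)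
    (h : e * a 0 ^ 2 - a 2 * a 0 * a 1 + t * a 1 ^ 2 = 0) (h' : 2 * t * a 1 - a 2 * a 0 ≠ 0) :
    HasTypeA 2 (triangleCubic e t 0 A B C' D) a :=
  hasTypeA_of_restriction a hs hq 1 _ t 0 h' fun y => by linear_combination h

/-- The constant and the linear coefficient of the restricted form both vanish, so that `ty²` with
`t ≠ 0` remains. -/
theorem hasTypeA_three (a : Fin 3 → ℂ)
    (hs : IsSingularPoint (triangleCubic e t 0 A B C' D) a) (hq : a 1 ≠ 0) (ht : t ≠ 0)
    (h : e * a 0 ^ 2 - a 2 * a 0 * a 1 + t * a 1 ^ 2 = 0) (h' : 2 * t * a 1 - a 2 * a 0 = 0) :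
    HasTypeA 3 (triangleCubic e t 0 A B C' D) a :=
  hasTypeA_of_restriction a hs hq 2 _ 0 0 ht fun y => by linear_combination h + y * h'

end

end

/-! ### Explicit local data, normal forms of analytic data and the monodromy relation -/

noncomputable section

open SL2

namespace LocalData

/-- Local data at a regular singular point. -/
def ofRegular (M : SL2) : LocalData .regular := ⟨M, trivial, Fin.elim0⟩

/-- Local data at an unramified irregular point. -/
def ofUnramified (r : ℕ) (α : ℂ) (h : α ≠ 0) (c : Fin (2 * r) → ℂ) :
    LocalData (.unramified r) := ⟨diag α h, ⟨rfl, rfl⟩, c⟩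

/-- Local data at a ramified point. -/
def ofRamified (m : ℕ) (c : Fin (2 * m + 1) → ℂ) : LocalData (.ramified m) := ⟨weylSL, rfl, c⟩

theorem top_regular (d : LocalData .regular) : d.top = d.formal := by
  simp [top, PointType.numStokes]

theorem top_unramified_one (d : LocalData (.unramified 1)) :
    d.top = d.formal * (lowerSL (d.stokes (0 : Fin 2)) * upperSL (d.stokes (1 : Fin 2))) := by
  have : ∀ f : Fin 2 → SL2, (List.ofFn f).prod = f 0 * f 1 := fun f => by
    simp [List.ofFn_succ]
  exact congrArg (d.formal * ·) (this fun k => d.stokesMap k)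

theorem top_unramified_two (d : LocalData (.unramified 2)) :
    d.top = d.formal * (lowerSL (d.stokes (0 : Fin 4)) * upperSL (d.stokes (1 : Fin 4)) *
      (lowerSL (d.stokes (2 : Fin 4)) * upperSL (d.stokes (3 : Fin 4)))) := by
  have : ∀ f : Fin 4 → SL2, (List.ofFn f).prod = f 0 * f 1 * (f 2 * f 3) := fun f => by
    simp [List.ofFn_succ, mul_assoc]
  exact congrArg (d.formal * ·) (this fun k => d.stokesMap k)

/-- The factors are bracketed into two halves so that `top = 1` can be solved as an equation between
one half and the inverse of the other. The same bracketing is used in `top_ramified_two`. -/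
theorem top_unramified_three (d : LocalData (.unramified 3)) :
    d.top = d.formal * ((lowerSL (d.stokes (0 : Fin 6)) * upperSL (d.stokes (1 : Fin 6)) *
      lowerSL (d.stokes (2 : Fin 6))) * (upperSL (d.stokes (3 : Fin 6)) *
      lowerSL (d.stokes (4 : Fin 6)) * upperSL (d.stokes (5 : Fin 6)))) := by
  have : ∀ f : Fin 6 → SL2, (List.ofFn f).prod = (f 0 * f 1 * f 2) * (f 3 * f 4 * f 5) :=
    fun f => by simp [List.ofFn_succ, mul_assoc]
  exact congrArg (d.formal * ·) (this fun k => d.stokesMap k)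

theorem formal_ramified {m : ℕ} (d : LocalData (.ramified m)) : d.formal = weylSL := d.isFormal

theorem top_ramified_zero (d : LocalData (.ramified 0)) :
    d.top = weylSL * lowerSL (d.stokes (0 : Fin 1)) := by
  have : ∀ f : Fin 1 → SL2, (List.ofFn f).prod = f 0 := fun f => by simp [List.ofFn_succ]
  rw [← formal_ramified d]
  exact congrArg (d.formal * ·) (this fun k => d.stokesMap k)

theorem top_ramified_one (d : LocalData (.ramified 1)) :
    d.top = weylSL * (lowerSL (d.stokes (0 : Fin 3)) * upperSL (d.stokes (1 : Fin 3)) *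
      lowerSL (d.stokes (2 : Fin 3))) := by
  have : ∀ f : Fin 3 → SL2, (List.ofFn f).prod = f 0 * f 1 * f 2 := fun f => by
    simp [List.ofFn_succ, mul_assoc]
  rw [← formal_ramified d]
  exact congrArg (d.formal * ·) (this fun k => d.stokesMap k)

theorem top_ramified_two (d : LocalData (.ramified 2)) :
    d.top = weylSL * (lowerSL (d.stokes (0 : Fin 5)) * upperSL (d.stokes (1 : Fin 5)) *
      (lowerSL (d.stokes (2 : Fin 5)) * upperSL (d.stokes (3 : Fin 5)) *
        lowerSL (d.stokes (4 : Fin 5)))) := by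
  have : ∀ f : Fin 5 → SL2, (List.ofFn f).prod = f 0 * f 1 * (f 2 * f 3 * f 4) := fun f => by
    simp [List.ofFn_succ, mul_assoc]
  rw [← formal_ramified d]
  exact congrArg (d.formal * ·) (this fun k => d.stokesMap k)

section

variable {r : ℕ} (d : LocalData (.unramified r))

theorem formal_entry₀₁ : d.formal 0 1 = 0 := d.isFormal.1

theorem formal_entry₁₀ : d.formal 1 0 = 0 := d.isFormal.2

theorem formal_mul : d.formal 0 0 * d.formal 1 1 = 1 := by
  have := det_entry d.formal
  rwa [formal_entry₀₁, zero_mul, sub_zero] at this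

theorem formal_ne_zero : d.formal 0 0 ≠ 0 := left_ne_zero_of_mul_eq_one d.formal_mul

theorem formal_entry₁₁ : d.formal 1 1 = (d.formal 0 0)⁻¹ :=
  eq_inv_of_mul_eq_one_right d.formal_mul

end

end LocalData

theorem isAdmissible_one (τ : PointType) : τ.IsAdmissible 1 := by
  cases τ
  · trivial
  · exact ⟨by simp, by simp⟩
  · rfl

theorem isAdmissible_diag (r : ℕ) (t : ℂ) (ht : t ≠ 0) :
    (PointType.unramified r).IsAdmissible (diag t ht) := ⟨rfl, rfl⟩

namespace AnalyticData

variable {r : ℕ} {τ : Fin r → PointType}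

theorem monodromyAt_self (x : AnalyticData τ) (i : Fin r) : x.monodromyAt i i = (x.loc i).top := by
  simp only [monodromyAt, monodromy]
  group

theorem linkFrom_self (x : AnalyticData τ) (i : Fin r) : x.linkFrom i i = 1 := by
  simp [linkFrom]

theorem trace_monodromyAt (x : AnalyticData τ) (i j : Fin r) :
    (x.monodromyAt i j).1.trace = (x.loc j).top.1.trace := by
  have : x.monodromyAt i j = (x.link i * (x.link j)⁻¹) * (x.loc j).top *
      (x.link i * (x.link j)⁻¹)⁻¹ := by
    simp only [monodromyAt, monodromy]
    group
  rw [this, trace_conj]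

theorem trace_monodromyAt_of_regular (x : AnalyticData τ) (i j : Fin r) (h : τ j = .regular) :
    (x.monodromyAt i j).1.trace = (x.loc j).formal.1.trace := by
  have : ∀ (σ : PointType), σ = .regular → ∀ d : LocalData σ, d.top = d.formal := by
    rintro _ rfl d
    exact d.top_regular
  rw [trace_monodromyAt, this _ h]

/-- The change of bases that makes the link at the `i`-th point and those at the regular singular
points trivial. -/
def normalizing (i : Fin r) (x : AnalyticData τ) (j : Fin r) : SL2 :=
  open Classical in if τ j = .regular then x.link i * (x.link j)⁻¹ else 1

theorem normalizing_isAdmissible (i : Fin r) (x : AnalyticData τ) (j : Fin r) :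
    (τ j).IsAdmissible (normalizing i x j) := by
  unfold normalizing
  split_ifs with h
  · rw [h]; trivial
  · exact isAdmissible_one _

/-- An invariant function is a polynomial in the entries of the monodromies at regular singular
points and of the links, formal monodromies, Stokes constants at irregular points. -/
theorem invariant_mem (i : Fin r) (A : Subalgebra ℂ (AnalyticData τ → ℂ))
    (h₁ : ∀ j, τ j = .regular → EntriesIn A fun x => x.monodromyAt i j)
    (h₂ : ∀ j, τ j ≠ .regular → EntriesIn A fun x => (x.loc j).formal)
    (h₃ : ∀ j, τ j ≠ .regular → ∀ k, (fun x => (x.loc j).stokes k) ∈ A)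
    (h₄ : ∀ j, τ j ≠ .regular → EntriesIn A fun x => x.linkFrom i j)
    {f : AnalyticData τ → ℂ} (hf : f ∈ invariantRing τ) : f ∈ A := by
  rw [mem_invariantRing_iff] at hf
  -- The value of `f` is read at the normal form. There the link at a regular point is `1` and its
  -- formal monodromy is the monodromy seen from `V(p_i)`; the link at an irregular point is the
  -- link from `V(p_i)`.
  have hfN : f = fun x => f (x.act (x.link i) (normalizing i x) (normalizing_isAdmissible i x)) :=
    funext fun x => (hf.2 x _ _ _).symm
  rw [hfN]
  refine pullback_mem A (fun x => x.act (x.link i) (normalizing i x)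
    (normalizing_isAdmissible i x)) (fun j => ?_) (fun j k => ?_) (fun j => ?_) hf.1
  · by_cases h : τ j = .regular
    · have htop : ∀ (σ : PointType), σ = .regular → ∀ d : LocalData σ, d.formal = d.top := by
        rintro _ rfl d
        exact d.top_regular.symm
      have : ∀ x : AnalyticData τ, ((x.act (x.link i) (normalizing i x)
          (normalizing_isAdmissible i x)).loc j).formal = x.monodromyAt i j := by
        intro x
        show normalizing i x j * (x.loc j).formal * (normalizing i x j)⁻¹ = _
        rw [htop _ h]
        simp only [normalizing, if_pos h, monodromyAt, monodromy]
        group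
      simp_rw [this]
      exact h₁ j h
    · have : ∀ x : AnalyticData τ, ((x.act (x.link i) (normalizing i x)
          (normalizing_isAdmissible i x)).loc j).formal = (x.loc j).formal := by
        intro x
        show normalizing i x j * (x.loc j).formal * (normalizing i x j)⁻¹ = _
        simp only [normalizing, if_neg h]
        group
      simp_rw [this]
      exact h₂ j h
  · by_cases h : τ j = .regular
    · exfalso
      have : ∀ σ : PointType, σ = .regular → Fin σ.numStokes → False := by
        rintro _ rfl k
        exact k.elim0
      exact this _ h k
    · have : ∀ x : AnalyticData τ, ((x.act (x.link i) (normalizing i x)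
          (normalizing_isAdmissible i x)).loc j).stokes k = (x.loc j).stokes k := by
        intro x
        apply stokesMatrix_injective k
        show LocalData.stokesMap _ k = (x.loc j).stokesMap k
        rw [loc_act, LocalData.stokesMap_conj]
        simp only [normalizing, if_neg h]
        group
      simp_rw [this]
      exact h₃ j h k
  · by_cases h : τ j = .regular
    · have : ∀ x : AnalyticData τ, (x.act (x.link i) (normalizing i x)
          (normalizing_isAdmissible i x)).link j = 1 := by
        intro x
        simp only [link_act, normalizing, if_pos h]
        group
      simp_rw [this]
      exact entriesIn_const A 1
    · have : ∀ x : AnalyticData τ, (x.act (x.link i) (normalizing i x)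
          (normalizing_isAdmissible i x)).link j = x.linkFrom i j := by
        intro x
        simp only [link_act, normalizing, if_neg h, linkFrom]
        group
      simp_rw [this]
      exact h₄ j h

/-- The action of the torus of `V(p_i) = V_q ⊕ V_{-q}`. -/
def torusAct (i : Fin r) {m : ℕ} (hi : τ i = .unramified m) (t : ℂ) (ht : t ≠ 0)
    (x : AnalyticData τ) : AnalyticData τ :=
  x.act 1 (fun j => if j = i then diag t ht else 1) fun j => by
    split_ifs with h
    · rw [h, hi]; exact isAdmissible_diag m t ht
    · exact isAdmissible_one _

/-- The entries have torus weights `0, 2, -2, 0`; halved, these are the weights used in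
`torus_invariant_mem` with `m = 2`. -/
theorem conj_diag_entry (t : ℂ) (ht : t ≠ 0) (A : SL2) :
    (diag t ht * A * (diag t ht)⁻¹) 0 0 = A 0 0 ∧
    (diag t ht * A * (diag t ht)⁻¹) 0 1 = t ^ 2 * A 0 1 ∧
    (diag t ht * A * (diag t ht)⁻¹) 1 0 = (t ^ 2)⁻¹ * A 1 0 ∧
    (diag t ht * A * (diag t ht)⁻¹) 1 1 = A 1 1 := by
  refine ⟨?_, ?_, ?_, ?_⟩ <;>
  simp only [mul_entry, inv_entry₀₀, inv_entry₀₁, inv_entry₁₀, inv_entry₁₁, diag_entry₀₀,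
    diag_entry₀₁, diag_entry₁₀, diag_entry₁₁] <;> field_simp <;> ring

/-! ### The monodromy relation -/

theorem top_eq_one {τ : Fin 1 → PointType} (x : AnalyticData τ) : (x.loc 0).top = 1 := by
  have := x.relation
  simp only [List.ofFn_succ, List.ofFn_zero, List.prod_cons, List.prod_nil, mul_one] at this
  calc (x.loc 0).top = x.link 0 * ((x.link 0)⁻¹ * (x.loc 0).top * x.link 0) * (x.link 0)⁻¹ := by
        group
    _ = 1 := by rw [this]; group

theorem relation_two {τ : Fin 2 → PointType} (x : AnalyticData τ) (i : Fin 2) :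
    x.monodromyAt i 0 * x.monodromyAt i 1 = 1 := by
  have : x.monodromy 0 * x.monodromy 1 = 1 := by
    have := x.relation
    simpa [List.ofFn_succ, monodromy] using this
  calc _ = x.link i * (x.monodromy 0 * x.monodromy 1) * (x.link i)⁻¹ := by
        simp only [monodromyAt]; group
    _ = 1 := by rw [this]; group

theorem relation_three {τ : Fin 3 → PointType} (x : AnalyticData τ) (i : Fin 3) :
    x.monodromyAt i 0 * x.monodromyAt i 1 * x.monodromyAt i 2 = 1 := by
  have : x.monodromy 0 * x.monodromy 1 * x.monodromy 2 = 1 := by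
    have := x.relation
    simpa [List.ofFn_succ, mul_assoc, monodromy] using this
  calc _ = x.link i * (x.monodromy 0 * x.monodromy 1 * x.monodromy 2) * (x.link i)⁻¹ := by
        simp only [monodromyAt]; group
    _ = 1 := by rw [this]; group

theorem monodromyAt_eq_linkFrom (x : AnalyticData τ) (i j : Fin r) :
    x.monodromyAt i j = (x.linkFrom i j)⁻¹ * (x.loc j).top * x.linkFrom i j := by
  simp only [monodromyAt, monodromy, linkFrom]
  group

/-! ### Construction of analytic data -/

/-- Analytic data with one singular point. -/
def ofOne {τ : PointType} (d : LocalData τ) (h : d.top = 1) : AnalyticData ![τ] where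
  loc := fun | 0 => d
  link _ := 1
  relation := by
    simp only [List.ofFn_succ, List.ofFn_zero, List.prod_cons, List.prod_nil]
    simpa using h

/-- Analytic data with two singular points. -/
def ofTwo {τ₀ τ₁ : PointType} (d₀ : LocalData τ₀) (d₁ : LocalData τ₁) (L : SL2)
    (h : d₀.top * (L⁻¹ * d₁.top * L) = 1) : AnalyticData ![τ₀, τ₁] where
  loc := fun | 0 => d₀ | 1 => d₁
  link := ![1, L]
  relation := by
    simp only [List.ofFn_succ, List.ofFn_zero, List.prod_cons, List.prod_nil]
    simpa using h

/-- Analytic data with three singular points and trivial links. -/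
def ofThree {τ₀ τ₁ τ₂ : PointType} (d₀ : LocalData τ₀) (d₁ : LocalData τ₁) (d₂ : LocalData τ₂)
    (h : d₀.top * d₁.top * d₂.top = 1) : AnalyticData ![τ₀, τ₁, τ₂] where
  loc := fun | 0 => d₀ | 1 => d₁ | 2 => d₂
  link _ := 1
  relation := by
    simp only [List.ofFn_succ, List.ofFn_zero, List.prod_cons, List.prod_nil]
    simpa [mul_assoc] using h

end AnalyticData

end

/-! ### Ramified points and the first Painlevé relation -/

noncomputable section

open SL2

namespace LocalData

/-- Two entries of the matrix relation determine the first two Stokes constants and a third one is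
the PI cubic; the last entry follows from these. -/
theorem top_eq_one_ramified_two {d : LocalData (.ramified 2)} : d.top = 1 ↔
    d.stokes (0 : Fin 5) = -(1 + d.stokes (2 : Fin 5) * d.stokes (3 : Fin 5)) ∧
    d.stokes (1 : Fin 5) = 1 + d.stokes (3 : Fin 5) * d.stokes (4 : Fin 5) ∧
    d.stokes (2 : Fin 5) * d.stokes (4 : Fin 5) * d.stokes (3 : Fin 5) + d.stokes (2 : Fin 5)
      + d.stokes (4 : Fin 5) + 1 = 0 := by
  rw [top_ramified_two, ← mul_assoc, ← eq_inv_iff_mul_eq_one, eq_iff_entries]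
  simp [-Matrix.SpecialLinearGroup.coe_mul, -Matrix.SpecialLinearGroup.coe_inv, mul_entry]
  constructor
  · rintro ⟨h₁, h₂, h₃, h₄⟩
    refine ⟨?_, ?_, ?_⟩
    · linear_combination -h₁
    · linear_combination h₄
    · linear_combination h₃
  · rintro ⟨h₁, h₂, h₃⟩
    refine ⟨?_, ?_, ?_, ?_⟩
    · linear_combination -h₁
    · linear_combination -h₁ * d.stokes (1 : Fin 5) + (1 + d.stokes (2 : Fin 5) * d.stokes (3 : Fin 5)) * h₂
        + d.stokes (3 : Fin 5) * h₃
    · linear_combination h₃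
    · linear_combination h₂

end LocalData

namespace AnalyticData

theorem entriesIn_formal_ramified {r : ℕ} {τ : Fin r → PointType} (j : Fin r) {m : ℕ}
    (hj : τ j = .ramified m) (A : Subalgebra ℂ (AnalyticData τ → ℂ)) :
    EntriesIn A fun x => (x.loc j).formal := by
  have : ∀ x : AnalyticData τ, (x.loc j).formal = weylSL := by
    intro x
    have : ∀ (σ : PointType), σ = .ramified m → ∀ d : LocalData σ, d.formal = weylSL := by
      rintro _ rfl d
      exact d.isFormal
    exact this _ hj _
  simp_rw [this]
  exact entriesIn_const A _

theorem entriesIn_linkFrom_self {r : ℕ} {τ : Fin r → PointType} (i : Fin r)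
    (A : Subalgebra ℂ (AnalyticData τ → ℂ)) : EntriesIn A fun x => x.linkFrom i i := by
  simp_rw [linkFrom_self]
  exact entriesIn_const A 1

theorem entriesIn_top {r : ℕ} {τ : Fin r → PointType} (j : Fin r)
    {A : Subalgebra ℂ (AnalyticData τ → ℂ)} (h₁ : EntriesIn A fun x => (x.loc j).formal)
    (h₂ : ∀ k, (fun x => (x.loc j).stokes k) ∈ A) : EntriesIn A fun x => (x.loc j).top :=
  h₁.mul (entriesIn_prod _ fun k => entriesIn_stokesMatrix _ (h₂ k))

theorem stokes_act_ramified {r : ℕ} {τ : Fin r → PointType} (j : Fin r) {m : ℕ}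
    (hj : τ j = .ramified m) (x : AnalyticData τ) (σ : SL2) (ρ : Fin r → SL2)
    (h : ∀ j, (τ j).IsAdmissible (ρ j)) (k : Fin (τ j).numStokes) :
    ((x.act σ ρ h).loc j).stokes k = (x.loc j).stokes k := by
  have hρ : ρ j = 1 := by
    have := h j
    rw [hj] at this
    exact this
  apply stokesMatrix_injective k
  show LocalData.stokesMap _ k = (x.loc j).stokesMap k
  rw [loc_act, LocalData.stokesMap_conj, hρ]
  group

/-- No base change is admissible at a ramified point, so each Stokes constant there is invariant by
itself. -/
theorem stokes_mem_invariantRing {r : ℕ} {τ : Fin r → PointType} (j : Fin r) {m : ℕ}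
    (hj : τ j = .ramified m) (k : Fin (τ j).numStokes) :
    (fun x => (x.loc j).stokes k) ∈ invariantRing τ :=
  (mem_invariantRing_iff _).2 ⟨stokes_mem j k, fun x σ ρ h => stokes_act_ramified j hj x σ ρ h k⟩

/-! ### Reducible data -/

theorem mulVec_zero_entry (A : SL2) (w : Fin 2 → ℂ) :
    A.1.mulVec w 0 = A 0 0 * w 0 + A 0 1 * w 1 := by
  simp [Matrix.mulVec, dotProduct, Fin.sum_univ_two]

theorem mulVec_one_entry (A : SL2) (w : Fin 2 → ℂ) :
    A.1.mulVec w 1 = A 1 0 * w 0 + A 1 1 * w 1 := by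
  simp [Matrix.mulVec, dotProduct, Fin.sum_univ_two]

theorem mulVec_ne_zero (A : SL2) {v : Fin 2 → ℂ} (hv : v ≠ 0) : A.1.mulVec v ≠ 0 := by
  intro h
  apply hv
  have : (A⁻¹ * A).1.mulVec v = 0 := by
    rw [Matrix.SpecialLinearGroup.coe_mul, ← Matrix.mulVec_mulVec, h, Matrix.mulVec_zero]
  simpa using this

/-- `w` spans a line that is stable under `A`. -/
def Stabilizes (A : SL2) (w : Fin 2 → ℂ) : Prop := ∃ c : ℂ, A.1.mulVec w = c • w

theorem Stabilizes.mul {A B : SL2} {w : Fin 2 → ℂ} (hA : Stabilizes A w) (hB : Stabilizes B w) :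
    Stabilizes (A * B) w := by
  obtain ⟨a, ha⟩ := hA
  obtain ⟨b, hb⟩ := hB
  refine ⟨b * a, ?_⟩
  rw [Matrix.SpecialLinearGroup.coe_mul, ← Matrix.mulVec_mulVec, hb, Matrix.mulVec_smul, ha,
    smul_smul]

theorem Stabilizes.prod {n : ℕ} {f : Fin n → SL2} {w : Fin 2 → ℂ}
    (h : ∀ k, Stabilizes (f k) w) : Stabilizes (List.ofFn f).prod w := by
  induction n with
  | zero => exact ⟨1, by simp⟩
  | succ n ih =>
    rw [List.ofFn_succ, List.prod_cons]
    exact (h 0).mul (ih fun k => h k.succ)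

theorem Stabilizes.conj {A g : SL2} {v : Fin 2 → ℂ} (h : Stabilizes A (g.1.mulVec v)) :
    Stabilizes (g⁻¹ * A * g) v := by
  obtain ⟨c, hc⟩ := h
  refine ⟨c, ?_⟩
  rw [Matrix.SpecialLinearGroup.coe_mul, Matrix.SpecialLinearGroup.coe_mul,
    ← Matrix.mulVec_mulVec, ← Matrix.mulVec_mulVec, hc, Matrix.mulVec_smul, Matrix.mulVec_mulVec,
    ← Matrix.SpecialLinearGroup.coe_mul, inv_mul_cancel]
  simp

theorem Stabilizes.entry₁₀ {A : SL2} {w : Fin 2 → ℂ} (h : Stabilizes A w) (h₁ : w 1 = 0)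
    (h₀ : w 0 ≠ 0) : A 1 0 = 0 := by
  obtain ⟨c, hc⟩ := h
  have := congrFun hc 1
  rw [mulVec_one_entry, Pi.smul_apply, h₁] at this
  simpa [h₀] using this

theorem Stabilizes.entry₀₁ {A : SL2} {w : Fin 2 → ℂ} (h : Stabilizes A w) (h₀ : w 0 = 0)
    (h₁ : w 1 ≠ 0) : A 0 1 = 0 := by
  obtain ⟨c, hc⟩ := h
  have := congrFun hc 0
  rw [mulVec_zero_entry, Pi.smul_apply, h₀] at this
  simpa [h₁] using this

theorem stabilizes_of_entry₁₀ {A : SL2} {w : Fin 2 → ℂ} (h : A 1 0 = 0) (h₁ : w 1 = 0) :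
    Stabilizes A w := by
  refine ⟨A 0 0, funext fun i => ?_⟩
  fin_cases i
  · show A.1.mulVec w 0 = A 0 0 * w 0
    rw [mulVec_zero_entry, h₁]; ring
  · show A.1.mulVec w 1 = A 0 0 * w 1
    rw [mulVec_one_entry, h₁, h]; ring

theorem stabilizes_of_entry₀₁ {A : SL2} {w : Fin 2 → ℂ} (h : A 0 1 = 0) (h₀ : w 0 = 0) :
    Stabilizes A w := by
  refine ⟨A 1 1, funext fun i => ?_⟩
  fin_cases i
  · show A.1.mulVec w 0 = A 1 1 * w 0
    rw [mulVec_zero_entry, h₀, h]; ring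
  · show A.1.mulVec w 1 = A 1 1 * w 1
    rw [mulVec_one_entry, h₀]; ring

section
variable {r : ℕ} {τ : Fin r → PointType}

theorem isReducible_iff (x : AnalyticData τ) : x.IsReducible ↔ ∃ v : Fin 2 → ℂ, v ≠ 0 ∧ ∀ j,
    Stabilizes (x.loc j).formal ((x.link j).1.mulVec v) ∧
    (∀ k, Stabilizes ((x.loc j).stokesMap k) ((x.link j).1.mulVec v)) ∧
    (τ j ≠ .regular → (x.link j).1.mulVec v 0 = 0 ∨ (x.link j).1.mulVec v 1 = 0) := by
  simp only [IsReducible, Stabilizes, Matrix.SpecialLinearGroup.coe_mul, Matrix.mulVec_mulVec]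

/-- The line of a reducible datum is stable under all monodromies. -/
theorem IsReducible.exists_vector {x : AnalyticData τ} (hx : x.IsReducible) :
    ∃ v : Fin 2 → ℂ, v ≠ 0 ∧
      (∀ i j, Stabilizes (x.monodromyAt i j) ((x.link i).1.mulVec v)) ∧
      (∀ j k, Stabilizes ((x.loc j).stokesMap k) ((x.link j).1.mulVec v)) ∧
      (∀ j, τ j ≠ .regular → (x.link j).1.mulVec v 0 = 0 ∨ (x.link j).1.mulVec v 1 = 0) := by
  rw [isReducible_iff] at hx
  obtain ⟨v, hv, h⟩ := hx
  refine ⟨v, hv, fun i j => ?_, fun j k => (h j).2.1 k, fun j => (h j).2.2⟩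
  have hM : Stabilizes (x.monodromy j) v :=
    Stabilizes.conj ((h j).1.mul (Stabilizes.prod fun k => (h j).2.1 k))
  have hM' : Stabilizes (((x.link i)⁻¹)⁻¹ * x.monodromy j * (x.link i)⁻¹)
      ((x.link i).1.mulVec v) := by
    apply Stabilizes.conj
    rw [Matrix.mulVec_mulVec, ← Matrix.SpecialLinearGroup.coe_mul, inv_mul_cancel]
    simpa using hM
  rwa [inv_inv] at hM'

/-- At an irregular point, the monodromies and the Stokes maps of reducible data are all upper
triangular or all lower triangular. -/
theorem IsReducible.triangular {x : AnalyticData τ} (hx : x.IsReducible) (i : Fin r)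
    (hi : τ i ≠ .regular) :
    ((∀ j, x.monodromyAt i j 1 0 = 0) ∧ ∀ k, (x.loc i).stokesMap k 1 0 = 0) ∨
    ((∀ j, x.monodromyAt i j 0 1 = 0) ∧ ∀ k, (x.loc i).stokesMap k 0 1 = 0) := by
  obtain ⟨v, hv, h₁, h₂, h₃⟩ := hx.exists_vector
  have hw := mulVec_ne_zero (x.link i) hv
  rcases h₃ i hi with h | h
  · have h' : (x.link i).1.mulVec v 1 ≠ 0 := fun h' => hw (funext fun k => by
      fin_cases k
      · exact h
      · exact h')
    exact Or.inr ⟨fun j => (h₁ i j).entry₀₁ h h', fun k => (h₂ i k).entry₀₁ h h'⟩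
  · have h' : (x.link i).1.mulVec v 0 ≠ 0 := fun h' => hw (funext fun k => by
      fin_cases k
      · exact h'
      · exact h)
    exact Or.inl ⟨fun j => (h₁ i j).entry₁₀ h h', fun k => (h₂ i k).entry₁₀ h h'⟩

/-- Data for which the first basis vector of `W` spans a stable line. -/
theorem isReducible_of_entries (x : AnalyticData τ)
    (h : ∀ j, (x.link j 1 0 = 0 ∧ (x.loc j).formal 1 0 = 0 ∧
        ∀ k, (x.loc j).stokesMap k 1 0 = 0) ∨
      (x.link j 0 0 = 0 ∧ (x.loc j).formal 0 1 = 0 ∧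
        ∀ k, (x.loc j).stokesMap k 0 1 = 0)) : x.IsReducible := by
  rw [isReducible_iff]
  refine ⟨![1, 0], fun h0 => one_ne_zero (congrFun h0 0), fun j => ?_⟩
  rcases h j with ⟨h₁, h₂, h₃⟩ | ⟨h₁, h₂, h₃⟩
  · have hw : (x.link j).1.mulVec ![1, 0] 1 = 0 := by
      rw [mulVec_one_entry, h₁]; simp
    exact ⟨stabilizes_of_entry₁₀ h₂ hw, fun k => stabilizes_of_entry₁₀ (h₃ k) hw,
      fun _ => Or.inr hw⟩
  · have hw : (x.link j).1.mulVec ![1, 0] 0 = 0 := by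
      rw [mulVec_zero_entry, h₁]; simp
    exact ⟨stabilizes_of_entry₀₁ h₂ hw, fun k => stabilizes_of_entry₀₁ (h₃ k) hw,
      fun _ => Or.inl hw⟩

end

/-- Analytic data with a ramified point are irreducible. -/
theorem not_isReducible_of_ramified {r : ℕ} {τ : Fin r → PointType} (j : Fin r) {m : ℕ}
    (hj : τ j = .ramified m) (x : AnalyticData τ) : ¬ x.IsReducible := by
  rw [isReducible_iff]
  rintro ⟨v, hv, h⟩
  obtain ⟨hc, -, hw⟩ := h j
  have hformal : (x.loc j).formal = weylSL := by
    have : ∀ (σ : PointType), σ = .ramified m → ∀ d : LocalData σ, d.formal = weylSL := by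
      rintro _ rfl d
      exact d.isFormal
    exact this _ hj _
  rw [hformal] at hc
  have hw := hw (by rw [hj]; exact fun h => by cases h)
  have hne := mulVec_ne_zero (x.link j) hv
  -- The stable line would be a coordinate axis, but both off-diagonal entries of the formal
  -- monodromy `weylSL` are non-zero.
  rcases hw with hw | hw
  · have := hc.entry₀₁ hw fun h' => hne (funext fun k => by
      fin_cases k
      · exact hw
      · exact h')
    simp at this
  · have := hc.entry₁₀ hw fun h' => hne (funext fun k => by
      fin_cases k
      · exact h'
      · exact hw)
    simp at this

end AnalyticData

namespace MonodromyFamily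

/-! ### Singular points of fibres and of the total space -/

theorem eval_eq_eval_fibre (D : MonodromyFamily) (p a) :
    eval (Sum.elim p a) D.equation = eval a (D.fibre p) := by
  unfold fibre
  induction D.equation using MvPolynomial.induction_on with
  | C c => simp
  | add f g hf hg => simp only [map_add, hf, hg]
  | mul_X f i hf =>
    rw [map_mul, hf, map_mul, map_mul]
    rcases i with i | i <;> simp

/-- Specialising the parameters commutes with differentiation in the coordinates. -/
theorem eval_pderiv_eq_eval_pderiv_fibre (D : MonodromyFamily) (p a i) :
    eval (Sum.elim p a) (pderiv (Sum.inr i) D.equation) = eval a (pderiv i (D.fibre p)) := by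
  have key : ∀ f : MvPolynomial (Fin D.numParams ⊕ Fin 3) ℂ,
      eval (Sum.elim p a) f = eval a (aeval (Sum.elim (fun i => C (p i)) X) f :
        MvPolynomial (Fin 3) ℂ) := by
    intro f
    induction f using MvPolynomial.induction_on with
    | C c => simp
    | add f g hf hg => simp only [map_add, hf, hg]
    | mul_X f i hf =>
      rw [map_mul, hf, map_mul, map_mul]
      rcases i with i | i <;> simp
  rw [key]
  unfold fibre
  congr 1
  induction D.equation using MvPolynomial.induction_on with
  | C c => simp
  | add f g hf hg => simp only [map_add, hf, hg]
  | mul_X f j hf =>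
    rw [Derivation.leibniz, map_mul, Derivation.leibniz, map_add, smul_eq_mul, smul_eq_mul,
      map_mul, map_mul, hf]
    congr 2
    rcases j with j | j
    · simp [pderiv_X]
    · by_cases hij : i = j
      · subst hij; simp
      · simp [pderiv_X, Ne.symm hij]

/-- A singular point of the total space is a singular point of the fibre at which the derivatives
with respect to the parameters vanish too. -/
theorem isSingularPoint_equation_iff (D : MonodromyFamily) (p a) :
    IsSingularPoint D.equation (Sum.elim p a) ↔ IsSingularPoint (D.fibre p) a ∧
      ∀ i, eval (Sum.elim p a) (pderiv (Sum.inl i) D.equation) = 0 := by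
  simp only [IsSingularPoint, Sum.forall, eval_eq_eval_fibre D,
    eval_pderiv_eq_eval_pderiv_fibre D]
  tauto

theorem hasSingularities_nil {f : MvPolynomial (Fin 3) ℂ} (h : ∀ a, ¬ IsSingularPoint f a) :
    HasSingularities f [] :=
  ⟨by simp, fun a => by simpa using h a, by simp⟩

/-! ### The first Painlevé equation -/

/-- The equation is linear in `x₃` with leading coefficient `x₁x₂`, whose factors do not divide the
constant term: it is `1` at the origin. -/
theorem irreducible_PI : Irreducible PI.equation := by
  refine irreducible_of_linear (Sum.inr 2) (A := Y 0 * Y 1) (B := Y 0 + Y 1 + 1) ?_ ?_ ?_ ?_ ?_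
  · show Y 0 * Y 1 * Y 2 + Y 0 + Y 1 + 1 = _
    ring
  · exact mul_mem (X_mem_supported_compl (by decide)) (X_mem_supported_compl (by decide))
  · exact add_mem (add_mem (X_mem_supported_compl (by decide)) (X_mem_supported_compl (by decide)))
      (one_mem _)
  · refine IsRelPrime.mul_left (isRelPrime_of_eval (irreducible_X _) 0 ?_ ?_)
      (isRelPrime_of_eval (irreducible_X _) 0 ?_ ?_) <;> simp
  · exact mul_ne_zero (X_ne_zero _) (X_ne_zero _)

theorem coord_PI (x : AnalyticData PI.type) :
    eval (Sum.elim (PI.param x) (PI.coord x)) PI.equation = 0 := by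
  have h := LocalData.top_eq_one_ramified_two.1 (AnalyticData.top_eq_one x)
  simp
  linear_combination h.2.2

theorem exists_PI (a : Fin 3 → ℂ) (ha : a 0 * a 1 * a 2 + a 0 + a 1 + 1 = 0) :
    ∃ x : AnalyticData PI.type, PI.coord x = a := by
  -- The first two Stokes constants are those forced by the relation; the other three are the
  -- coordinates in the order `x₁, x₃, x₂`.
  refine ⟨AnalyticData.ofOne (LocalData.ofRamified 2
    ![-(1 + a 0 * a 2), 1 + a 2 * a 1, a 0, a 2, a 1]) ?_, ?_⟩
  · rw [LocalData.top_eq_one_ramified_two]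
    simp [LocalData.ofRamified]
    linear_combination ha
  · funext i
    fin_cases i <;> rfl

/-- No group acts after the link is normalised. The data are Stokes constants subject to the
relation, and three of them generate all functions, subject to the cubic. -/
theorem isMonodromySpace_PI : PI.IsMonodromySpace := by
  refine isMonodromySpace_of PI (fun i => i.elim0) (fun i => ?_) (by simp) (by simp) coord_PI ?_ ?_
  · fin_cases i
    · exact AnalyticData.stokes_mem_invariantRing (τ := PI.type) 0 rfl (2 : Fin 5)
    · exact AnalyticData.stokes_mem_invariantRing (τ := PI.type) 0 rfl (4 : Fin 5)
    · exact AnalyticData.stokes_mem_invariantRing (τ := PI.type) 0 rfl (3 : Fin 5)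
  · intro g hg
    refine dvd_of_vanishing irreducible_PI (h := 1) (b := Sum.elim ![] ![-1, 0, 0]) ?_ ?_ ?_
    · simp
    · simp
    · intro p hp _
      obtain ⟨x, hx⟩ := exists_PI (fun i => p (Sum.inr i)) (by simpa using hp)
      have h := hg x
      have : Sum.elim (PI.param x) (PI.coord x) = p := by
        funext i
        rcases i with i | i
        · exact i.elim0
        · exact congrFun hx i
      rwa [this] at h
  · intro A _ hA _ f hf
    have hreg : ∀ j, PI.type j ≠ .regular := by
      intro j; fin_cases j; simp
    have h₂ : (fun x : AnalyticData PI.type => (x.loc 0).stokes (2 : Fin 5)) ∈ A := hA 0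
    have h₄ : (fun x : AnalyticData PI.type => (x.loc 0).stokes (4 : Fin 5)) ∈ A := hA 1
    have h₃ : (fun x : AnalyticData PI.type => (x.loc 0).stokes (3 : Fin 5)) ∈ A := hA 2
    refine AnalyticData.invariant_mem 0 A (fun j h => absurd h (hreg j)) (fun j _ => ?_)
      (fun j _ k => ?_) (fun j _ => ?_) hf
    · fin_cases j
      exact AnalyticData.entriesIn_formal_ramified 0 rfl A
    · fin_cases j
      have hx := fun x : AnalyticData PI.type =>
        LocalData.top_eq_one_ramified_two.1 (AnalyticData.top_eq_one x)
      change Fin 5 at k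
      fin_cases k
      · have : (fun x : AnalyticData PI.type => (x.loc 0).stokes (0 : Fin 5)) ∈ A := by
          rw [show (fun x : AnalyticData PI.type => (x.loc 0).stokes (0 : Fin 5)) = _ from
            funext fun x => (hx x).1]
          exact A.neg_mem (A.add_mem A.one_mem (A.mul_mem h₂ h₃))
        exact this
      · have : (fun x : AnalyticData PI.type => (x.loc 0).stokes (1 : Fin 5)) ∈ A := by
          rw [show (fun x : AnalyticData PI.type => (x.loc 0).stokes (1 : Fin 5)) = _ from
            funext fun x => (hx x).2.1]
          exact A.add_mem A.one_mem (A.mul_mem h₃ h₄)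
        exact this
      · exact h₂
      · exact h₃
      · exact h₄
    · fin_cases j
      exact AnalyticData.entriesIn_linkFrom_self 0 A

theorem fibre_PI (p) : PI.fibre p = triangleCubic 0 0 0 1 1 0 1 := by
  apply eq_triangleCubic
  intro b
  simp [fibre]
  ring

/-- The combination `F - x₁∂₁F - x₂∂₂F + x₃∂₃F` is the constant `1`. -/
theorem not_isSingularPoint_fibre_PI (p a) : ¬ IsSingularPoint (PI.fibre p) a := by
  rw [fibre_PI, isSingularPoint_triangleCubic]
  rintro ⟨h₀, h₁, h₂, h₃⟩
  have : (1 : ℂ) = 0 := by linear_combination h₀ - a 0 * h₁ - a 1 * h₂ + a 2 * h₃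
  exact one_ne_zero this

theorem not_reducibleAt_PI (p) : ¬ PI.ReducibleAt p := by
  rintro ⟨x, -, hx⟩
  exact x.not_isReducible_of_ramified 0 rfl hx

end MonodromyFamily
end

noncomputable section

open SL2

namespace MonodromyFamily

/-- Points of the hypersurface need lifting to analytic data only where `h ≠ 0`. The lifts
constructed below may therefore divide by parameters or coordinates. -/
theorem dvd_of_vanishing_on_data {D : MonodromyFamily} (hF : Irreducible D.equation)
    {h : MvPolynomial (Fin D.numParams ⊕ Fin 3) ℂ} {b : Fin D.numParams ⊕ Fin 3 → ℂ}
    (hb : eval b D.equation = 0) (hbh : eval b h ≠ 0)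
    (hlift : ∀ p a, eval (Sum.elim p a) D.equation = 0 → eval (Sum.elim p a) h ≠ 0 →
      ∃ x, D.param x = p ∧ D.coord x = a) (g)
    (hg : ∀ x, eval (Sum.elim (D.param x) (D.coord x)) g = 0) : D.equation ∣ g := by
  refine dvd_of_vanishing hF hb hbh fun p hp hph => ?_
  rw [← Sum.elim_comp_inl_inr p] at hp hph ⊢
  obtain ⟨x, h₁, h₂⟩ := hlift _ _ hp hph
  rw [← h₁, ← h₂]
  exact hg x

theorem hasSingularities_singleton {f : MvPolynomial (Fin 3) ℂ} {a : Fin 3 → ℂ} {n : ℕ}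
    (h : ∀ b, IsSingularPoint f b → b = a) (ha : IsSingularPoint f a) (hn : HasTypeA n f a) :
    HasSingularities f [(a, n)] :=
  ⟨by simp, fun b => by simpa using ⟨h b, fun hb => hb ▸ ha⟩, by simpa using hn⟩

theorem hasSingularities_pair {f : MvPolynomial (Fin 3) ℂ} {a a' : Fin 3 → ℂ} {n n' : ℕ}
    (hne : a ≠ a') (h : ∀ b, IsSingularPoint f b → b = a ∨ b = a') (ha : IsSingularPoint f a)
    (ha' : IsSingularPoint f a') (hn : HasTypeA n f a) (hn' : HasTypeA n' f a') :
    HasSingularities f [(a, n), (a', n')] :=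
  ⟨by simpa using hne, fun b => by
    simpa using ⟨h b, fun hb => hb.elim (fun hb => hb ▸ ha) fun hb => hb ▸ ha'⟩, by
    simpa using ⟨hn, hn'⟩⟩

theorem vec_eq {a : Fin 3 → ℂ} {p q s : ℂ} : a = ![p, q, s] ↔ a 0 = p ∧ a 1 = q ∧ a 2 = s := by
  refine ⟨fun h => by simp [h], fun ⟨h₀, h₁, h₂⟩ => funext fun i => ?_⟩
  fin_cases i <;> assumption

/-! ### The second Painlevé equation, Flaschka-Newell -/

/-- The relation determines the monodromy at the regular point from the Stokes data at the ramified
one, so these data are free. -/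
theorem relation_PIIFN (x : AnalyticData PIIFN.type) :
    x.monodromyAt 1 0 = (LocalData.top (τ := .ramified 1) (x.loc 1))⁻¹ :=
  (mul_eq_one_iff_eq_inv.1 (x.relation_two 1)).trans (congrArg (·⁻¹) (x.monodromyAt_self 1))

theorem trace_top_ramified_one (d : LocalData (.ramified 1)) :
    d.top⁻¹.1.trace = d.stokes (1 : Fin 3) - d.stokes (0 : Fin 3) - d.stokes (2 : Fin 3)
      - d.stokes (0 : Fin 3) * d.stokes (1 : Fin 3) * d.stokes (2 : Fin 3) := by
  rw [LocalData.top_ramified_one, trace_entry]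
  simp [-Matrix.SpecialLinearGroup.coe_mul, -Matrix.SpecialLinearGroup.coe_inv, mul_entry]
  ring

/-- The trace of the inverse of the topological monodromy at the ramified point gives `s`; solved
for `s`, this is the cubic. -/
theorem param_PIIFN (x : AnalyticData PIIFN.type) :
    PIIFN.param x 0 = PIIFN.coord x 1 - PIIFN.coord x 0 - PIIFN.coord x 2
      - PIIFN.coord x 0 * PIIFN.coord x 1 * PIIFN.coord x 2 := by
  show (x.loc 0).formal.1.trace = _
  rw [← x.trace_monodromyAt_of_regular 1 0 rfl, relation_PIIFN]
  exact trace_top_ramified_one _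

theorem exists_PIIFN (a : Fin 3 → ℂ) : ∃ x : AnalyticData PIIFN.type, PIIFN.coord x = a := by
  refine ⟨AnalyticData.ofTwo (LocalData.ofRegular (LocalData.ofRamified 1 a).top⁻¹)
    (LocalData.ofRamified 1 a) 1 ?_, ?_⟩
  · rw [LocalData.top_regular]
    simp [LocalData.ofRegular]
  · funext i
    fin_cases i <;> rfl

theorem exists_PIIFN' (s : ℂ) (a : Fin 3 → ℂ)
    (h : a 0 * a 1 * a 2 + a 0 - a 1 + a 2 + s = 0) :
    ∃ x : AnalyticData PIIFN.type, PIIFN.param x = ![s] ∧ PIIFN.coord x = a := by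
  obtain ⟨x, hx⟩ := exists_PIIFN a
  refine ⟨x, funext fun i => ?_, hx⟩
  fin_cases i
  show PIIFN.param x 0 = s
  rw [param_PIIFN, hx]
  linear_combination -h

theorem irreducible_PIIFN : Irreducible PIIFN.equation := by
  refine irreducible_of_linear (Sum.inl 0) (A := 1) (B := Y 0 * Y 1 * Y 2 + Y 0 - Y 1 + Y 2)
    ?_ (one_mem _) ?_ isRelPrime_one_left one_ne_zero
  · show Y 0 * Y 1 * Y 2 + Y 0 - Y 1 + Y 2 + S 0 = _
    ring
  · have hX : ∀ i : Fin 3, (Y i : MvPolynomial (Fin 1 ⊕ Fin 3) ℂ) ∈ supported ℂ {Sum.inl 0}ᶜ :=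
      fun i => X_mem_supported_compl (by simp)
    exact add_mem (sub_mem (add_mem (mul_mem (mul_mem (hX 0) (hX 1)) (hX 2)) (hX 0)) (hX 1)) (hX 2)

/-- The three Stokes constants are arbitrary and invariant, and they generate. The total space is an
affine three-space, the graph of `s` as a function of the coordinates. -/
theorem isMonodromySpace_PIIFN : PIIFN.IsMonodromySpace := by
  have hcoord : ∀ i, (fun x => PIIFN.coord x i) ∈ AnalyticData.invariantRing PIIFN.type := by
    intro i
    fin_cases i
    · exact AnalyticData.stokes_mem_invariantRing (τ := PIIFN.type) 1 rfl (0 : Fin 3)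
    · exact AnalyticData.stokes_mem_invariantRing (τ := PIIFN.type) 1 rfl (1 : Fin 3)
    · exact AnalyticData.stokes_mem_invariantRing (τ := PIIFN.type) 1 rfl (2 : Fin 3)
  refine isMonodromySpace_of PIIFN (fun i => ?_) hcoord (by simp) (by simp) (fun x => ?_) ?_ ?_
  · fin_cases i
    have : (fun x => PIIFN.param x 0) = _ := funext param_PIIFN
    show (fun x => PIIFN.param x 0) ∈ _
    rw [this]
    exact sub_mem (sub_mem (sub_mem (hcoord 1) (hcoord 0)) (hcoord 2))
      (mul_mem (mul_mem (hcoord 0) (hcoord 1)) (hcoord 2))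
  · have := param_PIIFN x
    simp only [map_add, map_sub, map_mul, eval_X, Sum.elim_inl, Sum.elim_inr]
    show PIIFN.coord x 0 * PIIFN.coord x 1 * PIIFN.coord x 2 + PIIFN.coord x 0 - PIIFN.coord x 1
      + PIIFN.coord x 2 + PIIFN.param x 0 = 0
    rw [this]
    ring
  · refine dvd_of_vanishing_on_data irreducible_PIIFN (h := 1) (b := 0) (by simp) (by simp) ?_
    intro p a hpa _
    obtain ⟨x, h₁, h₂⟩ := exists_PIIFN' (p 0) a (by simpa using hpa)
    exact ⟨x, by rw [h₁]; funext i; fin_cases i; rfl, h₂⟩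
  · intro A _ hA _ f hf
    have h₀ : (fun x : AnalyticData PIIFN.type => (x.loc 1).stokes (0 : Fin 3)) ∈ A := hA 0
    have h₁ : (fun x : AnalyticData PIIFN.type => (x.loc 1).stokes (1 : Fin 3)) ∈ A := hA 1
    have h₂ : (fun x : AnalyticData PIIFN.type => (x.loc 1).stokes (2 : Fin 3)) ∈ A := hA 2
    have hst : ∀ k, (fun x : AnalyticData PIIFN.type => (x.loc 1).stokes k) ∈ A := by
      intro k
      change Fin 3 at k
      fin_cases k
      · exact h₀
      · exact h₁
      · exact h₂
    have hfor := AnalyticData.entriesIn_formal_ramified (τ := PIIFN.type) 1 rfl A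
    refine AnalyticData.invariant_mem 1 A (fun j h => ?_) (fun j h => ?_)
      (fun j h => ?_) (fun j h => ?_) hf <;> fin_cases j
    · show AnalyticData.EntriesIn A fun x : AnalyticData PIIFN.type => x.monodromyAt 1 0
      simp_rw [relation_PIIFN]
      exact (AnalyticData.entriesIn_top 1 hfor hst).inv
    · cases h
    · exact absurd rfl h
    · exact hfor
    · exact absurd rfl h
    · exact hst
    · exact absurd rfl h
    · exact AnalyticData.entriesIn_linkFrom_self 1 A

theorem fibre_PIIFN (p : Fin 1 → ℂ) : PIIFN.fibre p = triangleCubic 0 0 0 1 (-1) 1 (p 0) := by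
  apply eq_triangleCubic
  intro b
  simp [fibre]
  ring

theorem isSingularPoint_fibre_PIIFN (p : Fin 1 → ℂ) (a : Fin 3 → ℂ) :
    IsSingularPoint (PIIFN.fibre p) a ↔
      p 0 = -2 * a 0 ∧ a 0 ^ 2 = 1 ∧ a = ![a 0, -a 0, a 0] := by
  rw [fibre_PIIFN, isSingularPoint_triangleCubic, vec_eq]
  constructor
  · rintro ⟨h₀, h₁, h₂, h₃⟩
    -- Differences such as `x₁∂₁F - x₂∂₂F` lose the cubic term and leave linear relations among the
    -- coordinates.
    have e₁ : a 1 = -a 0 := by linear_combination a 0 * h₁ - a 1 * h₂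
    have e₂ : a 2 = a 0 := by linear_combination a 2 * h₃ - a 0 * h₁
    rw [e₁, e₂] at h₀ h₃
    exact ⟨by linear_combination h₀ - a 0 * h₃, by linear_combination -h₃, rfl, e₁, e₂⟩
  · rintro ⟨hp, h, -, e₁, e₂⟩
    rw [e₁, e₂, hp]
    refine ⟨?_, ?_, ?_, ?_⟩
    · linear_combination -a 0 * h
    · linear_combination -h
    · linear_combination h
    · linear_combination -h

theorem not_reducibleAt_PIIFN (p) : ¬ PIIFN.ReducibleAt p := by
  rintro ⟨x, -, hx⟩
  exact x.not_isReducible_of_ramified 1 rfl hx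

theorem resonantAt_PIIFN (s : ℂ) : PIIFN.ResonantAt ![s] ↔ s = 2 ∨ s = -2 := by
  constructor
  · rintro ⟨x, hx, j, hj, h⟩
    fin_cases j
    · have : (x.loc 0).formal.1.trace = s := congrFun hx 0
      rw [← this]
      exact h
    · cases hj
  · intro h
    obtain ⟨x, hx, -⟩ := exists_PIIFN' s ![-s, 0, 0] (by simp)
    refine ⟨x, hx, 0, rfl, ?_⟩
    have : (x.loc 0).formal.1.trace = s := congrFun hx 0
    rw [this]
    exact h

theorem hasSingularities_PIIFN_nil {s : ℂ} (h : s ^ 2 ≠ 4) :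
    HasSingularities (PIIFN.fibre ![s]) [] := by
  refine hasSingularities_nil fun a ha => h ?_
  obtain ⟨h₁, h₂, -⟩ := (isSingularPoint_fibre_PIIFN _ a).1 ha
  have h₁ : s = -2 * a 0 := h₁
  rw [h₁]
  linear_combination 4 * h₂

theorem hasSingularities_PIIFN {ε s : ℂ} (hε : ε ∈ ({1, -1} : Set ℂ)) (h : s = 2 * ε) :
    HasSingularities (PIIFN.fibre ![s]) [(![-ε, ε, -ε], 1)] := by
  have hε2 : ε ^ 2 = 1 := by rcases hε with rfl | rfl <;> norm_num
  have hs : IsSingularPoint (PIIFN.fibre ![s]) ![-ε, ε, -ε] := by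
    rw [isSingularPoint_fibre_PIIFN]
    simp [h, hε2]
  refine hasSingularities_singleton (fun b hb => ?_) hs ?_
  · obtain ⟨h₁, h₂, h₃⟩ := (isSingularPoint_fibre_PIIFN _ b).1 hb
    have h₁ : s = -2 * b 0 := h₁
    have hb0 : b 0 = -ε := by linear_combination (h₁ - h) / 2
    rw [h₃, hb0, neg_neg]
  · rw [fibre_PIIFN] at hs ⊢
    refine hasTypeA_one _ hs ?_
    have : (-ε) * (-ε) * ε ≠ 0 := by rcases hε with rfl | rfl <;> norm_num
    simpa using this

/-! ### The second Painlevé equation -/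

/-- The second and the fourth equation express `b₂` and `b₁` through `α` and `b₃, …, b₆`; the other
two are relations among products of Stokes constants of opposite weights. -/
theorem top_eq_one_unramified_three {d : LocalData (.unramified 3)} : d.top = 1 ↔
    d.formal 0 0 * (1 + d.stokes (1 : Fin 6) * d.stokes (2 : Fin 6)) =
      1 + d.stokes (4 : Fin 6) * d.stokes (5 : Fin 6) ∧
    d.formal 0 0 * d.stokes (1 : Fin 6) = -(d.stokes (3 : Fin 6)
      + d.stokes (5 : Fin 6) * (1 + d.stokes (3 : Fin 6) * d.stokes (4 : Fin 6))) ∧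
    1 + d.stokes (0 : Fin 6) * d.stokes (1 : Fin 6) =
      d.formal 0 0 * (1 + d.stokes (3 : Fin 6) * d.stokes (4 : Fin 6)) ∧
    d.stokes (0 : Fin 6) = -(d.formal 0 0 * d.stokes (4 : Fin 6)) - d.formal 0 0 *
      ((1 + d.stokes (3 : Fin 6) * d.stokes (4 : Fin 6)) * d.stokes (2 : Fin 6)) := by
  have hα := d.formal_ne_zero
  rw [LocalData.top_unramified_three, ← mul_assoc, ← eq_inv_iff_mul_eq_one, eq_iff_entries]
  simp [-Matrix.SpecialLinearGroup.coe_mul, -Matrix.SpecialLinearGroup.coe_inv, mul_entry,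
    LocalData.formal_entry₀₁, LocalData.formal_entry₁₀, LocalData.formal_entry₁₁]
  field_simp
  constructor
  · rintro ⟨h₁, h₂, h₃, h₄⟩
    refine ⟨?_, ?_, ?_, ?_⟩
    · linear_combination h₁
    · linear_combination h₂
    · linear_combination h₄
    · linear_combination h₃ - d.stokes (2 : Fin 6) * h₄
  · rintro ⟨h₁, h₂, h₃, h₄⟩
    refine ⟨?_, ?_, ?_, ?_⟩
    · linear_combination h₁
    · linear_combination h₂
    · linear_combination h₄ + d.stokes (2 : Fin 6) * h₃
    · linear_combination h₃

end MonodromyFamily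
end

/-! ### Torus weights at unramified points and the second Painlevé equation -/

noncomputable section

open SL2

namespace LocalData

variable {r : ℕ} (d : LocalData (.unramified r)) (ρ : SL2)
  (h : (PointType.unramified r).IsAdmissible ρ)

theorem formal_conj_unramified : (d.conj ρ h).formal = d.formal := by
  show ρ * d.formal * ρ⁻¹ = d.formal
  rw [mul_inv_eq_iff_eq_mul, eq_iff_entries]
  obtain ⟨h₁, h₂⟩ := h
  simp [-Matrix.SpecialLinearGroup.coe_mul, mul_entry, h₁, h₂, formal_entry₀₁, formal_entry₁₀]
  constructor <;> ring

/-- Lower triangular Stokes constants have torus weight `-2` and upper triangular ones weight `2`,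
because the two diagonal entries of `ρ` are inverse to each other. Products of one of each kind are
invariant. -/
theorem stokes_conj_even (k : Fin (PointType.unramified r).numStokes) (hk : Even k.1) :
    (d.conj ρ h).stokes k = ρ 1 1 ^ 2 * d.stokes k := by
  obtain ⟨h₁, h₂⟩ := h
  simp [-Matrix.SpecialLinearGroup.coe_mul, conj, hk, mul_entry, stokesMap, stokesMatrix, h₂]
  ring

theorem stokes_conj_odd (k : Fin (PointType.unramified r).numStokes) (hk : ¬ Even k.1) :
    (d.conj ρ h).stokes k = ρ 0 0 ^ 2 * d.stokes k := by
  obtain ⟨h₁, h₂⟩ := h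
  simp only [conj, hk, if_false, stokesMap, stokesMatrix]
  simp [-Matrix.SpecialLinearGroup.coe_mul, mul_entry, h₁]
  ring

theorem stokes_conj_mul (k l : Fin (PointType.unramified r).numStokes) (hk : Even k.1)
    (hl : ¬ Even l.1) :
    (d.conj ρ h).stokes k * (d.conj ρ h).stokes l = d.stokes k * d.stokes l := by
  rw [stokes_conj_even _ _ _ _ hk, stokes_conj_odd _ _ _ _ hl]
  have := det_entry ρ
  rw [h.1, zero_mul, sub_zero] at this
  linear_combination (ρ 0 0 * ρ 1 1 + 1) * d.stokes k * d.stokes l * this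

end LocalData

namespace AnalyticData

section
variable {r : ℕ} {τ : Fin r → PointType} {A : Subalgebra ℂ (AnalyticData τ → ℂ)}

theorem mem_of_eq {Z : Type*} {A : Subalgebra ℂ (Z → ℂ)} {f g : Z → ℂ} (hg : g ∈ A)
    (h : ∀ z, f z = g z) : f ∈ A := by
  rwa [show f = g from funext h]

theorem entriesIn_formal_unramified (j : Fin r) {m : ℕ} (hj : τ j = .unramified m)
    (h : (fun x => (x.loc j).formal 0 0) ∈ A) (h' : (fun x => ((x.loc j).formal 0 0)⁻¹) ∈ A) :
    EntriesIn A fun x => (x.loc j).formal := by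
  have key : ∀ (σ : PointType), σ = .unramified m → ∀ d : LocalData σ,
      d.formal 0 1 = 0 ∧ d.formal 1 0 = 0 ∧ d.formal 1 1 = (d.formal 0 0)⁻¹ := by
    rintro _ rfl d
    exact ⟨d.formal_entry₀₁, d.formal_entry₁₀, d.formal_entry₁₁⟩
  intro a b
  fin_cases a <;> fin_cases b
  · exact h
  · exact mem_of_eq (const_mem A 0) fun x => (key _ hj _).1
  · exact mem_of_eq (const_mem A 0) fun x => (key _ hj _).2.1
  · exact mem_of_eq h' fun x => (key _ hj _).2.2

theorem formal_mem_invariantRing (j : Fin r) {m : ℕ} (hj : τ j = .unramified m) (a b : Fin 2) :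
    (fun x => (x.loc j).formal a b) ∈ invariantRing τ := by
  refine (mem_invariantRing_iff _).2 ⟨formal_mem j a b, fun x σ ρ h => ?_⟩
  have key : ∀ (σ : PointType), σ = .unramified m → ∀ (d : LocalData σ) (ρ) (h),
      (d.conj ρ h).formal = d.formal := by
    rintro _ rfl d ρ h
    exact d.formal_conj_unramified ρ h
  show ((x.loc j).conj _ (h j)).formal a b = _
  rw [key _ hj]

theorem stokes_mul_mem_invariantRing (j : Fin r) {m : ℕ} (hj : τ j = .unramified m)
    (k l : Fin (τ j).numStokes) (hk : Even k.1) (hl : ¬ Even l.1) :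
    (fun x => (x.loc j).stokes k * (x.loc j).stokes l) ∈ invariantRing τ := by
  refine (mem_invariantRing_iff _).2 ⟨mul_mem (stokes_mem j k) (stokes_mem j l),
    fun x σ ρ h => ?_⟩
  have key : ∀ (σ : PointType), σ = .unramified m → ∀ (d : LocalData σ) (ρ) (h)
      (k l : Fin σ.numStokes) (hk : Even k.1) (hl : ¬ Even l.1),
      (d.conj ρ h).stokes k * (d.conj ρ h).stokes l = d.stokes k * d.stokes l := by
    rintro _ rfl d ρ h k l hk hl
    exact d.stokes_conj_mul ρ h k l hk hl
  exact key _ hj _ _ (h j) k l hk hl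

theorem formal_torusAct (i : Fin r) {m : ℕ} (hi : τ i = .unramified m) (t : ℂ) (ht : t ≠ 0)
    (x : AnalyticData τ) (a b : Fin 2) :
    ((x.torusAct i hi t ht).loc i).formal a b = (x.loc i).formal a b :=
  ((mem_invariantRing_iff _).1 (formal_mem_invariantRing i hi a b)).2 x _ _ _

theorem stokes_torusAct (i : Fin r) {m : ℕ} (hi : τ i = .unramified m) (t : ℂ) (ht : t ≠ 0)
    (x : AnalyticData τ) (k : Fin (τ i).numStokes) :
    ((x.torusAct i hi t ht).loc i).stokes k =
      t ^ (2 * if Even k.1 then -1 else 1 : ℤ) * (x.loc i).stokes k := by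
  have key : ∀ (σ : PointType), σ = .unramified m → ∀ (d : LocalData σ) (ρ) (h)
      (k : Fin σ.numStokes), ρ = diag t ht →
      (d.conj ρ h).stokes k = t ^ (2 * if Even k.1 then -1 else 1 : ℤ) * d.stokes k := by
    rintro _ rfl d ρ h k rfl
    by_cases hk : Even k.1
    · rw [d.stokes_conj_even _ _ _ hk, if_pos hk, diag_entry₁₁]
      norm_num [zpow_neg]
    · rw [d.stokes_conj_odd _ _ _ hk, if_neg hk, diag_entry₀₀]
      norm_num
  refine key _ hi (x.loc i) (if i = i then diag t ht else 1) ?_ k (if_pos rfl)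
  rw [if_pos rfl, hi]
  exact isAdmissible_diag m t ht

theorem inv_formal_mem (j : Fin r) {m : ℕ} (hj : τ j = .unramified m) :
    (fun x => ((x.loc j).formal 0 0)⁻¹) ∈ regularFunctions τ := by
  have key : ∀ (σ : PointType), σ = .unramified m → ∀ d : LocalData σ,
      (d.formal 0 0)⁻¹ = d.formal 1 1 := by
    rintro _ rfl d
    exact d.formal_entry₁₁.symm
  exact mem_of_eq (formal_mem j 1 1) fun x => key _ hj _

end

end AnalyticData

namespace MonodromyFamily

theorem relation_PII (x : AnalyticData PII.type) :
    (x.loc 0).formal 0 0 * (1 + (x.loc 0).stokes (1 : Fin 6) * (x.loc 0).stokes (2 : Fin 6)) =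
      1 + (x.loc 0).stokes (4 : Fin 6) * (x.loc 0).stokes (5 : Fin 6) ∧
    (x.loc 0).formal 0 0 * (x.loc 0).stokes (1 : Fin 6) = -((x.loc 0).stokes (3 : Fin 6)
      + (x.loc 0).stokes (5 : Fin 6) *
        (1 + (x.loc 0).stokes (3 : Fin 6) * (x.loc 0).stokes (4 : Fin 6))) ∧
    1 + (x.loc 0).stokes (0 : Fin 6) * (x.loc 0).stokes (1 : Fin 6) = (x.loc 0).formal 0 0 *
      (1 + (x.loc 0).stokes (3 : Fin 6) * (x.loc 0).stokes (4 : Fin 6)) ∧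
    (x.loc 0).stokes (0 : Fin 6) = -((x.loc 0).formal 0 0 * (x.loc 0).stokes (4 : Fin 6))
      - (x.loc 0).formal 0 0 * ((1 + (x.loc 0).stokes (3 : Fin 6) * (x.loc 0).stokes (4 : Fin 6)) *
        (x.loc 0).stokes (2 : Fin 6)) :=
  top_eq_one_unramified_three.1 (AnalyticData.top_eq_one x)

theorem param_PII_ne_zero (x : AnalyticData PII.type) : (x.loc 0).formal 0 0 ≠ 0 :=
  LocalData.formal_ne_zero (r := 3) (x.loc 0)

/-- The product `b₃b₆` is a polynomial in the coordinates. -/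
theorem stokes_mul_PII (x : AnalyticData PII.type) :
    (x.loc 0).stokes (2 : Fin 6) * (x.loc 0).stokes (5 : Fin 6) =
      PII.param x 0 - PII.coord x 0 * PII.coord x 2 := by
  obtain ⟨h₁, h₂, -, -⟩ := relation_PII x
  have hα := param_PII_ne_zero x
  show _ = (x.loc 0).formal 0 0 -
    ((x.loc 0).stokes (2 : Fin 6) * (x.loc 0).stokes (3 : Fin 6) + 1) *
    ((x.loc 0).stokes (4 : Fin 6) * (x.loc 0).stokes (5 : Fin 6) + 1)
  linear_combination (x.loc 0).stokes (2 : Fin 6) * h₂ - h₁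

theorem equation_PII (x : AnalyticData PII.type) :
    eval (Sum.elim (PII.param x) (PII.coord x)) PII.equation = 0 := by
  have h : (x.loc 0).stokes (2 : Fin 6) * (x.loc 0).stokes (5 : Fin 6) = (x.loc 0).formal 0 0 -
    ((x.loc 0).stokes (2 : Fin 6) * (x.loc 0).stokes (3 : Fin 6) + 1) *
    ((x.loc 0).stokes (4 : Fin 6) * (x.loc 0).stokes (5 : Fin 6) + 1) := stokes_mul_PII x
  simp only [map_add, map_sub, map_mul, eval_X, Sum.elim_inl, Sum.elim_inr, map_one,
    Matrix.cons_val]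
  linear_combination ((x.loc 0).stokes (3 : Fin 6) * (x.loc 0).stokes (4 : Fin 6)) * h

/-- The torus allows the normalisation `b₄ = 1`. Then `b₃ = x₁ - 1` and `b₅ = x₂ - 1`; `b₆` comes
from `b₃b₆ = α - x₁x₃`, which is where `x₁ ≠ 1` enters. Finally `b₂` and `b₁` follow from the
relation. -/
theorem exists_PII {α : ℂ} (hα : α ≠ 0) (a : Fin 3 → ℂ) (h1 : a 0 ≠ 1)
    (h : a 0 * a 1 * a 2 - a 0 - α * a 1 - a 2 + α + 1 = 0) :
    ∃ x : AnalyticData PII.type, PII.param x = ![α] ∧ PII.coord x = a := by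
  have h1' : a 0 - 1 ≠ 0 := sub_ne_zero.2 h1
  let b₆ := (α - a 0 * a 2) / (a 0 - 1)
  have hb₆ : b₆ * (a 0 - 1) = α - a 0 * a 2 := div_mul_cancel₀ _ h1'
  have hb₅₆ : (a 1 - 1) * b₆ = a 2 - 1 := by
    apply mul_right_cancel₀ h1'
    linear_combination (a 1 - 1) * hb₆ - h
  let b₂ := -(1 + b₆ * a 1) / α
  have hb₂ : α * b₂ = -(1 + b₆ * a 1) := mul_div_cancel₀ _ hα
  refine ⟨AnalyticData.ofOne (LocalData.ofUnramified 3 α hα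
    ![-(α * (a 1 - 1)) - α * (a 1 * (a 0 - 1)), b₂, a 0 - 1, 1, a 1 - 1, b₆]) ?_, ?_, ?_⟩
  · rw [top_eq_one_unramified_three]
    simp only [LocalData.ofUnramified, diag_entry₀₀]
    refine ⟨?_, ?_, ?_, ?_⟩ <;> simp only [Matrix.cons_val]
    · linear_combination (a 0 - 1) * hb₂ - a 1 * hb₆ - hb₅₆ + h
    · linear_combination hb₂
    · linear_combination (-(a 1 - 1) - a 1 * (a 0 - 1)) * hb₂ + a 1 ^ 2 * hb₆ + a 1 * hb₅₆ - a 1 * h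
    · ring
  · funext i
    fin_cases i
    rfl
  · funext i
    fin_cases i
    · show (a 0 - 1) * 1 + 1 = a 0
      ring
    · show 1 * (a 1 - 1) + 1 = a 1
      ring
    · show (a 1 - 1) * b₆ + 1 = a 2
      rw [hb₅₆]
      ring

theorem irreducible_PII : Irreducible PII.equation := by
  refine irreducible_of_linear (Sum.inr 2) (A := Y 0 * Y 1 + (- 1))
    (B := (- Y 0 - S 0 * Y 1 + S 0 + 1)) ?_ ?_ ?_ ?_ ?_
  · show Y 0 * Y 1 * Y 2 - Y 0 - S 0 * Y 1 - Y 2 + S 0 + 1 = _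
    ring
  · exact add_mem (mul_mem (X_mem_supported_compl (by simp)) (X_mem_supported_compl (by simp)))
      (neg_mem (one_mem _))
  · have h₁ : (Y 0 : MvPolynomial (Fin 1 ⊕ Fin 3) ℂ) ∈ supported ℂ {Sum.inr 2}ᶜ :=
      X_mem_supported_compl (by simp)
    have h₂ : (Y 1 : MvPolynomial (Fin 1 ⊕ Fin 3) ℂ) ∈ supported ℂ {Sum.inr 2}ᶜ :=
      X_mem_supported_compl (by simp)
    have h₃ : (S 0 : MvPolynomial (Fin 1 ⊕ Fin 3) ℂ) ∈ supported ℂ {Sum.inr 2}ᶜ :=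
      X_mem_supported_compl (by simp)
    exact add_mem (add_mem (sub_mem (neg_mem h₁) (mul_mem h₃ h₂)) h₃) (one_mem _)
  · refine isRelPrime_of_eval (irreducible_of_linear (Sum.inr 1) (A := Y 0) (B := -1) rfl
      (X_mem_supported_compl (by simp)) (neg_mem (one_mem _)) ?_ (X_ne_zero _))
      (Sum.elim ![0] ![2, 1 / 2, 0]) (by simp) ?_
    · exact isUnit_one.neg.isRelPrime_right
    · simp
      norm_num
  · intro h
    have := congrArg (eval 0) h
    simp at this

/-- After elimination of `b₁` and `b₂` the torus acts on `b₃, …, b₆`. Its invariants are generated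
over `ℂ[α, α⁻¹]` by `b₃b₄`, `b₄b₅`, `b₅b₆` and `b₃b₆`; the first three are `x_i - 1` and the last is
given by `stokes_mul_PII`. The cubic is `(b₃b₄)(b₅b₆) = (b₄b₅)(b₃b₆)`. -/
theorem isMonodromySpace_PII : PII.IsMonodromySpace := by
  have hparam : (fun x : AnalyticData PII.type => (x.loc 0).formal 0 0) ∈
      AnalyticData.invariantRing PII.type :=
    AnalyticData.formal_mem_invariantRing 0 (m := 3) rfl 0 0
  have hprod : ∀ k l : Fin 6, Even k.1 → ¬ Even l.1 →
      (fun x : AnalyticData PII.type => (x.loc 0).stokes k * (x.loc 0).stokes l) ∈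
      AnalyticData.invariantRing PII.type :=
    AnalyticData.stokes_mul_mem_invariantRing (τ := PII.type) 0 rfl
  have hprod' : ∀ k l : Fin 6, ¬ Even k.1 → Even l.1 →
      (fun x : AnalyticData PII.type => (x.loc 0).stokes k * (x.loc 0).stokes l) ∈
      AnalyticData.invariantRing PII.type := fun k l hk hl =>
    AnalyticData.mem_of_eq (hprod l k hl hk) fun x => mul_comm _ _
  refine isMonodromySpace_of PII (fun i => ?_) (fun i => ?_) (fun i _ x => ?_) (fun i _ => ?_)
    equation_PII ?_ ?_
  · fin_cases i
    exact hparam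
  · fin_cases i
    · exact add_mem (hprod 2 3 (by decide) (by decide)) (one_mem _)
    · exact add_mem (hprod' 3 4 (by decide) (by decide)) (one_mem _)
    · exact add_mem (hprod 4 5 (by decide) (by decide)) (one_mem _)
  · fin_cases i
    exact param_PII_ne_zero x
  · fin_cases i
    exact AnalyticData.inv_formal_mem (τ := PII.type) 0 (m := 3) rfl
  · refine dvd_of_vanishing_on_data irreducible_PII (h := S 0 * (Y 0 - 1))
      (b := Sum.elim ![1] ![0, 2, 0]) ?_ ?_ ?_
    · simp; norm_num
    · simp
    · intro p a hpa hh
      simp at hpa hh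
      obtain ⟨x, h₁, h₂⟩ := exists_PII hh.1 a (sub_ne_zero.1 hh.2) hpa
      exact ⟨x, by rw [h₁]; funext i; fin_cases i; rfl, h₂⟩
  · intro A hpA hcA hiA f hf
    have hα : (fun x : AnalyticData PII.type => (x.loc 0).formal 0 0) ∈ A := hpA 0
    have hα' : (fun x : AnalyticData PII.type => ((x.loc 0).formal 0 0)⁻¹) ∈ A :=
      hiA 0 (by simp)
    let g : Fin 6 → AnalyticData PII.type → ℂ :=
      ![fun x => (x.loc 0).formal 0 0, fun x => ((x.loc 0).formal 0 0)⁻¹,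
        fun x => (x.loc 0).stokes (2 : Fin 6), fun x => (x.loc 0).stokes (3 : Fin 6),
        fun x => (x.loc 0).stokes (4 : Fin 6), fun x => (x.loc 0).stokes (5 : Fin 6)]
    have hg : ∀ i, g i ∈ Algebra.adjoin ℂ (Set.range g) := fun i =>
      Algebra.subset_adjoin ⟨i, rfl⟩
    have hfg : f ∈ Algebra.adjoin ℂ (Set.range g) := by
      refine AnalyticData.invariant_mem 0 _ (fun j h => ?_) (fun j _ => ?_)
        (fun j _ k => ?_) (fun j _ => ?_) hf <;> fin_cases j
      · cases h
      · exact AnalyticData.entriesIn_formal_unramified (τ := PII.type) 0 (m := 3) rfl (hg 0) (hg 1)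
      · change Fin 6 at k
        have h₃₄ := (Algebra.adjoin ℂ (Set.range g)).add_mem (one_mem _) (mul_mem (hg 3) (hg 4))
        have h₀ : (fun x : AnalyticData PII.type => (x.loc 0).stokes (0 : Fin 6)) ∈
            Algebra.adjoin ℂ (Set.range g) :=
          AnalyticData.mem_of_eq (sub_mem (neg_mem (mul_mem (hg 0) (hg 4)))
            (mul_mem (hg 0) (mul_mem h₃₄ (hg 2)))) fun x => (relation_PII x).2.2.2
        have h₁ : (fun x : AnalyticData PII.type => (x.loc 0).stokes (1 : Fin 6)) ∈
            Algebra.adjoin ℂ (Set.range g) := by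
          refine AnalyticData.mem_of_eq (mul_mem (hg 1) (neg_mem (add_mem (hg 3)
            (mul_mem (hg 5) h₃₄)))) fun x => ?_
          exact (inv_mul_eq_iff_eq_mul₀ (param_PII_ne_zero x)).2 (relation_PII x).2.1.symm |>.symm
        fin_cases k
        · exact h₀
        · exact h₁
        · exact hg 2
        · exact hg 3
        · exact hg 4
        · exact hg 5
      · exact AnalyticData.entriesIn_linkFrom_self 0 _
    -- The weights belong to `α, α⁻¹, b₃, b₄, b₅, b₆`. The torus acts on the Stokes constants
    -- through `t²`, hence `m = 2`.
    refine torus_invariant_mem g ![0, 0, -1, 1, -1, 1] (by decide) (m := 2) (by norm_num)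
      (fun t ht => AnalyticData.torusAct (τ := PII.type) 0 (m := 3) rfl t ht) ?_ A ?_ ?_ hfg
      (fun t ht z => ((AnalyticData.mem_invariantRing_iff f).1 hf).2 z _ _ _)
    · intro i t ht z
      have hst := AnalyticData.stokes_torusAct (τ := PII.type) 0 (m := 3) rfl t ht z
      have hfor := AnalyticData.formal_torusAct (τ := PII.type) 0 (m := 3) rfl t ht z 0 0
      fin_cases i
      · simpa [g] using hfor
      · simpa [g] using hfor
      · exact hst (2 : Fin 6)
      · exact hst (3 : Fin 6)
      · exact hst (4 : Fin 6)
      · exact hst (5 : Fin 6)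
    · intro i hi
      fin_cases i
      · exact hα
      · exact hα'
      all_goals simp at hi
    · have h₂₃ : (fun x : AnalyticData PII.type =>
          (x.loc 0).stokes (2 : Fin 6) * (x.loc 0).stokes (3 : Fin 6)) ∈ A :=
        AnalyticData.mem_of_eq (sub_mem (hcA 0) (one_mem A)) fun x => (add_sub_cancel_right _ _).symm
      have h₃₄ : (fun x : AnalyticData PII.type =>
          (x.loc 0).stokes (3 : Fin 6) * (x.loc 0).stokes (4 : Fin 6)) ∈ A :=
        AnalyticData.mem_of_eq (sub_mem (hcA 1) (one_mem A)) fun x => (add_sub_cancel_right _ _).symm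
      have h₄₅ : (fun x : AnalyticData PII.type =>
          (x.loc 0).stokes (4 : Fin 6) * (x.loc 0).stokes (5 : Fin 6)) ∈ A :=
        AnalyticData.mem_of_eq (sub_mem (hcA 2) (one_mem A)) fun x => (add_sub_cancel_right _ _).symm
      have h₂₅ : (fun x : AnalyticData PII.type =>
          (x.loc 0).stokes (2 : Fin 6) * (x.loc 0).stokes (5 : Fin 6)) ∈ A :=
        AnalyticData.mem_of_eq (sub_mem (hpA 0) (mul_mem (hcA 0) (hcA 2))) stokes_mul_PII
      intro i j hi hj
      fin_cases i <;> first | (exfalso; revert hi; decide) | skip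
      all_goals fin_cases j <;> first | (exfalso; revert hj; decide) | skip
      · exact AnalyticData.mem_of_eq h₂₃ fun x => mul_comm _ _
      · exact h₃₄
      · exact AnalyticData.mem_of_eq h₂₅ fun x => mul_comm _ _
      · exact AnalyticData.mem_of_eq h₄₅ fun x => mul_comm _ _

theorem fibre_PII (p : Fin 1 → ℂ) :
    PII.fibre p = triangleCubic 0 0 0 (-1) (-p 0) (-1) (p 0 + 1) := by
  apply eq_triangleCubic
  intro b
  simp [fibre]
  ring

theorem isSingularPoint_fibre_PII (p : Fin 1 → ℂ) (a : Fin 3 → ℂ) :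
    IsSingularPoint (PII.fibre p) a ↔ p 0 = 1 ∧ a = ![1, 1, 1] := by
  rw [fibre_PII, isSingularPoint_triangleCubic, vec_eq]
  constructor
  · rintro ⟨h₀, h₁, h₂, h₃⟩
    have e₀ : a 1 * a 0 = 1 := by linear_combination h₃
    have e₁ : a 1 * a 2 = 1 := by linear_combination h₁
    have e₂ : a 0 * a 2 = p 0 := by linear_combination h₂
    have hp : p 0 * a 1 = a 2 := by linear_combination -a 1 * e₂ + a 2 * e₀
    have h02 : a 0 = a 2 := by
      have h1 : a 1 ≠ 0 := left_ne_zero_of_mul_eq_one e₀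
      apply mul_left_cancel₀ h1
      rw [e₀, e₁]
    -- The gradient gives `x₁ = x₃`, `x₂x₃ = 1` and `α = x₃²`, and then `F` takes the value `(x₃ -
    -- 1)²`.
    have hsq : (a 2 - 1) ^ 2 = 0 := by
      linear_combination h₀ - a 0 * e₁ + hp - a 2 * h02 + e₂
    have h2 : a 2 = 1 := sub_eq_zero.1 (pow_eq_zero_iff two_ne_zero |>.1 hsq)
    rw [h02, h2] at e₂
    rw [h2, mul_one] at e₁
    exact ⟨by rw [← e₂, one_mul], h02.trans h2, e₁, h2⟩
  · rintro ⟨hp, e₀, e₁, e₂⟩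
    rw [e₀, e₁, e₂, hp]
    refine ⟨?_, ?_, ?_, ?_⟩ <;> norm_num

theorem isSingularPoint_equation_PII (α : ℂ) (a : Fin 3 → ℂ) :
    IsSingularPoint PII.equation (Sum.elim ![α] a) ↔ α = 1 ∧ a = ![1, 1, 1] := by
  rw [isSingularPoint_equation_iff PII, isSingularPoint_fibre_PII]
  refine ⟨fun h => h.1, fun h => ⟨h, fun i => ?_⟩⟩
  fin_cases i
  have h1 : a 1 = 1 := by rw [h.2]; rfl
  simp [pderiv_X, h1]

/-- For reducible data all lower or all upper Stokes constants vanish, so every invariant product is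
zero. The coordinates are then `1`, and the relation leaves `α = 1`. -/
theorem isReducible_PII {x : AnalyticData PII.type} (hx : x.IsReducible) :
    PII.param x = ![1] ∧ PII.coord x = ![1, 1, 1] := by
  have key : ∀ k l : Fin 6, Even k.1 → ¬ Even l.1 →
      (x.loc 0).stokes k * (x.loc 0).stokes l = 0 := by
    intro k l hk hl
    rcases hx.triangular 0 (by simp) with ⟨-, h⟩ | ⟨-, h⟩
    · have h := h k
      simp only [LocalData.stokesMap, stokesMatrix, if_pos hk, lower_entry₁₀] at h
      rw [h, zero_mul]
    · have h := h l
      simp only [LocalData.stokesMap, stokesMatrix, if_neg hl, upper_entry₀₁] at h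
      rw [h, mul_zero]
  obtain ⟨h₁, -, -, -⟩ := relation_PII x
  constructor
  · funext i
    fin_cases i
    show (x.loc 0).formal 0 0 = 1
    linear_combination h₁ - (x.loc 0).formal 0 0 * key 2 1 (by decide) (by decide)
      + key 4 5 (by decide) (by decide)
  · rw [vec_eq]
    refine ⟨?_, ?_, ?_⟩
    · exact add_eq_right.2 (key 2 3 (by decide) (by decide))
    · exact add_eq_right.2 ((mul_comm _ _).trans (key 4 3 (by decide) (by decide)))
    · exact add_eq_right.2 (key 4 5 (by decide) (by decide))

theorem exists_isReducible_PII : ∃ x : AnalyticData PII.type, x.IsReducible := by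
  let d : LocalData (.unramified 3) := LocalData.ofUnramified 3 1 one_ne_zero 0
  refine ⟨AnalyticData.ofOne d ?_, ?_⟩
  · rw [top_eq_one_unramified_three]
    simp [d, LocalData.ofUnramified]
  · refine AnalyticData.isReducible_of_entries _ fun j => Or.inl ?_
    fin_cases j
    refine ⟨rfl, rfl, fun k => ?_⟩
    show d.stokesMap k 1 0 = 0
    unfold LocalData.stokesMap stokesMatrix
    split_ifs <;> rfl

theorem reducibleAt_PII (α : ℂ) : PII.ReducibleAt ![α] ↔ α = 1 := by
  constructor
  · rintro ⟨x, hx, hr⟩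
    rw [(isReducible_PII hr).1] at hx
    exact (congrFun hx 0).symm
  · rintro rfl
    obtain ⟨x, hx⟩ := exists_isReducible_PII
    exact ⟨x, (isReducible_PII hx).1, hx⟩

theorem not_resonantAt_PII (p) : ¬ PII.ResonantAt p := by
  rintro ⟨x, -, j, hj, -⟩
  fin_cases j
  cases hj

theorem singularLocus_PII (p : Fin 1 → ℂ) (a : Fin 3 → ℂ) :
    IsSingularPoint PII.equation (Sum.elim p a) ↔
      ∃ x : AnalyticData PII.type, PII.param x = p ∧ PII.coord x = a ∧ x.IsReducible := by
  have hp : p = ![p 0] := by funext i; fin_cases i; rfl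
  rw [hp, isSingularPoint_equation_PII]
  constructor
  · rintro ⟨h₁, h₂⟩
    obtain ⟨x, hx⟩ := exists_isReducible_PII
    exact ⟨x, by rw [h₁]; exact (isReducible_PII hx).1, by rw [h₂]; exact (isReducible_PII hx).2, hx⟩
  · rintro ⟨x, h₁, h₂, hx⟩
    obtain ⟨h₃, h₄⟩ := isReducible_PII hx
    exact ⟨congrFun (h₁.symm.trans h₃) 0, h₂.symm.trans h₄⟩

theorem hasSingularities_PII : HasSingularities (PII.fibre ![1]) [(![1, 1, 1], 1)] := by
  have hs : IsSingularPoint (PII.fibre ![1]) ![1, 1, 1] :=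
    (isSingularPoint_fibre_PII _ _).2 ⟨rfl, rfl⟩
  refine hasSingularities_singleton (fun b hb => ((isSingularPoint_fibre_PII _ _).1 hb).2) hs ?_
  rw [fibre_PII] at hs ⊢
  exact hasTypeA_one _ hs (by simp)

end MonodromyFamily
end

/-! ### The fourth Painlevé equation: invariants and singular fibres -/

noncomputable section

open SL2

namespace MonodromyFamily

/-! ### The fourth Painlevé equation -/

theorem vec_eq_two {p : Fin 2 → ℂ} {s t : ℂ} : p = ![s, t] ↔ p 0 = s ∧ p 1 = t := by
  refine ⟨fun h => by simp [h], fun ⟨h₀, h₁⟩ => funext fun i => ?_⟩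
  fin_cases i <;> assumption

theorem relation_PIV (x : AnalyticData PIV.type) :
    x.monodromyAt 1 0 = (LocalData.top (τ := .unramified 2) (x.loc 1))⁻¹ :=
  (mul_eq_one_iff_eq_inv.1 (x.relation_two 1)).trans (congrArg (·⁻¹) (x.monodromyAt_self 1))

/-- Multiplying by the formal eigenvalue removes its inverse from the trace, so that everything is
polynomial in the Stokes constants. -/
theorem trace_top_unramified_two (d : LocalData (.unramified 2)) :
    d.formal 0 0 * d.top⁻¹.1.trace =
      d.formal 0 0 ^ 2 * (1 + d.stokes (1 : Fin 4) * d.stokes (2 : Fin 4))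
      + d.stokes (0 : Fin 4) * d.stokes (3 : Fin 4)
      + (1 + d.stokes (0 : Fin 4) * d.stokes (1 : Fin 4))
        * (1 + d.stokes (2 : Fin 4) * d.stokes (3 : Fin 4)) := by
  have h := d.formal_mul
  rw [LocalData.top_unramified_two, trace_entry]
  simp [-Matrix.SpecialLinearGroup.coe_mul, -Matrix.SpecialLinearGroup.coe_inv, mul_entry,
    LocalData.formal_entry₀₁, LocalData.formal_entry₁₀]
  linear_combination (d.stokes (0 : Fin 4) * d.stokes (3 : Fin 4)
      + (1 + d.stokes (0 : Fin 4) * d.stokes (1 : Fin 4))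
        * (1 + d.stokes (2 : Fin 4) * d.stokes (3 : Fin 4))) * h

theorem param_PIV_ne_zero (x : AnalyticData PIV.type) : (x.loc 1).formal 0 0 ≠ 0 :=
  LocalData.formal_ne_zero (r := 2) (x.loc 1)

theorem trace_PIV (x : AnalyticData PIV.type) :
    (x.loc 1).formal 0 0 * (x.loc 0).formal.1.trace =
      (x.loc 1).formal 0 0 ^ 2 *
        (1 + (x.loc 1).stokes (1 : Fin 4) * (x.loc 1).stokes (2 : Fin 4))
      + (x.loc 1).stokes (0 : Fin 4) * (x.loc 1).stokes (3 : Fin 4)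
      + (1 + (x.loc 1).stokes (0 : Fin 4) * (x.loc 1).stokes (1 : Fin 4))
        * (1 + (x.loc 1).stokes (2 : Fin 4) * (x.loc 1).stokes (3 : Fin 4)) := by
  rw [← x.trace_monodromyAt_of_regular 1 0 rfl, relation_PIV]
  exact trace_top_unramified_two _

/-- The product of the second and the third Stokes constant is a polynomial in the coordinates. -/
theorem stokes_mul_PIV (x : AnalyticData PIV.type) :
    PIV.param x 1 ^ 2 * ((x.loc 1).stokes (1 : Fin 4) * (x.loc 1).stokes (2 : Fin 4)) =
      PIV.param x 1 * PIV.param x 0 - PIV.coord x 0 - PIV.coord x 1 * PIV.coord x 2 := by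
  have h := trace_PIV x
  show (x.loc 1).formal 0 0 ^ 2 * _ = (x.loc 1).formal 0 0 * (x.loc 0).formal.1.trace
    - ((x.loc 1).stokes (0 : Fin 4) * (x.loc 1).stokes (3 : Fin 4) + (x.loc 1).formal 0 0 ^ 2)
    - ((x.loc 1).stokes (0 : Fin 4) * (x.loc 1).stokes (1 : Fin 4) + 1)
      * ((x.loc 1).stokes (2 : Fin 4) * (x.loc 1).stokes (3 : Fin 4) + 1)
  linear_combination -h

/-- The cubic is `(a₁a₄)(a₂a₃) = (a₁a₂)(a₃a₄)`, with `a₂a₃` eliminated by means of the trace at the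
regular point. -/
theorem equation_PIV (x : AnalyticData PIV.type) :
    eval (Sum.elim (PIV.param x) (PIV.coord x)) PIV.equation = 0 := by
  have h := trace_PIV x
  simp only [map_add, map_sub, map_mul, map_pow, eval_X, Sum.elim_inl, Sum.elim_inr,
    Matrix.cons_val]
  linear_combination -((x.loc 1).stokes (0 : Fin 4) * (x.loc 1).stokes (3 : Fin 4)) * h

/-- The Stokes data at `∞` are free, because the monodromy at `0` is defined by the relation. The
last clause recovers its trace without dividing by `α`. -/
theorem exists_PIV (α : ℂ) (hα : α ≠ 0) (c : Fin 4 → ℂ) : ∃ x : AnalyticData PIV.type,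
    (x.loc 1).formal 0 0 = α ∧ (∀ k : Fin 4, (x.loc 1).stokes k = c k) ∧
    ∀ s, α * s = α ^ 2 * (1 + c 1 * c 2) + c 0 * c 3 + (1 + c 0 * c 1) * (1 + c 2 * c 3) →
      (x.loc 0).formal.1.trace = s := by
  let d := LocalData.ofUnramified 2 α hα c
  refine ⟨AnalyticData.ofTwo (LocalData.ofRegular d.top⁻¹) d 1 ?_, rfl, fun k => rfl,
    fun s hs => ?_⟩
  · rw [LocalData.top_regular]
    simp [LocalData.ofRegular]
  · apply mul_left_cancel₀ hα
    rw [hs]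
    exact trace_top_unramified_two d

/-- The equation is linear in `s₁` with leading coefficient `s₂(s₂² - x₁)`; each factor is
irreducible and has a zero at which the remaining part does not vanish. -/
theorem irreducible_PIV : Irreducible PIV.equation := by
  have hX : ∀ i : Fin 3, (Y i : MvPolynomial (Fin 2 ⊕ Fin 3) ℂ) ∈ supported ℂ {Sum.inl 0}ᶜ :=
    fun i => X_mem_supported_compl (by simp)
  have hS : (S 1 : MvPolynomial (Fin 2 ⊕ Fin 3) ℂ) ∈ supported ℂ {Sum.inl 0}ᶜ :=
    X_mem_supported_compl (by simp)
  have hA : (S 1 ^ 2 - Y 0 : MvPolynomial (Fin 2 ⊕ Fin 3) ℂ) ≠ 0 := by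
    intro h
    have := congrArg (eval (Sum.elim ![0, 0] ![1, 0, 0])) h
    simp at this
  refine irreducible_of_linear (Sum.inl 0) (A := S 1 * (S 1 ^ 2 - Y 0))
    (B := Y 0 * Y 1 * Y 2 + Y 0 ^ 2 - S 1 ^ 2 * Y 0 - S 1 ^ 2 * Y 1 - S 1 ^ 2 * Y 2 + S 1 ^ 2)
    ?_ ?_ ?_ ?_ ?_
  · show Y 0 * Y 1 * Y 2 + Y 0 ^ 2 - (S 1 ^ 2 + S 0 * S 1) * Y 0 - S 1 ^ 2 * Y 1
      - S 1 ^ 2 * Y 2 + S 1 ^ 2 + S 0 * S 1 ^ 3 = _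
    ring
  · exact mul_mem hS (sub_mem (pow_mem hS 2) (hX 0))
  · exact add_mem (sub_mem (sub_mem (sub_mem (add_mem (mul_mem (mul_mem (hX 0) (hX 1)) (hX 2))
      (pow_mem (hX 0) 2)) (mul_mem (pow_mem hS 2) (hX 0))) (mul_mem (pow_mem hS 2) (hX 1)))
      (mul_mem (pow_mem hS 2) (hX 2))) (pow_mem hS 2)
  · refine IsRelPrime.mul_left (isRelPrime_of_eval (irreducible_X _)
      (Sum.elim ![0, 0] ![1, 0, 0]) ?_ ?_) (isRelPrime_of_eval (irreducible_of_linear (Sum.inr 0)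
        (A := -1) (B := S 1 ^ 2) (by ring) (neg_mem (one_mem _))
        (pow_mem (X_mem_supported_compl (by simp)) 2) isUnit_one.neg.isRelPrime_left
        (neg_ne_zero.2 one_ne_zero)) (Sum.elim ![0, 1] ![1, 0, 0]) ?_ ?_) <;> simp
  · exact mul_ne_zero (X_ne_zero _) hA

theorem isMonodromySpace_PIV : PIV.IsMonodromySpace := by
  have hα : (fun x : AnalyticData PIV.type => (x.loc 1).formal 0 0) ∈
      AnalyticData.invariantRing PIV.type :=
    AnalyticData.formal_mem_invariantRing 1 (m := 2) rfl 0 0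
  have hprod : ∀ k l : Fin 4, Even k.1 → ¬ Even l.1 →
      (fun x : AnalyticData PIV.type => (x.loc 1).stokes k * (x.loc 1).stokes l) ∈
      AnalyticData.invariantRing PIV.type :=
    AnalyticData.stokes_mul_mem_invariantRing (τ := PIV.type) 1 rfl
  have htr : (fun x : AnalyticData PIV.type => (x.loc 0).formal.1.trace) ∈
      AnalyticData.invariantRing PIV.type := by
    rw [AnalyticData.mem_invariantRing_iff]
    exact ⟨(AnalyticData.formal_mem 0).trace, fun x σ ρ h => trace_conj _ _⟩
  refine isMonodromySpace_of PIV (fun i => ?_) (fun i => ?_) (fun i hi x => ?_) (fun i hi => ?_)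
    equation_PIV ?_ ?_
  · fin_cases i
    · exact htr
    · exact hα
  · fin_cases i
    · exact add_mem (hprod 0 3 (by decide) (by decide)) (pow_mem hα 2)
    · exact add_mem (hprod 0 1 (by decide) (by decide)) (one_mem _)
    · exact add_mem (hprod 2 3 (by decide) (by decide)) (one_mem _)
  · obtain rfl : i = 1 := by simpa using hi
    exact param_PIV_ne_zero x
  · obtain rfl : i = 1 := by simpa using hi
    exact AnalyticData.inv_formal_mem (τ := PIV.type) 1 (m := 2) rfl
  · refine dvd_of_vanishing_on_data irreducible_PIV (h := S 1 * (Y 0 - S 1 ^ 2))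
      (b := Sum.elim ![0, 1] ![0, 1, 0]) ?_ ?_ ?_
    · simp
    · simp
    · intro p a hpa hh
      simp at hpa hh
      obtain ⟨hp, hh⟩ := hh
      -- The torus normalisation is `a₄ = 1`. The coordinates then give `a₁`, `a₃` and, where `x₁ ≠
      -- s₂²`, also `a₂`.
      obtain ⟨x, h₁, h₂, h₃⟩ := exists_PIV (p 1) hp
        ![a 0 - p 1 ^ 2, (a 1 - 1) / (a 0 - p 1 ^ 2), a 2 - 1, 1]
      have h₃ := h₃ (p 0) (by
        simp only [Matrix.cons_val]
        apply mul_left_cancel₀ hh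
        field_simp
        linear_combination -hpa)
      refine ⟨x, funext fun i => ?_, funext fun i => ?_⟩
      · fin_cases i
        · exact h₃
        · exact h₁
      · fin_cases i
        · show (x.loc 1).stokes (0 : Fin 4) * (x.loc 1).stokes (3 : Fin 4)
            + (x.loc 1).formal 0 0 ^ 2 = a 0
          rw [h₁, h₂, h₂]
          simp
        · show (x.loc 1).stokes (0 : Fin 4) * (x.loc 1).stokes (1 : Fin 4) + 1 = a 1
          rw [h₂, h₂]
          simp only [Matrix.cons_val]
          field_simp
          ring
        · show (x.loc 1).stokes (2 : Fin 4) * (x.loc 1).stokes (3 : Fin 4) + 1 = a 2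
          rw [h₂, h₂]
          simp
  · intro A hpA hcA hiA f hf
    have hα : (fun x : AnalyticData PIV.type => (x.loc 1).formal 0 0) ∈ A := hpA 1
    have hα' : (fun x : AnalyticData PIV.type => ((x.loc 1).formal 0 0)⁻¹) ∈ A :=
      hiA 1 (by simp)
    let g : Fin 6 → AnalyticData PIV.type → ℂ :=
      ![fun x => (x.loc 1).formal 0 0, fun x => ((x.loc 1).formal 0 0)⁻¹,
        fun x => (x.loc 1).stokes (0 : Fin 4), fun x => (x.loc 1).stokes (1 : Fin 4),
        fun x => (x.loc 1).stokes (2 : Fin 4), fun x => (x.loc 1).stokes (3 : Fin 4)]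
    have hg : ∀ i, g i ∈ Algebra.adjoin ℂ (Set.range g) := fun i =>
      Algebra.subset_adjoin ⟨i, rfl⟩
    have hfor := AnalyticData.entriesIn_formal_unramified (τ := PIV.type) 1 (m := 2) rfl (hg 0)
      (hg 1)
    have hst : ∀ k, (fun x : AnalyticData PIV.type => (x.loc 1).stokes k) ∈
        Algebra.adjoin ℂ (Set.range g) := by
      intro k
      change Fin 4 at k
      fin_cases k
      · exact hg 2
      · exact hg 3
      · exact hg 4
      · exact hg 5
    have hfg : f ∈ Algebra.adjoin ℂ (Set.range g) := by
      refine AnalyticData.invariant_mem 1 _ (fun j h => ?_) (fun j h => ?_)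
        (fun j h => ?_) (fun j h => ?_) hf <;> fin_cases j
      · show AnalyticData.EntriesIn _ fun x : AnalyticData PIV.type => x.monodromyAt 1 0
        simp_rw [relation_PIV]
        exact (AnalyticData.entriesIn_top 1 hfor hst).inv
      · cases h
      · exact absurd rfl h
      · exact hfor
      · exact absurd rfl h
      · exact hst
      · exact absurd rfl h
      · exact AnalyticData.entriesIn_linkFrom_self 1 _
    refine torus_invariant_mem g ![0, 0, -1, 1, -1, 1] (by decide) (m := 2) (by norm_num)
      (fun t ht => AnalyticData.torusAct (τ := PIV.type) 1 (m := 2) rfl t ht) ?_ A ?_ ?_ hfg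
      (fun t ht z => ((AnalyticData.mem_invariantRing_iff f).1 hf).2 z _ _ _)
    · intro i t ht z
      have hst := AnalyticData.stokes_torusAct (τ := PIV.type) 1 (m := 2) rfl t ht z
      have hfor := AnalyticData.formal_torusAct (τ := PIV.type) 1 (m := 2) rfl t ht z 0 0
      fin_cases i
      · simpa [g] using hfor
      · simpa [g] using hfor
      · exact hst (0 : Fin 4)
      · exact hst (1 : Fin 4)
      · exact hst (2 : Fin 4)
      · exact hst (3 : Fin 4)
    · intro i hi
      fin_cases i
      · exact hα
      · exact hα'
      all_goals simp at hi
    · have h₀₃ : (fun x : AnalyticData PIV.type =>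
          (x.loc 1).stokes (0 : Fin 4) * (x.loc 1).stokes (3 : Fin 4)) ∈ A :=
        AnalyticData.mem_of_eq (sub_mem (hcA 0) (pow_mem (hpA 1) 2)) fun x =>
          (add_sub_cancel_right _ _).symm
      have h₀₁ : (fun x : AnalyticData PIV.type =>
          (x.loc 1).stokes (0 : Fin 4) * (x.loc 1).stokes (1 : Fin 4)) ∈ A :=
        AnalyticData.mem_of_eq (sub_mem (hcA 1) (one_mem A)) fun x => (add_sub_cancel_right _ _).symm
      have h₂₃ : (fun x : AnalyticData PIV.type =>
          (x.loc 1).stokes (2 : Fin 4) * (x.loc 1).stokes (3 : Fin 4)) ∈ A :=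
        AnalyticData.mem_of_eq (sub_mem (hcA 2) (one_mem A)) fun x => (add_sub_cancel_right _ _).symm
      have h₁₂ : (fun x : AnalyticData PIV.type =>
          (x.loc 1).stokes (1 : Fin 4) * (x.loc 1).stokes (2 : Fin 4)) ∈ A := by
        refine AnalyticData.mem_of_eq (mul_mem (pow_mem hα' 2) (sub_mem (sub_mem
          (mul_mem (hpA 1) (hpA 0)) (hcA 0)) (mul_mem (hcA 1) (hcA 2)))) fun x => ?_
        have h := stokes_mul_PIV x
        have hne : PIV.param x 1 ≠ 0 := param_PIV_ne_zero x
        show _ = (PIV.param x 1)⁻¹ ^ 2 * (PIV.param x 1 * PIV.param x 0 - PIV.coord x 0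
          - PIV.coord x 1 * PIV.coord x 2)
        rw [← h, ← mul_assoc, ← mul_pow, inv_mul_cancel₀ hne, one_pow, one_mul]
      intro i j hi hj
      fin_cases i <;> first | (exfalso; revert hi; decide) | skip
      all_goals fin_cases j <;> first | (exfalso; revert hj; decide) | skip
      · exact AnalyticData.mem_of_eq h₀₁ fun x => mul_comm _ _
      · exact h₁₂
      · exact AnalyticData.mem_of_eq h₀₃ fun x => mul_comm _ _
      · exact AnalyticData.mem_of_eq h₂₃ fun x => mul_comm _ _

theorem fibre_PIV (p : Fin 2 → ℂ) :
    PIV.fibre p = triangleCubic 1 0 0 (-(p 1 ^ 2 + p 0 * p 1)) (-p 1 ^ 2) (-p 1 ^ 2)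
      (p 1 ^ 2 + p 0 * p 1 ^ 3) := by
  apply eq_triangleCubic
  intro b
  simp [fibre]
  ring

theorem isSingularPoint_fibre_PIV {s α : ℂ} (hα : α ≠ 0) (a : Fin 3 → ℂ) :
    IsSingularPoint (PIV.fibre ![s, α]) a ↔ (α ^ 2 - s * α + 1 = 0 ∧ a = ![α ^ 2, 1, 1]) ∨
      (s = 2 ∧ a = ![α, α, α]) ∨ (s = -2 ∧ a = ![-α, -α, -α]) := by
  rw [fibre_PIV, isSingularPoint_triangleCubic, vec_eq, vec_eq, vec_eq]
  simp only [Matrix.cons_val]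
  constructor
  · rintro ⟨h₀, h₁, h₂, h₃⟩
    have h0 : a 0 ≠ 0 := by
      intro h0
      rw [h0] at h₂
      apply pow_ne_zero 2 hα
      linear_combination -h₂
    have h12 : a 2 = a 1 := by
      apply mul_left_cancel₀ h0
      linear_combination h₂ - h₃
    rw [h12] at h₀ h₁ h₂
    -- The gradient gives `x₂ = x₃` and `x₁x₂ = α²`. Elimination from `F` and `∂₁F` leaves the
    -- reducible point `x₂ = 1` or the resonant ones `x₁ = ±α`.
    have hfac : (a 1 - 1) ^ 2 * ((a 0 - α) * (a 0 + α)) = 0 := by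
      linear_combination -h₀ + (a 0 - α ^ 2) * h₁ - (2 * a 0 - a 0 * a 1 - α ^ 2) * h₂
    have hy : ∀ z, z ≠ 0 → z ^ 2 = α ^ 2 → a 0 = z → a 1 = z := by
      intro z hz hzα h
      apply mul_left_cancel₀ hz
      rw [h] at h₂
      linear_combination h₂ - hzα
    rcases mul_eq_zero.1 hfac with h | h
    · have hy1 : a 1 = 1 := sub_eq_zero.1 (pow_eq_zero_iff two_ne_zero |>.1 h)
      rw [hy1] at h₁ h₂ h12
      refine Or.inl ⟨?_, ?_, hy1, h12⟩
      · linear_combination h₁ - 2 * h₂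
      · linear_combination h₂
    · right
      rcases mul_eq_zero.1 h with h | h
      · have hx := sub_eq_zero.1 h
        have hy := hy α hα rfl hx
        refine Or.inl ⟨?_, hx, hy, h12.trans hy⟩
        rw [hx, hy] at h₁
        apply mul_left_cancel₀ hα
        linear_combination -h₁
      · have hx := eq_neg_of_add_eq_zero_left h
        have hy := hy (-α) (neg_ne_zero.2 hα) (by ring) hx
        refine Or.inr ⟨?_, hx, hy, h12.trans hy⟩
        rw [hx, hy] at h₁
        apply mul_left_cancel₀ hα
        linear_combination -h₁
  · rintro (⟨h, e₀, e₁, e₂⟩ | ⟨rfl, e₀, e₁, e₂⟩ | ⟨rfl, e₀, e₁, e₂⟩) <;> rw [e₀, e₁, e₂]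
    · refine ⟨?_, ?_, ?_, ?_⟩
      · ring
      · linear_combination h
      · ring
      · ring
    · refine ⟨?_, ?_, ?_, ?_⟩ <;> ring
    · refine ⟨?_, ?_, ?_, ?_⟩ <;> ring

theorem isSingularPoint_equation_PIV {s α : ℂ} (hα : α ≠ 0) (a : Fin 3 → ℂ) :
    IsSingularPoint PIV.equation (Sum.elim ![s, α] a) ↔ s = α + α⁻¹ ∧ a = ![α ^ 2, 1, 1] := by
  have hs : s = α + α⁻¹ ↔ α ^ 2 - s * α + 1 = 0 := by
    constructor
    · rintro rfl
      field_simp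
      ring
    · intro h
      field_simp
      linear_combination -h
  rw [isSingularPoint_equation_iff PIV, isSingularPoint_fibre_PIV hα, hs]
  constructor
  · rintro ⟨h, hd⟩
    -- The derivative in `s₁` is `α(α² - x₁)`. It excludes the resonant points except where they
    -- coincide with the reducible one, at `α = ±1`.
    have h0 : a 0 = α ^ 2 := by
      have := hd 0
      simp [pderiv_X] at this
      apply mul_left_cancel₀ hα
      linear_combination -this
    rcases h with h | ⟨rfl, h⟩ | ⟨rfl, h⟩
    · exact h
    · have h1 : α = 1 := by
        rw [h] at h0
        simp only [Matrix.cons_val] at h0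
        apply mul_left_cancel₀ hα
        linear_combination -h0
      rw [h, h1]
      norm_num
    · have h1 : α = -1 := by
        rw [h] at h0
        simp only [Matrix.cons_val] at h0
        apply mul_left_cancel₀ hα
        linear_combination -h0
      rw [h, h1]
      norm_num
  · rintro ⟨h, rfl⟩
    refine ⟨Or.inl ⟨h, rfl⟩, fun i => ?_⟩
    fin_cases i
    · simp [pderiv_X]
      ring
    · simp [pderiv_X]
      linear_combination (-2 * α) * h

theorem resonantAt_PIV {s α : ℂ} (hα : α ≠ 0) : PIV.ResonantAt ![s, α] ↔ s = 2 ∨ s = -2 := by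
  constructor
  · rintro ⟨x, hx, j, hj, h⟩
    fin_cases j
    · have : (x.loc 0).formal.1.trace = s := congrFun hx 0
      rw [← this]
      exact h
    · cases hj
  · intro h
    -- With `a₁ = a₄ = 0` and `a₂ = 1` the trace relation is linear in `a₃`, so every trace is
    -- attained for every `α`.
    obtain ⟨x, h₁, -, h₃⟩ := exists_PIV α hα ![0, 1, (α * s - 1 - α ^ 2) / α ^ 2, 0]
    have h₃ : (x.loc 0).formal.1.trace = s := h₃ s (by
      simp only [Matrix.cons_val]
      field_simp
      ring)
    refine ⟨x, vec_eq_two.2 ⟨h₃, h₁⟩, 0, rfl, ?_⟩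
    rw [h₃]
    exact h

theorem isReducible_PIV {x : AnalyticData PIV.type} (hx : x.IsReducible) :
    PIV.param x 1 ^ 2 - PIV.param x 0 * PIV.param x 1 + 1 = 0 ∧
      PIV.coord x = ![PIV.param x 1 ^ 2, 1, 1] := by
  have key : ∀ k l : Fin 4, Even k.1 → ¬ Even l.1 →
      (x.loc 1).stokes k * (x.loc 1).stokes l = 0 := by
    intro k l hk hl
    rcases hx.triangular 1 (by simp) with ⟨-, h⟩ | ⟨-, h⟩
    · have h := h k
      simp only [LocalData.stokesMap, stokesMatrix, if_pos hk, lower_entry₁₀] at h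
      rw [h, zero_mul]
    · have h := h l
      simp only [LocalData.stokesMap, stokesMatrix, if_neg hl, upper_entry₀₁] at h
      rw [h, mul_zero]
  have hc : PIV.coord x = ![PIV.param x 1 ^ 2, 1, 1] := by
    rw [vec_eq]
    refine ⟨?_, ?_, ?_⟩
    · exact add_eq_right.2 (key 0 3 (by decide) (by decide))
    · exact add_eq_right.2 (key 0 1 (by decide) (by decide))
    · exact add_eq_right.2 (key 2 3 (by decide) (by decide))
  refine ⟨?_, hc⟩
  have h := stokes_mul_PIV x
  have h₁₂ : (x.loc 1).stokes (1 : Fin 4) * (x.loc 1).stokes (2 : Fin 4) = 0 :=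
    (mul_comm _ _).trans (key 2 1 (by decide) (by decide))
  rw [h₁₂, hc] at h
  simp only [Matrix.cons_val] at h ⊢
  linear_combination h

/-- All Stokes constants are zero, so everything is diagonal. The trace at `0` need not be computed:
`isReducible_PIV` and the hypothesis give the same equation for it. -/
theorem exists_isReducible_PIV {s α : ℂ} (hα : α ≠ 0) (h : α ^ 2 - s * α + 1 = 0) :
    ∃ x : AnalyticData PIV.type, PIV.param x = ![s, α] ∧ x.IsReducible := by
  let d : LocalData (.unramified 2) := LocalData.ofUnramified 2 α hα 0
  have hst : ∀ k, d.stokesMap k 1 0 = 0 := fun k => by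
    unfold LocalData.stokesMap stokesMatrix
    split_ifs <;> rfl
  let x : AnalyticData PIV.type := AnalyticData.ofTwo (LocalData.ofRegular d.top⁻¹) d 1 (by
    rw [LocalData.top_regular]
    simp [LocalData.ofRegular])
  have hx : x.IsReducible := by
    refine AnalyticData.isReducible_of_entries _ fun j => Or.inl ?_
    fin_cases j
    · refine ⟨rfl, ?_, fun k => k.elim0⟩
      show d.top⁻¹ 1 0 = 0
      rw [LocalData.top_unramified_two]
      simp [-Matrix.SpecialLinearGroup.coe_mul, -Matrix.SpecialLinearGroup.coe_inv, mul_entry,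
        d, LocalData.ofUnramified]
    · exact ⟨rfl, rfl, hst⟩
  refine ⟨x, vec_eq_two.2 ⟨?_, rfl⟩, hx⟩
  have h' : α ^ 2 - PIV.param x 0 * α + 1 = 0 := (isReducible_PIV hx).1
  apply mul_left_cancel₀ hα
  linear_combination h - h'

theorem reducibleAt_PIV {s α : ℂ} (hα : α ≠ 0) :
    PIV.ReducibleAt ![s, α] ↔ α ^ 2 - s * α + 1 = 0 := by
  constructor
  · rintro ⟨x, hx, hr⟩
    have := (isReducible_PIV hr).1
    rw [hx] at this
    exact this
  · exact exists_isReducible_PIV hα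

theorem singularLocus_PIV {p : Fin 2 → ℂ} (hp : p ∈ PIV.parameterSpace) (a : Fin 3 → ℂ) :
    IsSingularPoint PIV.equation (Sum.elim p a) ↔
      ∃ x : AnalyticData PIV.type, PIV.param x = p ∧ PIV.coord x = a ∧ x.IsReducible := by
  have hα : p 1 ≠ 0 := hp 1 (by simp)
  have hpe : p = ![p 0, p 1] := vec_eq_two.2 ⟨rfl, rfl⟩
  rw [hpe, isSingularPoint_equation_PIV hα]
  constructor
  · rintro ⟨h₁, h₂⟩
    obtain ⟨x, hx, hr⟩ := exists_isReducible_PIV (s := p 0) hα (by rw [h₁]; field_simp; ring)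
    refine ⟨x, hx, ?_, hr⟩
    rw [h₂, (isReducible_PIV hr).2, hx]
    rfl
  · rintro ⟨x, h₁, h₂, hx⟩
    obtain ⟨h₃, h₄⟩ := isReducible_PIV hx
    rw [h₁] at h₃ h₄
    refine ⟨?_, h₂.symm.trans h₄⟩
    have h₃ : p 1 ^ 2 - p 0 * p 1 + 1 = 0 := h₃
    field_simp
    linear_combination -h₃

theorem hasSingularities_PIV_nil {s α : ℂ} (hα : α ≠ 0) (h : s ^ 2 ≠ 4)
    (h' : α ^ 2 - s * α + 1 ≠ 0) : HasSingularities (PIV.fibre ![s, α]) [] := by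
  refine hasSingularities_nil fun a ha => ?_
  rcases (isSingularPoint_fibre_PIV hα a).1 ha with h₁ | h₁ | h₁
  · exact h' h₁.1
  · exact h (by rw [h₁.1]; norm_num)
  · exact h (by rw [h₁.1]; norm_num)

/-- The value deciding about type `A₁` is `α²ε(ε - α)`, so the point degenerates precisely when it
meets the reducible one. -/
theorem hasSingularities_PIV_resonant {s α ε : ℂ} (hα : α ≠ 0) (hε : ε ∈ ({1, -1} : Set ℂ))
    (h : s = 2 * ε) (h' : α ≠ ε) :
    HasSingularities (PIV.fibre ![s, α]) [(![ε * α, ε * α, ε * α], 1)] := by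
  have hε2 : ε ^ 2 = 1 := by rcases hε with rfl | rfl <;> norm_num
  have hε0 : ε ≠ 0 := by rcases hε with rfl | rfl <;> norm_num
  have hs : IsSingularPoint (PIV.fibre ![s, α]) ![ε * α, ε * α, ε * α] := by
    rw [isSingularPoint_fibre_PIV hα, h]
    right
    rcases hε with rfl | rfl
    · left; simp
    · right; simp
  refine hasSingularities_singleton (fun b hb => ?_) hs ?_
  · rcases (isSingularPoint_fibre_PIV hα b).1 hb with ⟨h₁, -⟩ | ⟨h₁, h₂⟩ | ⟨h₁, h₂⟩
    · refine absurd (sub_eq_zero.1 (pow_eq_zero_iff two_ne_zero |>.1 ?_)) h'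
      rw [h] at h₁
      linear_combination h₁ + hε2
    · have : ε = 1 := by linear_combination (h₁ - h) / 2
      rw [h₂, this, one_mul]
    · have : ε = -1 := by linear_combination (h₁ - h) / 2
      rw [h₂, this, neg_one_mul]
  · rw [fibre_PIV] at hs ⊢
    refine hasTypeA_one _ hs ?_
    have : α ^ 2 * ε * (ε - α) ≠ 0 :=
      mul_ne_zero (mul_ne_zero (pow_ne_zero 2 hα) hε0) (sub_ne_zero.2 h'.symm)
    simp only [Matrix.cons_val]
    intro h0
    apply this
    linear_combination h0 + α ^ 3 * ε * hε2

theorem hasSingularities_PIV_reducible {s α : ℂ} (hα : α ≠ 0) (h : s = α + α⁻¹) (h₁ : α ≠ 1)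
    (h₂ : α ≠ -1) : HasSingularities (PIV.fibre ![s, α]) [(![α ^ 2, 1, 1], 1)] := by
  have hs : IsSingularPoint (PIV.fibre ![s, α]) ![α ^ 2, 1, 1] := by
    rw [isSingularPoint_fibre_PIV hα]
    refine Or.inl ⟨?_, rfl⟩
    rw [h]
    field_simp
    ring
  refine hasSingularities_singleton (fun b hb => ?_) hs ?_
  · rcases (isSingularPoint_fibre_PIV hα b).1 hb with ⟨-, h₃⟩ | ⟨h₃, -⟩ | ⟨h₃, -⟩
    · exact h₃
    · rw [h₃] at h
      field_simp at h
      refine absurd (sub_eq_zero.1 (pow_eq_zero_iff two_ne_zero |>.1 ?_)) h₁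
      linear_combination -h
    · rw [h₃] at h
      field_simp at h
      refine absurd (eq_neg_of_add_eq_zero_left (pow_eq_zero_iff two_ne_zero |>.1 ?_)) h₂
      linear_combination -h
  · rw [fibre_PIV] at hs ⊢
    refine hasTypeA_one _ hs ?_
    have : α ^ 2 * ((α - 1) * (α + 1)) ≠ 0 :=
      mul_ne_zero (pow_ne_zero 2 hα) (mul_ne_zero (sub_ne_zero.2 h₁)
        (fun h => h₂ (eq_neg_of_add_eq_zero_left h)))
    simp only [Matrix.cons_val]
    intro h0
    apply this
    linear_combination h0

/-- The resonant and the reducible singular point collide. At `(1, 1, 1)` the restricted form is `1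
- (1 + y) = -y`, of order one. -/
theorem hasSingularities_PIV_special {s α ε : ℂ} (hε : ε ∈ ({1, -1} : Set ℂ))
    (h : s = 2 * ε) (h' : α = ε) : HasSingularities (PIV.fibre ![s, α]) [(![1, 1, 1], 2)] := by
  have hε2 : ε ^ 2 = 1 := by rcases hε with rfl | rfl <;> norm_num
  have hα : α ≠ 0 := by rw [h']; rcases hε with rfl | rfl <;> norm_num
  have hs : IsSingularPoint (PIV.fibre ![s, α]) ![1, 1, 1] := by
    rw [isSingularPoint_fibre_PIV hα, h, h']
    left
    exact ⟨by linear_combination -hε2, by rw [hε2]⟩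
  refine hasSingularities_singleton (fun b hb => ?_) hs ?_
  · rcases (isSingularPoint_fibre_PIV hα b).1 hb with ⟨-, h₃⟩ | ⟨h₃, h₄⟩ | ⟨h₃, h₄⟩
    · rw [h₃, h', hε2]
    · rw [h₄, h', show ε = 1 by linear_combination (h₃ - h) / 2]
    · rw [h₄, h', show ε = -1 by linear_combination (h₃ - h) / 2, neg_neg]
  · rw [fibre_PIV] at hs ⊢
    refine hasTypeA_two _ hs ?_ ?_ ?_ <;> simp

end MonodromyFamily
end

/-! ### Further invariants at ramified points; degenerate PV and PIII of type `D₈` -/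

noncomputable section

open SL2

namespace AnalyticData

variable {r : ℕ} {τ : Fin r → PointType}

theorem trace_formal_mem_invariantRing (j : Fin r) :
    (fun x => (x.loc j).formal.1.trace) ∈ invariantRing τ :=
  (mem_invariantRing_iff _).2 ⟨(formal_mem j).trace, fun _ _ _ _ => trace_conj _ _⟩

theorem isAdmissible_ramified {j : Fin r} {m : ℕ} (hj : τ j = .ramified m) {g : SL2}
    (h : (τ j).IsAdmissible g) : g = 1 := by
  rw [hj] at h
  exact h

theorem monodromyAt_mem_invariantRing (i j : Fin r) {m : ℕ} (hi : τ i = .ramified m)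
    (a b : Fin 2) : (fun x => x.monodromyAt i j a b) ∈ invariantRing τ := by
  refine (mem_invariantRing_iff _).2 ⟨monodromyAt_mem i j a b, fun x σ ρ h => ?_⟩
  rw [monodromyAt_act, isAdmissible_ramified hi (h i), one_mul, inv_one, mul_one]

theorem linkFrom_mem_invariantRing (i j : Fin r) {m n : ℕ} (hi : τ i = .ramified m)
    (hj : τ j = .ramified n) (a b : Fin 2) :
    (fun x => x.linkFrom i j a b) ∈ invariantRing τ := by
  refine (mem_invariantRing_iff _).2 ⟨linkFrom_mem i j a b, fun x σ ρ h => ?_⟩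
  rw [linkFrom_act, isAdmissible_ramified hi (h i), isAdmissible_ramified hj (h j), one_mul,
    inv_one, mul_one]

end AnalyticData

namespace MonodromyFamily

theorem ext_three {a b : Fin 3 → ℂ} (h₀ : a 0 = b 0) (h₁ : a 1 = b 1) (h₂ : a 2 = b 2) :
    a = b := by
  funext i
  fin_cases i <;> assumption

/-! ### The degenerate fifth Painlevé equation -/

theorem relation_PVdeg (x : AnalyticData PVdeg.type) :
    x.monodromyAt 2 0 = (x.monodromyAt 2 1 * (LocalData.top (τ := .ramified 0) (x.loc 2)))⁻¹ := by
  have h := x.relation_three 2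
  rw [mul_assoc] at h
  exact (mul_eq_one_iff_eq_inv.1 h).trans
    (congrArg (fun m => (x.monodromyAt 2 1 * m)⁻¹) (x.monodromyAt_self 2))

theorem trace_inv_mul_top_ramified_zero (M : SL2) (d : LocalData (.ramified 0)) :
    (M * d.top)⁻¹.1.trace = M 0 1 - M 1 0 - M 0 0 * d.stokes (0 : Fin 1) := by
  rw [LocalData.top_ramified_zero, trace_entry]
  simp [-Matrix.SpecialLinearGroup.coe_mul, -Matrix.SpecialLinearGroup.coe_inv, mul_entry]
  ring

/-- The traces at the two regular points give the two entries of `M₂` that are not coordinates up to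
sign. The cubic is then the condition `det M₂ = 1`. -/
theorem entries_PVdeg (x : AnalyticData PVdeg.type) :
    x.monodromyAt 2 1 1 0 =
      -(PVdeg.coord x 1 * PVdeg.coord x 2) - PVdeg.coord x 0 - PVdeg.param x 0 ∧
    x.monodromyAt 2 1 1 1 = PVdeg.param x 1 + PVdeg.coord x 1 := by
  have h₀ : PVdeg.param x 0 = _ := (x.trace_monodromyAt_of_regular 2 0 rfl).symm
  have h₁ : PVdeg.param x 1 = _ := (x.trace_monodromyAt_of_regular 2 1 rfl).symm
  rw [relation_PVdeg] at h₀
  replace h₀ := h₀.trans (trace_inv_mul_top_ramified_zero (x.monodromyAt 2 1) (x.loc 2))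
  rw [trace_entry] at h₁
  rw [h₀, h₁]
  simp only [Matrix.cons_val]
  constructor <;> ring

theorem equation_PVdeg (x : AnalyticData PVdeg.type) :
    eval (Sum.elim (PVdeg.param x) (PVdeg.coord x)) PVdeg.equation = 0 := by
  obtain ⟨h₀, h₁⟩ := entries_PVdeg x
  have hdet := det_entry (x.monodromyAt 2 1)
  rw [h₀, h₁] at hdet
  simp only [map_add, map_mul, map_pow, eval_X, Sum.elim_inl, Sum.elim_inr, map_one]
  simp only [Matrix.cons_val] at hdet ⊢
  linear_combination -hdet

theorem exists_PVdeg (s₀ s₁ : ℂ) (a : Fin 3 → ℂ)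
    (h : a 0 * a 1 * a 2 + a 0 ^ 2 + a 1 ^ 2 + s₀ * a 0 + s₁ * a 1 + 1 = 0) :
    ∃ x : AnalyticData PVdeg.type, PVdeg.param x = ![s₀, s₁] ∧ PVdeg.coord x = a := by
  let d : LocalData (.ramified 0) := LocalData.ofRamified 0 ![-a 2]
  let M : SL2 := SL2.mk (-a 1) (-a 0) (-(a 1 * a 2) - a 0 - s₀) (s₁ + a 1)
    (by linear_combination -h)
  let x : AnalyticData PVdeg.type := AnalyticData.ofThree (LocalData.ofRegular (M * d.top)⁻¹)
    (LocalData.ofRegular M) d (by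
      rw [LocalData.top_regular, LocalData.top_regular]
      simp [LocalData.ofRegular, mul_assoc])
  have hM : x.monodromyAt 2 1 = M := by
    show 1 * (1⁻¹ * (LocalData.ofRegular M).top * 1) * 1⁻¹ = M
    rw [LocalData.top_regular]
    simp [LocalData.ofRegular]
  refine ⟨x, vec_eq_two.2 ⟨?_, ?_⟩, ext_three ?_ ?_ ?_⟩
  · show (M * d.top)⁻¹.1.trace = s₀
    rw [trace_inv_mul_top_ramified_zero]
    simp [M, d, LocalData.ofRamified]
    ring
  · show M.1.trace = s₁
    rw [trace_entry]
    simp [M]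
  · show -x.monodromyAt 2 1 0 1 = a 0
    simp [hM, M]
  · show -x.monodromyAt 2 1 0 0 = a 1
    simp [hM, M]
  · show -(-a 2) = a 2
    ring

theorem irreducible_PVdeg : Irreducible PVdeg.equation := by
  have hX : ∀ i : Fin 3, (Y i : MvPolynomial (Fin 2 ⊕ Fin 3) ℂ) ∈ supported ℂ {Sum.inl 0}ᶜ :=
    fun i => X_mem_supported_compl (by simp)
  have hS : (S 1 : MvPolynomial (Fin 2 ⊕ Fin 3) ℂ) ∈ supported ℂ {Sum.inl 0}ᶜ :=
    X_mem_supported_compl (by simp)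
  refine irreducible_of_linear (Sum.inl 0) (A := Y 0)
    (B := Y 0 * Y 1 * Y 2 + Y 0 ^ 2 + Y 1 ^ 2 + S 1 * Y 1 + 1) ?_ (hX 0) ?_
    (isRelPrime_of_eval (irreducible_X _) 0 (by simp) (by simp)) (X_ne_zero _)
  · show Y 0 * Y 1 * Y 2 + Y 0 ^ 2 + Y 1 ^ 2 + S 0 * Y 0 + S 1 * Y 1 + 1 = _
    ring
  · exact add_mem (add_mem (add_mem (add_mem (mul_mem (mul_mem (hX 0) (hX 1)) (hX 2))
      (pow_mem (hX 0) 2)) (pow_mem (hX 1) 2)) (mul_mem hS (hX 1))) (one_mem _)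

/-- In the rigid basis at the ramified point no group is left. The entries of `M₂` and the single
Stokes constant are invariant and determine the data, because `M₁` follows from the relation. Every
point of the hypersurface lifts. -/
theorem isMonodromySpace_PVdeg : PVdeg.IsMonodromySpace := by
  refine isMonodromySpace_of PVdeg (fun i => ?_) (fun i => ?_) (by simp) (by simp)
    equation_PVdeg ?_ ?_
  · fin_cases i
    · exact AnalyticData.trace_formal_mem_invariantRing (τ := PVdeg.type) 0
    · exact AnalyticData.trace_formal_mem_invariantRing (τ := PVdeg.type) 1
  · fin_cases i
    · exact neg_mem (AnalyticData.monodromyAt_mem_invariantRing (τ := PVdeg.type) 2 1 (m := 0)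
        rfl 0 1)
    · exact neg_mem (AnalyticData.monodromyAt_mem_invariantRing (τ := PVdeg.type) 2 1 (m := 0)
        rfl 0 0)
    · exact neg_mem (AnalyticData.stokes_mem_invariantRing (τ := PVdeg.type) 2 (m := 0)
        rfl (0 : Fin 1))
  · refine dvd_of_vanishing_on_data irreducible_PVdeg (h := 1) (b := Sum.elim ![0, -2] ![0, 1, 0])
      (by simp; norm_num) (by simp) ?_
    intro p a hpa _
    obtain ⟨x, h₁, h₂⟩ := exists_PVdeg (p 0) (p 1) a (by simpa using hpa)
    exact ⟨x, by rw [h₁]; exact (vec_eq_two.2 ⟨rfl, rfl⟩).symm, h₂⟩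
  · intro A hpA hcA _ f hf
    have hM : AnalyticData.EntriesIn A fun x : AnalyticData PVdeg.type => x.monodromyAt 2 1 := by
      intro i j
      fin_cases i <;> fin_cases j
      · exact AnalyticData.mem_of_eq (neg_mem (hcA 1)) fun x => (neg_neg _).symm
      · exact AnalyticData.mem_of_eq (neg_mem (hcA 0)) fun x => (neg_neg _).symm
      · exact AnalyticData.mem_of_eq (sub_mem (sub_mem (neg_mem (mul_mem (hcA 1) (hcA 2))) (hcA 0))
          (hpA 0)) fun x => (entries_PVdeg x).1
      · exact AnalyticData.mem_of_eq (add_mem (hpA 1) (hcA 1)) fun x => (entries_PVdeg x).2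
    have hst : ∀ k, (fun x : AnalyticData PVdeg.type => (x.loc 2).stokes k) ∈ A := by
      intro k
      change Fin 1 at k
      fin_cases k
      exact AnalyticData.mem_of_eq (neg_mem (hcA 2)) fun x => (neg_neg _).symm
    have hfor := AnalyticData.entriesIn_formal_ramified (τ := PVdeg.type) 2 (m := 0) rfl A
    refine AnalyticData.invariant_mem 2 A (fun j h => ?_) (fun j h => ?_)
      (fun j h => ?_) (fun j h => ?_) hf <;> fin_cases j
    · show AnalyticData.EntriesIn A fun x : AnalyticData PVdeg.type => x.monodromyAt 2 0
      simp_rw [relation_PVdeg]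
      exact (hM.mul (AnalyticData.entriesIn_top 2 hfor hst)).inv
    · exact hM
    · cases h
    · exact absurd rfl h
    · exact absurd rfl h
    · exact hfor
    · exact absurd rfl h
    · exact absurd rfl h
    · exact hst
    · exact absurd rfl h
    · exact absurd rfl h
    · exact AnalyticData.entriesIn_linkFrom_self 2 A

theorem fibre_PVdeg (p : Fin 2 → ℂ) :
    PVdeg.fibre p = triangleCubic 1 1 0 (p 0) (p 1) 0 1 := by
  apply eq_triangleCubic
  intro b
  simp [fibre]
  ring

theorem isSingularPoint_fibre_PVdeg (s₀ s₁ : ℂ) (a : Fin 3 → ℂ) :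
    IsSingularPoint (PVdeg.fibre ![s₀, s₁]) a ↔
      (s₀ = -2 * a 0 ∧ a 0 ^ 2 = 1 ∧ a = ![a 0, 0, -(s₁ * a 0)]) ∨
      (s₁ = -2 * a 1 ∧ a 1 ^ 2 = 1 ∧ a = ![0, a 1, -(s₀ * a 1)]) := by
  rw [fibre_PVdeg, isSingularPoint_triangleCubic, vec_eq, vec_eq]
  simp only [Matrix.cons_val]
  constructor
  · rintro ⟨h₀, h₁, h₂, h₃⟩
    rcases mul_eq_zero.1 (show a 0 * a 1 = 0 by linear_combination h₃) with h | h
    · right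
      rw [h] at h₀ h₁ h₂
      have hsq : a 1 ^ 2 = 1 := by linear_combination a 1 * h₂ - h₀
      exact ⟨by linear_combination h₂, hsq, h, trivial, by
        linear_combination a 1 * h₁ - a 2 * hsq⟩
    · left
      rw [h] at h₀ h₁ h₂
      have hsq : a 0 ^ 2 = 1 := by linear_combination a 0 * h₁ - h₀
      exact ⟨by linear_combination h₁, hsq, trivial, h, by
        linear_combination a 0 * h₂ - a 2 * hsq⟩
  · rintro (⟨hp, h, -, e₁, e₂⟩ | ⟨hp, h, e₀, -, e₂⟩)
    · rw [e₁, e₂, hp]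
      refine ⟨?_, ?_, ?_, ?_⟩
      · linear_combination -h
      · ring
      · linear_combination -s₁ * h
      · ring
    · rw [e₀, e₂, hp]
      refine ⟨?_, ?_, ?_, ?_⟩
      · linear_combination -h
      · linear_combination -s₀ * h
      · ring
      · ring

/-- The derivatives in `s₀` and `s₁` are `x₁` and `x₂`, and a singular point of a fibre has one of
these equal to `±1`. -/
theorem not_isSingularPoint_equation_PVdeg (s₀ s₁ : ℂ) (a : Fin 3 → ℂ) :
    ¬ IsSingularPoint PVdeg.equation (Sum.elim ![s₀, s₁] a) := by
  rw [isSingularPoint_equation_iff PVdeg, isSingularPoint_fibre_PVdeg]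
  rintro ⟨h, hd⟩
  have h₀ : a 0 = 0 := by simpa [pderiv_X] using hd 0
  have h₁ : a 1 = 0 := by simpa [pderiv_X] using hd 1
  simp [h₀, h₁] at h

theorem not_reducibleAt_PVdeg (p) : ¬ PVdeg.ReducibleAt p := by
  rintro ⟨x, -, hx⟩
  exact x.not_isReducible_of_ramified 2 rfl hx

theorem resonantAt_PVdeg (s₀ s₁ : ℂ) :
    PVdeg.ResonantAt ![s₀, s₁] ↔ s₀ = 2 ∨ s₀ = -2 ∨ s₁ = 2 ∨ s₁ = -2 := by
  constructor
  · rintro ⟨x, hx, j, hj, h⟩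
    fin_cases j
    · have : (x.loc 0).formal.1.trace = s₀ := congrFun hx 0
      rw [← this]
      exact h.elim Or.inl fun h => Or.inr (Or.inl h)
    · have : (x.loc 1).formal.1.trace = s₁ := congrFun hx 1
      rw [← this]
      exact Or.inr (Or.inr h)
    · cases hj
  · intro h
    -- At `x₁ = x₂ = 1` the equation is solved for `x₃`, so every parameter value is attained.
    obtain ⟨x, hx, -⟩ := exists_PVdeg s₀ s₁ ![1, 1, -(3 + s₀ + s₁)] (by simp; ring)
    have h₀ : (x.loc 0).formal.1.trace = s₀ := congrFun hx 0
    have h₁ : (x.loc 1).formal.1.trace = s₁ := congrFun hx 1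
    rw [← or_assoc] at h
    rcases h with h | h
    · exact ⟨x, hx, 0, rfl, h₀.symm ▸ h⟩
    · exact ⟨x, hx, 1, rfl, h₁.symm ▸ h⟩

theorem hasSingularities_PVdeg_nil {s₀ s₁ : ℂ} (h₀ : s₀ ^ 2 ≠ 4) (h₁ : s₁ ^ 2 ≠ 4) :
    HasSingularities (PVdeg.fibre ![s₀, s₁]) [] := by
  refine hasSingularities_nil fun a ha => ?_
  rcases (isSingularPoint_fibre_PVdeg _ _ a).1 ha with ⟨h, h', -⟩ | ⟨h, h', -⟩
  · exact h₀ (by rw [h]; linear_combination 4 * h')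
  · exact h₁ (by rw [h]; linear_combination 4 * h')

theorem isSingularPoint_PVdeg_left {s₀ s₁ ε : ℂ} (hε : ε ^ 2 = 1) (h : s₀ = 2 * ε) :
    IsSingularPoint (PVdeg.fibre ![s₀, s₁]) ![-ε, 0, ε * s₁] ∧
      HasTypeA 1 (PVdeg.fibre ![s₀, s₁]) ![-ε, 0, ε * s₁] := by
  have hs : IsSingularPoint (PVdeg.fibre ![s₀, s₁]) ![-ε, 0, ε * s₁] := by
    rw [isSingularPoint_fibre_PVdeg]
    left
    refine ⟨by simpa using h, by simpa using hε, vec_eq.2 ⟨rfl, rfl, ?_⟩⟩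
    simp [mul_comm]
  refine ⟨hs, ?_⟩
  rw [fibre_PVdeg] at hs ⊢
  exact hasTypeA_one _ hs (by simp [hε])

theorem isSingularPoint_PVdeg_right {s₀ s₁ δ : ℂ} (hδ : δ ^ 2 = 1) (h : s₁ = 2 * δ) :
    IsSingularPoint (PVdeg.fibre ![s₀, s₁]) ![0, -δ, δ * s₀] ∧
      HasTypeA 1 (PVdeg.fibre ![s₀, s₁]) ![0, -δ, δ * s₀] := by
  have hs : IsSingularPoint (PVdeg.fibre ![s₀, s₁]) ![0, -δ, δ * s₀] := by
    rw [isSingularPoint_fibre_PVdeg]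
    right
    refine ⟨by simpa using h, by simpa using hδ, vec_eq.2 ⟨rfl, rfl, ?_⟩⟩
    simp [mul_comm]
  refine ⟨hs, ?_⟩
  rw [fibre_PVdeg] at hs ⊢
  exact hasTypeA_one _ hs (by simp [hδ])

theorem eq_of_isSingularPoint_PVdeg {s₀ s₁ : ℂ} {b : Fin 3 → ℂ}
    (hb : IsSingularPoint (PVdeg.fibre ![s₀, s₁]) b) :
    (s₀ ^ 2 = 4 ∧ ∀ ε, s₀ = 2 * ε → b = ![-ε, 0, ε * s₁]) ∨
    (s₁ ^ 2 = 4 ∧ ∀ δ, s₁ = 2 * δ → b = ![0, -δ, δ * s₀]) := by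
  rcases (isSingularPoint_fibre_PVdeg _ _ b).1 hb with ⟨h₁, h₂, h₃⟩ | ⟨h₁, h₂, h₃⟩
  · refine Or.inl ⟨by rw [h₁]; linear_combination 4 * h₂, fun ε h => ?_⟩
    rw [h₃, show b 0 = -ε by linear_combination (h₁ - h) / 2]
    congr 3
    ring
  · refine Or.inr ⟨by rw [h₁]; linear_combination 4 * h₂, fun ε h => ?_⟩
    rw [h₃, show b 1 = -ε by linear_combination (h₁ - h) / 2]
    congr 3
    ring

theorem hasSingularities_PVdeg_left {s₀ s₁ ε : ℂ} (hε : ε ∈ ({1, -1} : Set ℂ)) (h : s₀ = 2 * ε)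
    (h' : s₁ ^ 2 ≠ 4) :
    HasSingularities (PVdeg.fibre ![s₀, s₁]) [(![-ε, 0, ε * s₁], 1)] := by
  have hε2 : ε ^ 2 = 1 := by rcases hε with rfl | rfl <;> norm_num
  have hs := isSingularPoint_PVdeg_left (s₁ := s₁) hε2 h
  refine hasSingularities_singleton (fun b hb => ?_) hs.1 hs.2
  exact (eq_of_isSingularPoint_PVdeg hb).elim (fun hb => hb.2 ε h) fun hb => absurd hb.1 h'

theorem hasSingularities_PVdeg_right {s₀ s₁ δ : ℂ} (hδ : δ ∈ ({1, -1} : Set ℂ)) (h' : s₀ ^ 2 ≠ 4)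
    (h : s₁ = 2 * δ) : HasSingularities (PVdeg.fibre ![s₀, s₁]) [(![0, -δ, δ * s₀], 1)] := by
  have hδ2 : δ ^ 2 = 1 := by rcases hδ with rfl | rfl <;> norm_num
  have hs := isSingularPoint_PVdeg_right (s₀ := s₀) hδ2 h
  refine hasSingularities_singleton (fun b hb => ?_) hs.1 hs.2
  exact (eq_of_isSingularPoint_PVdeg hb).elim (fun hb => absurd hb.1 h') fun hb => hb.2 δ h

theorem hasSingularities_PVdeg_both {s₀ s₁ ε δ : ℂ} (hε : ε ∈ ({1, -1} : Set ℂ))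
    (hδ : δ ∈ ({1, -1} : Set ℂ)) (h₀ : s₀ = 2 * ε) (h₁ : s₁ = 2 * δ) :
    HasSingularities (PVdeg.fibre ![s₀, s₁])
      [(![-ε, 0, 2 * ε * δ], 1), (![0, -δ, 2 * ε * δ], 1)] := by
  have hε2 : ε ^ 2 = 1 := by rcases hε with rfl | rfl <;> norm_num
  have hδ2 : δ ^ 2 = 1 := by rcases hδ with rfl | rfl <;> norm_num
  have hs := isSingularPoint_PVdeg_left (s₁ := s₁) hε2 h₀
  have hs' := isSingularPoint_PVdeg_right (s₀ := s₀) hδ2 h₁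
  rw [show 2 * ε * δ = ε * s₁ by rw [h₁]; ring]
  nth_rewrite 2 [show ε * s₁ = δ * s₀ by rw [h₁, h₀]; ring]
  refine hasSingularities_pair (fun h => ?_) (fun b hb => ?_) hs.1 hs'.1 hs.2 hs'.2
  · have : -ε = 0 := congrFun h 0
    rw [neg_eq_zero.1 this] at hε2
    norm_num at hε2
  · exact (eq_of_isSingularPoint_PVdeg hb).imp (fun hb => hb.2 ε h₀) fun hb => hb.2 δ h₁

/-! ### The third Painlevé equation of type `D₈` -/

/-- Read as `L · top₀ = top₁⁻¹ · L`, the relation is linear in the link `L`. It leaves two free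
entries of `L` and identifies the two Stokes constants. -/
theorem relation_PIIID8 (x : AnalyticData PIIID8.type) :
    x.linkFrom 0 1 0 0 = -x.linkFrom 0 1 1 1 ∧
    x.linkFrom 0 1 1 0 =
      x.linkFrom 0 1 0 1 + (x.loc 0).stokes (0 : Fin 1) * x.linkFrom 0 1 1 1 ∧
    (x.loc 1).stokes (0 : Fin 1) = (x.loc 0).stokes (0 : Fin 1) := by
  let d₀ : LocalData (.ramified 0) := x.loc 0
  let d₁ : LocalData (.ramified 0) := x.loc 1
  have h : x.linkFrom 0 1 * d₀.top = d₁.top⁻¹ * x.linkFrom 0 1 := by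
    have h := x.relation_two 0
    rw [x.monodromyAt_eq_linkFrom 0 1] at h
    have h' : d₀.top * ((x.linkFrom 0 1)⁻¹ * d₁.top * x.linkFrom 0 1) = 1 :=
      (congrArg (· * _) (x.monodromyAt_self 0)).symm.trans h
    rw [mul_eq_one_iff_eq_inv.1 h']
    group
  rw [LocalData.top_ramified_zero, LocalData.top_ramified_zero, eq_iff_entries] at h
  simp [-Matrix.SpecialLinearGroup.coe_mul, -Matrix.SpecialLinearGroup.coe_inv, mul_entry] at h
  obtain ⟨h₁, h₂, h₃, h₄⟩ := h
  have hdet := det_entry (x.linkFrom 0 1)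
  have e₁ : x.linkFrom 0 1 0 0 = -x.linkFrom 0 1 1 1 := by linear_combination -h₂
  have e₂ : x.linkFrom 0 1 1 0 =
      x.linkFrom 0 1 0 1 + d₀.stokes (0 : Fin 1) * x.linkFrom 0 1 1 1 := by
    linear_combination -h₁ - d₀.stokes (0 : Fin 1) * e₁
  refine ⟨e₁, e₂, ?_⟩
  show d₁.stokes (0 : Fin 1) = d₀.stokes (0 : Fin 1)
  -- The difference of the Stokes constants annihilates the second row of `L`, which cannot vanish
  -- since `det L = 1`.
  have e₃ : (d₁.stokes (0 : Fin 1) - d₀.stokes (0 : Fin 1)) * x.linkFrom 0 1 1 0 = 0 := by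
    linear_combination h₃ - e₁
  have e₄ : (d₁.stokes (0 : Fin 1) - d₀.stokes (0 : Fin 1)) * x.linkFrom 0 1 1 1 = 0 := by
    linear_combination e₂ + h₄
  linear_combination (-(d₁.stokes (0 : Fin 1) - d₀.stokes (0 : Fin 1))) * hdet
    + x.linkFrom 0 1 0 0 * e₄ - x.linkFrom 0 1 0 1 * e₃

/-- The cubic is `det L = 1`; the factors `i` in `x₁` and `x₃` only adjust its signs. -/
theorem equation_PIIID8 (x : AnalyticData PIIID8.type) :
    eval (Sum.elim (PIIID8.param x) (PIIID8.coord x)) PIIID8.equation = 0 := by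
  obtain ⟨h₀, h₁, -⟩ := relation_PIIID8 x
  have hdet := det_entry (x.linkFrom 0 1)
  rw [h₀, h₁] at hdet
  simp only [map_add, map_sub, map_mul, map_pow, eval_X, Sum.elim_inr, map_one]
  simp only [Matrix.cons_val]
  linear_combination hdet + ((x.linkFrom 0 1 1 1) ^ 2 + x.linkFrom 0 1 1 1 * x.linkFrom 0 1 0 1
    * (x.loc 0).stokes (0 : Fin 1)) * Complex.I_sq

theorem exists_PIIID8 (a : Fin 3 → ℂ)
    (h : a 0 * a 1 * a 2 + a 0 ^ 2 - a 1 ^ 2 - 1 = 0) :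
    ∃ x : AnalyticData PIIID8.type, PIIID8.coord x = a := by
  let d : LocalData (.ramified 0) := LocalData.ofRamified 0 ![Complex.I * a 2]
  let M : SL2 := SL2.mk (-(Complex.I * a 0)) (a 1)
    (a 1 + Complex.I * a 2 * (Complex.I * a 0)) (Complex.I * a 0)
    (by linear_combination h - (a 0 ^ 2 + a 0 * a 1 * a 2) * Complex.I_sq)
  have hM : M * d.top = d.top⁻¹ * M := by
    rw [LocalData.top_ramified_zero, eq_iff_entries]
    simp [-Matrix.SpecialLinearGroup.coe_mul, -Matrix.SpecialLinearGroup.coe_inv, mul_entry, M, d,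
      LocalData.ofRamified]
    ring_nf
    trivial
  let x : AnalyticData PIIID8.type := AnalyticData.ofTwo d d M (by
    rw [mul_eq_one_iff_eq_inv', mul_assoc, inv_mul_eq_iff_eq_mul]
    apply eq_mul_inv_of_mul_eq
    rw [mul_assoc, hM, mul_inv_cancel_left])
  have hx : x.linkFrom 0 1 = M := by
    show M * 1⁻¹ = M
    simp
  refine ⟨x, ext_three ?_ ?_ ?_⟩
  · show -(Complex.I * x.linkFrom 0 1 1 1) = a 0
    simp only [hx, M, mk_entry₁₁]
    linear_combination -a 0 * Complex.I_sq
  · show x.linkFrom 0 1 0 1 = a 1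
    simp only [hx, M, mk_entry₀₁]
  · show -(Complex.I * (Complex.I * a 2)) = a 2
    linear_combination -a 2 * Complex.I_sq

theorem irreducible_PIIID8 : Irreducible PIIID8.equation := by
  have hX : ∀ i : Fin 3, i ≠ 2 →
      (Y i : MvPolynomial (Fin 0 ⊕ Fin 3) ℂ) ∈ supported ℂ {Sum.inr 2}ᶜ :=
    fun i hi => X_mem_supported_compl (by simpa using hi)
  have h₀ := hX 0 (by decide)
  have h₁ := hX 1 (by decide)
  refine irreducible_of_linear (Sum.inr 2) (A := Y 0 * Y 1) (B := Y 0 ^ 2 - Y 1 ^ 2 - 1)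
    ?_ (mul_mem h₀ h₁) (sub_mem (sub_mem (pow_mem h₀ 2) (pow_mem h₁ 2)) (one_mem _)) ?_
    (mul_ne_zero (X_ne_zero _) (X_ne_zero _))
  · show Y 0 * Y 1 * Y 2 + Y 0 ^ 2 - Y 1 ^ 2 - 1 = _
    ring
  · refine IsRelPrime.mul_left (isRelPrime_of_eval (irreducible_X _) 0 ?_ ?_)
      (isRelPrime_of_eval (irreducible_X _) 0 ?_ ?_) <;> simp

theorem isMonodromySpace_PIIID8 : PIIID8.IsMonodromySpace := by
  have hI : ∀ A : Subalgebra ℂ (AnalyticData PIIID8.type → ℂ), ∀ {f : AnalyticData PIIID8.type → ℂ},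
      f ∈ A → (fun x => Complex.I * f x) ∈ A := fun A f h => A.smul_mem h Complex.I
  refine isMonodromySpace_of PIIID8 (fun i => i.elim0) (fun i => ?_) (by simp) (by simp)
    equation_PIIID8 ?_ ?_
  · fin_cases i
    · exact neg_mem (hI _ (AnalyticData.linkFrom_mem_invariantRing (τ := PIIID8.type) 0 1 (m := 0)
        (n := 0) rfl rfl 1 1))
    · exact AnalyticData.linkFrom_mem_invariantRing (τ := PIIID8.type) 0 1 (m := 0)
        (n := 0) rfl rfl 0 1
    · exact neg_mem (hI _ (AnalyticData.stokes_mem_invariantRing (τ := PIIID8.type) 0 (m := 0)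
        rfl (0 : Fin 1)))
  · refine dvd_of_vanishing_on_data irreducible_PIIID8 (h := 1) (b := Sum.elim ![] ![1, 0, 0])
      (by simp) (by simp) ?_
    intro p a hpa _
    obtain ⟨x, h⟩ := exists_PIIID8 a (by simpa using hpa)
    exact ⟨x, funext fun i => i.elim0, h⟩
  · intro A _ hcA _ f hf
    have h₁₁ : (fun x : AnalyticData PIIID8.type => x.linkFrom 0 1 1 1) ∈ A :=
      AnalyticData.mem_of_eq (hI A (hcA 0)) fun x => by
        show _ = Complex.I * -(Complex.I * x.linkFrom 0 1 1 1)
        linear_combination x.linkFrom 0 1 1 1 * Complex.I_sq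
    have h₀₁ : (fun x : AnalyticData PIIID8.type => x.linkFrom 0 1 0 1) ∈ A := hcA 1
    have hc : (fun x : AnalyticData PIIID8.type => (x.loc 0).stokes (0 : Fin 1)) ∈ A :=
      AnalyticData.mem_of_eq (hI A (hcA 2)) fun x => by
        show _ = Complex.I * -(Complex.I * (x.loc 0).stokes (0 : Fin 1))
        linear_combination (x.loc 0).stokes (0 : Fin 1) * Complex.I_sq
    have hL : AnalyticData.EntriesIn A fun x : AnalyticData PIIID8.type => x.linkFrom 0 1 := by
      intro i j
      fin_cases i <;> fin_cases j
      · exact AnalyticData.mem_of_eq (neg_mem h₁₁) fun x => (relation_PIIID8 x).1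
      · exact h₀₁
      · exact AnalyticData.mem_of_eq (add_mem h₀₁ (mul_mem hc h₁₁)) fun x =>
          (relation_PIIID8 x).2.1
      · exact h₁₁
    refine AnalyticData.invariant_mem 0 A (fun j h => ?_) (fun j h => ?_)
      (fun j h => ?_) (fun j h => ?_) hf <;> fin_cases j
    · cases h
    · cases h
    · exact AnalyticData.entriesIn_formal_ramified (τ := PIIID8.type) 0 (m := 0) rfl A
    · exact AnalyticData.entriesIn_formal_ramified (τ := PIIID8.type) 1 (m := 0) rfl A
    · intro k
      change Fin 1 at k
      fin_cases k
      exact hc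
    · intro k
      change Fin 1 at k
      fin_cases k
      exact AnalyticData.mem_of_eq hc fun x => (relation_PIIID8 x).2.2
    · exact AnalyticData.entriesIn_linkFrom_self 0 A
    · exact hL

theorem fibre_PIIID8 (p) : PIIID8.fibre p = triangleCubic 1 (-1) 0 0 0 0 (-1) := by
  apply eq_triangleCubic
  intro b
  simp [fibre]
  ring

/-- The combination `F - (x₁∂₁F + x₂∂₂F)/2` is the constant `-1`. -/
theorem not_isSingularPoint_fibre_PIIID8 (p a) : ¬ IsSingularPoint (PIIID8.fibre p) a := by
  rw [fibre_PIIID8, isSingularPoint_triangleCubic]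
  rintro ⟨h₀, h₁, h₂, h₃⟩
  have : (1 : ℂ) = 0 := by linear_combination -h₀ + (a 0 * h₁ + a 1 * h₂) / 2
  exact one_ne_zero this

theorem not_reducibleAt_PIIID8 (p) : ¬ PIIID8.ReducibleAt p := by
  rintro ⟨x, -, hx⟩
  exact x.not_isReducible_of_ramified 0 rfl hx

end MonodromyFamily
end

/-! ### Katz invariant one, links with a torus action, and PIII of type `D₇` -/

noncomputable section

open SL2

namespace LocalData

/-- Local data at an unramified point of Katz invariant one with given topological monodromy. -/
def ofTop (M : SL2) (h : M 0 0 ≠ 0) : LocalData (.unramified 1) :=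
  ofUnramified 1 (M 0 0) h ![M 0 0 * M 1 0, (M 0 0)⁻¹ * M 0 1]

/-- The product of a diagonal, a lower and an upper unipotent matrix is a triangular factorisation.
At Katz invariant one the local data are thus equivalent to a matrix in `SL₂` with non-zero upper
left entry, and that entry is the formal eigenvalue. -/
theorem top_entries (d : LocalData (.unramified 1)) :
    d.top 0 0 = d.formal 0 0 ∧ d.top 0 1 = d.formal 0 0 * d.stokes (1 : Fin 2) ∧
    d.top 1 0 = (d.formal 0 0)⁻¹ * d.stokes (0 : Fin 2) ∧
    d.top 1 1 = (d.formal 0 0)⁻¹ * (1 + d.stokes (0 : Fin 2) * d.stokes (1 : Fin 2)) := by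
  rw [top_unramified_one]
  refine ⟨?_, ?_, ?_, ?_⟩ <;>
  simp [-Matrix.SpecialLinearGroup.coe_mul, -Matrix.SpecialLinearGroup.coe_inv, mul_entry,
    formal_entry₀₁, formal_entry₁₀, formal_entry₁₁]
  exact Or.inl (by ring)

theorem stokes_eq_top (d : LocalData (.unramified 1)) :
    d.stokes (0 : Fin 2) = d.formal 0 0 * d.top 1 0 ∧
    d.stokes (1 : Fin 2) = (d.formal 0 0)⁻¹ * d.top 0 1 := by
  obtain ⟨-, h₁, h₂, -⟩ := d.top_entries
  rw [h₁, h₂, mul_inv_cancel_left₀ d.formal_ne_zero, inv_mul_cancel_left₀ d.formal_ne_zero]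
  exact ⟨rfl, rfl⟩

theorem top_ofTop (M : SL2) (h : M 0 0 ≠ 0) : (ofTop M h).top = M := by
  obtain ⟨h₁, h₂, h₃, h₄⟩ := (ofTop M h).top_entries
  have hf : (ofTop M h).formal 0 0 = M 0 0 := rfl
  have h0 : (ofTop M h).stokes (0 : Fin 2) = M 0 0 * M 1 0 := rfl
  have h1 : (ofTop M h).stokes (1 : Fin 2) = (M 0 0)⁻¹ * M 0 1 := rfl
  rw [hf] at h₁ h₂ h₃ h₄
  rw [h1] at h₂ h₄
  rw [h0] at h₃ h₄
  refine eq_iff_entries.2 ⟨h₁, ?_, ?_, ?_⟩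
  · rw [h₂, mul_inv_cancel_left₀ h]
  · rw [h₃, inv_mul_cancel_left₀ h]
  · rw [h₄]
    field_simp
    linear_combination -det_entry M

end LocalData

namespace AnalyticData

theorem top_one_eq {τ₀ τ₁ : PointType} (x : AnalyticData ![τ₀, τ₁]) :
    LocalData.top (τ := τ₁) (x.loc 1) =
      x.linkFrom 0 1 * (LocalData.top (τ := τ₀) (x.loc 0))⁻¹ * (x.linkFrom 0 1)⁻¹ := by
  have h := x.relation_two 0
  rw [x.monodromyAt_eq_linkFrom 0 1] at h
  have h' : LocalData.top (τ := τ₀) (x.loc 0) * ((x.linkFrom 0 1)⁻¹ *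
      LocalData.top (τ := τ₁) (x.loc 1) * x.linkFrom 0 1) = 1 :=
    (congrArg (· * _) (x.monodromyAt_self 0)).symm.trans h
  rw [mul_eq_one_iff_eq_inv.1 h']
  group

/-- The torus at the target scales the two rows of the link inversely, so products of entries from
different rows are the candidates for invariants. -/
theorem linkFrom_act_entries {r : ℕ} {τ : Fin r → PointType} (x : AnalyticData τ) (σ : SL2)
    (ρ : Fin r → SL2) (h : ∀ j, (τ j).IsAdmissible (ρ j)) (i j : Fin r) {n : ℕ}
    (hj : τ j = .unramified n) (a : Fin 2) :
    (x.act σ ρ h).linkFrom i j 0 a = ρ j 0 0 * (x.linkFrom i j * (ρ i)⁻¹) 0 a ∧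
    (x.act σ ρ h).linkFrom i j 1 a = ρ j 1 1 * (x.linkFrom i j * (ρ i)⁻¹) 1 a := by
  have hρ := h j
  rw [hj] at hρ
  obtain ⟨h₁, h₂⟩ : ρ j 0 1 = 0 ∧ ρ j 1 0 = 0 := hρ
  rw [linkFrom_act, mul_assoc, mul_entry (ρ j), mul_entry (ρ j), h₁, h₂]
  constructor <;> ring

theorem diag_mul_of_isAdmissible {τ : PointType} {n : ℕ} (hτ : τ = .unramified n) {g : SL2}
    (h : τ.IsAdmissible g) : g 0 0 * g 1 1 = 1 := by
  rw [hτ] at h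
  have := det_entry g
  rwa [h.1, zero_mul, sub_zero] at this

theorem linkFrom_torusAct {r : ℕ} {τ : Fin r → PointType} (x : AnalyticData τ) {i j : Fin r}
    (hij : i ≠ j) {n : ℕ} (hj : τ j = .unramified n) (t : ℂ) (ht : t ≠ 0) (a : Fin 2) :
    (x.torusAct j hj t ht).linkFrom i j 0 a = t * x.linkFrom i j 0 a ∧
    (x.torusAct j hj t ht).linkFrom i j 1 a = t⁻¹ * x.linkFrom i j 1 a := by
  have h := x.linkFrom_act_entries 1 (fun k => if k = j then diag t ht else 1) (fun k => by
    split_ifs with h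
    · rw [h, hj]; exact isAdmissible_diag n t ht
    · exact isAdmissible_one _) i j hj a
  simp [-Matrix.SpecialLinearGroup.coe_mul, -Matrix.SpecialLinearGroup.coe_inv, hij] at h
  exact h

end AnalyticData

namespace MonodromyFamily

/-! ### The third Painlevé equation of type `D₇` -/

/-- The first identity is `det L = 1`. The second one reads the formal eigenvalue `α` as the upper
left entry of `L · top₀⁻¹ · L⁻¹`. -/
theorem entries_PIIID7 (x : AnalyticData PIIID7.type) :
    x.linkFrom 0 1 0 0 * x.linkFrom 0 1 1 1 = 1 + PIIID7.coord x 1 ∧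
    x.linkFrom 0 1 0 1 * x.linkFrom 0 1 1 1 =
      -PIIID7.param x 0 - PIIID7.coord x 0 - PIIID7.coord x 1 * PIIID7.coord x 2 := by
  have h := congrArg (fun m : SL2 => m 0 0) (AnalyticData.top_one_eq x)
  have h' : PIIID7.param x 0 = _ :=
    (LocalData.top_entries (x.loc 1)).1.symm.trans h
  replace h' := h'.trans (congrArg (fun m : SL2 => (x.linkFrom 0 1 * m⁻¹ * (x.linkFrom 0 1)⁻¹) 0 0)
    (LocalData.top_ramified_zero (x.loc 0)))
  simp [-Matrix.SpecialLinearGroup.coe_mul, -Matrix.SpecialLinearGroup.coe_inv, mul_entry] at h'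
  have hdet := det_entry (x.linkFrom 0 1)
  simp only [Matrix.cons_val]
  constructor
  · linear_combination hdet
  · linear_combination h'

/-- The cubic is the identity `(L₀₀L₁₀)(L₀₁L₁₁) = (L₀₁L₁₀)(L₀₀L₁₁)` between the invariant products.
-/
theorem equation_PIIID7 (x : AnalyticData PIIID7.type) :
    eval (Sum.elim (PIIID7.param x) (PIIID7.coord x)) PIIID7.equation = 0 := by
  obtain ⟨h₁, h₂⟩ := entries_PIIID7 x
  simp only [map_add, map_mul, map_pow, eval_X, Sum.elim_inr, Sum.elim_inl]
  simp only [Matrix.cons_val] at h₁ h₂ ⊢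
  linear_combination (-(x.linkFrom 0 1 0 1 * x.linkFrom 0 1 1 0)) * h₁
    + x.linkFrom 0 1 0 0 * x.linkFrom 0 1 1 0 * h₂

/-- The torus permits `L₁₀ = 1`; then `L₀₀ = x₁`, `L₀₁ = x₂`, and `det L = 1` gives `L₁₁`, which
needs `x₁ ≠ 0`. The data at `∞` are those of the matrix required by the relation. -/
theorem exists_PIIID7 {α : ℂ} (hα : α ≠ 0) {a : Fin 3 → ℂ} (ha : a 0 ≠ 0)
    (h : a 0 * a 1 * a 2 + a 0 ^ 2 + a 1 ^ 2 + α * a 0 + a 1 = 0) :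
    ∃ x : AnalyticData PIIID7.type, PIIID7.param x = ![α] ∧ PIIID7.coord x = a := by
  let d : LocalData (.ramified 0) := LocalData.ofRamified 0 ![-a 2]
  let M : SL2 := SL2.mk (a 0) (a 1) 1 ((1 + a 1) / a 0) (by field_simp; ring)
  have hM : (M * d.top⁻¹ * M⁻¹) 0 0 = α := by
    rw [LocalData.top_ramified_zero]
    simp [-Matrix.SpecialLinearGroup.coe_mul, -Matrix.SpecialLinearGroup.coe_inv, mul_entry, M, d,
      LocalData.ofRamified]
    field_simp
    linear_combination -h
  let x : AnalyticData PIIID7.type := AnalyticData.ofTwo d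
    (LocalData.ofTop (M * d.top⁻¹ * M⁻¹) (hM.symm ▸ hα)) M (by
      rw [LocalData.top_ofTop]
      group)
  have hx : x.linkFrom 0 1 = M := by
    show M * 1⁻¹ = M
    simp
  refine ⟨x, ?_, ext_three ?_ ?_ ?_⟩
  · funext i
    fin_cases i
    exact hM
  · show x.linkFrom 0 1 0 0 * x.linkFrom 0 1 1 0 = a 0
    simp [hx, M]
  · show x.linkFrom 0 1 0 1 * x.linkFrom 0 1 1 0 = a 1
    simp [hx, M]
  · show -(-a 2) = a 2
    ring

theorem irreducible_PIIID7 : Irreducible PIIID7.equation := by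
  have hX : ∀ i : Fin 3, (Y i : MvPolynomial (Fin 1 ⊕ Fin 3) ℂ) ∈ supported ℂ {Sum.inl 0}ᶜ :=
    fun i => X_mem_supported_compl (by simp)
  refine irreducible_of_linear (Sum.inl 0) (A := Y 0)
    (B := Y 0 * Y 1 * Y 2 + Y 0 ^ 2 + Y 1 ^ 2 + Y 1) ?_ (hX 0) ?_
    (isRelPrime_of_eval (irreducible_X _) (Sum.elim ![0] ![0, 1, 0]) (by simp)
      (by simp)) (X_ne_zero _)
  · show Y 0 * Y 1 * Y 2 + Y 0 ^ 2 + Y 1 ^ 2 + S 0 * Y 0 + Y 1 = _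
    ring
  · exact add_mem (add_mem (add_mem (mul_mem (mul_mem (hX 0) (hX 1)) (hX 2))
      (pow_mem (hX 0) 2)) (pow_mem (hX 1) 2)) (hX 1)

/-- The link and the Stokes constant at the ramified point determine the Stokes constants at the
other point. The torus acts on the rows of the link with weights `1` and `-1`, and the four products
of entries of different rows are given by the coordinates and `entries_PIIID7`. -/
theorem isMonodromySpace_PIIID7 : PIIID7.IsMonodromySpace := by
  have hα : (fun x : AnalyticData PIIID7.type => (x.loc 1).formal 0 0) ∈
      AnalyticData.invariantRing PIIID7.type :=
    AnalyticData.formal_mem_invariantRing 1 (m := 1) rfl 0 0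
  have hlink : ∀ a b : Fin 2, (fun x : AnalyticData PIIID7.type =>
      x.linkFrom 0 1 0 a * x.linkFrom 0 1 1 b) ∈ AnalyticData.invariantRing PIIID7.type := by
    intro a b
    refine (AnalyticData.mem_invariantRing_iff _).2 ⟨mul_mem (AnalyticData.linkFrom_mem 0 1 0 a)
      (AnalyticData.linkFrom_mem 0 1 1 b), fun x σ ρ h => ?_⟩
    have h₀ : ρ 0 = 1 := AnalyticData.isAdmissible_ramified (τ := PIIID7.type) (m := 0) rfl (h 0)
    have h₁ := AnalyticData.diag_mul_of_isAdmissible (n := 1) rfl (h 1)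
    rw [(x.linkFrom_act_entries σ ρ h 0 1 (n := 1) rfl a).1,
      (x.linkFrom_act_entries σ ρ h 0 1 (n := 1) rfl b).2, h₀, inv_one, mul_one]
    linear_combination (x.linkFrom 0 1 0 a * x.linkFrom 0 1 1 b) * h₁
  refine isMonodromySpace_of PIIID7 (fun i => ?_) (fun i => ?_) (fun i hi x => ?_) (fun i hi => ?_)
    equation_PIIID7 ?_ ?_
  · fin_cases i
    exact hα
  · fin_cases i
    · exact hlink 0 0
    · exact hlink 1 0
    · exact neg_mem (AnalyticData.stokes_mem_invariantRing (τ := PIIID7.type) 0 (m := 0)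
        rfl (0 : Fin 1))
  · obtain rfl : i = 0 := by simpa using hi
    exact LocalData.formal_ne_zero (r := 1) (x.loc 1)
  · obtain rfl : i = 0 := by simpa using hi
    exact AnalyticData.inv_formal_mem (τ := PIIID7.type) 1 (m := 1) rfl
  · refine dvd_of_vanishing_on_data irreducible_PIIID7 (h := S 0 * Y 0)
      (b := Sum.elim ![-1] ![1, 0, 0]) ?_ ?_ ?_
    · simp
    · simp
    · intro p a hpa hh
      simp at hpa hh
      obtain ⟨x, h₁, h₂⟩ := exists_PIIID7 hh.1 hh.2 hpa
      exact ⟨x, by rw [h₁]; funext i; fin_cases i; rfl, h₂⟩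
  · intro A hpA hcA hiA f hf
    let g : Fin 7 → AnalyticData PIIID7.type → ℂ :=
      ![fun x => (x.loc 1).formal 0 0, fun x => ((x.loc 1).formal 0 0)⁻¹,
        fun x => (x.loc 0).stokes (0 : Fin 1), fun x => x.linkFrom 0 1 0 0,
        fun x => x.linkFrom 0 1 0 1, fun x => x.linkFrom 0 1 1 0, fun x => x.linkFrom 0 1 1 1]
    have hg : ∀ i, g i ∈ Algebra.adjoin ℂ (Set.range g) := fun i =>
      Algebra.subset_adjoin ⟨i, rfl⟩
    have hfor₀ := AnalyticData.entriesIn_formal_ramified (τ := PIIID7.type) 0 (m := 0) rfl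
      (Algebra.adjoin ℂ (Set.range g))
    have hfor₁ := AnalyticData.entriesIn_formal_unramified (τ := PIIID7.type) 1 (m := 1) rfl (hg 0)
      (hg 1)
    have hst₀ : ∀ k, (fun x : AnalyticData PIIID7.type => (x.loc 0).stokes k) ∈
        Algebra.adjoin ℂ (Set.range g) := by
      intro k
      change Fin 1 at k
      fin_cases k
      exact hg 2
    have hL : AnalyticData.EntriesIn (Algebra.adjoin ℂ (Set.range g))
        fun x : AnalyticData PIIID7.type => x.linkFrom 0 1 := by
      intro i j
      fin_cases i <;> fin_cases j
      · exact hg 3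
      · exact hg 4
      · exact hg 5
      · exact hg 6
    have htop : AnalyticData.EntriesIn (Algebra.adjoin ℂ (Set.range g))
        fun x : AnalyticData PIIID7.type => LocalData.top (τ := .unramified 1) (x.loc 1) := by
      have : (fun x : AnalyticData PIIID7.type => LocalData.top (τ := .unramified 1) (x.loc 1)) = _ :=
        funext fun x => AnalyticData.top_one_eq x
      rw [this]
      exact (hL.mul (AnalyticData.entriesIn_top 0 hfor₀ hst₀).inv).mul hL.inv
    have hst₁ : ∀ k, (fun x : AnalyticData PIIID7.type => (x.loc 1).stokes k) ∈
        Algebra.adjoin ℂ (Set.range g) := by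
      intro k
      change Fin 2 at k
      fin_cases k
      · exact AnalyticData.mem_of_eq (mul_mem (hg 0) (htop 1 0)) fun x =>
          (LocalData.stokes_eq_top (x.loc 1)).1
      · exact AnalyticData.mem_of_eq (mul_mem (hg 1) (htop 0 1)) fun x =>
          (LocalData.stokes_eq_top (x.loc 1)).2
    have hfg : f ∈ Algebra.adjoin ℂ (Set.range g) := by
      refine AnalyticData.invariant_mem 0 _ (fun j h => ?_) (fun j h => ?_)
        (fun j h => ?_) (fun j h => ?_) hf <;> fin_cases j
      · cases h
      · cases h
      · exact hfor₀
      · exact hfor₁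
      · exact hst₀
      · exact hst₁
      · exact AnalyticData.entriesIn_linkFrom_self 0 _
      · exact hL
    refine torus_invariant_mem g ![0, 0, 0, 1, 1, -1, -1] (by decide) (m := 1) (by norm_num)
      (fun t ht => AnalyticData.torusAct (τ := PIIID7.type) 1 (m := 1) rfl t ht) ?_ A ?_ ?_ hfg
      (fun t ht z => ((AnalyticData.mem_invariantRing_iff f).1 hf).2 z _ _ _)
    · intro i t ht z
      have hfor := AnalyticData.formal_torusAct (τ := PIIID7.type) 1 (m := 1) rfl t ht z 0 0
      have hl := AnalyticData.linkFrom_torusAct (τ := PIIID7.type) z (i := 0) (j := 1) (by decide)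
        (n := 1) rfl t ht
      fin_cases i
      · simpa [g] using hfor
      · simpa [g] using hfor
      · refine Eq.trans ?_ (one_mul _).symm
        exact AnalyticData.stokes_act_ramified (τ := PIIID7.type) 0 (m := 0) rfl z _ _ _
          (0 : Fin 1)
      · simpa [g] using (hl 0).1
      · simpa [g] using (hl 1).1
      · simpa [g] using (hl 0).2
      · simpa [g] using (hl 1).2
    · intro i hi
      fin_cases i
      · exact hpA 0
      · exact hiA 0 (by simp)
      · exact AnalyticData.mem_of_eq (neg_mem (hcA 2)) fun x => (neg_neg _).symm
      all_goals simp at hi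
    · intro i j hi hj
      fin_cases i <;> first | (exfalso; revert hi; decide) | skip
      all_goals fin_cases j <;> first | (exfalso; revert hj; decide) | skip
      · exact hcA 0
      · exact AnalyticData.mem_of_eq (add_mem (one_mem A) (hcA 1)) fun x => (entries_PIIID7 x).1
      · exact hcA 1
      · exact AnalyticData.mem_of_eq (sub_mem (sub_mem (neg_mem (hpA 0)) (hcA 0))
          (mul_mem (hcA 1) (hcA 2))) fun x => (entries_PIIID7 x).2

theorem fibre_PIIID7 (p : Fin 1 → ℂ) :
    PIIID7.fibre p = triangleCubic 1 1 0 (p 0) 1 0 0 := by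
  apply eq_triangleCubic
  intro b
  simp [fibre]
  ring

theorem not_isSingularPoint_fibre_PIIID7 {p : Fin 1 → ℂ} (hp : p 0 ≠ 0) (a) :
    ¬ IsSingularPoint (PIIID7.fibre p) a := by
  rw [fibre_PIIID7, isSingularPoint_triangleCubic]
  rintro ⟨h₀, h₁, h₂, h₃⟩
  -- On each of the lines `x₁ = 0` and `x₂ = 0` the equation is a quadratic in one variable, and a
  -- double root would need discriminant zero. The discriminants are `1` and `α²`.
  rcases mul_eq_zero.1 (show a 0 * a 1 = 0 by linear_combination h₃) with h | h
  · rw [h] at h₀ h₂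
    have : (1 : ℂ) = 0 := by linear_combination -4 * h₀ + (2 * a 1 + 1) * h₂
    exact one_ne_zero this
  · rw [h] at h₀ h₁
    apply pow_ne_zero 2 hp
    linear_combination -4 * h₀ + (2 * a 0 + p 0) * h₁

theorem not_reducibleAt_PIIID7 (p) : ¬ PIIID7.ReducibleAt p := by
  rintro ⟨x, -, hx⟩
  exact x.not_isReducible_of_ramified 0 rfl hx

end MonodromyFamily
end

/-! ### Two tori acting on a link, and PIII of type `D₆` -/

noncomputable section

open SL2

namespace AnalyticData

variable {r : ℕ} {τ : Fin r → PointType}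

/-- The torus at the target scales the rows of the link and the torus at the source its columns. The
invariants are computed for one torus after the other. -/
theorem linkFrom_act_diagonal (x : AnalyticData τ) (σ : SL2) (ρ : Fin r → SL2)
    (h : ∀ j, (τ j).IsAdmissible (ρ j)) (i j : Fin r) {m n : ℕ} (hi : τ i = .unramified m)
    (hj : τ j = .unramified n) :
    (x.act σ ρ h).linkFrom i j 0 0 = ρ j 0 0 * x.linkFrom i j 0 0 * ρ i 1 1 ∧
    (x.act σ ρ h).linkFrom i j 0 1 = ρ j 0 0 * x.linkFrom i j 0 1 * ρ i 0 0 ∧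
    (x.act σ ρ h).linkFrom i j 1 0 = ρ j 1 1 * x.linkFrom i j 1 0 * ρ i 1 1 ∧
    (x.act σ ρ h).linkFrom i j 1 1 = ρ j 1 1 * x.linkFrom i j 1 1 * ρ i 0 0 := by
  have hρ := h i
  rw [hi] at hρ
  obtain ⟨h₁, h₂⟩ : ρ i 0 1 = 0 ∧ ρ i 1 0 = 0 := hρ
  have key := x.linkFrom_act_entries σ ρ h i j hj
  refine ⟨(key 0).1.trans ?_, (key 1).1.trans ?_, (key 0).2.trans ?_, (key 1).2.trans ?_⟩ <;>
  rw [mul_entry (x.linkFrom i j)] <;>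
  simp only [inv_entry₀₀, inv_entry₀₁, inv_entry₁₀, inv_entry₁₁, h₁, h₂] <;> ring

theorem top_act_diagonal (x : AnalyticData τ) (σ : SL2) (ρ : Fin r → SL2)
    (h : ∀ j, (τ j).IsAdmissible (ρ j)) (i : Fin r) {m : ℕ} (hi : τ i = .unramified m) :
    ((x.act σ ρ h).loc i).top 0 0 = (x.loc i).top 0 0 ∧
    ((x.act σ ρ h).loc i).top 1 0 = ρ i 1 1 ^ 2 * (x.loc i).top 1 0 ∧
    ((x.act σ ρ h).loc i).top.1.trace = (x.loc i).top.1.trace := by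
  have hdet := diag_mul_of_isAdmissible hi (h i)
  have hρ := h i
  rw [hi] at hρ
  obtain ⟨h₁, h₂⟩ : ρ i 0 1 = 0 ∧ ρ i 1 0 = 0 := hρ
  rw [loc_act, LocalData.top_conj]
  refine ⟨?_, ?_, trace_conj _ _⟩
  · rw [mul_entry, mul_entry (ρ i), mul_entry (ρ i), inv_entry₀₀, inv_entry₁₀, h₁, h₂]
    linear_combination (x.loc i).top 0 0 * hdet
  · rw [mul_entry, mul_entry (ρ i), mul_entry (ρ i), inv_entry₀₀, inv_entry₁₀, h₂]
    ring

theorem linkFrom_torusAct_source (x : AnalyticData τ) {i j : Fin r} (hij : i ≠ j) {m n : ℕ}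
    (hi : τ i = .unramified m) (hj : τ j = .unramified n) (t : ℂ) (ht : t ≠ 0) (a : Fin 2) :
    (x.torusAct i hi t ht).linkFrom i j a 0 = t⁻¹ * x.linkFrom i j a 0 ∧
    (x.torusAct i hi t ht).linkFrom i j a 1 = t * x.linkFrom i j a 1 := by
  have h := x.linkFrom_act_diagonal 1 (fun k => if k = i then diag t ht else 1) (fun k => by
    split_ifs with h
    · rw [h, hi]; exact isAdmissible_diag m t ht
    · exact isAdmissible_one _) i j hi hj
  simp [hij.symm] at h
  obtain ⟨h₁, h₂, h₃, h₄⟩ := h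
  fin_cases a
  · exact ⟨h₁.trans (mul_comm _ _), h₂.trans (mul_comm _ _)⟩
  · exact ⟨h₃.trans (mul_comm _ _), h₄.trans (mul_comm _ _)⟩

theorem stokes_torusAct_of_ne (x : AnalyticData τ) {i j : Fin r} (hij : i ≠ j) {n : ℕ}
    (hj : τ j = .unramified n) (t : ℂ) (ht : t ≠ 0) (k : Fin (τ i).numStokes) :
    ((x.torusAct j hj t ht).loc i).stokes k = (x.loc i).stokes k := by
  apply stokesMatrix_injective k
  show LocalData.stokesMap _ k = (x.loc i).stokesMap k
  unfold torusAct
  rw [loc_act, LocalData.stokesMap_conj, if_neg hij]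
  group

theorem formal_torusAct_of_unramified (x : AnalyticData τ) {i j : Fin r} {m n : ℕ}
    (hi : τ i = .unramified m) (hj : τ j = .unramified n) (t : ℂ) (ht : t ≠ 0) (a b : Fin 2) :
    ((x.torusAct j hj t ht).loc i).formal a b = (x.loc i).formal a b :=
  ((mem_invariantRing_iff _).1 (formal_mem_invariantRing i hi a b)).2 x _ _ _

end AnalyticData

namespace MonodromyFamily

/-! ### The third Painlevé equation of type `D₆` -/

theorem param_PIIID6_ne_zero (x : AnalyticData PIIID6.type) (i : Fin 2) :
    PIIID6.param x i ≠ 0 := by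
  fin_cases i
  · exact LocalData.formal_ne_zero (r := 1) (x.loc 0)
  · exact LocalData.formal_ne_zero (r := 1) (x.loc 1)

theorem entry_conj_inv (L M : SL2) : (L * M⁻¹ * L⁻¹) 0 0 = L 0 0 * L 1 1 * M 1 1
    - L 0 1 * L 1 1 * M 1 0 + L 0 0 * L 1 0 * M 0 1 - L 0 1 * L 1 0 * M 0 0 := by
  simp only [mul_entry, inv_entry₀₀, inv_entry₀₁, inv_entry₁₀, inv_entry₁₁]
  ring

/-- These are products invariant under both tori, expressed by parameters and coordinates. They come
from `det L = 1`, from the determinant and trace of the topological monodromy at `0`, from the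
definition of `x₂`, and from `β` as the upper left entry of `L · top₀⁻¹ · L⁻¹`. -/
theorem entries_PIIID6 (x : AnalyticData PIIID6.type) :
    x.linkFrom 0 1 0 0 * x.linkFrom 0 1 1 1 = -PIIID6.coord x 0 ∧
    x.linkFrom 0 1 0 1 * x.linkFrom 0 1 1 0 = -PIIID6.coord x 0 - 1 ∧
    (x.loc 0).stokes (0 : Fin 2) * (x.loc 0).stokes (1 : Fin 2) =
      PIIID6.param x 0 * PIIID6.coord x 2 - PIIID6.param x 0 ^ 2 - 1 ∧
    (x.loc 0).stokes (0 : Fin 2) * (x.linkFrom 0 1 0 1 * x.linkFrom 0 1 1 1) =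
      PIIID6.param x 0 * (PIIID6.coord x 1 + PIIID6.param x 0 * (1 + PIIID6.coord x 0)) ∧
    (x.loc 0).stokes (1 : Fin 2) * (x.linkFrom 0 1 0 0 * x.linkFrom 0 1 1 0) =
      (PIIID6.param x 0)⁻¹ * (PIIID6.param x 1 + PIIID6.coord x 0 * PIIID6.coord x 2
        - PIIID6.param x 0 * PIIID6.coord x 0 + PIIID6.coord x 1) := by
  have hα : PIIID6.param x 0 ≠ 0 := param_PIIID6_ne_zero x 0
  have hβ : PIIID6.param x 1 = _ :=
    ((LocalData.top_entries (x.loc 1)).1.symm.trans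
      (congrArg (fun m : SL2 => m 0 0) (AnalyticData.top_one_eq x))).trans (entry_conj_inv _ _)
  obtain ⟨e₁, e₂, e₃, e₄⟩ := LocalData.top_entries (x.loc 0)
  have hdet := det_entry (x.linkFrom 0 1)
  have hM₀₀ : (x.loc 0).top 0 0 = PIIID6.param x 0 := e₁
  have hM₁₁ : (x.loc 0).top 1 1 = PIIID6.coord x 2 - PIIID6.param x 0 := by
    have : PIIID6.coord x 2 = _ := trace_entry (x.loc 0).top
    rw [this, hM₀₀]
    ring
  have h₀ : (x.loc 0).stokes (0 : Fin 2) = PIIID6.param x 0 * (x.loc 0).top 1 0 :=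
    (LocalData.stokes_eq_top (x.loc 0)).1
  have h₁ : (x.loc 0).stokes (1 : Fin 2) = (PIIID6.param x 0)⁻¹ * (x.loc 0).top 0 1 :=
    (LocalData.stokes_eq_top (x.loc 0)).2
  have hdetM := det_entry (x.loc 0).top
  rw [hM₀₀, hM₁₁] at hdetM
  have hx₀ : PIIID6.coord x 0 = -(x.linkFrom 0 1 0 0 * x.linkFrom 0 1 1 1) := rfl
  have hx₁ : PIIID6.coord x 1 = (x.loc 0).top 1 0 * x.linkFrom 0 1 0 1 * x.linkFrom 0 1 1 1
      + PIIID6.param x 0 * x.linkFrom 0 1 0 1 * x.linkFrom 0 1 1 0 := by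
    rw [← hM₀₀]; rfl
  have h₂₃ : x.linkFrom 0 1 0 1 * x.linkFrom 0 1 1 0 = -PIIID6.coord x 0 - 1 := by
    rw [hx₀]
    linear_combination -hdet
  have hβ' : PIIID6.param x 1 = x.linkFrom 0 1 0 0 * x.linkFrom 0 1 1 1
        * (PIIID6.coord x 2 - PIIID6.param x 0)
      - x.linkFrom 0 1 0 1 * x.linkFrom 0 1 1 1 * (x.loc 0).top 1 0
      + x.linkFrom 0 1 0 0 * x.linkFrom 0 1 1 0 * (x.loc 0).top 0 1
      - x.linkFrom 0 1 0 1 * x.linkFrom 0 1 1 0 * PIIID6.param x 0 := by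
    rw [← hM₁₁, ← hM₀₀]; exact hβ
  refine ⟨by rw [hx₀, neg_neg], h₂₃, ?_, ?_, ?_⟩
  · rw [h₀, h₁]
    linear_combination (x.loc 0).top 1 0 * (x.loc 0).top 0 1 * mul_inv_cancel₀ hα - hdetM
  · rw [h₀]
    linear_combination PIIID6.param x 0 * (-hx₁ - PIIID6.param x 0 * h₂₃)
  · rw [h₁, mul_assoc]
    congr 1
    linear_combination -hβ' - hx₁ - PIIID6.coord x 2 * hx₀ + PIIID6.param x 0 * hx₀

/-- With `c₁, c₂` the Stokes constants at `0`, the cubic comes from `(c₁ L₀₁L₁₁)(c₂ L₀₀L₁₀) =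
(c₁c₂)(L₀₀L₁₁)(L₀₁L₁₀)`. -/
theorem equation_PIIID6 (x : AnalyticData PIIID6.type) :
    eval (Sum.elim (PIIID6.param x) (PIIID6.coord x)) PIIID6.equation = 0 := by
  have hα : PIIID6.param x 0 ≠ 0 := param_PIIID6_ne_zero x 0
  obtain ⟨h₁, h₂, h₃, h₄, h₅⟩ := entries_PIIID6 x
  simp only [map_add, map_mul, map_pow, eval_X, Sum.elim_inr, Sum.elim_inl, map_one]
  have h₅' : PIIID6.param x 0 * ((x.loc 0).stokes (1 : Fin 2)
      * (x.linkFrom 0 1 0 0 * x.linkFrom 0 1 1 0)) = PIIID6.param x 1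
        + PIIID6.coord x 0 * PIIID6.coord x 2 - PIIID6.param x 0 * PIIID6.coord x 0
        + PIIID6.coord x 1 := by
    rw [h₅, mul_inv_cancel_left₀ hα]
  show PIIID6.coord x 0 * PIIID6.coord x 1 * PIIID6.coord x 2 + PIIID6.coord x 0 ^ 2
    + PIIID6.coord x 1 ^ 2 + (1 + PIIID6.param x 0 * PIIID6.param x 1) * PIIID6.coord x 0
    + (PIIID6.param x 0 + PIIID6.param x 1) * PIIID6.coord x 1
    + PIIID6.param x 0 * PIIID6.param x 1 = 0
  generalize PIIID6.param x 0 = α at *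
  generalize PIIID6.param x 1 = β at *
  generalize PIIID6.coord x 0 = x₁ at *
  generalize PIIID6.coord x 1 = x₂ at *
  generalize PIIID6.coord x 2 = x₃ at *
  linear_combination (-(x₂ + α * (1 + x₁))) * h₅'
    - (x.loc 0).stokes (1 : Fin 2) * (x.linkFrom 0 1 0 0 * x.linkFrom 0 1 1 0) * h₄
    + x₁ * (1 + x₁) * h₃ + (x.loc 0).stokes (0 : Fin 2) * (x.loc 0).stokes (1 : Fin 2)
      * (x.linkFrom 0 1 0 1 * x.linkFrom 0 1 1 0 * h₁ - x₁ * h₂)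

/-- The two tori allow the second row of `L` to be `(1, 1)`, and `det L = 1` with the value of `x₁`
fixes the first row. The definition of `x₂` and the formula for `β` are then linear in the
off-diagonal entries of `M`, with coefficients `1 + x₁` and `x₁`; the cubic becomes `det M = 1`. -/
theorem exists_PIIID6 {α β : ℂ} (hα : α ≠ 0) (hβ : β ≠ 0) {a : Fin 3 → ℂ} (ha : a 0 ≠ 0)
    (ha' : 1 + a 0 ≠ 0) (h : a 0 * a 1 * a 2 + a 0 ^ 2 + a 1 ^ 2 + (1 + α * β) * a 0
      + (α + β) * a 1 + α * β = 0) :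
    ∃ x : AnalyticData PIIID6.type, PIIID6.param x = ![α, β] ∧ PIIID6.coord x = a := by
  let M : SL2 := SL2.mk α (-(β + a 0 * a 2 - α * a 0 + a 1) / a 0)
    (-(a 1 + α * (1 + a 0)) / (1 + a 0)) (a 2 - α) (by
      field_simp
      linear_combination -h)
  let L : SL2 := SL2.mk (-a 0) (-(1 + a 0)) 1 1 (by ring)
  have hM : M 0 0 ≠ 0 := hα
  have hL : (L * M⁻¹ * L⁻¹) 0 0 = β := by
    rw [entry_conj_inv]
    simp [M, L]
    field_simp
    ring
  let x : AnalyticData PIIID6.type := AnalyticData.ofTwo (LocalData.ofTop M hM)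
    (LocalData.ofTop (L * M⁻¹ * L⁻¹) (hL.symm ▸ hβ)) L (by
      rw [LocalData.top_ofTop, LocalData.top_ofTop]
      group)
  have hx : x.linkFrom 0 1 = L := by
    show L * 1⁻¹ = L
    simp
  have hx' : (x.loc 0).top = M := LocalData.top_ofTop M hM
  refine ⟨x, vec_eq_two.2 ⟨rfl, hL⟩, ext_three ?_ ?_ ?_⟩
  · show -(x.linkFrom 0 1 0 0 * x.linkFrom 0 1 1 1) = a 0
    simp [hx, L]
  · show (x.loc 0).top 1 0 * x.linkFrom 0 1 0 1 * x.linkFrom 0 1 1 1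
      + (x.loc 0).top 0 0 * x.linkFrom 0 1 0 1 * x.linkFrom 0 1 1 0 = a 1
    simp only [hx, hx', L, M, mk_entry₀₀, mk_entry₀₁, mk_entry₁₀, mk_entry₁₁]
    field_simp
    ring
  · show (x.loc 0).top.1.trace = a 2
    rw [hx', trace_entry]
    simp [M]

theorem irreducible_PIIID6 : Irreducible PIIID6.equation := by
  have hX : ∀ i : Fin 3, i ≠ 2 →
      (Y i : MvPolynomial (Fin 2 ⊕ Fin 3) ℂ) ∈ supported ℂ {Sum.inr 2}ᶜ :=
    fun i hi => X_mem_supported_compl (by simpa using hi)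
  have hS : ∀ i, (S i : MvPolynomial (Fin 2 ⊕ Fin 3) ℂ) ∈ supported ℂ {Sum.inr 2}ᶜ :=
    fun i => X_mem_supported_compl (by simp)
  have h₀ := hX 0 (by decide)
  have h₁ := hX 1 (by decide)
  have hSS := mul_mem (hS 0) (hS 1)
  refine irreducible_of_linear (Sum.inr 2) (A := Y 0 * Y 1)
    (B := Y 0 ^ 2 + Y 1 ^ 2 + (1 + S 0 * S 1) * Y 0 + (S 0 + S 1) * Y 1 + S 0 * S 1)
    ?_ (mul_mem h₀ h₁) (add_mem (add_mem (add_mem (add_mem (pow_mem h₀ 2) (pow_mem h₁ 2))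
      (mul_mem (add_mem (one_mem _) hSS) h₀)) (mul_mem (add_mem (hS 0) (hS 1)) h₁)) hSS) ?_
    (mul_ne_zero (X_ne_zero _) (X_ne_zero _))
  · show Y 0 * Y 1 * Y 2 + Y 0 ^ 2 + Y 1 ^ 2 + (1 + S 0 * S 1) * Y 0 + (S 0 + S 1) * Y 1
      + S 0 * S 1 = _
    ring
  · refine IsRelPrime.mul_left (isRelPrime_of_eval (irreducible_X _) (Sum.elim ![1, 1] 0) ?_ ?_)
      (isRelPrime_of_eval (irreducible_X _) (Sum.elim ![1, 1] 0) ?_ ?_) <;> simp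

theorem coord_mem_invariantRing_PIIID6 (i : Fin 3) :
    (fun x => PIIID6.coord x i) ∈ AnalyticData.invariantRing PIIID6.type := by
  have hl := AnalyticData.linkFrom_mem (τ := PIIID6.type) 0 1
  have ht := AnalyticData.top_mem (τ := PIIID6.type) 0
  have hd : ∀ (ρ : Fin 2 → SL2) (h : ∀ j, (PIIID6.type j).IsAdmissible (ρ j)) (j : Fin 2),
      ρ j 0 0 * ρ j 1 1 = 1 := by
    intro ρ h j
    fin_cases j
    · exact AnalyticData.diag_mul_of_isAdmissible (n := 1) rfl (h 0)
    · exact AnalyticData.diag_mul_of_isAdmissible (n := 1) rfl (h 1)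
  fin_cases i
  · refine (AnalyticData.mem_invariantRing_iff _).2 ⟨neg_mem (mul_mem (hl 0 0) (hl 1 1)),
      fun x σ ρ h => ?_⟩
    obtain ⟨h₁, h₂, h₃, h₄⟩ := x.linkFrom_act_diagonal σ ρ h 0 1 (m := 1) (n := 1) rfl rfl
    show -((x.act σ ρ h).linkFrom 0 1 0 0 * (x.act σ ρ h).linkFrom 0 1 1 1)
      = -(x.linkFrom 0 1 0 0 * x.linkFrom 0 1 1 1)
    rw [h₁, h₄]
    linear_combination (-(x.linkFrom 0 1 0 0 * x.linkFrom 0 1 1 1)) * (ρ 0 0 0 * ρ 0 1 1 *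
      hd ρ h 1 + hd ρ h 0)
  · refine (AnalyticData.mem_invariantRing_iff _).2 ⟨add_mem (mul_mem (mul_mem (ht 1 0) (hl 0 1))
      (hl 1 1)) (mul_mem (mul_mem (ht 0 0) (hl 0 1)) (hl 1 0)), fun x σ ρ h => ?_⟩
    obtain ⟨h₁, h₂, h₃, h₄⟩ := x.linkFrom_act_diagonal σ ρ h 0 1 (m := 1) (n := 1) rfl rfl
    obtain ⟨h₅, h₆, -⟩ := x.top_act_diagonal σ ρ h 0 (m := 1) rfl
    show ((x.act σ ρ h).loc 0).top 1 0 * (x.act σ ρ h).linkFrom 0 1 0 1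
        * (x.act σ ρ h).linkFrom 0 1 1 1 + ((x.act σ ρ h).loc 0).top 0 0
        * (x.act σ ρ h).linkFrom 0 1 0 1 * (x.act σ ρ h).linkFrom 0 1 1 0
      = (x.loc 0).top 1 0 * x.linkFrom 0 1 0 1 * x.linkFrom 0 1 1 1
        + (x.loc 0).top 0 0 * x.linkFrom 0 1 0 1 * x.linkFrom 0 1 1 0
    rw [h₅, h₆, h₂, h₃, h₄]
    linear_combination (x.loc 0).top 1 0 * x.linkFrom 0 1 0 1 * x.linkFrom 0 1 1 1
        * (ρ 1 0 0 * ρ 1 1 1 * (ρ 0 0 0 * ρ 0 1 1 + 1) * hd ρ h 0 + hd ρ h 1)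
      + (x.loc 0).top 0 0 * x.linkFrom 0 1 0 1 * x.linkFrom 0 1 1 0
        * (ρ 1 0 0 * ρ 1 1 1 * hd ρ h 0 + hd ρ h 1)
  · refine (AnalyticData.mem_invariantRing_iff _).2 ⟨ht.trace, fun x σ ρ h => ?_⟩
    exact (x.top_act_diagonal σ ρ h 0 (m := 1) rfl).2.2

/-- Generators of the functions on the normal forms. -/
def linkGenerators : Fin 10 → AnalyticData PIIID6.type → ℂ :=
  ![fun x => (x.loc 0).formal 0 0, fun x => ((x.loc 0).formal 0 0)⁻¹,
    fun x => (x.loc 1).formal 0 0, fun x => ((x.loc 1).formal 0 0)⁻¹,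
    fun x => (x.loc 0).stokes (0 : Fin 2), fun x => (x.loc 0).stokes (1 : Fin 2),
    fun x => x.linkFrom 0 1 0 0, fun x => x.linkFrom 0 1 0 1, fun x => x.linkFrom 0 1 1 0,
    fun x => x.linkFrom 0 1 1 1]

/-- Generators of the invariants of the torus at the second point. -/
def productGenerators : Fin 10 → AnalyticData PIIID6.type → ℂ :=
  ![fun x => (x.loc 0).formal 0 0, fun x => ((x.loc 0).formal 0 0)⁻¹,
    fun x => (x.loc 1).formal 0 0, fun x => ((x.loc 1).formal 0 0)⁻¹,
    fun x => x.linkFrom 0 1 0 0 * x.linkFrom 0 1 1 1,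
    fun x => x.linkFrom 0 1 0 1 * x.linkFrom 0 1 1 0,
    fun x => (x.loc 0).stokes (0 : Fin 2), fun x => (x.loc 0).stokes (1 : Fin 2),
    fun x => x.linkFrom 0 1 0 0 * x.linkFrom 0 1 1 0,
    fun x => x.linkFrom 0 1 0 1 * x.linkFrom 0 1 1 1]

/-- The data at the second point are determined by the link and the data at the first one, so its
Stokes constants are not needed as generators. -/
theorem mem_adjoin_linkGenerators {f : AnalyticData PIIID6.type → ℂ}
    (hf : f ∈ AnalyticData.invariantRing PIIID6.type) :
    f ∈ Algebra.adjoin ℂ (Set.range linkGenerators) := by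
  have hg : ∀ i, linkGenerators i ∈ Algebra.adjoin ℂ (Set.range linkGenerators) := fun i =>
    Algebra.subset_adjoin ⟨i, rfl⟩
  have hfor₀ := AnalyticData.entriesIn_formal_unramified (τ := PIIID6.type) 0 (m := 1) rfl
    (hg 0) (hg 1)
  have hfor₁ := AnalyticData.entriesIn_formal_unramified (τ := PIIID6.type) 1 (m := 1) rfl
    (hg 2) (hg 3)
  have hst₀ : ∀ k, (fun x : AnalyticData PIIID6.type => (x.loc 0).stokes k) ∈
      Algebra.adjoin ℂ (Set.range linkGenerators) := by
    intro k
    change Fin 2 at k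
    fin_cases k
    · exact hg 4
    · exact hg 5
  have hL : AnalyticData.EntriesIn (Algebra.adjoin ℂ (Set.range linkGenerators))
      fun x : AnalyticData PIIID6.type => x.linkFrom 0 1 := by
    intro i j
    fin_cases i <;> fin_cases j
    · exact hg 6
    · exact hg 7
    · exact hg 8
    · exact hg 9
  have htop : AnalyticData.EntriesIn (Algebra.adjoin ℂ (Set.range linkGenerators))
      fun x : AnalyticData PIIID6.type => LocalData.top (τ := .unramified 1) (x.loc 1) := by
    have : (fun x : AnalyticData PIIID6.type =>
        LocalData.top (τ := .unramified 1) (x.loc 1)) = _ :=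
      funext fun x => AnalyticData.top_one_eq x
    rw [this]
    exact (hL.mul (AnalyticData.entriesIn_top 0 hfor₀ hst₀).inv).mul hL.inv
  have hst₁ : ∀ k, (fun x : AnalyticData PIIID6.type => (x.loc 1).stokes k) ∈
      Algebra.adjoin ℂ (Set.range linkGenerators) := by
    intro k
    change Fin 2 at k
    fin_cases k
    · exact AnalyticData.mem_of_eq (mul_mem (hg 2) (htop 1 0)) fun x =>
        (LocalData.stokes_eq_top (x.loc 1)).1
    · exact AnalyticData.mem_of_eq (mul_mem (hg 3) (htop 0 1)) fun x =>
        (LocalData.stokes_eq_top (x.loc 1)).2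
  refine AnalyticData.invariant_mem 0 _ (fun j h => ?_) (fun j h => ?_)
    (fun j h => ?_) (fun j h => ?_) hf <;> fin_cases j
  · cases h
  · cases h
  · exact hfor₀
  · exact hfor₁
  · exact hst₀
  · exact hst₁
  · exact AnalyticData.entriesIn_linkFrom_self 0 _
  · exact hL

/-- Invariance under the torus at the second point: its weights are `±1` on the rows of the link and
`0` on everything else. -/
theorem mem_adjoin_productGenerators {f : AnalyticData PIIID6.type → ℂ}
    (hf : f ∈ AnalyticData.invariantRing PIIID6.type) :
    f ∈ Algebra.adjoin ℂ (Set.range productGenerators) := by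
  have h0 : (fun x : AnalyticData PIIID6.type => (x.loc 0).formal 0 0) ∈
      Algebra.adjoin ℂ (Set.range productGenerators) := Algebra.subset_adjoin ⟨0, rfl⟩
  have h1 : (fun x : AnalyticData PIIID6.type => ((x.loc 0).formal 0 0)⁻¹) ∈
      Algebra.adjoin ℂ (Set.range productGenerators) := Algebra.subset_adjoin ⟨1, rfl⟩
  have h2 : (fun x : AnalyticData PIIID6.type => (x.loc 1).formal 0 0) ∈
      Algebra.adjoin ℂ (Set.range productGenerators) := Algebra.subset_adjoin ⟨2, rfl⟩
  have h3 : (fun x : AnalyticData PIIID6.type => ((x.loc 1).formal 0 0)⁻¹) ∈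
      Algebra.adjoin ℂ (Set.range productGenerators) := Algebra.subset_adjoin ⟨3, rfl⟩
  have h4 : (fun x : AnalyticData PIIID6.type => x.linkFrom 0 1 0 0 * x.linkFrom 0 1 1 1) ∈
      Algebra.adjoin ℂ (Set.range productGenerators) := Algebra.subset_adjoin ⟨4, rfl⟩
  have h5 : (fun x : AnalyticData PIIID6.type => x.linkFrom 0 1 0 1 * x.linkFrom 0 1 1 0) ∈
      Algebra.adjoin ℂ (Set.range productGenerators) := Algebra.subset_adjoin ⟨5, rfl⟩
  have h6 : (fun x : AnalyticData PIIID6.type => (x.loc 0).stokes (0 : Fin 2)) ∈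
      Algebra.adjoin ℂ (Set.range productGenerators) := Algebra.subset_adjoin ⟨6, rfl⟩
  have h7 : (fun x : AnalyticData PIIID6.type => (x.loc 0).stokes (1 : Fin 2)) ∈
      Algebra.adjoin ℂ (Set.range productGenerators) := Algebra.subset_adjoin ⟨7, rfl⟩
  have h8 : (fun x : AnalyticData PIIID6.type => x.linkFrom 0 1 0 0 * x.linkFrom 0 1 1 0) ∈
      Algebra.adjoin ℂ (Set.range productGenerators) := Algebra.subset_adjoin ⟨8, rfl⟩
  have h9 : (fun x : AnalyticData PIIID6.type => x.linkFrom 0 1 0 1 * x.linkFrom 0 1 1 1) ∈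
      Algebra.adjoin ℂ (Set.range productGenerators) := Algebra.subset_adjoin ⟨9, rfl⟩
  refine torus_invariant_mem linkGenerators ![0, 0, 0, 0, 0, 0, 1, 1, -1, -1] (by decide) (m := 1)
    (by norm_num) (fun t ht => AnalyticData.torusAct (τ := PIIID6.type) 1 (m := 1) rfl t ht)
    ?_ _ ?_ ?_ (mem_adjoin_linkGenerators hf)
    (fun t ht z => ((AnalyticData.mem_invariantRing_iff f).1 hf).2 z _ _ _)
  · intro i t ht z
    have hfor₀ := AnalyticData.formal_torusAct_of_unramified (τ := PIIID6.type) z (i := 0)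
      (j := 1) (m := 1) (n := 1) rfl rfl t ht 0 0
    have hfor₁ := AnalyticData.formal_torusAct (τ := PIIID6.type) 1 (m := 1) rfl t ht z 0 0
    have hst := AnalyticData.stokes_torusAct_of_ne (τ := PIIID6.type) z (i := 0) (j := 1)
      (by decide) (n := 1) rfl t ht
    have hl := AnalyticData.linkFrom_torusAct (τ := PIIID6.type) z (i := 0) (j := 1)
      (by decide) (n := 1) rfl t ht
    fin_cases i
    · simpa [linkGenerators] using hfor₀
    · simpa [linkGenerators] using hfor₀
    · simpa [linkGenerators] using hfor₁
    · simpa [linkGenerators] using hfor₁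
    · show _ = t ^ (1 * 0 : ℤ) * _
      rw [mul_zero, zpow_zero, one_mul]
      exact hst (0 : Fin 2)
    · show _ = t ^ (1 * 0 : ℤ) * _
      rw [mul_zero, zpow_zero, one_mul]
      exact hst (1 : Fin 2)
    · simpa [linkGenerators] using (hl 0).1
    · simpa [linkGenerators] using (hl 1).1
    · simpa [linkGenerators] using (hl 0).2
    · simpa [linkGenerators] using (hl 1).2
  · intro i hi
    fin_cases i
    · exact h0
    · exact h1
    · exact h2
    · exact h3
    · exact h6
    · exact h7
    all_goals simp at hi
  · intro i j hi hj
    fin_cases i <;> first | (exfalso; revert hi; decide) | skip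
    all_goals fin_cases j <;> first | (exfalso; revert hj; decide) | skip
    · exact h8
    · exact h4
    · exact h5
    · exact h9

/-- Invariance under the torus at the first point. Both `c₁` and `L₀₀L₁₀` have halved weight `-1`,
both `c₂` and `L₀₁L₁₁` have halved weight `1`; the four mixed products are polynomials in
parameters, coordinates and `α⁻¹`. -/
theorem generation_PIIID6 (A : Subalgebra ℂ (AnalyticData PIIID6.type → ℂ))
    (hpA : ∀ i, (fun x => PIIID6.param x i) ∈ A) (hcA : ∀ i, (fun x => PIIID6.coord x i) ∈ A)
    (hi₀ : (fun x : AnalyticData PIIID6.type => ((x.loc 0).formal 0 0)⁻¹) ∈ A)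
    (hi₁ : (fun x : AnalyticData PIIID6.type => ((x.loc 1).formal 0 0)⁻¹) ∈ A)
    {f : AnalyticData PIIID6.type → ℂ} (hf : f ∈ AnalyticData.invariantRing PIIID6.type) :
    f ∈ A := by
  refine torus_invariant_mem productGenerators ![0, 0, 0, 0, 0, 0, -1, 1, -1, 1] (by decide) (m := 2)
      (by norm_num) (fun t ht => AnalyticData.torusAct (τ := PIIID6.type) 0 (m := 1) rfl t ht)
      ?_ _ ?_ ?_ (mem_adjoin_productGenerators hf)
      (fun t ht z => ((AnalyticData.mem_invariantRing_iff f).1 hf).2 z _ _ _)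
  · intro i t ht z
    have hfor₁ := AnalyticData.formal_torusAct_of_unramified (τ := PIIID6.type) z (i := 1)
      (j := 0) (m := 1) (n := 1) rfl rfl t ht 0 0
    have hfor₀ := AnalyticData.formal_torusAct (τ := PIIID6.type) 0 (m := 1) rfl t ht z 0 0
    have hst := AnalyticData.stokes_torusAct (τ := PIIID6.type) 0 (m := 1) rfl t ht z
    have hl := AnalyticData.linkFrom_torusAct_source (τ := PIIID6.type) z (i := 0) (j := 1)
      (by decide) (m := 1) (n := 1) rfl rfl t ht
    fin_cases i
    · simpa [productGenerators] using hfor₀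
    · simpa [productGenerators] using hfor₀
    · simpa [productGenerators] using hfor₁
    · simpa [productGenerators] using hfor₁
    · simp [productGenerators, (hl 0).1, (hl 1).2]
      field_simp
    · simp [productGenerators, (hl 0).2, (hl 1).1]
      field_simp
    · exact hst (0 : Fin 2)
    · exact hst (1 : Fin 2)
    · simp [productGenerators, (hl 0).1, (hl 1).1]
      field_simp
    · simp [productGenerators, (hl 0).2, (hl 1).2]
      field_simp
  · intro i hi
    fin_cases i
    · exact hpA 0
    · exact hi₀
    · exact hpA 1
    · exact hi₁
    · exact AnalyticData.mem_of_eq (neg_mem (hcA 0)) fun x => (entries_PIIID6 x).1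
    · exact AnalyticData.mem_of_eq (sub_mem (neg_mem (hcA 0)) (one_mem A)) fun x =>
        (entries_PIIID6 x).2.1
    all_goals simp at hi
  · have h₀₁ : (fun x : AnalyticData PIIID6.type =>
        (x.loc 0).stokes (0 : Fin 2) * (x.loc 0).stokes (1 : Fin 2)) ∈ A :=
      AnalyticData.mem_of_eq (sub_mem (sub_mem (mul_mem (hpA 0) (hcA 2)) (pow_mem (hpA 0) 2))
        (one_mem A)) fun x => (entries_PIIID6 x).2.2.1
    have h₀l : (fun x : AnalyticData PIIID6.type => (x.loc 0).stokes (0 : Fin 2) *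
        (x.linkFrom 0 1 0 1 * x.linkFrom 0 1 1 1)) ∈ A :=
      AnalyticData.mem_of_eq (mul_mem (hpA 0) (add_mem (hcA 1) (mul_mem (hpA 0)
        (add_mem (one_mem A) (hcA 0))))) fun x => (entries_PIIID6 x).2.2.2.1
    have h₁l : (fun x : AnalyticData PIIID6.type => (x.loc 0).stokes (1 : Fin 2) *
        (x.linkFrom 0 1 0 0 * x.linkFrom 0 1 1 0)) ∈ A :=
      AnalyticData.mem_of_eq (mul_mem hi₀ (add_mem (sub_mem (add_mem (hpA 1) (mul_mem (hcA 0)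
        (hcA 2))) (mul_mem (hpA 0) (hcA 0))) (hcA 1))) fun x => (entries_PIIID6 x).2.2.2.2
    have hll : (fun x : AnalyticData PIIID6.type => (x.linkFrom 0 1 0 0 * x.linkFrom 0 1 1 1) *
        (x.linkFrom 0 1 0 1 * x.linkFrom 0 1 1 0)) ∈ A :=
      AnalyticData.mem_of_eq (mul_mem (neg_mem (hcA 0)) (sub_mem (neg_mem (hcA 0)) (one_mem A)))
        fun x => congrArg₂ (· * ·) (entries_PIIID6 x).1 (entries_PIIID6 x).2.1
    intro i j hi hj
    fin_cases i <;> first | (exfalso; revert hi; decide) | skip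
    all_goals fin_cases j <;> first | (exfalso; revert hj; decide) | skip
    · exact AnalyticData.mem_of_eq h₀₁ fun x => mul_comm _ _
    · exact h₁l
    · exact AnalyticData.mem_of_eq h₀l fun x => mul_comm _ _
    · refine AnalyticData.mem_of_eq hll fun x => ?_
      simp [productGenerators]
      ring

theorem dvd_PIIID6 (g : MvPolynomial (Fin 2 ⊕ Fin 3) ℂ)
    (hg : ∀ x, eval (Sum.elim (PIIID6.param x) (PIIID6.coord x)) g = 0) : PIIID6.equation ∣ g := by
  refine dvd_of_vanishing_on_data irreducible_PIIID6 (h := S 0 * S 1 * Y 0 * (1 + Y 0))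
    (b := Sum.elim ![1, 1] ![1, 1, -7]) ?_ ?_ ?_ g hg
  · simp
    norm_num
  · simp
  · intro p a hpa hh
    simp at hpa hh
    obtain ⟨x, h₁, h₂⟩ := exists_PIIID6 hh.1.1.1 hh.1.1.2 hh.1.2 hh.2 hpa
    exact ⟨x, by rw [h₁]; exact (vec_eq_two.2 ⟨rfl, rfl⟩).symm, h₂⟩

theorem isMonodromySpace_PIIID6 : PIIID6.IsMonodromySpace := by
  have hα : ∀ j a b, (fun x : AnalyticData PIIID6.type => (x.loc j).formal a b) ∈
      AnalyticData.invariantRing PIIID6.type := by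
    intro j a b
    fin_cases j
    · exact AnalyticData.formal_mem_invariantRing 0 (m := 1) rfl a b
    · exact AnalyticData.formal_mem_invariantRing 1 (m := 1) rfl a b
  refine isMonodromySpace_of PIIID6 (fun i => ?_) (fun i => ?_) (fun i hi x => ?_) (fun i hi => ?_)
    equation_PIIID6 ?_ ?_
  · fin_cases i
    · exact hα 0 0 0
    · exact hα 1 0 0
  · exact coord_mem_invariantRing_PIIID6 i
  · exact param_PIIID6_ne_zero x i
  · fin_cases i
    · exact AnalyticData.inv_formal_mem (τ := PIIID6.type) 0 (m := 1) rfl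
    · exact AnalyticData.inv_formal_mem (τ := PIIID6.type) 1 (m := 1) rfl
  · exact dvd_PIIID6
  · intro A hpA hcA hiA f hf
    exact generation_PIIID6 A hpA hcA (hiA 0 (by simp)) (hiA 1 (by simp)) hf

end MonodromyFamily
end

/-! ### PIII of type `D₆`: singular points and reducible data -/

noncomputable section

open SL2

namespace MonodromyFamily

theorem fibre_PIIID6 (p : Fin 2 → ℂ) : PIIID6.fibre p =
    triangleCubic 1 1 0 (1 + p 0 * p 1) (p 0 + p 1) 0 (p 0 * p 1) := by
  apply eq_triangleCubic
  intro b
  simp [fibre]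
  ring

/-- The derivative in `x₃` forces `x₁ = 0` or `x₂ = 0`. On these lines the equation is a quadratic
with discriminant `(α - β)²` or `(αβ - 1)²`, and a singular point is a double root; the remaining
derivative gives `x₃`. -/
theorem isSingularPoint_fibre_PIIID6 {α β : ℂ} (hα : α ≠ 0) (a : Fin 3 → ℂ) :
    IsSingularPoint (PIIID6.fibre ![α, β]) a ↔
      (α = β ∧ a = ![0, -α, α + α⁻¹]) ∨ (α = β⁻¹ ∧ a = ![-1, 0, α + α⁻¹]) := by
  have hinv : α = β⁻¹ ↔ α * β = 1 :=
    ⟨fun h => by rw [h]; exact inv_mul_cancel₀ (by rintro rfl; simp at h; exact hα h),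
      eq_inv_of_mul_eq_one_left⟩
  rw [hinv, fibre_PIIID6, isSingularPoint_triangleCubic, vec_eq, vec_eq]
  simp only [Matrix.cons_val]
  constructor
  · rintro ⟨h₀, h₁, h₂, h₃⟩
    rcases mul_eq_zero.1 (show a 0 * a 1 = 0 by linear_combination h₃) with h | h
    · left
      rw [h] at h₀ h₁ h₂
      have hsq : (α - β) ^ 2 = 0 := by
        linear_combination -4 * h₀ + (2 * a 1 + α + β) * h₂
      have hαβ : α = β := sub_eq_zero.1 (pow_eq_zero_iff two_ne_zero |>.1 hsq)
      have ha : a 1 = -α := by rw [← hαβ] at h₂; linear_combination h₂ / 2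
      refine ⟨hαβ, h, ha, ?_⟩
      rw [ha, ← hαβ] at h₁
      field_simp
      linear_combination -h₁
    · right
      rw [h] at h₀ h₁ h₂
      have hsq : (α * β - 1) ^ 2 = 0 := by
        linear_combination -4 * h₀ + (2 * a 0 + α * β + 1) * h₁
      have hαβ : α * β = 1 := sub_eq_zero.1 (pow_eq_zero_iff two_ne_zero |>.1 hsq)
      have ha : a 0 = -1 := by rw [hαβ] at h₁; linear_combination h₁ / 2
      refine ⟨hαβ, ha, h, ?_⟩
      rw [ha] at h₂
      field_simp
      linear_combination -α * h₂ + hαβ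
  · rintro (⟨hp, e₀, e₁, e₂⟩ | ⟨hp, e₀, e₁, e₂⟩)
    · rw [e₀, e₁, e₂, ← hp]
      refine ⟨?_, ?_, ?_, ?_⟩
      · ring
      · field_simp
        ring
      · ring
      · ring
    · have hβ : β = α⁻¹ := eq_inv_of_mul_eq_one_right hp
      rw [e₀, e₁, e₂, hβ]
      refine ⟨?_, ?_, ?_, ?_⟩ <;> field_simp <;> ring

/-- At the singular points of the fibres the derivatives in `α` and `β` vanish automatically. -/
theorem isSingularPoint_equation_PIIID6 {α β : ℂ} (hα : α ≠ 0) (a : Fin 3 → ℂ) :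
    IsSingularPoint PIIID6.equation (Sum.elim ![α, β] a) ↔
      (α = β ∧ a = ![0, -α, α + α⁻¹]) ∨ (α = β⁻¹ ∧ a = ![-1, 0, α + α⁻¹]) := by
  rw [isSingularPoint_equation_iff PIIID6, isSingularPoint_fibre_PIIID6 hα]
  refine ⟨fun h => h.1, fun h => ⟨h, fun i => ?_⟩⟩
  rcases h with ⟨rfl, rfl⟩ | ⟨rfl, rfl⟩ <;> fin_cases i <;> simp [pderiv_X]

theorem top_ofUnramified_zero (α : ℂ) (hα : α ≠ 0) :
    (LocalData.ofUnramified 1 α hα 0).top = diag α hα := by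
  rw [LocalData.top_unramified_one, eq_iff_entries]
  simp [-Matrix.SpecialLinearGroup.coe_mul, mul_entry, LocalData.ofUnramified]

theorem stokesMap_ofUnramified_zero {γ : ℂ} (hγ : γ ≠ 0) (k) :
    (LocalData.ofUnramified 1 γ hγ 0).stokesMap k = 1 := by
  rw [eq_iff_entries]
  unfold LocalData.stokesMap stokesMatrix
  split_ifs <;> simp [LocalData.ofUnramified] <;> rfl

/-- Diagonal data joined by a link that exchanges `V_q` and `V_{-q}`, so that equal formal
eigenvalues cancel in the relation. The identity link gives the other component, `α = β⁻¹`. -/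
theorem exists_isReducible_PIIID6_left {α : ℂ} (hα : α ≠ 0) : ∃ x : AnalyticData PIIID6.type,
    PIIID6.param x = ![α, α] ∧ PIIID6.coord x 0 = 0 ∧ x.IsReducible := by
  refine ⟨AnalyticData.ofTwo (LocalData.ofUnramified 1 α hα 0) (LocalData.ofUnramified 1 α hα 0)
    weylSL ?_, vec_eq_two.2 ⟨rfl, rfl⟩, ?_, ?_⟩
  · rw [top_ofUnramified_zero, eq_iff_entries]
    simp [-Matrix.SpecialLinearGroup.coe_mul, -Matrix.SpecialLinearGroup.coe_inv, mul_entry, hα]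
  · show -((weylSL * 1⁻¹ : SL2) 0 0 * (weylSL * 1⁻¹ : SL2) 1 1) = 0
    rw [inv_one, mul_one, weyl_entry₁₁, mul_zero, neg_zero]
  · refine AnalyticData.isReducible_of_entries _ fun j => ?_
    fin_cases j
    · refine Or.inl ⟨rfl, rfl, fun k => ?_⟩
      exact (congrArg (fun m : SL2 => m 1 0) (stokesMap_ofUnramified_zero hα k)).trans (by simp)
    · refine Or.inr ⟨rfl, rfl, fun k => ?_⟩
      exact (congrArg (fun m : SL2 => m 0 1) (stokesMap_ofUnramified_zero hα k)).trans (by simp)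

theorem exists_isReducible_PIIID6_right {α β : ℂ} (hα : α ≠ 0) (hβ : β ≠ 0) (h : α = β⁻¹) :
    ∃ x : AnalyticData PIIID6.type,
      PIIID6.param x = ![α, β] ∧ PIIID6.coord x 0 = -1 ∧ x.IsReducible := by
  refine ⟨AnalyticData.ofTwo (LocalData.ofUnramified 1 α hα 0) (LocalData.ofUnramified 1 β hβ 0)
    1 ?_, vec_eq_two.2 ⟨rfl, rfl⟩, ?_, ?_⟩
  · rw [top_ofUnramified_zero, top_ofUnramified_zero, eq_iff_entries]
    simp [-Matrix.SpecialLinearGroup.coe_mul, -Matrix.SpecialLinearGroup.coe_inv, mul_entry, h, hβ]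
  · show -((1 * 1⁻¹ : SL2) 0 0 * (1 * 1⁻¹ : SL2) 1 1) = -1
    simp
  · refine AnalyticData.isReducible_of_entries _ fun j => Or.inl ?_
    fin_cases j
    · refine ⟨rfl, rfl, fun k => ?_⟩
      exact (congrArg (fun m : SL2 => m 1 0) (stokesMap_ofUnramified_zero hα k)).trans (by simp)
    · refine ⟨rfl, rfl, fun k => ?_⟩
      exact (congrArg (fun m : SL2 => m 1 0) (stokesMap_ofUnramified_zero hβ k)).trans (by simp)

/-- The stable line is a coordinate axis in both formal solution spaces. At the first point this
makes the monodromy triangular; at the second it makes one entry of the corresponding column of the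
link vanish. -/
theorem isReducible_entries_PIIID6 {x : AnalyticData PIIID6.type} (hx : x.IsReducible) :
    ((x.loc 0).top 1 0 = 0 ∧ (x.linkFrom 0 1 0 0 = 0 ∨ x.linkFrom 0 1 1 0 = 0)) ∨
    ((x.loc 0).top 0 1 = 0 ∧ (x.linkFrom 0 1 0 1 = 0 ∨ x.linkFrom 0 1 1 1 = 0)) := by
  obtain ⟨v, hv, h₁, -, h₃⟩ := hx.exists_vector
  have hM := h₁ 0 0
  rw [x.monodromyAt_self 0] at hM
  have hw := AnalyticData.mulVec_ne_zero (x.link 0) hv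
  have hl : (x.link 1).1.mulVec v = (x.linkFrom 0 1).1.mulVec ((x.link 0).1.mulVec v) := by
    rw [Matrix.mulVec_mulVec, ← Matrix.SpecialLinearGroup.coe_mul, AnalyticData.linkFrom,
      inv_mul_cancel_right]
  have h₃₁ := h₃ 1 (by simp)
  have h₃₀ := h₃ 0 (by simp)
  rw [hl] at h₃₁
  generalize (x.link 0).1.mulVec v = w at *
  rw [AnalyticData.mulVec_zero_entry, AnalyticData.mulVec_one_entry] at h₃₁
  rcases h₃₀ with h | h
  · have h' : w 1 ≠ 0 := fun h' => hw (funext fun k => by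
      fin_cases k
      · exact h
      · exact h')
    refine Or.inr ⟨hM.entry₀₁ h h', ?_⟩
    simpa [h, h'] using h₃₁
  · have h' : w 0 ≠ 0 := fun h' => hw (funext fun k => by
      fin_cases k
      · exact h'
      · exact h)
    refine Or.inl ⟨hM.entry₁₀ h h', ?_⟩
    simpa [h, h'] using h₃₁

theorem isReducible_PIIID6 {x : AnalyticData PIIID6.type} (hx : x.IsReducible) :
    (PIIID6.param x 0 = PIIID6.param x 1 ∧
      PIIID6.coord x = ![0, -PIIID6.param x 0, PIIID6.param x 0 + (PIIID6.param x 0)⁻¹]) ∨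
    (PIIID6.param x 0 = (PIIID6.param x 1)⁻¹ ∧
      PIIID6.coord x = ![-1, 0, PIIID6.param x 0 + (PIIID6.param x 0)⁻¹]) := by
  have hα := param_PIIID6_ne_zero x 0
  have hβ : PIIID6.param x 1 = _ :=
    ((LocalData.top_entries (x.loc 1)).1.symm.trans
      (congrArg (fun m : SL2 => m 0 0) (AnalyticData.top_one_eq x))).trans (entry_conj_inv _ _)
  have hM₀₀ : (x.loc 0).top 0 0 = PIIID6.param x 0 := (LocalData.top_entries (x.loc 0)).1
  have hdet := det_entry (x.linkFrom 0 1)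
  have hdetM := det_entry (x.loc 0).top
  have hx₂ : PIIID6.coord x 2 = (x.loc 0).top 0 0 + (x.loc 0).top 1 1 :=
    trace_entry (x.loc 0).top
  have hx₀ : PIIID6.coord x 0 = -(x.linkFrom 0 1 0 0 * x.linkFrom 0 1 1 1) := rfl
  have hx₁ : PIIID6.coord x 1 = (x.loc 0).top 1 0 * x.linkFrom 0 1 0 1 * x.linkFrom 0 1 1 1
      + (x.loc 0).top 0 0 * x.linkFrom 0 1 0 1 * x.linkFrom 0 1 1 0 := rfl
  have hdiag : (x.loc 0).top 0 1 * (x.loc 0).top 1 0 = 0 := by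
    rcases isReducible_entries_PIIID6 hx with ⟨h, -⟩ | ⟨h, -⟩ <;> rw [h] <;> ring
  have hM₁₁ : (x.loc 0).top 1 1 = (PIIID6.param x 0)⁻¹ := by
    apply eq_inv_of_mul_eq_one_right
    rw [← hM₀₀]
    linear_combination hdetM + hdiag
  have hc₂ : PIIID6.coord x 2 = PIIID6.param x 0 + (PIIID6.param x 0)⁻¹ := by
    rw [hx₂, hM₀₀, hM₁₁]
  rw [hM₀₀] at hx₁
  replace hβ : PIIID6.param x 1 = x.linkFrom 0 1 0 0 * x.linkFrom 0 1 1 1 * (PIIID6.param x 0)⁻¹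
      - x.linkFrom 0 1 0 1 * x.linkFrom 0 1 1 1 * (x.loc 0).top 1 0
      + x.linkFrom 0 1 0 0 * x.linkFrom 0 1 1 0 * (x.loc 0).top 0 1
      - x.linkFrom 0 1 0 1 * x.linkFrom 0 1 1 0 * PIIID6.param x 0 := by
    rw [← hM₁₁, ← hM₀₀]
    exact hβ
  rw [vec_eq, vec_eq, hc₂, hβ, hx₀, hx₁]
  generalize PIIID6.param x 0 = α at *
  rcases isReducible_entries_PIIID6 hx with ⟨h, h' | h'⟩ | ⟨h, h' | h'⟩ <;> rw [h'] at hdet <;>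
    rw [h, h']
  · left
    refine ⟨?_, ?_, ?_, rfl⟩
    · linear_combination -α * hdet
    · ring
    · linear_combination -α * hdet
  · right
    rw [mul_zero, sub_zero] at hdet
    simp [hdet]
  · right
    rw [zero_mul, sub_zero] at hdet
    simp [hdet]
  · left
    refine ⟨?_, ?_, ?_, rfl⟩
    · linear_combination -α * hdet
    · ring
    · linear_combination -α * hdet

theorem reducibleAt_PIIID6 {α β : ℂ} (hα : α ≠ 0) (hβ : β ≠ 0) :
    PIIID6.ReducibleAt ![α, β] ↔ α = β ∨ α = β⁻¹ := by
  constructor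
  · rintro ⟨x, hx, hr⟩
    have := isReducible_PIIID6 hr
    rw [hx] at this
    exact this.imp And.left And.left
  · rintro (rfl | h)
    · obtain ⟨x, hx, -, hr⟩ := exists_isReducible_PIIID6_left hα
      exact ⟨x, hx, hr⟩
    · obtain ⟨x, hx, -, hr⟩ := exists_isReducible_PIIID6_right hα hβ h
      exact ⟨x, hx, hr⟩

theorem not_resonantAt_PIIID6 (p) : ¬ PIIID6.ResonantAt p := by
  rintro ⟨x, -, j, hj, -⟩
  fin_cases j <;> cases hj

theorem singularLocus_PIIID6 {p : Fin 2 → ℂ} (hp : p ∈ PIIID6.parameterSpace) (a : Fin 3 → ℂ) :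
    IsSingularPoint PIIID6.equation (Sum.elim p a) ↔
      ∃ x : AnalyticData PIIID6.type, PIIID6.param x = p ∧ PIIID6.coord x = a ∧ x.IsReducible := by
  have hα : p 0 ≠ 0 := hp 0 (by simp)
  have hβ : p 1 ≠ 0 := hp 1 (by simp)
  have hpe : p = ![p 0, p 1] := vec_eq_two.2 ⟨rfl, rfl⟩
  rw [hpe, isSingularPoint_equation_PIIID6 hα]
  constructor
  · rintro (⟨h, ha⟩ | ⟨h, ha⟩)
    · obtain ⟨x, hx, hx₀, hr⟩ := exists_isReducible_PIIID6_left hα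
      rw [h] at ha hx ⊢
      refine ⟨x, hx, ?_, hr⟩
      rcases isReducible_PIIID6 hr with ⟨-, hc⟩ | ⟨-, hc⟩
      · rw [hc, ha, hx]
        rfl
      · rw [hc] at hx₀
        exact absurd hx₀ (by simp)
    · obtain ⟨x, hx, hx₀, hr⟩ := exists_isReducible_PIIID6_right hα hβ h
      refine ⟨x, hx, ?_, hr⟩
      rcases isReducible_PIIID6 hr with ⟨-, hc⟩ | ⟨-, hc⟩
      · rw [hc] at hx₀
        exact absurd hx₀ (by simp)
      · rw [hc, ha, hx]
        rfl
  · rintro ⟨x, h₁, h₂, hx⟩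
    have h := isReducible_PIIID6 hx
    rw [h₁, h₂] at h
    exact h

theorem isSingularPoint_PIIID6_left {α β : ℂ} (hα : α ≠ 0) (h : α = β) :
    IsSingularPoint (PIIID6.fibre ![α, β]) ![0, -α, α + α⁻¹] ∧
      HasTypeA 1 (PIIID6.fibre ![α, β]) ![0, -α, α + α⁻¹] := by
  have hs := (isSingularPoint_fibre_PIIID6 (β := β) hα ![0, -α, α + α⁻¹]).2 (Or.inl ⟨h, rfl⟩)
  refine ⟨hs, ?_⟩
  rw [fibre_PIIID6] at hs ⊢
  exact hasTypeA_one _ hs (by simpa using hα)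

theorem isSingularPoint_PIIID6_right {α β : ℂ} (hα : α ≠ 0) (h : α = β⁻¹) :
    IsSingularPoint (PIIID6.fibre ![α, β]) ![-1, 0, α + α⁻¹] ∧
      HasTypeA 1 (PIIID6.fibre ![α, β]) ![-1, 0, α + α⁻¹] := by
  have hs := (isSingularPoint_fibre_PIIID6 (β := β) hα ![-1, 0, α + α⁻¹]).2 (Or.inr ⟨h, rfl⟩)
  refine ⟨hs, ?_⟩
  rw [fibre_PIIID6] at hs ⊢
  exact hasTypeA_one _ hs (by simp)

theorem hasSingularities_PIIID6_nil {α β : ℂ} (hα : α ≠ 0) (h : α ≠ β) (h' : α ≠ β⁻¹) :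
    HasSingularities (PIIID6.fibre ![α, β]) [] :=
  hasSingularities_nil fun a ha => ((isSingularPoint_fibre_PIIID6 hα a).1 ha).elim
    (fun ha => h ha.1) fun ha => h' ha.1

theorem hasSingularities_PIIID6_left {α β : ℂ} (hα : α ≠ 0) (h : α = β) (h' : α ≠ β⁻¹) :
    HasSingularities (PIIID6.fibre ![α, β]) [(![0, -α, α + α⁻¹], 1)] :=
  have hs := isSingularPoint_PIIID6_left hα h
  hasSingularities_singleton (fun b hb => ((isSingularPoint_fibre_PIIID6 hα b).1 hb).elim And.right
    fun hb => absurd hb.1 h') hs.1 hs.2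

theorem hasSingularities_PIIID6_right {α β : ℂ} (hα : α ≠ 0) (h : α ≠ β) (h' : α = β⁻¹) :
    HasSingularities (PIIID6.fibre ![α, β]) [(![-1, 0, α + α⁻¹], 1)] :=
  have hs := isSingularPoint_PIIID6_right hα h'
  hasSingularities_singleton (fun b hb => ((isSingularPoint_fibre_PIIID6 hα b).1 hb).elim
    (fun hb => absurd hb.1 h) And.right) hs.1 hs.2

theorem hasSingularities_PIIID6_both {α β : ℂ} (hα : α ≠ 0) (h : α = β) (h' : α = β⁻¹) :
    HasSingularities (PIIID6.fibre ![α, β])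
      [(![0, -α, α + α⁻¹], 1), (![-1, 0, α + α⁻¹], 1)] := by
  have hs := isSingularPoint_PIIID6_left hα h
  have hs' := isSingularPoint_PIIID6_right hα h'
  refine hasSingularities_pair (fun h0 => ?_) (fun b hb =>
    ((isSingularPoint_fibre_PIIID6 hα b).1 hb).imp And.right And.right) hs.1 hs'.1 hs.2 hs'.2
  have : (0 : ℂ) = -1 := congrFun h0 0
  norm_num at this

end MonodromyFamily
end

noncomputable section

open SL2

namespace MonodromyFamily

/-! ### The fifth Painlevé equation -/

theorem trace_conj_mul_conj (g A B : SL2) :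
    (g * A * g⁻¹ * (g * B * g⁻¹)).1.trace = (A * B).1.trace := by
  rw [show g * A * g⁻¹ * (g * B * g⁻¹) = g * (A * B) * g⁻¹ by group, trace_conj]

theorem relation_PV (x : AnalyticData PV.type) :
    LocalData.top (τ := .unramified 1) (x.loc 2) =
      (x.monodromyAt 2 0 * x.monodromyAt 2 1)⁻¹ := by
  have h := x.relation_three 2
  exact (x.monodromyAt_self 2).symm.trans (mul_eq_one_iff_inv_eq.1 h).symm

theorem param_PV_ne_zero (x : AnalyticData PV.type) : PV.param x 2 ≠ 0 :=
  LocalData.formal_ne_zero (r := 1) (x.loc 2)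

/-- The traces give the upper left entries and the determinants give the products within one matrix.
The mixed products come from the upper left entry of `(M₁M₂)⁻¹`, which is `s₃`, and from `tr(M₁M₂)`.
-/
theorem entries_PV (x : AnalyticData PV.type) :
    x.monodromyAt 2 0 0 0 = PV.param x 0 - PV.coord x 0 ∧
    x.monodromyAt 2 1 0 0 = PV.param x 1 - PV.coord x 1 ∧
    x.monodromyAt 2 0 0 1 * x.monodromyAt 2 0 1 0 =
      (PV.param x 0 - PV.coord x 0) * PV.coord x 0 - 1 ∧
    x.monodromyAt 2 1 0 1 * x.monodromyAt 2 1 1 0 =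
      (PV.param x 1 - PV.coord x 1) * PV.coord x 1 - 1 ∧
    x.monodromyAt 2 1 0 1 * x.monodromyAt 2 0 1 0 =
      PV.param x 2 - PV.coord x 0 * PV.coord x 1 ∧
    x.monodromyAt 2 0 0 1 * x.monodromyAt 2 1 1 0 =
      PV.coord x 2 - PV.param x 2
        - (PV.param x 0 - PV.coord x 0) * (PV.param x 1 - PV.coord x 1) := by
  have h₀ : PV.param x 0 = _ :=
    (x.trace_monodromyAt_of_regular 2 0 rfl).symm.trans (trace_entry _)
  have h₁ : PV.param x 1 = _ :=
    (x.trace_monodromyAt_of_regular 2 1 rfl).symm.trans (trace_entry _)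
  have h₂ : PV.param x 2 = _ := (LocalData.top_entries (x.loc 2)).1.symm.trans
    (congrArg (fun m : SL2 => m 0 0) (relation_PV x))
  rw [inv_entry₀₀, mul_entry (x.monodromyAt 2 0)] at h₂
  have h₃ : PV.coord x 2 = _ := trace_entry (x.monodromyAt 2 0 * x.monodromyAt 2 1)
  rw [mul_entry (x.monodromyAt 2 0), mul_entry (x.monodromyAt 2 0)] at h₃
  have hd₀ := det_entry (x.monodromyAt 2 0)
  have hd₁ := det_entry (x.monodromyAt 2 1)
  have e₀ : x.monodromyAt 2 0 1 1 = PV.coord x 0 := rfl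
  have e₁ : x.monodromyAt 2 1 1 1 = PV.coord x 1 := rfl
  rw [e₀] at h₀ h₂ h₃ hd₀
  rw [e₁] at h₁ h₂ h₃ hd₁
  generalize PV.param x 0 = s₁ at *
  generalize PV.param x 1 = s₂ at *
  generalize PV.param x 2 = s₃ at *
  generalize PV.coord x 0 = x₁ at *
  generalize PV.coord x 1 = x₂ at *
  generalize PV.coord x 2 = x₃ at *
  generalize x.monodromyAt 2 0 = M at *
  generalize x.monodromyAt 2 1 = N at *
  have ha : M 0 0 = s₁ - x₁ := by linear_combination -h₀
  have ha' : N 0 0 = s₂ - x₂ := by linear_combination -h₁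
  rw [ha] at hd₀ h₃
  rw [ha'] at hd₁ h₃
  refine ⟨ha, ha', ?_, ?_, ?_, ?_⟩
  · linear_combination -hd₀
  · linear_combination -hd₁
  · linear_combination -h₂
  · linear_combination h₂ - h₃

/-- For the off-diagonal entries `b, c` of `M₁` and `b', c'` of `M₂` the cubic is `(bc)(b'c') =
(b'c)(bc')`. -/
theorem equation_PV (x : AnalyticData PV.type) :
    eval (Sum.elim (PV.param x) (PV.coord x)) PV.equation = 0 := by
  obtain ⟨-, -, h₁, h₂, h₃, h₄⟩ := entries_PV x
  simp only [map_add, map_sub, map_mul, map_pow, eval_X, Sum.elim_inr, Sum.elim_inl, map_one]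
  show PV.coord x 0 * PV.coord x 1 * PV.coord x 2 + PV.coord x 0 ^ 2 + PV.coord x 1 ^ 2
    - (PV.param x 0 + PV.param x 1 * PV.param x 2) * PV.coord x 0
    - (PV.param x 1 + PV.param x 0 * PV.param x 2) * PV.coord x 1
    - PV.param x 2 * PV.coord x 2 + PV.param x 2 ^ 2
    + PV.param x 0 * PV.param x 1 * PV.param x 2 + 1 = 0
  generalize PV.param x 0 = s₁ at *
  generalize PV.param x 1 = s₂ at *
  generalize PV.param x 2 = s₃ at *
  generalize PV.coord x 0 = x₁ at *
  generalize PV.coord x 1 = x₂ at *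
  generalize PV.coord x 2 = x₃ at *
  generalize x.monodromyAt 2 0 = M at *
  generalize x.monodromyAt 2 1 = N at *
  linear_combination (-(N 0 1 * N 1 0)) * h₁ - ((s₁ - x₁) * x₁ - 1) * h₂
    + M 0 1 * N 1 0 * h₃ + (s₃ - x₁ * x₂) * h₄

/-- The torus normalisation is `c = 1` for the lower left entry of `M₁`. Then `b' = s₃ - x₁x₂`, and
since this is assumed non-zero, `det M₂ = 1` gives `c'`. -/
theorem exists_PV {s₁ s₂ s₃ : ℂ} (hs : s₃ ≠ 0) {a : Fin 3 → ℂ} (ha : s₃ - a 0 * a 1 ≠ 0)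
    (h : a 0 * a 1 * a 2 + a 0 ^ 2 + a 1 ^ 2 - (s₁ + s₂ * s₃) * a 0 - (s₂ + s₁ * s₃) * a 1
      - s₃ * a 2 + s₃ ^ 2 + s₁ * s₂ * s₃ + 1 = 0) :
    ∃ x : AnalyticData PV.type, PV.param x = ![s₁, s₂, s₃] ∧ PV.coord x = a := by
  let M : SL2 := SL2.mk (s₁ - a 0) ((s₁ - a 0) * a 0 - 1) 1 (a 0) (by ring)
  let N : SL2 := SL2.mk (s₂ - a 1) (s₃ - a 0 * a 1)
    (((s₂ - a 1) * a 1 - 1) / (s₃ - a 0 * a 1)) (a 1) (by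
      linear_combination -(mul_div_cancel₀ ((s₂ - a 1) * a 1 - 1) ha))
  have hT : (M * N)⁻¹ 0 0 = s₃ := by
    simp [-Matrix.SpecialLinearGroup.coe_mul, -Matrix.SpecialLinearGroup.coe_inv, mul_entry, M, N]
    ring
  let x : AnalyticData PV.type := AnalyticData.ofThree (LocalData.ofRegular M)
    (LocalData.ofRegular N) (LocalData.ofTop (M * N)⁻¹ (hT.symm ▸ hs)) (by
      rw [LocalData.top_regular, LocalData.top_regular, LocalData.top_ofTop]
      exact mul_inv_cancel _)
  have hM : x.monodromyAt 2 0 = M := by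
    show 1 * (1⁻¹ * (LocalData.ofRegular M).top * 1) * 1⁻¹ = M
    rw [LocalData.top_regular]
    simp [LocalData.ofRegular]
  have hN : x.monodromyAt 2 1 = N := by
    show 1 * (1⁻¹ * (LocalData.ofRegular N).top * 1) * 1⁻¹ = N
    rw [LocalData.top_regular]
    simp [LocalData.ofRegular]
  refine ⟨x, vec_eq.2 ⟨?_, ?_, hT⟩, ext_three ?_ ?_ ?_⟩
  · show M.1.trace = s₁
    rw [trace_entry]
    simp [M]
  · show N.1.trace = s₂
    rw [trace_entry]
    simp [N]
  · show x.monodromyAt 2 0 1 1 = a 0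
    rw [hM]; rfl
  · show x.monodromyAt 2 1 1 1 = a 1
    rw [hN]; rfl
  · show (x.monodromyAt 2 0 * x.monodromyAt 2 1).1.trace = a 2
    rw [hM, hN, trace_entry]
    simp only [mul_entry, M, N, mk_entry₀₀, mk_entry₀₁, mk_entry₁₀, mk_entry₁₁]
    field_simp
    linear_combination h

theorem irreducible_PV : Irreducible PV.equation := by
  have hX : ∀ i : Fin 3, i ≠ 2 →
      (Y i : MvPolynomial (Fin 3 ⊕ Fin 3) ℂ) ∈ supported ℂ {Sum.inr 2}ᶜ :=
    fun i hi => X_mem_supported_compl (by simpa using hi)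
  have hS : ∀ i, (S i : MvPolynomial (Fin 3 ⊕ Fin 3) ℂ) ∈ supported ℂ {Sum.inr 2}ᶜ :=
    fun i => X_mem_supported_compl (by simp)
  have h₀ := hX 0 (by decide)
  have h₁ := hX 1 (by decide)
  have hA : Irreducible (Y 0 * Y 1 - S 2 : MvPolynomial (Fin 3 ⊕ Fin 3) ℂ) :=
    irreducible_of_linear (Sum.inl 2) (A := -1) (B := Y 0 * Y 1) (by ring)
      (neg_mem (one_mem _)) (mul_mem (X_mem_supported_compl (by simp))
      (X_mem_supported_compl (by simp))) isUnit_one.neg.isRelPrime_left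
      (neg_ne_zero.2 one_ne_zero)
  refine irreducible_of_linear (Sum.inr 2) (A := Y 0 * Y 1 - S 2)
    (B := Y 0 ^ 2 + Y 1 ^ 2 - (S 0 + S 1 * S 2) * Y 0 - (S 1 + S 0 * S 2) * Y 1
      + S 2 ^ 2 + S 0 * S 1 * S 2 + 1) ?_ (sub_mem (mul_mem h₀ h₁) (hS 2))
    (add_mem (add_mem (add_mem (sub_mem (sub_mem (add_mem (pow_mem h₀ 2) (pow_mem h₁ 2))
      (mul_mem (add_mem (hS 0) (mul_mem (hS 1) (hS 2))) h₀))
      (mul_mem (add_mem (hS 1) (mul_mem (hS 0) (hS 2))) h₁)) (pow_mem (hS 2) 2))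
      (mul_mem (mul_mem (hS 0) (hS 1)) (hS 2))) (one_mem _))
    (isRelPrime_of_eval hA 0 (by simp) (by simp)) hA.ne_zero
  show Y 0 * Y 1 * Y 2 + Y 0 ^ 2 + Y 1 ^ 2 - (S 0 + S 1 * S 2) * Y 0 - (S 1 + S 0 * S 2) * Y 1
    - S 2 * Y 2 + S 2 ^ 2 + S 0 * S 1 * S 2 + 1 = _
  ring

theorem dvd_PV (g : MvPolynomial (Fin 3 ⊕ Fin 3) ℂ)
    (hg : ∀ x, eval (Sum.elim (PV.param x) (PV.coord x)) g = 0) : PV.equation ∣ g := by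
  refine dvd_of_vanishing_on_data irreducible_PV (h := S 2 * (S 2 - Y 0 * Y 1))
    (b := Sum.elim ![0, 0, 1] ![0, 0, 2]) ?_ ?_ ?_ g hg
  · simp
    norm_num
  · simp
  · intro p a hpa hh
    simp at hpa hh
    obtain ⟨x, h₁, h₂⟩ := exists_PV hh.1 hh.2 hpa
    exact ⟨x, by rw [h₁]; exact (vec_eq.2 ⟨rfl, rfl, rfl⟩).symm, h₂⟩

theorem coord_mem_invariantRing_PV (i : Fin 3) :
    (fun x => PV.coord x i) ∈ AnalyticData.invariantRing PV.type := by
  have hm : ∀ j, (fun x : AnalyticData PV.type => x.monodromyAt 2 j 1 1) ∈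
      AnalyticData.invariantRing PV.type := by
    intro j
    refine (AnalyticData.mem_invariantRing_iff _).2 ⟨AnalyticData.monodromyAt_mem 2 j 1 1,
      fun x σ ρ h => ?_⟩
    obtain ⟨h₁, h₂⟩ : ρ 2 0 1 = 0 ∧ ρ 2 1 0 = 0 := h 2
    have hdet := AnalyticData.diag_mul_of_isAdmissible (n := 1) rfl (h 2)
    rw [AnalyticData.monodromyAt_act, mul_entry, mul_entry (ρ 2), mul_entry (ρ 2), inv_entry₀₁,
      inv_entry₁₁, h₁, h₂]
    linear_combination x.monodromyAt 2 j 1 1 * hdet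
  fin_cases i
  · exact hm 0
  · exact hm 1
  · refine (AnalyticData.mem_invariantRing_iff _).2
      ⟨((AnalyticData.monodromyAt_mem 2 0).mul (AnalyticData.monodromyAt_mem 2 1)).trace,
      fun x σ ρ h => ?_⟩
    show ((x.act σ ρ h).monodromyAt 2 0 * (x.act σ ρ h).monodromyAt 2 1).1.trace =
      (x.monodromyAt 2 0 * x.monodromyAt 2 1).1.trace
    rw [AnalyticData.monodromyAt_act, AnalyticData.monodromyAt_act]
    exact trace_conj_mul_conj _ _ _

/-- Generators of the functions on the normal forms. -/
def monodromyGenerators : Fin 10 → AnalyticData PV.type → ℂ :=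
  ![fun x => (x.loc 2).formal 0 0, fun x => ((x.loc 2).formal 0 0)⁻¹,
    fun x => x.monodromyAt 2 0 0 0, fun x => x.monodromyAt 2 0 1 1,
    fun x => x.monodromyAt 2 1 0 0, fun x => x.monodromyAt 2 1 1 1,
    fun x => x.monodromyAt 2 0 0 1, fun x => x.monodromyAt 2 1 0 1,
    fun x => x.monodromyAt 2 0 1 0, fun x => x.monodromyAt 2 1 1 0]

/-- The Stokes constants at `∞` are entries of `(M₁M₂)⁻¹` up to powers of the formal eigenvalue. -/
theorem mem_adjoin_monodromyGenerators {f : AnalyticData PV.type → ℂ}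
    (hf : f ∈ AnalyticData.invariantRing PV.type) :
    f ∈ Algebra.adjoin ℂ (Set.range monodromyGenerators) := by
  have hg : ∀ i, monodromyGenerators i ∈ Algebra.adjoin ℂ (Set.range monodromyGenerators) :=
    fun i => Algebra.subset_adjoin ⟨i, rfl⟩
  have hfor := AnalyticData.entriesIn_formal_unramified (τ := PV.type) 2 (m := 1) rfl
    (hg 0) (hg 1)
  have hM : AnalyticData.EntriesIn (Algebra.adjoin ℂ (Set.range monodromyGenerators))
      fun x : AnalyticData PV.type => x.monodromyAt 2 0 := by
    intro i j
    fin_cases i <;> fin_cases j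
    · exact hg 2
    · exact hg 6
    · exact hg 8
    · exact hg 3
  have hN : AnalyticData.EntriesIn (Algebra.adjoin ℂ (Set.range monodromyGenerators))
      fun x : AnalyticData PV.type => x.monodromyAt 2 1 := by
    intro i j
    fin_cases i <;> fin_cases j
    · exact hg 4
    · exact hg 7
    · exact hg 9
    · exact hg 5
  have htop : AnalyticData.EntriesIn (Algebra.adjoin ℂ (Set.range monodromyGenerators))
      fun x : AnalyticData PV.type => LocalData.top (τ := .unramified 1) (x.loc 2) := by
    have : (fun x : AnalyticData PV.type => LocalData.top (τ := .unramified 1) (x.loc 2)) = _ :=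
      funext fun x => relation_PV x
    rw [this]
    exact (hM.mul hN).inv
  have hst : ∀ k, (fun x : AnalyticData PV.type => (x.loc 2).stokes k) ∈
      Algebra.adjoin ℂ (Set.range monodromyGenerators) := by
    intro k
    change Fin 2 at k
    fin_cases k
    · exact AnalyticData.mem_of_eq (mul_mem (hg 0) (htop 1 0)) fun x =>
        (LocalData.stokes_eq_top (x.loc 2)).1
    · exact AnalyticData.mem_of_eq (mul_mem (hg 1) (htop 0 1)) fun x =>
        (LocalData.stokes_eq_top (x.loc 2)).2
  refine AnalyticData.invariant_mem 2 _ (fun j h => ?_) (fun j h => ?_)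
    (fun j h => ?_) (fun j h => ?_) hf <;> fin_cases j
  · exact hM
  · exact hN
  · cases h
  · exact absurd rfl h
  · exact absurd rfl h
  · exact hfor
  · exact absurd rfl h
  · exact absurd rfl h
  · exact hst
  · exact absurd rfl h
  · exact absurd rfl h
  · exact AnalyticData.entriesIn_linkFrom_self 2 _

theorem monodromyAt_torusAct_PV (x : AnalyticData PV.type) (j : Fin 3) (t : ℂ) (ht : t ≠ 0) :
    (x.torusAct 2 (m := 1) rfl t ht).monodromyAt 2 j =
      diag t ht * x.monodromyAt 2 j * (diag t ht)⁻¹ :=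
  AnalyticData.monodromyAt_act _ _ _ _ _ _

/-- The torus acts on the upper right entries of `M₁` and `M₂` with weight `2` and on the lower left
ones with weight `-2`; `entries_PV` supplies the four products. -/
theorem generation_PV (A : Subalgebra ℂ (AnalyticData PV.type → ℂ))
    (hpA : ∀ i, (fun x => PV.param x i) ∈ A) (hcA : ∀ i, (fun x => PV.coord x i) ∈ A)
    (hinv : (fun x : AnalyticData PV.type => ((x.loc 2).formal 0 0)⁻¹) ∈ A)
    {f : AnalyticData PV.type → ℂ} (hf : f ∈ AnalyticData.invariantRing PV.type) : f ∈ A := by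
  refine torus_invariant_mem monodromyGenerators ![0, 0, 0, 0, 0, 0, 1, 1, -1, -1] (by decide)
    (m := 2) (by norm_num) (fun t ht => AnalyticData.torusAct (τ := PV.type) 2 (m := 1) rfl t ht)
    ?_ _ ?_ ?_ (mem_adjoin_monodromyGenerators hf)
    (fun t ht z => ((AnalyticData.mem_invariantRing_iff f).1 hf).2 z _ _ _)
  · intro i t ht z
    have hfor := AnalyticData.formal_torusAct (τ := PV.type) 2 (m := 1) rfl t ht z 0 0
    have hz : (t ^ 2)⁻¹ = t ^ (2 * -1 : ℤ) := by
      rw [show (2 * -1 : ℤ) = -((2 : ℕ) : ℤ) by norm_num, zpow_neg, zpow_natCast]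
    have hm : ∀ j, _ := fun j => monodromyAt_torusAct_PV z j t ht
    have hc : ∀ j, _ := fun j => AnalyticData.conj_diag_entry t ht (z.monodromyAt 2 j)
    fin_cases i
    · simpa [monodromyGenerators] using hfor
    · simpa [monodromyGenerators] using hfor
    · exact (congrArg (fun m : SL2 => m 0 0) (hm 0)).trans ((hc 0).1.trans (one_mul _).symm)
    · exact (congrArg (fun m : SL2 => m 1 1) (hm 0)).trans ((hc 0).2.2.2.trans (one_mul _).symm)
    · exact (congrArg (fun m : SL2 => m 0 0) (hm 1)).trans ((hc 1).1.trans (one_mul _).symm)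
    · exact (congrArg (fun m : SL2 => m 1 1) (hm 1)).trans ((hc 1).2.2.2.trans (one_mul _).symm)
    · exact (congrArg (fun m : SL2 => m 0 1) (hm 0)).trans ((hc 0).2.1)
    · exact (congrArg (fun m : SL2 => m 0 1) (hm 1)).trans ((hc 1).2.1)
    · exact (congrArg (fun m : SL2 => m 1 0) (hm 0)).trans ((hc 0).2.2.1.trans (congrArg (· * _) hz))
    · exact (congrArg (fun m : SL2 => m 1 0) (hm 1)).trans ((hc 1).2.2.1.trans (congrArg (· * _) hz))
  · intro i hi
    fin_cases i
    · exact hpA 2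
    · exact hinv
    · exact AnalyticData.mem_of_eq (sub_mem (hpA 0) (hcA 0)) fun x => (entries_PV x).1
    · exact hcA 0
    · exact AnalyticData.mem_of_eq (sub_mem (hpA 1) (hcA 1)) fun x => (entries_PV x).2.1
    · exact hcA 1
    all_goals simp at hi
  · have ha := sub_mem (hpA 0) (hcA 0)
    have ha' := sub_mem (hpA 1) (hcA 1)
    have h₁ : (fun x : AnalyticData PV.type =>
        x.monodromyAt 2 0 0 1 * x.monodromyAt 2 0 1 0) ∈ A :=
      AnalyticData.mem_of_eq (sub_mem (mul_mem ha (hcA 0)) (one_mem A)) fun x =>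
        (entries_PV x).2.2.1
    have h₂ : (fun x : AnalyticData PV.type =>
        x.monodromyAt 2 1 0 1 * x.monodromyAt 2 1 1 0) ∈ A :=
      AnalyticData.mem_of_eq (sub_mem (mul_mem ha' (hcA 1)) (one_mem A)) fun x =>
        (entries_PV x).2.2.2.1
    have h₃ : (fun x : AnalyticData PV.type =>
        x.monodromyAt 2 1 0 1 * x.monodromyAt 2 0 1 0) ∈ A :=
      AnalyticData.mem_of_eq (sub_mem (hpA 2) (mul_mem (hcA 0) (hcA 1))) fun x =>
        (entries_PV x).2.2.2.2.1
    have h₄ : (fun x : AnalyticData PV.type =>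
        x.monodromyAt 2 0 0 1 * x.monodromyAt 2 1 1 0) ∈ A :=
      AnalyticData.mem_of_eq (sub_mem (sub_mem (hcA 2) (hpA 2)) (mul_mem ha ha')) fun x =>
        (entries_PV x).2.2.2.2.2
    intro i j hi hj
    fin_cases i <;> first | (exfalso; revert hi; decide) | skip
    all_goals fin_cases j <;> first | (exfalso; revert hj; decide) | skip
    · exact h₁
    · exact h₄
    · exact h₃
    · exact h₂

theorem isMonodromySpace_PV : PV.IsMonodromySpace := by
  refine isMonodromySpace_of PV (fun i => ?_) coord_mem_invariantRing_PV (fun i hi x => ?_)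
    (fun i hi => ?_) equation_PV dvd_PV fun A hpA hcA hiA f hf =>
      generation_PV A hpA hcA (hiA 2 (by simp)) hf
  · fin_cases i
    · exact AnalyticData.trace_formal_mem_invariantRing (τ := PV.type) 0
    · exact AnalyticData.trace_formal_mem_invariantRing (τ := PV.type) 1
    · exact AnalyticData.formal_mem_invariantRing (τ := PV.type) 2 (m := 1) rfl 0 0
  · obtain rfl : i = 2 := by simpa using hi
    exact param_PV_ne_zero x
  · obtain rfl : i = 2 := by simpa using hi
    exact AnalyticData.inv_formal_mem (τ := PV.type) 2 (m := 1) rfl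

end MonodromyFamily
end

/-! ### PV: singular points, the reducible divisor and resonance -/

noncomputable section

open SL2

namespace MonodromyFamily

theorem fibre_PV (p : Fin 3 → ℂ) : PV.fibre p =
    triangleCubic 1 1 0 (-(p 0 + p 1 * p 2)) (-(p 1 + p 0 * p 2)) (-p 2)
      (p 2 ^ 2 + p 0 * p 1 * p 2 + 1) := by
  apply eq_triangleCubic
  intro b
  simp [fibre]
  ring

theorem isSingularPoint_fibre_PV {s₁ s₂ s₃ : ℂ} (hs : s₃ ≠ 0) (a : Fin 3 → ℂ) :
    IsSingularPoint (PV.fibre ![s₁, s₂, s₃]) a ↔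
      (a 0 ^ 2 = 1 ∧ s₁ = 2 * a 0 ∧ a = ![a 0, a 0 * s₃, a 0 * s₂]) ∨
      (a 1 ^ 2 = 1 ∧ s₂ = 2 * a 1 ∧ a = ![a 1 * s₃, a 1, a 1 * s₁]) ∨
      ∃ u v : ℂ, u ≠ 0 ∧ v ≠ 0 ∧ s₁ = u + u⁻¹ ∧ s₂ = v + v⁻¹ ∧ s₃ = u * v ∧
        a = ![u, v, u * v + u⁻¹ * v⁻¹] := by
  rw [fibre_PV, isSingularPoint_triangleCubic, vec_eq, vec_eq]
  simp only [vec_eq, Matrix.cons_val]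
  constructor
  · rintro ⟨h₀, h₁, h₂, h₃⟩
    have hxy : s₃ = a 0 * a 1 := by linear_combination -h₃
    have hx : a 0 ≠ 0 := fun h => hs (by rw [hxy, h, zero_mul])
    have hy : a 1 ≠ 0 := fun h => hs (by rw [hxy, h, mul_zero])
    -- with `P = s₁x - x² - 1`, `Q = s₂y - y² - 1`, the equation becomes `P Q = 0`
    have hPQ : ((s₁ - a 0) * a 0 - 1) * ((s₂ - a 1) * a 1 - 1) = 0 := by
      linear_combination h₀ - (a 2 - s₃ - (s₁ - a 0) * (s₂ - a 1)) * h₃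
    -- With `R = x₃ - s₃ - (s₁ - x₁)(s₂ - x₂)` the cubic is `PQ + R(x₁x₂ - s₃)`. These are its
    -- derivatives in `x₁` and `x₂` on `x₁x₂ = s₃`.
    have hx' : (s₁ - 2 * a 0) * ((s₂ - a 1) * a 1 - 1)
        + (a 2 - s₃ - (s₁ - a 0) * (s₂ - a 1)) * a 1 = 0 := by
      linear_combination h₁ - (s₂ - a 1) * h₃
    have hy' : (s₂ - 2 * a 1) * ((s₁ - a 0) * a 0 - 1)
        + (a 2 - s₃ - (s₁ - a 0) * (s₂ - a 1)) * a 0 = 0 := by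
      linear_combination h₂ - (s₁ - a 0) * h₃
    have hboth : (s₁ - a 0) * a 0 - 1 = 0 → (s₂ - a 1) * a 1 - 1 = 0 →
        a 2 - s₃ - (s₁ - a 0) * (s₂ - a 1) = 0 → ∃ u v : ℂ, u ≠ 0 ∧ v ≠ 0 ∧ s₁ = u + u⁻¹ ∧
          s₂ = v + v⁻¹ ∧ s₃ = u * v ∧ a 0 = u ∧ a 1 = v ∧ a 2 = u * v + u⁻¹ * v⁻¹ := by
      intro hP hQ hR
      have hu : s₁ = a 0 + (a 0)⁻¹ := by field_simp; linear_combination hP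
      have hv : s₂ = a 1 + (a 1)⁻¹ := by field_simp; linear_combination hQ
      refine ⟨a 0, a 1, hx, hy, hu, hv, hxy, rfl, rfl, ?_⟩
      rw [hu, hv, hxy] at hR
      linear_combination hR
    rcases mul_eq_zero.1 hPQ with hP | hQ
    · rw [hP, mul_zero, zero_add] at hy'
      have hR := (mul_eq_zero.1 hy').resolve_right hx
      rw [hR, zero_mul, add_zero] at hx'
      rcases mul_eq_zero.1 hx' with h | hQ
      · left
        have hs₁ : s₁ = 2 * a 0 := sub_eq_zero.1 h
        have hsq : a 0 ^ 2 = 1 := by rw [hs₁] at hP; linear_combination hP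
        refine ⟨hsq, hs₁, trivial, ?_, ?_⟩
        · rw [hxy]; linear_combination -a 1 * hsq
        · rw [hs₁, hxy] at hR; linear_combination hR
      · exact Or.inr (Or.inr (hboth hP hQ hR))
    · rw [hQ, mul_zero, zero_add] at hx'
      have hR := (mul_eq_zero.1 hx').resolve_right hy
      rw [hR, zero_mul, add_zero] at hy'
      rcases mul_eq_zero.1 hy' with h | hP
      · right; left
        have hs₂ : s₂ = 2 * a 1 := sub_eq_zero.1 h
        have hsq : a 1 ^ 2 = 1 := by rw [hs₂] at hQ; linear_combination hQ
        refine ⟨hsq, hs₂, ?_, trivial, ?_⟩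
        · rw [hxy]; linear_combination -a 0 * hsq
        · rw [hs₂, hxy] at hR; linear_combination hR
      · exact Or.inr (Or.inr (hboth hP hQ hR))
  · rintro (⟨hsq, hs₁, -, e₁, e₂⟩ | ⟨hsq, hs₂, e₀, -, e₂⟩ | ⟨u, v, hu, hv, hs₁, hs₂, hs₃, e₀, e₁, e₂⟩)
    · rw [e₁, e₂, hs₁]
      refine ⟨?_, ?_, ?_, ?_⟩
      · linear_combination (a 0 * s₂ * s₃ - 1 + s₃ ^ 2) * hsq - 2 * s₃ ^ 2 * hsq
      · linear_combination s₂ * s₃ * hsq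
      · linear_combination s₂ * hsq
      · linear_combination s₃ * hsq
    · rw [e₀, e₂, hs₂]
      refine ⟨?_, ?_, ?_, ?_⟩
      · linear_combination (a 1 * s₁ * s₃ - 1 + s₃ ^ 2) * hsq - 2 * s₃ ^ 2 * hsq
      · linear_combination s₁ * hsq
      · linear_combination s₁ * s₃ * hsq
      · linear_combination s₃ * hsq
    · rw [e₀, e₁, e₂, hs₁, hs₂, hs₃]
      refine ⟨?_, ?_, ?_, ?_⟩ <;> field_simp <;> ring

/-- At a resonant singular point of a fibre, the derivative in `s₁` (or `s₂`) forces the remaining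
trace into the form that makes the point reducible, with `u` (or `v`) equal to `±1`. -/
theorem isSingularPoint_equation_PV {s₁ s₂ s₃ : ℂ} (hs : s₃ ≠ 0) (a : Fin 3 → ℂ) :
    IsSingularPoint PV.equation (Sum.elim ![s₁, s₂, s₃] a) ↔
      ∃ u v : ℂ, u ≠ 0 ∧ v ≠ 0 ∧ s₁ = u + u⁻¹ ∧ s₂ = v + v⁻¹ ∧ s₃ = u * v ∧
        a = ![u, v, u * v + u⁻¹ * v⁻¹] := by
  rw [isSingularPoint_equation_iff PV, isSingularPoint_fibre_PV hs]
  constructor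
  · rintro ⟨h, hd⟩
    have h₀ := hd 0
    have h₁ := hd 1
    simp [pderiv_X] at h₀ h₁
    rcases h with ⟨hsq, hs₁, ha⟩ | ⟨hsq, hs₂, ha⟩ | h
    · obtain ⟨-, e₁, e₂⟩ := vec_eq.1 ha
      have h0 : a 0 ≠ 0 := fun h => by simp [h] at hsq
      have hinv : (a 0)⁻¹ = a 0 := inv_eq_of_mul_eq_one_right (by linear_combination hsq)
      have hs₂ : s₂ = a 0 * s₃ + a 0 * s₃⁻¹ := by
        field_simp
        rw [e₁] at h₀
        linear_combination h₀
      refine ⟨a 0, a 0 * s₃, h0, mul_ne_zero h0 hs, ?_, ?_, ?_, ?_⟩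
      · rw [hinv, hs₁]; ring
      · rw [mul_inv, hinv, hs₂]
      · linear_combination -s₃ * hsq
      · rw [mul_inv, hinv]
        refine vec_eq.2 ⟨rfl, e₁, ?_⟩
        rw [e₂, hs₂]
        ring
    · obtain ⟨e₀, -, e₂⟩ := vec_eq.1 ha
      have h0 : a 1 ≠ 0 := fun h => by simp [h] at hsq
      have hinv : (a 1)⁻¹ = a 1 := inv_eq_of_mul_eq_one_right (by linear_combination hsq)
      have hs₁ : s₁ = a 1 * s₃ + a 1 * s₃⁻¹ := by
        field_simp
        rw [e₀] at h₁
        linear_combination h₁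
      refine ⟨a 1 * s₃, a 1, mul_ne_zero h0 hs, h0, ?_, ?_, ?_, ?_⟩
      · rw [mul_inv, hinv, hs₁]
      · rw [hinv, hs₂]; ring
      · linear_combination -s₃ * hsq
      · rw [mul_inv, hinv]
        refine vec_eq.2 ⟨e₀, rfl, ?_⟩
        rw [e₂, hs₁]
        ring
    · exact h
  · intro h
    refine ⟨Or.inr (Or.inr h), ?_⟩
    obtain ⟨u, v, hu, hv, rfl, rfl, rfl, rfl⟩ := h
    intro i
    fin_cases i <;> simp [pderiv_X] <;> field_simp <;> ring

/-- Writing `s₁ = u + u⁻¹` and `s₂ = v + v⁻¹`, the divisor splits into two factors that compare `s₃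
+ s₃⁻¹` with `w + w⁻¹` for `w = uv` and `w = uv⁻¹`. Inverting `u` and `v` as needed turns `s₃ =
w^{±1}` into `s₃ = uv`. -/
theorem reducibleDivisorPV_eq_zero_iff {s₁ s₂ s₃ : ℂ} (hs : s₃ ≠ 0) :
    reducibleDivisorPV s₁ s₂ s₃ = 0 ↔
      ∃ u v : ℂ, u ≠ 0 ∧ v ≠ 0 ∧ s₁ = u + u⁻¹ ∧ s₂ = v + v⁻¹ ∧ s₃ = u * v := by
  have hroot : ∀ s : ℂ, ∃ u : ℂ, u ≠ 0 ∧ s = u + u⁻¹ := by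
    intro s
    obtain ⟨d, hd⟩ := IsAlgClosed.exists_pow_nat_eq (s ^ 2 / 4 - 1) (n := 2) two_pos
    have h0 : (s / 2 + d) * (s / 2 - d) = 1 := by linear_combination -hd
    have hinv := eq_inv_of_mul_eq_one_right h0
    exact ⟨s / 2 + d, left_ne_zero_of_mul_eq_one h0, by rw [← hinv]; ring⟩
  have heq : ∀ x y : ℂ, x ≠ 0 → y ≠ 0 → x + x⁻¹ = y + y⁻¹ → x = y ∨ x = y⁻¹ := by
    intro x y hx hy h
    field_simp at h
    rcases mul_eq_zero.1 (show (x - y) * (x * y - 1) = 0 by linear_combination h) with h | h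
    · exact Or.inl (sub_eq_zero.1 h)
    · exact Or.inr (eq_inv_of_mul_eq_one_left (sub_eq_zero.1 h))
  have hfac : ∀ u v : ℂ, u ≠ 0 → v ≠ 0 → reducibleDivisorPV (u + u⁻¹) (v + v⁻¹) s₃ =
      (s₃ + s₃⁻¹ - (u * v + (u * v)⁻¹)) * (s₃ + s₃⁻¹ - (u * v⁻¹ + (u * v⁻¹)⁻¹)) := by
    intro u v hu hv
    unfold reducibleDivisorPV
    field_simp
    ring
  constructor
  · intro h
    obtain ⟨u, hu, rfl⟩ := hroot s₁
    obtain ⟨v, hv, rfl⟩ := hroot s₂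
    rw [hfac u v hu hv] at h
    have key : ∀ w : ℂ, w ≠ 0 → s₃ + s₃⁻¹ - (u * w + (u * w)⁻¹) = 0 →
        ∃ u' v' : ℂ, u' ≠ 0 ∧ v' ≠ 0 ∧ u + u⁻¹ = u' + u'⁻¹ ∧ w + w⁻¹ = v' + v'⁻¹ ∧ s₃ = u' * v' := by
      intro w hw h
      rcases heq s₃ (u * w) hs (mul_ne_zero hu hw) (sub_eq_zero.1 h) with h | h
      · exact ⟨u, w, hu, hw, rfl, rfl, h⟩
      · refine ⟨u⁻¹, w⁻¹, inv_ne_zero hu, inv_ne_zero hw, ?_, ?_, h.trans (mul_inv _ _)⟩ <;>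
        rw [inv_inv, add_comm]
    rcases mul_eq_zero.1 h with h | h
    · exact key v hv h
    · have := key v⁻¹ (inv_ne_zero hv) h
      rwa [inv_inv, add_comm v⁻¹] at this
  · rintro ⟨u, v, hu, hv, rfl, rfl, h⟩
    rw [hfac u v hu hv, h, sub_self, zero_mul]

/-- Both monodromies are triangular of the same kind, so all four products in `entries_PV` vanish.
The lower right entries serve as `u` and `v`, and the parameters follow from them. -/
theorem isReducible_PV {x : AnalyticData PV.type} (hx : x.IsReducible) :
    ∃ u v : ℂ, u ≠ 0 ∧ v ≠ 0 ∧ PV.param x = ![u + u⁻¹, v + v⁻¹, u * v] ∧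
      PV.coord x = ![u, v, u * v + u⁻¹ * v⁻¹] := by
  obtain ⟨-, -, h₁, h₂, h₃, h₄⟩ := entries_PV x
  have hdiag : ∀ j k, x.monodromyAt 2 j 0 1 * x.monodromyAt 2 k 1 0 = 0 := by
    intro j k
    rcases hx.triangular 2 (by simp) with ⟨h, -⟩ | ⟨h, -⟩
    · rw [h k, mul_zero]
    · rw [h j, zero_mul]
  rw [hdiag] at h₁ h₂ h₃ h₄
  have e₁ : (PV.param x 0 - PV.coord x 0) * PV.coord x 0 = 1 := by linear_combination -h₁
  have e₂ : (PV.param x 1 - PV.coord x 1) * PV.coord x 1 = 1 := by linear_combination -h₂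
  have i₁ := eq_inv_of_mul_eq_one_left e₁
  have i₂ := eq_inv_of_mul_eq_one_left e₂
  have e₃ : PV.param x 2 = PV.coord x 0 * PV.coord x 1 := by linear_combination -h₃
  refine ⟨PV.coord x 0, PV.coord x 1, right_ne_zero_of_mul_eq_one e₁,
    right_ne_zero_of_mul_eq_one e₂, vec_eq.2 ⟨?_, ?_, e₃⟩, vec_eq.2 ⟨rfl, rfl, ?_⟩⟩
  · linear_combination i₁
  · linear_combination i₂
  · rw [i₁, i₂] at h₄
    linear_combination e₃ - h₄

theorem exists_isReducible_PV {u v : ℂ} (hu : u ≠ 0) (hv : v ≠ 0) :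
    ∃ x : AnalyticData PV.type, PV.param x = ![u + u⁻¹, v + v⁻¹, u * v] ∧
      PV.coord x = ![u, v, u * v + u⁻¹ * v⁻¹] ∧ x.IsReducible := by
  let d : LocalData (.unramified 1) := LocalData.ofUnramified 1 (u * v) (mul_ne_zero hu hv) 0
  let M : SL2 := diag u⁻¹ (inv_ne_zero hu)
  let N : SL2 := diag v⁻¹ (inv_ne_zero hv)
  have hd : d.top = diag (u * v) (mul_ne_zero hu hv) := top_ofUnramified_zero _ _
  let x : AnalyticData PV.type := AnalyticData.ofThree (LocalData.ofRegular M)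
    (LocalData.ofRegular N) d (by
      rw [LocalData.top_regular, LocalData.top_regular, hd, eq_iff_entries]
      simp [-Matrix.SpecialLinearGroup.coe_mul, mul_entry, LocalData.ofRegular, M, N]
      constructor <;> field_simp)
  have hM : x.monodromyAt 2 0 = M := by
    show 1 * (1⁻¹ * (LocalData.ofRegular M).top * 1) * 1⁻¹ = M
    rw [LocalData.top_regular]
    simp [LocalData.ofRegular]
  have hN : x.monodromyAt 2 1 = N := by
    show 1 * (1⁻¹ * (LocalData.ofRegular N).top * 1) * 1⁻¹ = N
    rw [LocalData.top_regular]
    simp [LocalData.ofRegular]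
  refine ⟨x, vec_eq.2 ⟨?_, ?_, rfl⟩, vec_eq.2 ⟨?_, ?_, ?_⟩, ?_⟩
  · show M.1.trace = _
    rw [trace_entry]
    simp [M, add_comm]
  · show N.1.trace = _
    rw [trace_entry]
    simp [N, add_comm]
  · show x.monodromyAt 2 0 1 1 = u
    rw [hM]
    simp [M]
  · show x.monodromyAt 2 1 1 1 = v
    rw [hN]
    simp [N]
  · show (x.monodromyAt 2 0 * x.monodromyAt 2 1).1.trace = _
    rw [hM, hN, trace_entry]
    simp [-Matrix.SpecialLinearGroup.coe_mul, mul_entry, M, N, add_comm]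
  · refine AnalyticData.isReducible_of_entries _ fun j => Or.inl ?_
    fin_cases j
    · exact ⟨rfl, rfl, fun k => k.elim0⟩
    · exact ⟨rfl, rfl, fun k => k.elim0⟩
    · refine ⟨rfl, rfl, fun k => ?_⟩
      exact (congrArg (fun m : SL2 => m 1 0)
        (stokesMap_ofUnramified_zero (mul_ne_zero hu hv) k)).trans (by simp)

theorem reducibleAt_PV {s₁ s₂ s₃ : ℂ} (hs : s₃ ≠ 0) :
    PV.ReducibleAt ![s₁, s₂, s₃] ↔ reducibleDivisorPV s₁ s₂ s₃ = 0 := by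
  rw [reducibleDivisorPV_eq_zero_iff hs]
  constructor
  · rintro ⟨x, hx, hr⟩
    obtain ⟨u, v, hu, hv, hp, -⟩ := isReducible_PV hr
    rw [hx] at hp
    exact ⟨u, v, hu, hv, vec_eq.1 hp⟩
  · rintro ⟨u, v, hu, hv, rfl, rfl, rfl⟩
    obtain ⟨x, hx, -, hr⟩ := exists_isReducible_PV hu hv
    exact ⟨x, hx, hr⟩

theorem singularLocus_PV {p : Fin 3 → ℂ} (hp : p ∈ PV.parameterSpace) (a : Fin 3 → ℂ) :
    IsSingularPoint PV.equation (Sum.elim p a) ↔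
      ∃ x : AnalyticData PV.type, PV.param x = p ∧ PV.coord x = a ∧ x.IsReducible := by
  have hs : p 2 ≠ 0 := hp 2 (by simp)
  have hpe : p = ![p 0, p 1, p 2] := vec_eq.2 ⟨rfl, rfl, rfl⟩
  rw [hpe, isSingularPoint_equation_PV hs]
  constructor
  · rintro ⟨u, v, hu, hv, h₀, h₁, h₂, rfl⟩
    rw [h₀, h₁, h₂]
    exact exists_isReducible_PV hu hv
  · rintro ⟨x, h₁, h₂, hx⟩
    obtain ⟨u, v, hu, hv, h, h'⟩ := isReducible_PV hx
    rw [h₁] at h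
    rw [h₂] at h'
    exact ⟨u, v, hu, hv, congrFun h 0, congrFun h 1, congrFun h 2, h'⟩

theorem resonantAt_PV {s₁ s₂ s₃ : ℂ} (hs : s₃ ≠ 0) :
    PV.ResonantAt ![s₁, s₂, s₃] ↔ s₁ = 2 ∨ s₁ = -2 ∨ s₂ = 2 ∨ s₂ = -2 := by
  constructor
  · rintro ⟨x, hx, j, hj, h⟩
    fin_cases j
    · have : (x.loc 0).formal.1.trace = s₁ := congrFun hx 0
      rw [← this]
      exact h.elim Or.inl fun h => Or.inr (Or.inl h)
    · have : (x.loc 1).formal.1.trace = s₂ := congrFun hx 1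
      rw [← this]
      exact Or.inr (Or.inr h)
    · cases hj
  · intro h
    -- At `x₁ = 0`, `x₂ = s₂` the equation is linear in `x₃` with coefficient `-s₃ ≠ 0`, so data
    -- exist for all parameters.
    obtain ⟨x, hx, -⟩ := exists_PV (s₁ := s₁) (s₂ := s₂) hs
      (a := ![0, s₂, (s₂ ^ 2 - (s₂ + s₁ * s₃) * s₂ + s₃ ^ 2 + s₁ * s₂ * s₃ + 1) / s₃])
      (by simpa using hs) (by simp; field_simp; ring)
    have h₀ : (x.loc 0).formal.1.trace = s₁ := congrFun hx 0
    have h₁ : (x.loc 1).formal.1.trace = s₂ := congrFun hx 1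
    rw [← or_assoc] at h
    rcases h with h | h
    · exact ⟨x, hx, 0, rfl, h₀.symm ▸ h⟩
    · exact ⟨x, hx, 1, rfl, h₁.symm ▸ h⟩

end MonodromyFamily
end

/-! ### PV: types of the singular points -/

noncomputable section

open SL2

namespace MonodromyFamily

theorem hasTypeA_one_PV {p a : Fin 3 → ℂ} (hs : IsSingularPoint (PV.fibre p) a)
    (h : a 0 ^ 2 - a 2 * a 0 * a 1 + a 1 ^ 2 ≠ 0) : HasTypeA 1 (PV.fibre p) a := by
  rw [fibre_PV] at hs ⊢
  exact hasTypeA_one a hs (by rwa [one_mul, one_mul])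

theorem hasTypeA_two_PV {p a : Fin 3 → ℂ} (hs : IsSingularPoint (PV.fibre p) a) (hq : a 1 ≠ 0)
    (h : a 0 ^ 2 - a 2 * a 0 * a 1 + a 1 ^ 2 = 0) (h' : 2 * a 1 - a 2 * a 0 ≠ 0) :
    HasTypeA 2 (PV.fibre p) a := by
  rw [fibre_PV] at hs ⊢
  exact hasTypeA_two a hs hq (by rwa [one_mul, one_mul]) (by rwa [mul_one])

theorem hasTypeA_three_PV {p a : Fin 3 → ℂ} (hs : IsSingularPoint (PV.fibre p) a) (hq : a 1 ≠ 0)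
    (h : a 0 ^ 2 - a 2 * a 0 * a 1 + a 1 ^ 2 = 0) (h' : 2 * a 1 - a 2 * a 0 = 0) :
    HasTypeA 3 (PV.fibre p) a := by
  rw [fibre_PV] at hs ⊢
  exact hasTypeA_three a hs hq one_ne_zero (by rwa [one_mul, one_mul]) (by rwa [mul_one])

variable {s₁ s₂ s₃ ε δ : ℂ}

theorem sq_eq_one_of_mem (hε : ε ∈ ({1, -1} : Set ℂ)) : ε ^ 2 = 1 := by
  rcases hε with rfl | rfl <;> norm_num

/-- For `s₁ = ±2` the eigenvalues `u` and `u⁻¹` agree, the two factors of the divisor coincide, and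
reducibility becomes a single equation without squares. -/
theorem reducibleDivisorPV_of_left (hε : ε ^ 2 = 1) (h : s₁ = 2 * ε) :
    reducibleDivisorPV s₁ s₂ s₃ = (s₃ + s₃⁻¹ - ε * s₂) ^ 2 := by
  unfold reducibleDivisorPV
  rw [h]
  linear_combination (4 - s₂ ^ 2) * hε

theorem reducibleDivisorPV_of_right (hδ : δ ^ 2 = 1) (h : s₂ = 2 * δ) :
    reducibleDivisorPV s₁ s₂ s₃ = (s₃ + s₃⁻¹ - δ * s₁) ^ 2 := by
  unfold reducibleDivisorPV
  rw [h]
  linear_combination (4 - s₁ ^ 2) * hδ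

theorem isSingularPoint_PV_left (hs : s₃ ≠ 0) (hε : ε ^ 2 = 1) (h : s₁ = 2 * ε) :
    IsSingularPoint (PV.fibre ![s₁, s₂, s₃]) ![ε, ε * s₃, ε * s₂] :=
  (isSingularPoint_fibre_PV hs _).2 (Or.inl ⟨hε, h, rfl⟩)

theorem isSingularPoint_PV_right (hs : s₃ ≠ 0) (hδ : δ ^ 2 = 1) (h : s₂ = 2 * δ) :
    IsSingularPoint (PV.fibre ![s₁, s₂, s₃]) ![δ * s₃, δ, δ * s₁] :=
  (isSingularPoint_fibre_PV hs _).2 (Or.inr (Or.inl ⟨hδ, h, rfl⟩))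

theorem sq_ne_of_left {a : ℂ} (h : a ^ 2 = 1) (h' : s₁ = 2 * a) : s₁ ^ 2 = 4 := by
  rw [h']; linear_combination 4 * h

theorem eq_of_add_inv_eq {u : ℂ} (hu : u ≠ 0) (hε : ε ^ 2 = 1) (h : 2 * ε = u + u⁻¹) : u = ε := by
  field_simp at h
  have : (u - ε) ^ 2 = 0 := by linear_combination hε - h
  exact sub_eq_zero.1 (pow_eq_zero_iff two_ne_zero |>.1 this)

theorem hasSingularities_PV_nil (hs : s₃ ≠ 0) (h₁ : s₁ ^ 2 ≠ 4) (h₂ : s₂ ^ 2 ≠ 4)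
    (h : reducibleDivisorPV s₁ s₂ s₃ ≠ 0) : HasSingularities (PV.fibre ![s₁, s₂, s₃]) [] := by
  refine hasSingularities_nil fun a ha => ?_
  rcases (isSingularPoint_fibre_PV hs a).1 ha with ⟨e, e', -⟩ | ⟨e, e', -⟩ | ⟨u, v, h'⟩
  · exact h₁ (sq_ne_of_left e e')
  · exact h₂ (sq_ne_of_left e e')
  · exact h ((reducibleDivisorPV_eq_zero_iff hs).2
      ⟨u, v, h'.1, h'.2.1, h'.2.2.1, h'.2.2.2.1, h'.2.2.2.2.1⟩)

/-- At the resonant point the quantity deciding about type `A₁` is `s₃(s₃ + s₃⁻¹ - εs₂)`, whose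
vanishing is reducibility. -/
theorem hasSingularities_PV_left (hs : s₃ ≠ 0) (hε : ε ∈ ({1, -1} : Set ℂ)) (h₁ : s₁ = 2 * ε)
    (h₂ : s₂ ^ 2 ≠ 4) (h : reducibleDivisorPV s₁ s₂ s₃ ≠ 0) :
    HasSingularities (PV.fibre ![s₁, s₂, s₃]) [(![ε, ε * s₃, ε * s₂], 1)] := by
  replace hε := sq_eq_one_of_mem hε
  have ha := isSingularPoint_PV_left (s₂ := s₂) hs hε h₁
  refine hasSingularities_singleton (fun b hb => ?_) ha (hasTypeA_one_PV ha ?_)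
  · rcases (isSingularPoint_fibre_PV hs b).1 hb with ⟨e, e', h'⟩ | ⟨e, e', -⟩ | ⟨u, v, h'⟩
    · rw [h₁] at e'
      rwa [← mul_left_cancel₀ two_ne_zero e'] at h'
    · exact absurd (sq_ne_of_left e e') h₂
    · exact absurd ((reducibleDivisorPV_eq_zero_iff hs).2
        ⟨u, v, h'.1, h'.2.1, h'.2.2.1, h'.2.2.2.1, h'.2.2.2.2.1⟩) h
  · rw [reducibleDivisorPV_of_left hε h₁] at h
    intro h'
    apply h
    simp only [Matrix.cons_val] at h'
    have : s₃ + s₃⁻¹ - ε * s₂ = 0 := by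
      field_simp
      linear_combination h' - (s₃ ^ 2 + 1 - ε * s₂ * s₃) * hε
    rw [this]
    ring

/-- The reducible singular point has `u = ε` and coincides with the resonant one. If the linear
coefficient also vanished, then `s₂ = 2εs₃` with `s₃² = 1`, against `s₂² ≠ 4`. -/
theorem hasSingularities_PV_left_reducible (hs : s₃ ≠ 0) (hε : ε ∈ ({1, -1} : Set ℂ))
    (h₁ : s₁ = 2 * ε) (h₂ : s₂ ^ 2 ≠ 4) (h : reducibleDivisorPV s₁ s₂ s₃ = 0) :
    HasSingularities (PV.fibre ![s₁, s₂, s₃]) [(![ε, ε * s₃, s₃ + s₃⁻¹], 2)] := by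
  replace hε := sq_eq_one_of_mem hε
  have hε0 : ε ≠ 0 := fun h0 => by simp [h0] at hε
  rw [reducibleDivisorPV_of_left hε h₁, pow_eq_zero_iff two_ne_zero, sub_eq_zero] at h
  have ha := isSingularPoint_PV_left (s₂ := s₂) hs hε h₁
  rw [h]
  have h3 : s₃ ^ 2 + 1 = ε * s₂ * s₃ := by field_simp at h; linear_combination h
  refine hasSingularities_singleton (fun b hb => ?_) ha (hasTypeA_two_PV ha ?_ ?_ ?_)
  · rcases (isSingularPoint_fibre_PV hs b).1 hb with ⟨e, e', h'⟩ | ⟨e, e', -⟩ |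
      ⟨u, v, hu, hv, e₁, e₂, e₃, h'⟩
    · rw [h₁] at e'
      rwa [← mul_left_cancel₀ two_ne_zero e'] at h'
    · exact absurd (sq_ne_of_left e e') h₂
    · obtain rfl := eq_of_add_inv_eq hu hε (h₁ ▸ e₁)
      rw [h', ← mul_inv, ← e₃, h, e₃]
      refine vec_eq.2 ⟨rfl, ?_, rfl⟩
      simp only [Matrix.cons_val]
      linear_combination -v * hε
  · exact mul_ne_zero hε0 hs
  · simp only [Matrix.cons_val]
    linear_combination (s₃ ^ 2 + 1 - ε * s₂ * s₃) * hε + h3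
  · simp only [Matrix.cons_val]
    intro h'
    have h4 : s₂ = 2 * ε * s₃ := by linear_combination -h' - s₂ * hε
    have h5 : s₃ ^ 2 = 1 := by rw [h4] at h3; linear_combination -h3 - 2 * s₃ ^ 2 * hε
    apply h₂
    rw [h4]
    linear_combination 4 * s₃ ^ 2 * hε + 4 * h5

theorem hasSingularities_PV_right (hs : s₃ ≠ 0) (hδ : δ ∈ ({1, -1} : Set ℂ)) (h₁ : s₁ ^ 2 ≠ 4)
    (h₂ : s₂ = 2 * δ) (h : reducibleDivisorPV s₁ s₂ s₃ ≠ 0) :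
    HasSingularities (PV.fibre ![s₁, s₂, s₃]) [(![δ * s₃, δ, δ * s₁], 1)] := by
  replace hδ := sq_eq_one_of_mem hδ
  have ha := isSingularPoint_PV_right (s₁ := s₁) hs hδ h₂
  refine hasSingularities_singleton (fun b hb => ?_) ha (hasTypeA_one_PV ha ?_)
  · rcases (isSingularPoint_fibre_PV hs b).1 hb with ⟨e, e', -⟩ | ⟨e, e', h'⟩ | ⟨u, v, h'⟩
    · exact absurd (sq_ne_of_left e e') h₁
    · rw [h₂] at e'
      rwa [← mul_left_cancel₀ two_ne_zero e'] at h'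
    · exact absurd ((reducibleDivisorPV_eq_zero_iff hs).2
        ⟨u, v, h'.1, h'.2.1, h'.2.2.1, h'.2.2.2.1, h'.2.2.2.2.1⟩) h
  · rw [reducibleDivisorPV_of_right hδ h₂] at h
    intro h'
    apply h
    simp only [Matrix.cons_val] at h'
    have : s₃ + s₃⁻¹ - δ * s₁ = 0 := by
      field_simp
      linear_combination h' - (s₃ ^ 2 + 1 - δ * s₁ * s₃) * hδ
    rw [this]
    ring

theorem hasSingularities_PV_right_reducible (hs : s₃ ≠ 0) (hδ : δ ∈ ({1, -1} : Set ℂ))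
    (h₁ : s₁ ^ 2 ≠ 4) (h₂ : s₂ = 2 * δ) (h : reducibleDivisorPV s₁ s₂ s₃ = 0) :
    HasSingularities (PV.fibre ![s₁, s₂, s₃]) [(![δ * s₃, δ, s₃ + s₃⁻¹], 2)] := by
  replace hδ := sq_eq_one_of_mem hδ
  have hδ0 : δ ≠ 0 := fun h0 => by simp [h0] at hδ
  rw [reducibleDivisorPV_of_right hδ h₂, pow_eq_zero_iff two_ne_zero, sub_eq_zero] at h
  have ha := isSingularPoint_PV_right (s₁ := s₁) hs hδ h₂
  rw [h]
  have h3 : s₃ ^ 2 + 1 = δ * s₁ * s₃ := by field_simp at h; linear_combination h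
  refine hasSingularities_singleton (fun b hb => ?_) ha (hasTypeA_two_PV ha hδ0 ?_ ?_)
  · rcases (isSingularPoint_fibre_PV hs b).1 hb with ⟨e, e', -⟩ | ⟨e, e', h'⟩ |
      ⟨u, v, hu, hv, e₁, e₂, e₃, h'⟩
    · exact absurd (sq_ne_of_left e e') h₁
    · rw [h₂] at e'
      rwa [← mul_left_cancel₀ two_ne_zero e'] at h'
    · obtain rfl := eq_of_add_inv_eq hv hδ (h₂ ▸ e₂)
      rw [h', ← mul_inv, ← e₃, h, e₃]
      refine vec_eq.2 ⟨?_, rfl, rfl⟩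
      simp only [Matrix.cons_val]
      linear_combination -u * hδ
  · simp only [Matrix.cons_val]
    linear_combination (s₃ ^ 2 + 1 - δ * s₁ * s₃) * hδ + h3
  · simp only [Matrix.cons_val]
    intro h'
    have h4 : s₁ * s₃ = 2 * δ := by linear_combination -h' - s₁ * s₃ * hδ
    have h5 : s₃ ^ 2 = 1 := by linear_combination h3 + δ * h4 + 2 * hδ
    apply h₁
    linear_combination (s₁ * s₃ + 2 * δ) * h4 - s₁ ^ 2 * h5 + 4 * hδ

/-- The two resonant points agree exactly when `s₃ = εδ`, and off the reducible divisor `(s₃ - εδ)²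
≠ 0`; the same quantity decides about type `A₁`. -/
theorem hasSingularities_PV_both (hs : s₃ ≠ 0) (hε : ε ∈ ({1, -1} : Set ℂ))
    (hδ : δ ∈ ({1, -1} : Set ℂ)) (h₁ : s₁ = 2 * ε) (h₂ : s₂ = 2 * δ)
    (h : reducibleDivisorPV s₁ s₂ s₃ ≠ 0) :
    HasSingularities (PV.fibre ![s₁, s₂, s₃])
      [(![ε, ε * s₃, 2 * ε * δ], 1), (![δ * s₃, δ, 2 * ε * δ], 1)] := by
  replace hε := sq_eq_one_of_mem hε
  replace hδ := sq_eq_one_of_mem hδ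
  have ha := isSingularPoint_PV_left (s₂ := s₂) hs hε h₁
  have ha' := isSingularPoint_PV_right (s₁ := s₁) hs hδ h₂
  have e₁ : ε * s₂ = 2 * ε * δ := by rw [h₂]; ring
  have e₂ : δ * s₁ = 2 * ε * δ := by rw [h₁]; ring
  rw [e₁] at ha
  rw [e₂] at ha'
  have hX : s₃ ^ 2 + 1 - 2 * ε * δ * s₃ ≠ 0 := by
    intro h'
    apply h
    rw [reducibleDivisorPV_of_left hε h₁, e₁]
    have : s₃ + s₃⁻¹ - 2 * ε * δ = 0 := by
      field_simp
      linear_combination h'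
    rw [this]
    ring
  refine hasSingularities_pair (fun hne => ?_) (fun b hb => ?_) ha ha' (hasTypeA_one_PV ha ?_)
    (hasTypeA_one_PV ha' ?_)
  · have h0 : ε = δ * s₃ := congrFun hne 0
    apply hX
    rw [h0]
    linear_combination (ε + δ * s₃) * h0 - s₃ ^ 2 * hδ - hε
  · rcases (isSingularPoint_fibre_PV hs b).1 hb with ⟨e, e', h'⟩ | ⟨e, e', h'⟩ | ⟨u, v, h'⟩
    · rw [h₁] at e'
      rw [← mul_left_cancel₀ two_ne_zero e', e₁] at h'
      exact Or.inl h'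
    · rw [h₂] at e'
      rw [← mul_left_cancel₀ two_ne_zero e', e₂] at h'
      exact Or.inr h'
    · exact absurd ((reducibleDivisorPV_eq_zero_iff hs).2
        ⟨u, v, h'.1, h'.2.1, h'.2.2.1, h'.2.2.2.1, h'.2.2.2.2.1⟩) h
  · simp only [Matrix.cons_val]
    intro h'
    apply hX
    linear_combination h' + (-s₃ ^ 2 - 1 + 2 * ε * δ * s₃) * hε
  · simp only [Matrix.cons_val]
    intro h'
    apply hX
    linear_combination h' + (-s₃ ^ 2 - 1 + 2 * ε * δ * s₃) * hδ

/-- Reducibility now means `s₃ = εδ`. Both resonant points and the reducible one coincide, and the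
restricted form is `y²`. -/
theorem hasSingularities_PV_both_reducible (hs : s₃ ≠ 0) (hε : ε ∈ ({1, -1} : Set ℂ))
    (hδ : δ ∈ ({1, -1} : Set ℂ)) (h₁ : s₁ = 2 * ε) (h₂ : s₂ = 2 * δ)
    (h : reducibleDivisorPV s₁ s₂ s₃ = 0) :
    HasSingularities (PV.fibre ![s₁, s₂, s₃]) [(![ε, δ, 2 * ε * δ], 3)] := by
  replace hε := sq_eq_one_of_mem hε
  replace hδ := sq_eq_one_of_mem hδ
  have hδ0 : δ ≠ 0 := fun h0 => by simp [h0] at hδ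
  rw [reducibleDivisorPV_of_left hε h₁, pow_eq_zero_iff two_ne_zero, h₂] at h
  have h3 : s₃ = ε * δ := by
    field_simp at h
    have : (s₃ - ε * δ) ^ 2 = 0 := by linear_combination h + δ ^ 2 * hε + hδ
    exact sub_eq_zero.1 (pow_eq_zero_iff two_ne_zero |>.1 this)
  have ha := isSingularPoint_PV_left (s₂ := s₂) hs hε h₁
  have e₁ : ε * s₂ = 2 * ε * δ := by rw [h₂]; ring
  have e₃ : ε * s₃ = δ := by rw [h3]; linear_combination δ * hε
  rw [e₁, e₃] at ha
  refine hasSingularities_singleton (fun b hb => ?_) ha (hasTypeA_three_PV ha hδ0 ?_ ?_)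
  · rcases (isSingularPoint_fibre_PV hs b).1 hb with ⟨e, e', h'⟩ | ⟨e, e', h'⟩ |
      ⟨u, v, hu, hv, e, e', -, h'⟩
    · rw [h₁] at e'
      rwa [← mul_left_cancel₀ two_ne_zero e', e₁, e₃] at h'
    · rw [h₂] at e'
      rw [← mul_left_cancel₀ two_ne_zero e', h₁, h3] at h'
      rw [h']
      refine vec_eq.2 ⟨?_, rfl, ?_⟩ <;> simp only [Matrix.cons_val]
      · linear_combination ε * hδ
      · ring
    · obtain rfl := eq_of_add_inv_eq hu hε (h₁ ▸ e)
      obtain rfl := eq_of_add_inv_eq hv hδ (h₂ ▸ e')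
      rw [h', inv_eq_of_mul_eq_one_right (a := u) (by linear_combination hε),
        inv_eq_of_mul_eq_one_right (a := v) (by linear_combination hδ)]
      refine vec_eq.2 ⟨rfl, rfl, ?_⟩
      simp only [Matrix.cons_val]
      ring
  · simp only [Matrix.cons_val]
    linear_combination (1 - 2 * δ ^ 2) * hε - hδ
  · simp only [Matrix.cons_val]
    linear_combination -2 * δ * hε

theorem hasSingularities_PV_reducible (hs : s₃ ≠ 0) (h₁ : s₁ ^ 2 ≠ 4) (h₂ : s₂ ^ 2 ≠ 4)
    (h : reducibleDivisorPV s₁ s₂ s₃ = 0) (h₃ : s₃ ≠ 1) (h₃' : s₃ ≠ -1) :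
    s₂ * s₃ - s₁ ≠ 0 ∧ HasSingularities (PV.fibre ![s₁, s₂, s₃])
      [(![(s₃ ^ 2 - 1) / (s₂ * s₃ - s₁), s₃ * (s₂ * s₃ - s₁) / (s₃ ^ 2 - 1), s₃ + s₃⁻¹], 1)] := by
  have hs1 : s₃ ^ 2 - 1 ≠ 0 := by
    rw [show s₃ ^ 2 - 1 = (s₃ - 1) * (s₃ + 1) by ring]
    exact mul_ne_zero (sub_ne_zero.2 h₃) fun h0 => h₃' (eq_neg_of_add_eq_zero_left h0)
  -- This determines `u` from the parameters when `s₃² ≠ 1`, so the pair `(u, v)`, and with it the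
  -- singular point, is unique.
  have hkey : ∀ u v : ℂ, u ≠ 0 → v ≠ 0 → s₁ = u + u⁻¹ → s₂ = v + v⁻¹ → s₃ = u * v →
      s₂ * s₃ - s₁ = (s₃ ^ 2 - 1) / u := by
    rintro u v hu hv rfl rfl rfl
    field_simp
    ring
  obtain ⟨u, v, hu, hv, e₁, e₂, e₃⟩ := (reducibleDivisorPV_eq_zero_iff hs).1 h
  have hd := hkey u v hu hv e₁ e₂ e₃
  have hpt : ∀ u v : ℂ, u ≠ 0 → v ≠ 0 → s₁ = u + u⁻¹ → s₂ = v + v⁻¹ → s₃ = u * v →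
      ![u, v, u * v + u⁻¹ * v⁻¹] =
        ![(s₃ ^ 2 - 1) / (s₂ * s₃ - s₁), s₃ * (s₂ * s₃ - s₁) / (s₃ ^ 2 - 1), s₃ + s₃⁻¹] := by
    intro u v hu hv e₁ e₂ e₃
    refine vec_eq.2 ⟨?_, ?_, ?_⟩
    · rw [hkey u v hu hv e₁ e₂ e₃]
      simp only [Matrix.cons_val]
      field_simp
    · rw [hkey u v hu hv e₁ e₂ e₃]
      simp only [Matrix.cons_val]
      field_simp
      exact (mul_comm v u).trans e₃.symm
    · rw [e₃, mul_inv]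
      rfl
  refine ⟨by rw [hd]; exact div_ne_zero hs1 hu, ?_⟩
  rw [← hpt u v hu hv e₁ e₂ e₃]
  have ha : IsSingularPoint (PV.fibre ![s₁, s₂, s₃]) ![u, v, u * v + u⁻¹ * v⁻¹] :=
    (isSingularPoint_fibre_PV hs _).2 (Or.inr (Or.inr ⟨u, v, hu, hv, e₁, e₂, e₃, rfl⟩))
  refine hasSingularities_singleton (fun b hb => ?_) ha (hasTypeA_one_PV ha ?_)
  · rcases (isSingularPoint_fibre_PV hs b).1 hb with ⟨e, e', -⟩ | ⟨e, e', -⟩ |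
      ⟨u', v', hu', hv', e₁', e₂', e₃', h'⟩
    · exact absurd (sq_ne_of_left e e') h₁
    · exact absurd (sq_ne_of_left e e') h₂
    · rw [h', hpt u v hu hv e₁ e₂ e₃, hpt u' v' hu' hv' e₁' e₂' e₃']
  · simp only [Matrix.cons_val]
    intro h'
    -- At the reducible point the deciding quantity equals `-(u² - 1)(v² - 1)`, so degeneration
    -- would mean resonance.
    have : (u ^ 2 - 1) * (v ^ 2 - 1) = 0 := by
      field_simp at h'
      linear_combination -h'
    rcases mul_eq_zero.1 this with h | h
    · apply h₁
      rw [e₁, inv_eq_of_mul_eq_one_right (a := u) (b := u) (by linear_combination h)]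
      linear_combination 4 * h
    · apply h₂
      rw [e₂, inv_eq_of_mul_eq_one_right (a := v) (b := v) (by linear_combination h)]
      linear_combination 4 * h

/-- For `s₃ = ε` the divisor becomes `(s₂ - εs₁)² = 0`, and both roots of `u² - s₁u + 1` are
possible for `u`. The two roots differ because `s₁² ≠ 4`, and the deciding quantity is `(α - β)²`.
-/
theorem hasSingularities_PV_reducible_pair {α β : ℂ} (hε : ε ∈ ({1, -1} : Set ℂ))
    (hα : α + β = s₁) (hβ : α * β = 1) (h₁ : s₁ ^ 2 ≠ 4) (h₂ : s₂ ^ 2 ≠ 4)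
    (h : reducibleDivisorPV s₁ s₂ s₃ = 0) (h₃ : s₃ = ε) :
    s₂ = ε * s₁ ∧ HasSingularities (PV.fibre ![s₁, s₂, s₃])
      [(![α, ε * β, 2 * ε], 1), (![β, ε * α, 2 * ε], 1)] := by
  replace hε := sq_eq_one_of_mem hε
  have hinv : ε⁻¹ = ε := inv_eq_of_mul_eq_one_right (by linear_combination hε)
  have hε0 : ε ≠ 0 := fun h0 => by simp [h0] at hε
  have e₂ : s₂ = ε * s₁ := by
    rw [reducibleDivisorPV, h₃, hinv] at h
    have : (s₂ - ε * s₁) ^ 2 = 0 := by linear_combination h + (s₁ ^ 2 - 4) * hε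
    exact sub_eq_zero.1 (pow_eq_zero_iff two_ne_zero |>.1 this)
  have hs : s₃ ≠ 0 := h₃ ▸ hε0
  have hα0 := left_ne_zero_of_mul_eq_one hβ
  have hβ0 := right_ne_zero_of_mul_eq_one hβ
  have hpt : ∀ α β : ℂ, α + β = s₁ → α * β = 1 →
      IsSingularPoint (PV.fibre ![s₁, s₂, s₃]) ![α, ε * β, 2 * ε] := by
    intro α β hα hβ
    have iα := inv_eq_of_mul_eq_one_right hβ
    have iβ := inv_eq_of_mul_eq_one_left hβ
    refine (isSingularPoint_fibre_PV hs _).2 (Or.inr (Or.inr ⟨α, ε * β,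
      left_ne_zero_of_mul_eq_one hβ, mul_ne_zero hε0 (right_ne_zero_of_mul_eq_one hβ), ?_, ?_,
      ?_, vec_eq.2 ⟨rfl, rfl, ?_⟩⟩))
    · rw [iα, hα]
    · rw [mul_inv, hinv, iβ, e₂, ← hα]
      ring
    · rw [h₃]
      linear_combination -ε * hβ
    · rw [mul_inv, hinv, iα, iβ]
      simp only [Matrix.cons_val]
      linear_combination -2 * ε * hβ
  have ha := hpt α β hα hβ
  have ha' := hpt β α ((add_comm _ _).trans hα) ((mul_comm _ _).trans hβ)
  have hne : α - β ≠ 0 := by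
    intro h0
    apply h₁
    rw [← hα]
    linear_combination (α - β) * h0 + 4 * hβ
  have htype : ∀ α β : ℂ, α + β = s₁ → α * β = 1 → α - β ≠ 0 →
      α ^ 2 - 2 * ε * α * (ε * β) + (ε * β) ^ 2 ≠ 0 := by
    intro α β hα hβ hne h'
    apply pow_ne_zero 2 hne
    linear_combination h' + (2 * α * β - β ^ 2) * hε
  refine ⟨e₂, hasSingularities_pair (fun h0 => hne (sub_eq_zero.2 (congrFun h0 0)))
    (fun b hb => ?_) ha ha' (hasTypeA_one_PV ha (htype α β hα hβ hne)) (hasTypeA_one_PV ha'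
    (htype β α ((add_comm _ _).trans hα) ((mul_comm _ _).trans hβ) fun h0 => hne ?_))⟩
  · rcases (isSingularPoint_fibre_PV hs b).1 hb with ⟨e, e', -⟩ | ⟨e, e', -⟩ |
      ⟨u, v, hu, hv, f₁, -, f₃, h'⟩
    · exact absurd (sq_ne_of_left e e') h₁
    · exact absurd (sq_ne_of_left e e') h₂
    · have hx : b 2 = 2 * ε := by
        rw [h', ← mul_inv, ← f₃, h₃, hinv]
        simp only [Matrix.cons_val]
        ring
      have b0 : b 0 = u := congrFun h' 0
      have b1 : b 1 = v := congrFun h' 1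
      rw [h₃] at f₃
      rw [← hα] at f₁
      field_simp at f₁
      rcases mul_eq_zero.1 (show (u - α) * (u - β) = 0 by linear_combination -f₁ + hβ) with h0 | h0
      · left
        have hu : u = α := sub_eq_zero.1 h0
        refine vec_eq.2 ⟨b0.trans hu, ?_, hx⟩
        rw [b1, f₃, hu]
        linear_combination -v * hβ
      · right
        have hu : u = β := sub_eq_zero.1 h0
        refine vec_eq.2 ⟨b0.trans hu, ?_, hx⟩
        rw [b1, f₃, hu]
        linear_combination -v * hβ
  · linear_combination -h0

end MonodromyFamily
end

noncomputable section

open SL2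

/-! ### Invariants of triples of unimodular matrices -/

namespace SL2Triple

/-- The traces `a₁, a₂, a₃` of the matrices, followed by `x₁ = tr(M₂M₃)`, `x₂ = tr(M₁M₃)`,
`x₃ = tr(M₁M₂)`. -/
def traces (M : Fin 3 → SL2) : Fin 6 → ℂ :=
  ![(M 0).1.trace, (M 1).1.trace, (M 2).1.trace, (M 1 * M 2).1.trace, (M 0 * M 2).1.trace,
    (M 0 * M 1).1.trace]

/-- The trace of the product of the three matrices. -/
def tripleTrace (M : Fin 3 → SL2) : ℂ := (M 0 * M 1 * M 2).1.trace

/-- The sum of the traces of `M₁M₂M₃` and `M₃M₂M₁`. -/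
def frickeSum : MvPolynomial (Fin 6) ℂ := X 0 * X 3 + X 1 * X 4 + X 2 * X 5 - X 0 * X 1 * X 2

/-- The product of the traces of `M₁M₂M₃` and `M₃M₂M₁`. -/
def frickeProd : MvPolynomial (Fin 6) ℂ :=
  X 3 * X 4 * X 5 + X 3 ^ 2 + X 4 ^ 2 + X 5 ^ 2 - X 1 * X 2 * X 3 - X 2 * X 0 * X 4
    - X 0 * X 1 * X 5 + X 0 ^ 2 + X 1 ^ 2 + X 2 ^ 2 - 4

/-- The polarised Cayley–Hamilton identity; it holds for all `2 × 2` matrices. -/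
theorem frickeSum_eq (M : Fin 3 → SL2) :
    tripleTrace M + (M 2 * M 1 * M 0).1.trace = eval (traces M) frickeSum := by
  have h₀ := det_entry (M 0)
  have h₁ := det_entry (M 1)
  have h₂ := det_entry (M 2)
  simp [-Matrix.SpecialLinearGroup.coe_mul, tripleTrace, traces, frickeSum, trace_entry, mul_entry]
  ring

/-- The traces of `M₁M₂M₃` and `M₃M₂M₁` are the roots of a quadratic with coefficients in the six
traces. This gives the PVI cubic and makes the trace algebra a module of rank two over the
polynomials in the six traces. -/
theorem fricke_relation (M : Fin 3 → SL2) :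
    tripleTrace M ^ 2 = eval (traces M) frickeSum * tripleTrace M - eval (traces M) frickeProd := by
  have h₀ := det_entry (M 0)
  have h₁ := det_entry (M 1)
  have h₂ := det_entry (M 2)
  simp [-Matrix.SpecialLinearGroup.coe_mul, tripleTrace, traces, frickeSum, frickeProd,
    trace_entry, mul_entry]
  generalize M 0 0 0 = a at *
  generalize M 0 0 1 = b at *
  generalize M 0 1 0 = c at *
  generalize M 0 1 1 = d at *
  generalize M 1 0 0 = a' at *
  generalize M 1 0 1 = b' at *
  generalize M 1 1 0 = c' at *
  generalize M 1 1 1 = d' at *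
  generalize M 2 0 0 = a'' at *
  generalize M 2 0 1 = b'' at *
  generalize M 2 1 0 = c'' at *
  generalize M 2 1 1 = d'' at *
  -- The identity has a homogeneous version for arbitrary matrices; the coefficients account for
  -- replacing the three determinants by `1` one after the other.
  linear_combination
    (-((a' * a'' + b' * c'' + c' * b'' + d' * d'') ^ 2
        - (a' + d') * (a'' + d'') * (a' * a'' + b' * c'' + c' * b'' + d' * d'')
        + (a' + d') ^ 2 * (a'' * d'' - b'' * c'') + (a'' + d'') ^ 2 * (a' * d' - b' * c')
        - 4 * (a' * d' - b' * c') * (a'' * d'' - b'' * c''))) * h₀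
    - ((a * a'' + b * c'' + c * b'' + d * d'') ^ 2
        - (a + d) * (a'' + d'') * (a * a'' + b * c'' + c * b'' + d * d'')
        + (a + d) ^ 2 * (a'' * d'' - b'' * c'') + (a'' + d'') ^ 2
        - 4 * (a'' * d'' - b'' * c'')) * h₁
    - ((a * a' + b * c' + c * b' + d * d') ^ 2
        - (a + d) * (a' + d') * (a * a' + b * c' + c * b' + d * d')
        + (a + d) ^ 2 + (a' + d') ^ 2 - 4) * h₂

theorem exists_quadratic_root {A B C : ℂ} (hA : A ≠ 0) : ∃ p, A * p ^ 2 + B * p + C = 0 := by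
  obtain ⟨d, hd⟩ := IsAlgClosed.exists_pow_nat_eq (B ^ 2 - 4 * A * C) (n := 2) two_pos
  refine ⟨(d - B) / (2 * A), ?_⟩
  field_simp
  linear_combination hd

theorem exists_add_inv (s : ℂ) : ∃ u : ℂ, u ≠ 0 ∧ s = u + u⁻¹ := by
  obtain ⟨u, hu⟩ := exists_quadratic_root (A := 1) (B := -s) (C := 1) one_ne_zero
  have hu0 : u ≠ 0 := fun h => by simp [h] at hu
  refine ⟨u, hu0, ?_⟩
  field_simp
  linear_combination -hu

/-- Generic values of the six traces are attained. -/
theorem exists_traces_eq (v : Fin 6 → ℂ) (h : v 5 ^ 2 - 4 ≠ 0)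
    (hκ : v 0 ^ 2 + v 1 ^ 2 + v 5 ^ 2 - v 0 * v 1 * v 5 - 4 ≠ 0) : ∃ M, traces M = v := by
  obtain ⟨u, hu, hv⟩ := exists_add_inv (v 5)
  have hw : u - u⁻¹ ≠ 0 := by
    intro h0
    apply h
    rw [hv]
    have := mul_inv_cancel₀ hu
    linear_combination (u - u⁻¹) * h0 + 4 * this
  have hui := mul_inv_cancel₀ hu
  generalize u⁻¹ = w at *
  -- `r = r₀ + r₁ p` and `q = q₀ + q₁ p`
  let r₀ := (v 3 + v 4 * w - v 1 * v 2) / (u - w)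
  let r₁ := (v 1 - v 0 * w) / (u - w)
  have e₀ : r₀ * (u - w) = v 3 + v 4 * w - v 1 * v 2 := div_mul_cancel₀ _ hw
  have e₁ : r₁ * (u - w) = v 1 - v 0 * w := div_mul_cancel₀ _ hw
  -- Times `(u - u⁻¹)²`, the leading coefficient of the quadratic for `p` is, up to sign, the
  -- quantity assumed non-zero in `hκ`.
  have hlead : -1 - r₁ * (r₁ - v 0) ≠ 0 := by
    intro h0
    apply hκ
    have e₂ : (r₁ - v 0) * (u - w) = v 1 - v 0 * u := by linear_combination e₁
    rw [hv]
    linear_combination -(u - w) ^ 2 * h0 - (r₁ - v 0) * (u - w) * e₁ - (v 1 - v 0 * w) * e₂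
      + (4 - v 0 ^ 2) * hui
  obtain ⟨p, hp⟩ := exists_quadratic_root (B := v 2 - r₀ * (r₁ - v 0) - r₁ * (r₀ + v 4))
    (C := -1 - r₀ * (r₀ + v 4)) hlead
  -- `M₁` is a companion matrix and `M₂` is chosen so that `tr(M₁M₂) = u + u⁻¹`. The conditions on
  -- `tr M₃`, `tr(M₁M₃)` and `tr(M₂M₃)` are linear and leave one free entry `p`, for which `det M₃ =
  -- 1` is a quadratic equation.
  refine ⟨![SL2.mk (v 0) (-1) 1 0 (by ring), SL2.mk 0 u (-w) (v 1) (by linear_combination hui),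
    SL2.mk p (v 4 - v 0 * p + (r₀ + r₁ * p)) (r₀ + r₁ * p) (v 2 - p) (by
      linear_combination hp)], ?_⟩
  funext i
  fin_cases i <;>
    simp [-Matrix.SpecialLinearGroup.coe_mul, traces, trace_entry, mul_entry]
  · linear_combination e₀ + p * e₁
  · ring
  · rw [hv]; ring

end SL2Triple
end

/-! ### The trace algebra: independence and cancellation of denominators -/

noncomputable section

open SL2 AnalyticData

namespace SL2Triple

/-- The triple of transposed matrices. -/
def transpose (M : Fin 3 → SL2) : Fin 3 → SL2 := fun i => (M i).transpose

theorem transpose_entry (A : SL2) (i j : Fin 2) : A.transpose i j = A j i := rfl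

theorem traces_transpose (M : Fin 3 → SL2) : traces (transpose M) = traces M := by
  funext i
  fin_cases i <;> simp only [traces, transpose, trace_entry, mul_entry, transpose_entry] <;>
    simp <;> ring

/-- Transposition reverses products, so it keeps the six traces and exchanges the two roots of the
Fricke quadratic. Both roots are thereby attained. -/
theorem tripleTrace_transpose (M : Fin 3 → SL2) :
    tripleTrace (transpose M) = eval (traces M) frickeSum - tripleTrace M := by
  rw [← frickeSum_eq, add_sub_cancel_left]
  simp only [tripleTrace, transpose, trace_entry, mul_entry, transpose_entry]
  ring

/-- The open set over which triples of matrices with given traces exist and the traces of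
`M₁M₂M₃` and `M₃M₂M₁` differ. -/
def generic : MvPolynomial (Fin 6) ℂ :=
  (X 5 ^ 2 - 4) * (X 0 ^ 2 + X 1 ^ 2 + X 5 ^ 2 - X 0 * X 1 * X 5 - 4) *
    (frickeSum ^ 2 - 4 * frickeProd)

/-- The generic set meets every hyperplane `a₁ = c`; this is needed for `c = ±2`, where the
denominators are cancelled. -/
theorem exists_eval_generic_ne_zero (c : ℂ) : ∃ v : Fin 6 → ℂ, v 0 = c ∧ eval v generic ≠ 0 := by
  by_cases h : c ^ 2 = 4
  · refine ⟨![c, 0, 0, 0, 0, 1], rfl, ?_⟩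
    simp [generic, frickeSum, frickeProd, h]
    norm_num
  · refine ⟨![c, 0, 0, 0, 0, 0], rfl, ?_⟩
    have h' := sub_ne_zero.2 h
    simp [generic, frickeSum, frickeProd, h']

/-- `g₀ + g₁T` vanishes at both roots `T` of the Fricke quadratic, obtained from a triple and its
transpose, and these are distinct because the discriminant is a factor of `generic`. -/
theorem generic_dichotomy {g₀ g₁ : MvPolynomial (Fin 6) ℂ} {v : Fin 6 → ℂ}
    (h : ∀ M, traces M = v → eval v g₀ + eval v g₁ * tripleTrace M = 0)
    (hv : eval v generic ≠ 0) : eval v g₀ = 0 ∧ eval v g₁ = 0 := by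
  simp only [generic, map_mul, map_sub, map_add, map_pow, eval_X, map_ofNat] at hv
  obtain ⟨⟨h₁, h₂⟩, h₃⟩ := mul_ne_zero_iff.1 hv |>.imp_left mul_ne_zero_iff.1
  obtain ⟨M, hM⟩ := exists_traces_eq v h₁ h₂
  have e₁ := h M hM
  have e₂ := h (transpose M) ((traces_transpose M).trans hM)
  have hr := fricke_relation M
  rw [tripleTrace_transpose] at e₂
  rw [hM] at e₂ hr
  have hne : 2 * tripleTrace M - eval v frickeSum ≠ 0 := by
    intro h0
    apply h₃
    linear_combination (2 * tripleTrace M - eval v frickeSum) * h0 - 4 * hr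
  have hg₁ : eval v g₁ = 0 := by
    refine (mul_eq_zero.1 ?_).resolve_right hne
    linear_combination e₁ - e₂
  refine ⟨?_, hg₁⟩
  rw [hg₁, zero_mul, add_zero] at e₁
  exact e₁

/-- Setting the trace of `M₁` to a constant. -/
def specialize (c : ℂ) : MvPolynomial (Fin 6) ℂ →ₐ[ℂ] MvPolynomial (Fin 6) ℂ :=
  aeval (Function.update X 0 (C c))

theorem eval_specialize (c : ℂ) (v : Fin 6 → ℂ) (g : MvPolynomial (Fin 6) ℂ) :
    eval v (specialize c g) = eval (Function.update v 0 c) g := by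
  have : (aeval v).comp (specialize c) = aeval (R := ℂ) (Function.update v 0 c) := by
    ext i
    by_cases h : i = 0
    · subst h; simp [specialize]
    · simp [specialize, h]
  exact DFunLike.congr_fun this g

/-- The monomials in the six traces, and their products with the trace of `M₁M₂M₃`, are linearly
independent, even on the triples with given trace of `M₁`. -/
theorem eval_eq_zero_of_trace_eq {g₀ g₁ : MvPolynomial (Fin 6) ℂ} {c : ℂ}
    (h : ∀ M, traces M 0 = c → eval (traces M) g₀ + eval (traces M) g₁ * tripleTrace M = 0)
    {v : Fin 6 → ℂ} (hv : v 0 = c) : eval v g₀ = 0 ∧ eval v g₁ = 0 := by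
  have key : ∀ w : Fin 6 → ℂ, w 0 = c → eval w generic ≠ 0 → eval w g₀ = 0 ∧ eval w g₁ = 0 :=
    fun w hw hw' => generic_dichotomy (fun M hM => by
      have := h M (by rw [hM, hw]); rwa [hM] at this) hw'
  have hgen : specialize c generic ≠ 0 := by
    obtain ⟨w, hw, hw'⟩ := exists_eval_generic_ne_zero c
    intro h0
    apply hw'
    have := eval_specialize c w generic
    rw [h0, map_zero, ← hw, Function.update_eq_self] at this
    exact this.symm
  have hz : ∀ g, (∀ w : Fin 6 → ℂ, w 0 = c → eval w generic ≠ 0 → eval w g = 0) →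
      eval v g = 0 := by
    intro g hg
    -- On the hyperplane `a₁ = c` the product of `g` with the non-zero polynomial `generic` vanishes
    -- everywhere, and polynomial rings over `ℂ` are domains.
    have : specialize c generic * specialize c g = 0 := by
      refine MvPolynomial.funext fun w => ?_
      rw [map_mul, eval_specialize, eval_specialize, map_zero]
      by_cases hw : eval (Function.update w 0 c) generic = 0
      · rw [hw, zero_mul]
      · rw [hg _ (Function.update_self _ _ _) hw, mul_zero]
    have h0 := (mul_eq_zero.1 this).resolve_left hgen
    have := eval_specialize c v g
    rw [h0, map_zero, ← hv, Function.update_eq_self] at this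
    exact this.symm
  exact ⟨hz g₀ fun w hw hw' => (key w hw hw').1, hz g₁ fun w hw hw' => (key w hw hw').2⟩

theorem eq_zero_of_forall {g₀ g₁ : MvPolynomial (Fin 6) ℂ}
    (h : ∀ M, eval (traces M) g₀ + eval (traces M) g₁ * tripleTrace M = 0) : g₀ = 0 ∧ g₁ = 0 :=
  ⟨MvPolynomial.funext fun v => by
      rw [map_zero]; exact (eval_eq_zero_of_trace_eq (fun M _ => h M) (rfl : v 0 = v 0)).1,
    MvPolynomial.funext fun v => by
      rw [map_zero]; exact (eval_eq_zero_of_trace_eq (fun M _ => h M) (rfl : v 0 = v 0)).2⟩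

theorem X_sub_C_dvd {c : ℂ} {g : MvPolynomial (Fin 6) ℂ}
    (h : ∀ v : Fin 6 → ℂ, v 0 = c → eval v g = 0) : X 0 - C c ∣ g := by
  have hirr : Irreducible (X 0 - C c : MvPolynomial (Fin 6) ℂ) :=
    irreducible_of_linear 0 (A := 1) (B := -C c) (by ring) (one_mem _)
      (neg_mem (C_mem_supported _ c)) isRelPrime_one_left one_ne_zero
  refine dvd_of_vanishing hirr (h := 1) (b := fun _ => c) (by simp) (by simp) fun v hv _ => h v ?_
  simpa [sub_eq_zero] using hv

/-- The polynomials in the six traces and the trace of `M₁M₂M₃`. -/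
def traceAlgebra : Subalgebra ℂ ((Fin 3 → SL2) → ℂ) where
  carrier := {f | ∃ g₀ g₁ : MvPolynomial (Fin 6) ℂ, ∀ M,
    f M = eval (traces M) g₀ + eval (traces M) g₁ * tripleTrace M}
  mul_mem' := by
    rintro f f' ⟨g₀, g₁, h⟩ ⟨g₀', g₁', h'⟩
    -- The square of the triple trace is reduced by `fricke_relation`.
    refine ⟨g₀ * g₀' - g₁ * g₁' * frickeProd, g₀ * g₁' + g₁ * g₀' + g₁ * g₁' * frickeSum,
      fun M => ?_⟩
    rw [Pi.mul_apply, h, h']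
    simp only [map_add, map_mul, map_sub]
    linear_combination (eval (traces M) g₁ * eval (traces M) g₁') * fricke_relation M
  add_mem' := by
    rintro f f' ⟨g₀, g₁, h⟩ ⟨g₀', g₁', h'⟩
    refine ⟨g₀ + g₀', g₁ + g₁', fun M => ?_⟩
    rw [Pi.add_apply, h, h', map_add, map_add]
    ring
  algebraMap_mem' := fun c => ⟨C c, 0, fun M => by simp⟩

theorem traces_mem (i : Fin 6) : (fun M => traces M i) ∈ traceAlgebra :=
  ⟨X i, 0, fun M => by simp⟩

theorem tripleTrace_mem : tripleTrace ∈ traceAlgebra := ⟨0, 1, fun M => by simp⟩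

/-- The functions that are polynomials in the entries of the matrices. -/
def entryAlgebra : Subalgebra ℂ ((Fin 3 → SL2) → ℂ) :=
  Algebra.adjoin ℂ (Set.range fun (k : Fin 3 × Fin 2 × Fin 2) M => M k.1 k.2.1 k.2.2)

theorem entriesIn_entryAlgebra (i : Fin 3) : EntriesIn entryAlgebra fun M => M i :=
  fun a b => Algebra.subset_adjoin ⟨(i, a, b), rfl⟩

theorem traceAlgebra_le : traceAlgebra ≤ entryAlgebra := by
  have ht : ∀ i, (fun M => traces M i) ∈ entryAlgebra := by
    intro i
    have h := entriesIn_entryAlgebra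
    fin_cases i
    · exact (h 0).trace
    · exact (h 1).trace
    · exact (h 2).trace
    · exact ((h 1).mul (h 2)).trace
    · exact ((h 0).mul (h 2)).trace
    · exact ((h 0).mul (h 1)).trace
  have he : ∀ g : MvPolynomial (Fin 6) ℂ, (fun M => eval (traces M) g) ∈ entryAlgebra := by
    intro g
    induction g using MvPolynomial.induction_on with
    | C c => simpa using const_mem entryAlgebra c
    | add p q hp hq => simp only [map_add]; exact add_mem hp hq
    | mul_X p i hp => simp only [map_mul, eval_X]; exact mul_mem hp (ht i)
  rintro f ⟨g₀, g₁, h⟩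
  rw [funext h]
  exact add_mem (he g₀) (mul_mem (he g₁) (((entriesIn_entryAlgebra 0).mul
    (entriesIn_entryAlgebra 1)).mul (entriesIn_entryAlgebra 2)).trace)

/-- A curve through a triple of matrices. -/
def curve (s : ℂ) (M : Fin 3 → SL2) (t : ℂ) : Fin 3 → SL2 :=
  Function.update M 0 (M 0 * (upperSL t * lowerSL (s * t)))

/-- The entries of the curve are polynomials in `t`, so regular functions restrict to polynomials,
where zero divisors are absent. -/
theorem exists_polynomial_curve (s : ℂ) (M : Fin 3 → SL2) {f : (Fin 3 → SL2) → ℂ}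
    (hf : f ∈ entryAlgebra) : ∃ p : Polynomial ℂ, ∀ t, f (curve s M t) = p.eval t := by
  unfold entryAlgebra at hf
  induction hf using Algebra.adjoin_induction with
  | mem f hf =>
    obtain ⟨⟨i, a, b⟩, rfl⟩ := hf
    have hpol : ∀ p : Polynomial ℂ, (fun t => p.eval t) ∈ Set.range
        (fun (p : Polynomial ℂ) t => p.eval t) := fun p => ⟨p, rfl⟩
    by_cases hi : i = 0
    · subst hi
      have e : ∀ t, (upperSL t * lowerSL (s * t)) 0 0 = 1 + s * t ^ 2 ∧
          (upperSL t * lowerSL (s * t)) 0 1 = t ∧ (upperSL t * lowerSL (s * t)) 1 0 = s * t ∧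
          (upperSL t * lowerSL (s * t)) 1 1 = 1 := by
        intro t
        simp [-Matrix.SpecialLinearGroup.coe_mul, mul_entry]
        ring
      fin_cases b
      · refine ⟨Polynomial.C (M 0 a 0) * (1 + Polynomial.C s * Polynomial.X ^ 2) +
          Polynomial.C (M 0 a 1) * (Polynomial.C s * Polynomial.X), fun t => ?_⟩
        simp only [curve, Function.update_self, Fin.zero_eta, mul_entry (M 0), (e t).1,
          (e t).2.2.1]
        simp
      · refine ⟨Polynomial.C (M 0 a 0) * Polynomial.X + Polynomial.C (M 0 a 1), fun t => ?_⟩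
        simp only [curve, Function.update_self, Fin.mk_one, mul_entry (M 0), (e t).2.1,
          (e t).2.2.2]
        simp
    · exact ⟨Polynomial.C (M i a b), fun t => by simp [curve, hi]⟩
  | algebraMap c => exact ⟨Polynomial.C c, fun t => by simp⟩
  | add f g _ _ hf hg =>
    obtain ⟨p, hp⟩ := hf
    obtain ⟨q, hq⟩ := hg
    exact ⟨p + q, fun t => by simp [hp, hq]⟩
  | mul f g _ _ hf hg =>
    obtain ⟨p, hp⟩ := hf
    obtain ⟨q, hq⟩ := hg
    exact ⟨p * q, fun t => by simp [hp, hq]⟩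

/-- A regular function that vanishes where the trace of `M₁` is not `c` vanishes. -/
theorem eq_zero_of_mul_eq_zero {f : (Fin 3 → SL2) → ℂ} (hf : f ∈ entryAlgebra) (c : ℂ)
    (h : ∀ M, (traces M 0 - c) * f M = 0) : f = 0 := by
  funext M
  -- The trace of `M₁` along the curve is a quadratic polynomial in `t` with coefficients `A` and
  -- `B` below; `s` is chosen to make it non-constant.
  obtain ⟨s, hs⟩ : ∃ s : ℂ, M 0 1 0 + s * M 0 0 1 ≠ 0 ∨ s * M 0 0 0 ≠ 0 := by
    by_contra! hcon
    have h₁ := hcon 1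
    have h₂ := hcon (-1)
    have hd := det_entry (M 0)
    have e₀ : M 0 0 1 = 0 := by linear_combination (h₁.1 - h₂.1) / 2
    rw [e₀, show M 0 0 0 = 0 by linear_combination h₁.2] at hd
    simp at hd
  obtain ⟨p, hp⟩ := exists_polynomial_curve s M hf
  generalize hA : M 0 1 0 + s * M 0 0 1 = A at hs
  generalize hB : s * M 0 0 0 = B at hs
  let q : Polynomial ℂ := Polynomial.C (M 0 0 0 + M 0 1 1 - c) + Polynomial.C A * Polynomial.X +
    Polynomial.C B * Polynomial.X ^ 2
  have hq : ∀ t, traces (curve s M t) 0 - c = q.eval t := by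
    intro t
    have : traces (curve s M t) 0 = (M 0 * (upperSL t * lowerSL (s * t))).1.trace := rfl
    rw [this, trace_entry]
    simp [-Matrix.SpecialLinearGroup.coe_mul, mul_entry, q, ← hA, ← hB]
    ring
  have hq0 : q ≠ 0 := by
    intro h0
    rcases hs with hs | hs
    · apply hs
      have := congrArg (fun q : Polynomial ℂ => q.coeff 1) h0
      simpa [q, Polynomial.coeff_X, Polynomial.coeff_X_pow, Polynomial.coeff_C] using this
    · apply hs
      have := congrArg (fun q : Polynomial ℂ => q.coeff 2) h0
      simpa [q, Polynomial.coeff_X, Polynomial.coeff_X_pow, Polynomial.coeff_C] using this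
  have hpq : q * p = 0 := Polynomial.funext fun t => by
    rw [Polynomial.eval_mul, ← hq, ← hp, h, Polynomial.eval_zero]
  have hp0 := (mul_eq_zero.1 hpq).resolve_left hq0
  have := hp 0
  rw [hp0, Polynomial.eval_zero] at this
  have hM : curve s M 0 = M := by
    have h1 : upperSL 0 * lowerSL (s * 0) = 1 := by
      rw [eq_iff_entries]
      simp [-Matrix.SpecialLinearGroup.coe_mul, mul_entry]
    rw [curve, h1, mul_one, Function.update_eq_self]
  rwa [hM] at this

/-- The components `g₀, g₁` of `(a₁ - c)f` vanish on `a₁ = c` by independence there, hence are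
divisible by `a₁ - c`. The quotient agrees with `f` because `a₁ - c` can be cancelled among regular
functions. -/
theorem mem_traceAlgebra_of_mul {f : (Fin 3 → SL2) → ℂ} (hf : f ∈ entryAlgebra) (c : ℂ)
    (h : (fun M => (traces M 0 - c) * f M) ∈ traceAlgebra) : f ∈ traceAlgebra := by
  obtain ⟨g₀, g₁, h⟩ := h
  have hv : ∀ v : Fin 6 → ℂ, v 0 = c → eval v g₀ = 0 ∧ eval v g₁ = 0 :=
    fun v hv => eval_eq_zero_of_trace_eq (fun M hM => by
      rw [← h M]; simp only [hM, sub_self, zero_mul]) hv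
  obtain ⟨q₀, rfl⟩ := X_sub_C_dvd fun v hv' => (hv v hv').1
  obtain ⟨q₁, rfl⟩ := X_sub_C_dvd fun v hv' => (hv v hv').2
  have hq : (fun M => eval (traces M) q₀ + eval (traces M) q₁ * tripleTrace M) ∈ traceAlgebra :=
    ⟨q₀, q₁, fun _ => rfl⟩
  have := eq_zero_of_mul_eq_zero (sub_mem hf (traceAlgebra_le hq)) c fun M => by
    have := h M
    simp only [map_mul, map_sub, eval_X, eval_C] at this
    simp only [Pi.sub_apply]
    linear_combination this
  rw [sub_eq_zero.1 this]
  exact hq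

/-- Each factor `a₁² - 4 = (a₁ - 2)(a₁ + 2)` is cancelled in two steps. -/
theorem mem_traceAlgebra_of_pow_mul {f : (Fin 3 → SL2) → ℂ} (hf : f ∈ entryAlgebra) (n : ℕ)
    (h : (fun M => (traces M 0 ^ 2 - 4) ^ n * f M) ∈ traceAlgebra) : f ∈ traceAlgebra := by
  induction n with
  | zero => simpa using h
  | succ n ih =>
    have ht := traceAlgebra_le (traces_mem 0)
    have h₁ : (fun M => (traces M 0 ^ 2 - 4) ^ n * f M) ∈ entryAlgebra :=
      mul_mem (pow_mem (sub_mem (pow_mem ht 2) (const_mem _ 4)) n) hf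
    refine ih (mem_traceAlgebra_of_mul h₁ 2 (mem_traceAlgebra_of_mul
      (mul_mem (sub_mem ht (const_mem _ 2)) h₁) (-2) ?_))
    convert h using 2 with M
    ring_nf

end SL2Triple
end

/-! ### Reduction to triples whose first matrix is diagonal -/

noncomputable section

open SL2 AnalyticData

namespace SL2Triple

/-- A unimodular matrix with distinct eigenvalues is diagonalizable. -/
theorem exists_conj_eq_diag (A : SL2) (hA : A.1.trace ^ 2 - 4 ≠ 0) :
    ∃ (g : SL2) (u : ℂ) (hu : u ≠ 0), g * A * g⁻¹ = diag u hu := by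
  have main : ∀ A : SL2, A.1.trace ^ 2 - 4 ≠ 0 → A 1 0 ≠ 0 →
      ∃ (g : SL2) (u : ℂ) (hu : u ≠ 0), g * A * g⁻¹ = diag u hu := by
    intro A hA hc
    obtain ⟨u, hu, ht⟩ := exists_add_inv A.1.trace
    have hui := mul_inv_cancel₀ hu
    have hw : u - u⁻¹ ≠ 0 := by
      intro h0
      apply hA
      rw [ht]
      linear_combination (u - u⁻¹) * h0 + 4 * hui
    rw [trace_entry] at ht
    have hd := det_entry A
    generalize hwu : u⁻¹ = w at *
    -- the rows of `g` are eigenvectors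
    let g : SL2 := SL2.mk (A 1 0) (A 1 1 - w) (-(u - w)⁻¹) ((u - A 1 1) / (A 1 0 * (u - w)))
      (by field_simp; ring)
    refine ⟨g, u, hu, ?_⟩
    rw [mul_inv_eq_iff_eq_mul, eq_iff_entries]
    have ha : A 0 0 = u + w - A 1 1 := by linear_combination ht
    have hb : A 0 1 = ((u + w - A 1 1) * A 1 1 - 1) / A 1 0 := by
      rw [eq_div_iff hc]
      rw [ha] at hd
      linear_combination -hd
    simp only [mul_entry, g, mk_entry₀₀, mk_entry₀₁, mk_entry₁₀, mk_entry₁₁, diag_entry₀₀,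
      diag_entry₀₁, diag_entry₁₀, diag_entry₁₁, ha, hb, hwu]
    refine ⟨?_, ?_, ?_, ?_⟩
    · ring
    · field_simp
      linear_combination A 1 0 * (u - w) * hui
    · field_simp
      ring
    · field_simp
      linear_combination -hui
  by_cases hc : A 1 0 = 0
  · by_cases hb : A 0 1 = 0
    · have hd := det_entry A
      rw [hb, hc, mul_zero, sub_zero] at hd
      refine ⟨1, A 0 0, left_ne_zero_of_mul_eq_one hd, ?_⟩
      rw [one_mul, inv_one, mul_one, eq_iff_entries]
      exact ⟨rfl, hb, hc, eq_inv_of_mul_eq_one_right hd⟩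
    · obtain ⟨g, u, hu, h⟩ := main (weylSL * A * weylSL⁻¹) (by rwa [trace_conj]) (by
        simpa [-Matrix.SpecialLinearGroup.coe_mul, -Matrix.SpecialLinearGroup.coe_inv,
          mul_entry] using hb)
      exact ⟨g * weylSL, u, hu, by rw [← h]; group⟩
  · exact main A hA hc

/-- The triples whose first matrix is diagonal. -/
abbrev TorusTriple : Type := {u : ℂ // u ≠ 0} × SL2 × SL2

/-- The underlying triple. -/
def TorusTriple.toTriple (z : TorusTriple) : Fin 3 → SL2 := ![diag z.1.1 z.1.2, z.2.1, z.2.2]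

/-- The functions `P + Q u`, with `P` and `Q` polynomials in the traces and `u` the first eigenvalue
of the diagonal matrix. -/
def torusTraceAlgebra : Subalgebra ℂ (TorusTriple → ℂ) where
  carrier := {f | ∃ P ∈ traceAlgebra, ∃ Q ∈ traceAlgebra,
    ∀ z : TorusTriple, f z = P z.toTriple + Q z.toTriple * z.1.1}
  mul_mem' := by
    rintro f f' ⟨P, hP, Q, hQ, h⟩ ⟨P', hP', Q', hQ', h'⟩
    refine ⟨_, sub_mem (mul_mem hP hP') (mul_mem hQ hQ'), _,
      add_mem (add_mem (mul_mem hP hQ') (mul_mem hQ hP')) (mul_mem (mul_mem hQ hQ') (traces_mem 0)),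
      fun z => ?_⟩
    have ht : traces z.toTriple 0 = z.1.1 + z.1.1⁻¹ := trace_entry _
    have hu := mul_inv_cancel₀ z.1.2
    simp only [Pi.mul_apply, Pi.add_apply, Pi.sub_apply, h, h', ht]
    linear_combination (-(Q z.toTriple * Q' z.toTriple)) * hu
  add_mem' := by
    rintro f f' ⟨P, hP, Q, hQ, h⟩ ⟨P', hP', Q', hQ', h'⟩
    refine ⟨_, add_mem hP hP', _, add_mem hQ hQ', fun z => ?_⟩
    simp only [Pi.add_apply, h, h']
    ring
  algebraMap_mem' := fun c => ⟨_, const_mem _ c, _, zero_mem _, fun z => by simp⟩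

theorem traceAlgebra_toTriple {P : (Fin 3 → SL2) → ℂ} (hP : P ∈ traceAlgebra) :
    (fun z : TorusTriple => P z.toTriple) ∈ torusTraceAlgebra :=
  ⟨P, hP, _, zero_mem _, fun z => by simp⟩

theorem eigenvalue_mem : (fun z : TorusTriple => z.1.1) ∈ torusTraceAlgebra :=
  ⟨_, zero_mem _, _, one_mem _, fun z => by simp⟩

theorem inv_eigenvalue_mem : (fun z : TorusTriple => z.1.1⁻¹) ∈ torusTraceAlgebra := by
  have h := sub_mem (traceAlgebra_toTriple (traces_mem 0)) eigenvalue_mem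
  convert h using 2 with z
  have ht : traces z.toTriple 0 = z.1.1 + z.1.1⁻¹ := trace_entry _
  simp only [Pi.sub_apply, ht]
  ring

/-- The functions that are in `torusTraceAlgebra` after multiplication by a power of the difference
of the eigenvalues. -/
def localizedAlgebra : Subalgebra ℂ (TorusTriple → ℂ) where
  carrier := {f | ∃ n : ℕ, (fun z => (z.1.1 - z.1.1⁻¹) ^ n * f z) ∈ torusTraceAlgebra}
  mul_mem' := by
    rintro f f' ⟨n, h⟩ ⟨n', h'⟩
    refine ⟨n + n', ?_⟩
    convert mul_mem h h' using 2 with z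
    simp only [Pi.mul_apply]
    ring
  add_mem' := by
    rintro f f' ⟨n, h⟩ ⟨n', h'⟩
    refine ⟨n + n', ?_⟩
    have hd := sub_mem eigenvalue_mem inv_eigenvalue_mem
    convert add_mem (mul_mem (pow_mem hd n') h) (mul_mem (pow_mem hd n) h') using 2 with z
    simp only [Pi.mul_apply, Pi.add_apply, Pi.sub_apply, Pi.pow_apply]
    ring
  algebraMap_mem' := fun c => ⟨0, by simpa using const_mem torusTraceAlgebra c⟩

theorem mem_localizedAlgebra {f : TorusTriple → ℂ} (hf : f ∈ torusTraceAlgebra) :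
    f ∈ localizedAlgebra := ⟨0, by simpa using hf⟩

theorem mem_localizedAlgebra_of_mul {f : TorusTriple → ℂ}
    (hf : (fun z => (z.1.1 - z.1.1⁻¹) * f z) ∈ localizedAlgebra) : f ∈ localizedAlgebra := by
  obtain ⟨n, h⟩ := hf
  refine ⟨n + 1, ?_⟩
  convert h using 2 with z
  ring

/-- The traces of `A` and `diag(u, u⁻¹)A` are two linear equations for the diagonal entries of `A`,
with determinant `u - u⁻¹` up to sign. -/
theorem entries_of_traces {u a d t x : ℂ} (ht : t = a + d) (hx : x = u * a + u⁻¹ * d) :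
    (u - u⁻¹) * a = x - u⁻¹ * t ∧ (u - u⁻¹) * d = u * t - x := by
  subst ht hx
  constructor <;> ring

theorem diag_entries_mem :
    ((fun z : TorusTriple => z.2.1 0 0) ∈ localizedAlgebra ∧
      (fun z : TorusTriple => z.2.1 1 1) ∈ localizedAlgebra) ∧
    ((fun z : TorusTriple => z.2.2 0 0) ∈ localizedAlgebra ∧
      (fun z : TorusTriple => z.2.2 1 1) ∈ localizedAlgebra) := by
  have hx : ∀ (z : TorusTriple) (A : SL2), (diag z.1.1 z.1.2 * A).1.trace =
      z.1.1 * A 0 0 + z.1.1⁻¹ * A 1 1 := by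
    intro z A
    simp [-Matrix.SpecialLinearGroup.coe_mul, trace_entry, mul_entry]
  have hu := mem_localizedAlgebra eigenvalue_mem
  have hu' := mem_localizedAlgebra inv_eigenvalue_mem
  have ht := fun i => mem_localizedAlgebra (traceAlgebra_toTriple (traces_mem i))
  have h₂ := fun z : TorusTriple => entries_of_traces (u := z.1.1) (trace_entry z.2.1) (hx z z.2.1)
  have h₃ := fun z : TorusTriple => entries_of_traces (u := z.1.1) (trace_entry z.2.2) (hx z z.2.2)
  refine ⟨⟨mem_localizedAlgebra_of_mul ?_, mem_localizedAlgebra_of_mul ?_⟩,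
    ⟨mem_localizedAlgebra_of_mul ?_, mem_localizedAlgebra_of_mul ?_⟩⟩
  · rw [funext fun z => (h₂ z).1]
    exact sub_mem (ht 5) (mul_mem hu' (ht 1))
  · rw [funext fun z => (h₂ z).2]
    exact sub_mem (mul_mem hu (ht 1)) (ht 5)
  · rw [funext fun z => (h₃ z).1]
    exact sub_mem (ht 4) (mul_mem hu' (ht 2))
  · rw [funext fun z => (h₃ z).2]
    exact sub_mem (mul_mem hu (ht 2)) (ht 4)

/-- The mixed products `bc'` and `b'c` are found from `tr(M₂M₃)` and `tr(M₁M₂M₃)`, again two linear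
equations after the diagonal entries are known; `bc` and `b'c'` come from the determinants. -/
theorem off_diag_mem :
    ((fun z : TorusTriple => z.2.1 0 1 * z.2.1 1 0) ∈ localizedAlgebra ∧
      (fun z : TorusTriple => z.2.1 0 1 * z.2.2 1 0) ∈ localizedAlgebra) ∧
    ((fun z : TorusTriple => z.2.2 0 1 * z.2.1 1 0) ∈ localizedAlgebra ∧
      (fun z : TorusTriple => z.2.2 0 1 * z.2.2 1 0) ∈ localizedAlgebra) := by
  obtain ⟨⟨ha, hd⟩, ha', hd'⟩ := diag_entries_mem
  have hu := mem_localizedAlgebra eigenvalue_mem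
  have hu' := mem_localizedAlgebra inv_eigenvalue_mem
  have hx := mem_localizedAlgebra (traceAlgebra_toTriple (traces_mem 3))
  have h4 := mem_localizedAlgebra (traceAlgebra_toTriple tripleTrace_mem)
  have ex : ∀ z : TorusTriple, traces z.toTriple 3 = z.2.1 0 0 * z.2.2 0 0 + z.2.1 0 1 * z.2.2 1 0
      + (z.2.1 1 0 * z.2.2 0 1 + z.2.1 1 1 * z.2.2 1 1) := by
    intro z
    show (z.2.1 * z.2.2).1.trace = _
    rw [trace_entry, mul_entry, mul_entry]
  have e4 : ∀ z : TorusTriple, tripleTrace z.toTriple =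
      z.1.1 * (z.2.1 0 0 * z.2.2 0 0 + z.2.1 0 1 * z.2.2 1 0)
      + z.1.1⁻¹ * (z.2.1 1 0 * z.2.2 0 1 + z.2.1 1 1 * z.2.2 1 1) := by
    intro z
    show (diag z.1.1 z.1.2 * z.2.1 * z.2.2).1.trace = _
    rw [trace_entry]
    simp only [mul_entry, diag_entry₀₀, diag_entry₀₁, diag_entry₁₀, diag_entry₁₁]
    ring
  have hbc : (fun z : TorusTriple => z.2.1 0 1 * z.2.2 1 0) ∈ localizedAlgebra := by
    refine mem_localizedAlgebra_of_mul ?_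
    convert sub_mem (sub_mem (sub_mem h4 (mul_mem hu (mul_mem ha ha')))
      (mul_mem hu' (mul_mem hd hd'))) (mul_mem hu' (sub_mem (sub_mem hx (mul_mem ha ha'))
      (mul_mem hd hd'))) using 2 with z
    simp only [Pi.sub_apply, Pi.mul_apply, ex, e4]
    ring
  have hcb : (fun z : TorusTriple => z.2.2 0 1 * z.2.1 1 0) ∈ localizedAlgebra := by
    convert sub_mem (sub_mem (sub_mem hx (mul_mem ha ha')) (mul_mem hd hd')) hbc using 2 with z
    simp only [Pi.sub_apply, Pi.mul_apply, ex]
    ring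
  refine ⟨⟨?_, hbc⟩, hcb, ?_⟩
  · convert sub_mem (mul_mem ha hd) (one_mem localizedAlgebra) using 2 with z
    simp only [Pi.sub_apply, Pi.mul_apply, Pi.one_apply]
    linear_combination -det_entry z.2.1
  · convert sub_mem (mul_mem ha' hd') (one_mem localizedAlgebra) using 2 with z
    simp only [Pi.sub_apply, Pi.mul_apply, Pi.one_apply]
    linear_combination -det_entry z.2.2

/-- The generators of the regular functions on `TorusTriple`. -/
def torusGenerator : Bool ⊕ (Bool × Fin 2 × Fin 2) → TorusTriple → ℂ
  | .inl false, z => z.1.1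
  | .inl true, z => z.1.1⁻¹
  | .inr (false, a, b), z => z.2.1 a b
  | .inr (true, a, b), z => z.2.2 a b

/-- The weights of the generators under conjugation by the torus. -/
def torusWeight : Bool ⊕ (Bool × Fin 2 × Fin 2) → ℤ
  | .inl _ => 0
  | .inr (_, a, b) => (b : ℤ) - (a : ℤ)

/-- Conjugation by a diagonal matrix. -/
def torusConj (t : ℂ) (ht : t ≠ 0) (z : TorusTriple) : TorusTriple :=
  (z.1, diag t ht * z.2.1 * (diag t ht)⁻¹, diag t ht * z.2.2 * (diag t ht)⁻¹)

theorem entryAlgebra_toTriple {f : (Fin 3 → SL2) → ℂ} (hf : f ∈ entryAlgebra) :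
    (fun z : TorusTriple => f z.toTriple) ∈ Algebra.adjoin ℂ (Set.range torusGenerator) := by
  have hsub : ∀ i, torusGenerator i ∈ Algebra.adjoin ℂ (Set.range torusGenerator) :=
    fun i => Algebra.subset_adjoin ⟨i, rfl⟩
  unfold entryAlgebra at hf
  induction hf using Algebra.adjoin_induction with
  | mem f hf =>
    obtain ⟨⟨i, a, b⟩, rfl⟩ := hf
    fin_cases i
    · fin_cases a <;> fin_cases b
      · exact hsub (.inl false)
      · exact zero_mem _
      · exact zero_mem _
      · exact hsub (.inl true)
    · exact hsub (.inr (false, a, b))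
    · exact hsub (.inr (true, a, b))
  | algebraMap c => exact const_mem _ c
  | add f g _ _ hf hg => exact add_mem hf hg
  | mul f g _ _ hf hg => exact mul_mem hf hg

/-- The torus fixes the diagonal first matrix, so the restriction of `f` is a torus invariant. It is
generated by the diagonal entries and the products of opposite off-diagonal entries. -/
theorem mem_localizedAlgebra_of_invariant {f : (Fin 3 → SL2) → ℂ} (hf : f ∈ entryAlgebra)
    (hinv : ∀ (g : SL2) M, f (fun i => g * M i * g⁻¹) = f M) :
    (fun z : TorusTriple => f z.toTriple) ∈ localizedAlgebra := by
  obtain ⟨⟨ha, hd⟩, ha', hd'⟩ := diag_entries_mem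
  obtain ⟨⟨h₁, h₂⟩, h₃, h₄⟩ := off_diag_mem
  refine torus_invariant_mem torusGenerator torusWeight ?_ (m := 2) two_ne_zero torusConj ?_
    localizedAlgebra ?_ ?_ (entryAlgebra_toTriple hf) ?_
  · rintro (i | ⟨i, a, b⟩)
    · exact Or.inl rfl
    · fin_cases a <;> fin_cases b <;> simp [torusWeight]
  · rintro (i | ⟨i, a, b⟩) t ht z
    · cases i <;> simp [torusWeight, torusGenerator, torusConj]
    · have hc := conj_diag_entry t ht
      have h2 : t ^ (2 : ℤ) = t ^ 2 := by norm_cast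
      have h2' : t ^ (-2 : ℤ) = (t ^ 2)⁻¹ := by rw [zpow_neg, h2]
      cases i <;> fin_cases a <;> fin_cases b <;> simp only [torusGenerator, torusConj,
        torusWeight] <;> simp [-Matrix.SpecialLinearGroup.coe_mul,
        -Matrix.SpecialLinearGroup.coe_inv, (hc _).1, (hc _).2.1, (hc _).2.2.1, (hc _).2.2.2, h2, h2']
  · rintro (i | ⟨i, a, b⟩) hw
    · cases i
      · exact mem_localizedAlgebra eigenvalue_mem
      · exact mem_localizedAlgebra inv_eigenvalue_mem
    · cases i <;> fin_cases a <;> fin_cases b <;> first | assumption | simp [torusWeight] at hw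
  · rintro (i | ⟨i, a, b⟩) (j | ⟨j, a', b'⟩) hw hw'
    · simp [torusWeight] at hw
    · simp [torusWeight] at hw
    · simp [torusWeight] at hw'
    · obtain ⟨rfl, rfl⟩ : a = 0 ∧ b = 1 := by
        fin_cases a <;> fin_cases b <;> simp_all [torusWeight]
      obtain ⟨rfl, rfl⟩ : a' = 1 ∧ b' = 0 := by
        fin_cases a' <;> fin_cases b' <;> simp_all [torusWeight]
      cases i <;> cases j <;> assumption
  · intro t ht z
    have hD : diag t ht * diag z.1.1 z.1.2 * (diag t ht)⁻¹ = diag z.1.1 z.1.2 := by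
      obtain ⟨e₀, e₁, e₂, e₃⟩ := conj_diag_entry t ht (diag z.1.1 z.1.2)
      rw [eq_iff_entries, e₀, e₁, e₂, e₃]
      simp
    rw [← hinv (diag t ht) z.toTriple]
    congr 1
    funext i
    fin_cases i
    · exact hD.symm
    · rfl
    · rfl

theorem traceAlgebra_invariant {f : (Fin 3 → SL2) → ℂ} (hf : f ∈ traceAlgebra) (g : SL2)
    (M : Fin 3 → SL2) : f (fun i => g * M i * g⁻¹) = f M := by
  obtain ⟨g₀, g₁, h⟩ := hf
  have h₂ : ∀ A B : SL2, g * A * g⁻¹ * (g * B * g⁻¹) = g * (A * B) * g⁻¹ := fun A B => by group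
  have ht : traces (fun i => g * M i * g⁻¹) = traces M := by
    funext i
    fin_cases i <;> simp only [traces, h₂, trace_conj]
  have h4 : tripleTrace (fun i => g * M i * g⁻¹) = tripleTrace M := by
    simp only [tripleTrace, h₂, trace_conj]
  rw [h, h, ht, h4]

/-- The ring of invariants of triples of unimodular matrices under conjugation. -/
theorem mem_traceAlgebra_of_invariant {f : (Fin 3 → SL2) → ℂ} (hf : f ∈ entryAlgebra)
    (hinv : ∀ (g : SL2) M, f (fun i => g * M i * g⁻¹) = f M) : f ∈ traceAlgebra := by
  obtain ⟨n, hn⟩ := mem_localizedAlgebra_of_invariant hf hinv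
  have hd := pow_mem (sub_mem eigenvalue_mem inv_eigenvalue_mem) n
  obtain ⟨P, hP, Q, hQ, h⟩ := mul_mem hd hn
  -- Multiplying once more by `(u - u⁻¹)ⁿ` turns the denominator into a power of `a₁² - 4 = (u -
  -- u⁻¹)²`.
  have hsq : ∀ z : TorusTriple, (traces z.toTriple 0 ^ 2 - 4) ^ n * f z.toTriple =
      P z.toTriple + Q z.toTriple * z.1.1 := by
    intro z
    rw [← h z]
    have ht : traces z.toTriple 0 = z.1.1 + z.1.1⁻¹ := trace_entry _
    have hu := mul_inv_cancel₀ z.1.2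
    simp only [Pi.mul_apply, Pi.pow_apply, Pi.sub_apply, ht]
    rw [← mul_assoc, ← mul_pow]
    congr 2
    linear_combination 4 * hu
  -- Conjugation by the Weyl element keeps `f`, `P` and `Q` and replaces `u` by `u⁻¹`. The mean of
  -- the two formulas contains only `u + u⁻¹ = a₁`.
  have hdiag : ∀ z : TorusTriple, (traces z.toTriple 0 ^ 2 - 4) ^ n * f z.toTriple =
      P z.toTriple + Q z.toTriple * traces z.toTriple 0 / 2 := by
    intro z
    let z' : TorusTriple := (⟨z.1.1⁻¹, inv_ne_zero z.1.2⟩, weylSL * z.2.1 * weylSL⁻¹,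
      weylSL * z.2.2 * weylSL⁻¹)
    have hz' : z'.toTriple = fun i => weylSL * z.toTriple i * weylSL⁻¹ := by
      funext i
      fin_cases i
      · show diag z.1.1⁻¹ (inv_ne_zero z.1.2) = weylSL * diag z.1.1 z.1.2 * weylSL⁻¹
        rw [eq_iff_entries]
        simp [-Matrix.SpecialLinearGroup.coe_mul, -Matrix.SpecialLinearGroup.coe_inv, mul_entry]
      · rfl
      · rfl
    have e₁ := hsq z
    have e₂ := hsq z'
    have ht0 := traceAlgebra_invariant (traces_mem 0) weylSL z.toTriple
    rw [hz', hinv, traceAlgebra_invariant hP, traceAlgebra_invariant hQ] at e₂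
    rw [ht0] at e₂
    have ht : traces z.toTriple 0 = z.1.1 + z.1.1⁻¹ := trace_entry _
    have e₂ : _ = P z.toTriple + Q z.toTriple * z.1.1⁻¹ := e₂
    rw [ht] at e₁ e₂ ⊢
    linear_combination (e₁ + e₂) / 2
  -- Both sides are conjugation invariant, and `M₁` is diagonalisable when `a₁² ≠ 4`.
  have hall : ∀ M, traces M 0 ^ 2 - 4 ≠ 0 → (traces M 0 ^ 2 - 4) ^ n * f M =
      P M + Q M * traces M 0 / 2 := by
    intro M hM
    obtain ⟨g, u, hu, hg⟩ := exists_conj_eq_diag (M 0) hM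
    have hz := hdiag (⟨u, hu⟩, g * M 1 * g⁻¹, g * M 2 * g⁻¹)
    have e : TorusTriple.toTriple (⟨u, hu⟩, g * M 1 * g⁻¹, g * M 2 * g⁻¹) =
        fun i => g * M i * g⁻¹ := by
      funext i
      fin_cases i
      · exact hg.symm
      · rfl
      · rfl
    have ht0 := traceAlgebra_invariant (traces_mem 0) g M
    beta_reduce at ht0
    rwa [e, hinv, traceAlgebra_invariant hP, traceAlgebra_invariant hQ, ht0] at hz
  -- The additional factor `a₁² - 4` makes the identity hold also where `a₁² = 4`.
  refine mem_traceAlgebra_of_pow_mul hf (n + 1) ?_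
  have ht := traces_mem 0
  convert mul_mem (sub_mem (pow_mem ht 2) (const_mem _ 4))
    (add_mem hP (mul_mem (mul_mem hQ ht) (const_mem _ 2⁻¹))) using 2 with M
  simp only [Pi.mul_apply, Pi.sub_apply, Pi.add_apply, Pi.pow_apply]
  by_cases hM : traces M 0 ^ 2 - 4 = 0
  · rw [hM]; simp
  · rw [pow_succ']
    linear_combination (traces M 0 ^ 2 - 4) * hall M hM

end SL2Triple
end

noncomputable section

open SL2 AnalyticData

namespace MonodromyFamily

/-! ### The sixth Painlevé equation -/

/-- The first three monodromies. -/
def triple (x : AnalyticData PVI.type) : Fin 3 → SL2 := fun j => x.monodromy (Fin.castSucc j)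

/-- The local data with given monodromies. -/
def locPVI (N : Fin 4 → SL2) : ∀ j, LocalData (PVI.type j)
  | 0 => LocalData.ofRegular (N 0)
  | 1 => LocalData.ofRegular (N 1)
  | 2 => LocalData.ofRegular (N 2)
  | 3 => LocalData.ofRegular (N 3)

theorem locPVI_formal (N : Fin 4 → SL2) (j) : (locPVI N j).formal = N j := by
  fin_cases j <;> rfl

theorem type_PVI (j) : PVI.type j = .regular := by
  fin_cases j <;> rfl

theorem top_PVI {j} (d : LocalData (PVI.type j)) : d.top = d.formal := by
  fin_cases j <;> exact LocalData.top_regular d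

/-- The analytic data with given first three monodromies. -/
def ofTriple (M : Fin 3 → SL2) : AnalyticData PVI.type where
  loc := locPVI ![M 0, M 1, M 2, (M 0 * M 1 * M 2)⁻¹]
  link _ := 1
  relation := by
    simp only [top_PVI, locPVI_formal]
    simp [List.ofFn_succ, mul_assoc]

theorem monodromy_ofTriple (M : Fin 3 → SL2) (j) :
    (ofTriple M).monodromy j = ![M 0, M 1, M 2, (M 0 * M 1 * M 2)⁻¹] j := by
  show 1⁻¹ * (locPVI _ j).top * 1 = _
  rw [top_PVI, locPVI_formal, inv_one, one_mul, mul_one]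

theorem triple_ofTriple (M : Fin 3 → SL2) : triple (ofTriple M) = M := by
  funext j
  rw [triple, monodromy_ofTriple]
  fin_cases j <;> rfl

theorem isAdmissible_PVI (j) (g : SL2) : (PVI.type j).IsAdmissible g := by
  rw [type_PVI]
  trivial

theorem isEmpty_stokes_PVI (j) : IsEmpty (Fin (PVI.type j).numStokes) := by
  rw [type_PVI]
  exact Fin.isEmpty

theorem relation_PVI (x : AnalyticData PVI.type) :
    x.monodromy 3 = (x.monodromy 0 * x.monodromy 1 * x.monodromy 2)⁻¹ := by
  have h : x.monodromy 0 * x.monodromy 1 * x.monodromy 2 * x.monodromy 3 = 1 := by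
    have := x.relation
    simpa [List.ofFn_succ, mul_assoc, monodromy] using this
  exact (mul_eq_one_iff_inv_eq.1 h).symm

/-- All base changes are admissible at regular points, so every link can be made trivial; the fourth
monodromy is then determined by the relation. -/
theorem equivalent_ofTriple (x : AnalyticData PVI.type) : Equivalent x (ofTriple (triple x)) := by
  refine ⟨1, fun j => (x.link j)⁻¹, fun j => ⟨isAdmissible_PVI j _, ?_, ?_,
    fun k => (isEmpty_stokes_PVI j).elim k⟩⟩
  · rw [inv_mul_cancel]
    exact (one_mul 1).symm
  · have h : ((ofTriple (triple x)).loc j).formal = x.monodromy j := by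
      refine (locPVI_formal _ j).trans ?_
      fin_cases j
      · rfl
      · rfl
      · rfl
      · exact (relation_PVI x).symm
    rw [h, monodromy, top_PVI]
    group

theorem equivalent_conj (g : SL2) (M : Fin 3 → SL2) :
    Equivalent (ofTriple M) (ofTriple fun i => g * M i * g⁻¹) := by
  refine ⟨g, fun _ => g, fun j => ⟨isAdmissible_PVI j _, ?_, ?_,
    fun k => (isEmpty_stokes_PVI j).elim k⟩⟩
  · exact (mul_one g).trans (one_mul g).symm
  · have h : ∀ M, ((ofTriple M).loc j).formal = _ := fun M => locPVI_formal _ j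
    rw [h, h]
    fin_cases j
    · simp
    · simp
    · simp
    · simp [-mul_inv_rev]
      group

/-- The residual base change, common to `W` and all `V(p_j)`, acts on the normal form by
simultaneous conjugation. -/
theorem invariant_PVI {f : AnalyticData PVI.type → ℂ} (hf : f ∈ invariantRing PVI.type) :
    (fun M => f (ofTriple M)) ∈ SL2Triple.traceAlgebra := by
  refine SL2Triple.mem_traceAlgebra_of_invariant ?_ fun g M => (hf.2 _ _ (equivalent_conj g M)).symm
  have h := SL2Triple.entriesIn_entryAlgebra
  refine pullback_mem _ ofTriple (fun j => ?_) (fun j k => (isEmpty_stokes_PVI j).elim k)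
    (fun j => entriesIn_const _ 1) hf.1
  have e : ∀ M, ((ofTriple M).loc j).formal = _ := fun M => locPVI_formal _ j
  simp only [e]
  fin_cases j
  · exact h 0
  · exact h 1
  · exact h 2
  · exact (((h 0).mul (h 1)).mul (h 2)).inv

theorem trace_monodromy_PVI (x : AnalyticData PVI.type) (j) :
    (x.monodromy j).1.trace = PVI.param x j := by
  have := trace_conj (x.link j)⁻¹ (x.loc j).formal
  rw [inv_inv] at this
  rw [monodromy, top_PVI, this]

theorem trace_inv (A : SL2) : A⁻¹.1.trace = A.1.trace := by
  rw [trace_entry, trace_entry, inv_entry₀₀, inv_entry₁₁, add_comm]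

theorem traces_triple (x : AnalyticData PVI.type) : SL2Triple.traces (triple x) =
    ![PVI.param x 0, PVI.param x 1, PVI.param x 2, PVI.coord x 0, PVI.coord x 1, PVI.coord x 2] := by
  funext i
  fin_cases i
  · exact trace_monodromy_PVI x 0
  · exact trace_monodromy_PVI x 1
  · exact trace_monodromy_PVI x 2
  · rfl
  · rfl
  · rfl

theorem tripleTrace_triple (x : AnalyticData PVI.type) :
    SL2Triple.tripleTrace (triple x) = PVI.param x 3 := by
  rw [← trace_monodromy_PVI, relation_PVI, trace_inv]
  rfl

/-- The position of the six traces among the parameters and coordinates. -/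
def traceIndex : Fin 6 → Fin 4 ⊕ Fin 3 := ![.inl 0, .inl 1, .inl 2, .inr 0, .inr 1, .inr 2]

theorem eval_rename_traceIndex (x : AnalyticData PVI.type) (g : MvPolynomial (Fin 6) ℂ) :
    eval (Sum.elim (PVI.param x) (PVI.coord x)) (rename traceIndex g) =
      eval (SL2Triple.traces (triple x)) g := by
  rw [eval_rename, traces_triple]
  congr 2
  funext i
  fin_cases i <;> rfl

/-- The PVI cubic is the Fricke quadratic, with `a₄` in the role of the trace of `M₁M₂M₃`. -/
theorem equation_PVI_eq : PVI.equation = S 3 ^ 2 - rename traceIndex SL2Triple.frickeSum * S 3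
    + rename traceIndex SL2Triple.frickeProd := by
  simp only [SL2Triple.frickeSum, SL2Triple.frickeProd, map_add, map_sub, map_mul, map_pow,
    rename_X, map_ofNat]
  simp only [traceIndex, Matrix.cons_val]
  ring

/-- Division with remainder by the equation, which is monic of degree two in `a₄`. -/
theorem exists_normalForm (g : MvPolynomial (Fin 4 ⊕ Fin 3) ℂ) :
    ∃ g₀ g₁, PVI.equation ∣ g - (rename traceIndex g₀ + rename traceIndex g₁ * S 3) := by
  have hmul : ∀ i : Fin 6, ∀ p : MvPolynomial (Fin 4 ⊕ Fin 3) ℂ,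
      (∃ g₀ g₁, PVI.equation ∣ p - (rename traceIndex g₀ + rename traceIndex g₁ * S 3)) →
      ∃ g₀ g₁, PVI.equation ∣ p * X (traceIndex i) -
        (rename traceIndex g₀ + rename traceIndex g₁ * S 3) := by
    rintro i p ⟨g₀, g₁, k, hk⟩
    refine ⟨g₀ * X i, g₁ * X i, k * X (traceIndex i), ?_⟩
    simp only [map_mul, rename_X]
    linear_combination X (traceIndex i) * hk
  induction g using MvPolynomial.induction_on with
  | C c => exact ⟨C c, 0, by simp⟩
  | add p q hp hq =>
    obtain ⟨p₀, p₁, k, hp⟩ := hp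
    obtain ⟨q₀, q₁, l, hq⟩ := hq
    refine ⟨p₀ + q₀, p₁ + q₁, k + l, ?_⟩
    simp only [map_add]
    linear_combination hp + hq
  | mul_X p i hp =>
    rcases i with i | i
    · fin_cases i
      · exact hmul 0 p hp
      · exact hmul 1 p hp
      · exact hmul 2 p hp
      · obtain ⟨g₀, g₁, k, hk⟩ := hp
        refine ⟨-(g₁ * SL2Triple.frickeProd), g₀ + g₁ * SL2Triple.frickeSum,
          k * S 3 + rename traceIndex g₁, ?_⟩
        have hE := equation_PVI_eq
        simp only [map_add, map_mul, map_neg]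
        show p * S 3 - _ = _
        linear_combination S 3 * hk - rename traceIndex g₁ * hE
    · fin_cases i
      · exact hmul 3 p hp
      · exact hmul 4 p hp
      · exact hmul 5 p hp

theorem equation_PVI (x : AnalyticData PVI.type) :
    eval (Sum.elim (PVI.param x) (PVI.coord x)) PVI.equation = 0 := by
  rw [equation_PVI_eq, map_add, map_sub, map_mul, map_pow, eval_rename_traceIndex,
    eval_rename_traceIndex, eval_X, Sum.elim_inl, ← tripleTrace_triple]
  linear_combination SL2Triple.fricke_relation (triple x)

/-- A remainder `g₀ + g₁a₄` that vanishes on all data is zero by `eq_zero_of_forall`, so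
irreducibility of the cubic is not needed. -/
theorem dvd_of_vanishing_PVI (g : MvPolynomial (Fin 4 ⊕ Fin 3) ℂ)
    (hg : ∀ x, eval (Sum.elim (PVI.param x) (PVI.coord x)) g = 0) : PVI.equation ∣ g := by
  obtain ⟨g₀, g₁, k, hk⟩ := exists_normalForm g
  have h : ∀ M, eval (SL2Triple.traces M) g₀ + eval (SL2Triple.traces M) g₁ *
      SL2Triple.tripleTrace M = 0 := by
    intro M
    have := congrArg (eval (Sum.elim (PVI.param (ofTriple M)) (PVI.coord (ofTriple M)))) hk
    rw [map_sub, hg, map_mul, equation_PVI, map_add, map_mul, eval_rename_traceIndex,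
      eval_rename_traceIndex, eval_X, Sum.elim_inl, ← tripleTrace_triple, triple_ofTriple] at this
    linear_combination -this
  obtain ⟨rfl, rfl⟩ := SL2Triple.eq_zero_of_forall h
  exact ⟨k, by rw [← hk]; simp⟩

theorem coord_PVI_mem (i : Fin 3) : (fun x => PVI.coord x i) ∈ invariantRing PVI.type := by
  have hm := fun j => monodromy_mem (τ := PVI.type) j
  have htr : ∀ j k, (fun x : AnalyticData PVI.type => (x.monodromy j * x.monodromy k).1.trace) ∈
      invariantRing PVI.type := by
    intro j k
    refine (mem_invariantRing_iff _).2 ⟨((hm j).mul (hm k)).trace, fun x σ ρ h => ?_⟩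
    rw [monodromy_act, monodromy_act, trace_conj_mul_conj]
  fin_cases i
  · exact htr 1 2
  · exact htr 0 2
  · exact htr 0 1

theorem isMonodromySpace_PVI : PVI.IsMonodromySpace := by
  refine isMonodromySpace_of PVI (fun i => trace_formal_mem_invariantRing (τ := PVI.type) i)
    coord_PVI_mem (by simp) (by simp) equation_PVI dvd_of_vanishing_PVI ?_
  intro A hp hc _ f hf
  obtain ⟨g₀, g₁, h⟩ := invariant_PVI hf
  have hf' : f = fun x => eval (SL2Triple.traces (triple x)) g₀ +
      eval (SL2Triple.traces (triple x)) g₁ * PVI.param x 3 := by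
    funext x
    rw [← tripleTrace_triple, ← h]
    exact hf.2 _ _ (equivalent_ofTriple x)
  have he : ∀ g : MvPolynomial (Fin 6) ℂ,
      (fun x => eval (SL2Triple.traces (triple x)) g) ∈ A := by
    intro g
    induction g using MvPolynomial.induction_on with
    | C c => simpa using const_mem A c
    | add p q hp hq => simp only [map_add]; exact add_mem hp hq
    | mul_X p i hp' =>
      simp only [map_mul, eval_X, traces_triple]
      simp only [traces_triple] at hp'
      refine mul_mem hp' ?_
      fin_cases i
      · exact hp 0
      · exact hp 1
      · exact hp 2
      · exact hc 0
      · exact hc 1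
      · exact hc 2
  rw [hf']
  exact add_mem (he g₀) (mul_mem (he g₁) (hp 3))

end MonodromyFamily
end

/-! ### PVI: parameters, reducible data and singular fibres -/

noncomputable section

open SL2 AnalyticData

namespace MonodromyFamily

theorem fibre_PVI (p : Fin 4 → ℂ) : PVI.fibre p =
    triangleCubic 1 1 1 (-(p 0 * p 3 + p 1 * p 2)) (-(p 1 * p 3 + p 2 * p 0))
      (-(p 2 * p 3 + p 0 * p 1))
      (p 0 * p 1 * p 2 * p 3 + p 0 ^ 2 + p 1 ^ 2 + p 2 ^ 2 + p 3 ^ 2 - 4) := by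
  apply eq_triangleCubic
  intro b
  rw [fibre, map_add _ _ (_ - 4 : MvPolynomial (Fin 4 ⊕ Fin 3) ℂ), map_sub _ _ 4, map_ofNat]
  simp
  ring

/-- By the cubic, `a₄` is a root of the Fricke quadratic of the chosen triple; it is the triple
trace either of that triple or of its transpose. -/
theorem exists_PVI_of_generic {p : Fin 4 → ℂ} {a : Fin 3 → ℂ} (h : a 2 ^ 2 - 4 ≠ 0)
    (hκ : p 0 ^ 2 + p 1 ^ 2 + a 2 ^ 2 - p 0 * p 1 * a 2 - 4 ≠ 0)
    (hF : eval (Sum.elim p a) PVI.equation = 0) :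
    ∃ x : AnalyticData PVI.type, PVI.param x = p ∧ PVI.coord x = a := by
  obtain ⟨M, hM⟩ := SL2Triple.exists_traces_eq ![p 0, p 1, p 2, a 0, a 1, a 2] h hκ
  have hlift : ∀ M, SL2Triple.traces M = ![p 0, p 1, p 2, a 0, a 1, a 2] →
      SL2Triple.tripleTrace M = p 3 →
      ∃ x : AnalyticData PVI.type, PVI.param x = p ∧ PVI.coord x = a := by
    intro M hM h4
    have ht := traces_triple (ofTriple M)
    rw [triple_ofTriple, hM] at ht
    have h3 := tripleTrace_triple (ofTriple M)
    rw [triple_ofTriple, h4] at h3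
    refine ⟨ofTriple M, funext fun j => ?_, ext_three ?_ ?_ ?_⟩
    · fin_cases j
      · exact (congrFun ht 0).symm
      · exact (congrFun ht 1).symm
      · exact (congrFun ht 2).symm
      · exact h3.symm
    · exact (congrFun ht 3).symm
    · exact (congrFun ht 4).symm
    · exact (congrFun ht 5).symm
  have hr := SL2Triple.fricke_relation M
  have ht := SL2Triple.tripleTrace_transpose M
  rw [hM] at hr ht
  rw [equation_PVI_eq, map_add, map_sub, map_mul, map_pow, eval_rename, eval_rename, eval_X,
    Sum.elim_inl, show (Sum.elim p a) ∘ traceIndex = ![p 0, p 1, p 2, a 0, a 1, a 2] by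
      funext i; fin_cases i <;> rfl] at hF
  rcases mul_eq_zero.1 (show (SL2Triple.tripleTrace M - p 3) *
    (SL2Triple.tripleTrace (SL2Triple.transpose M) - p 3) = 0 by
      rw [ht]; linear_combination hF - hr) with h0 | h0
  · exact hlift M hM (sub_eq_zero.1 h0)
  · exact hlift _ ((SL2Triple.traces_transpose M).trans hM) (sub_eq_zero.1 h0)

theorem exists_PVI (p : Fin 4 → ℂ) : ∃ x : AnalyticData PVI.type, PVI.param x = p := by
  -- The product is a non-zero polynomial in `t`; vanishing at the four points `0, ±1, 3` is already
  -- contradictory. With `x₃ = t` and `x₂ = 0` the cubic is then a quadratic equation for `x₁`.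
  obtain ⟨t, ht⟩ : ∃ t : ℂ, (t ^ 2 - 4) *
      (p 0 ^ 2 + p 1 ^ 2 + t ^ 2 - p 0 * p 1 * t - 4) ≠ 0 := by
    by_contra! hcon
    have h0 := hcon 0
    have h1 := hcon 1
    have h2 := hcon (-1)
    have h3 := hcon 3
    have e : p 0 * p 1 = 0 := by linear_combination (h1 - h2) / 6
    have e' : p 0 ^ 2 + p 1 ^ 2 - 4 = 0 := by linear_combination -h0 / 4
    have : (5 * 9 : ℂ) = 0 := by linear_combination h3 + 15 * e - 5 * e'
    norm_num at this
  obtain ⟨h, hκ⟩ := mul_ne_zero_iff.1 ht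
  obtain ⟨z, hz⟩ := SL2Triple.exists_quadratic_root (A := 1) (B := -(p 0 * p 3 + p 1 * p 2))
    (C := t ^ 2 - (p 2 * p 3 + p 0 * p 1) * t
      + (p 0 * p 1 * p 2 * p 3 + p 0 ^ 2 + p 1 ^ 2 + p 2 ^ 2 + p 3 ^ 2 - 4)) one_ne_zero
  obtain ⟨x, hx, -⟩ := exists_PVI_of_generic (p := p) (a := ![z, 0, t]) h hκ (by
    simp
    linear_combination hz)
  exact ⟨x, hx⟩

theorem resonantAt_PVI (p : Fin 4 → ℂ) : PVI.ResonantAt p ↔ ∃ j, p j = 2 ∨ p j = -2 := by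
  constructor
  · rintro ⟨x, rfl, j, -, h⟩
    exact ⟨j, h⟩
  · rintro ⟨j, h⟩
    obtain ⟨x, rfl⟩ := exists_PVI p
    exact ⟨x, rfl, j, type_PVI j, h⟩

/-- Parameters of direct sums of rank one data with eigenvalues `u, v, w`. -/
def reduciblePVI (u v w : ℂ) : Fin 4 → ℂ :=
  ![u + u⁻¹, v + v⁻¹, w + w⁻¹, u * v * w + (u * v * w)⁻¹]

theorem trace_diag (u : ℂ) (hu : u ≠ 0) : (diag u hu).1.trace = u + u⁻¹ := trace_entry _

theorem exists_isReducible_PVI {u v w : ℂ} (hu : u ≠ 0) (hv : v ≠ 0) (hw : w ≠ 0) :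
    ∃ x : AnalyticData PVI.type, PVI.param x = reduciblePVI u v w ∧ x.IsReducible := by
  let M : Fin 3 → SL2 := ![diag u hu, diag v hv, diag w hw]
  have hM : ∀ j, ((ofTriple M).loc j).formal = _ := fun j => locPVI_formal _ j
  have hz : ∀ j, ((ofTriple M).loc j).formal 1 0 = 0 := by
    intro j
    rw [hM]
    fin_cases j
    · rfl
    · rfl
    · rfl
    · show (M 0 * M 1 * M 2)⁻¹ 1 0 = 0
      simp [-Matrix.SpecialLinearGroup.coe_mul, -Matrix.SpecialLinearGroup.coe_inv, -mul_inv_rev,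
        mul_entry, M]
  refine ⟨ofTriple M, funext fun j => ?_, ![1, 0], fun h => one_ne_zero (congrFun h 0),
    fun j => ⟨⟨((ofTriple M).loc j).formal 0 0, ?_⟩, fun k => (isEmpty_stokes_PVI j).elim k,
      fun h => absurd (type_PVI j) h⟩⟩
  · show ((ofTriple M).loc j).formal.1.trace = _
    rw [hM]
    fin_cases j
    · exact trace_diag _ hu
    · exact trace_diag _ hv
    · exact trace_diag _ hw
    · show (M 0 * M 1 * M 2)⁻¹.1.trace = _
      rw [trace_inv, trace_entry]
      simp [-Matrix.SpecialLinearGroup.coe_mul, mul_entry, M, reduciblePVI]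
      ring
  · show (((ofTriple M).loc j).formal * 1).1.mulVec ![1, 0] = _ • (1 : SL2).1.mulVec ![1, 0]
    have h0 := mulVec_zero_entry ((ofTriple M).loc j).formal ![1, 0]
    have h1 := mulVec_one_entry ((ofTriple M).loc j).formal ![1, 0]
    rw [hz j] at h1
    rw [mul_one, Matrix.SpecialLinearGroup.coe_one, Matrix.one_mulVec]
    funext i
    fin_cases i
    · exact h0.trans (by simp)
    · exact h1.trans (by simp)

theorem trace_of_eigenvector {A : SL2} {v : Fin 2 → ℂ} {c : ℂ} (hv : v ≠ 0)
    (h : A.1.mulVec v = c • v) : c ≠ 0 ∧ A.1.trace = c + c⁻¹ := by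
  have h₀ := congrFun h 0
  have h₁ := congrFun h 1
  rw [mulVec_zero_entry] at h₀
  rw [mulVec_one_entry] at h₁
  simp only [Pi.smul_apply, smul_eq_mul] at h₀ h₁
  have hd := det_entry A
  have key : c * (A.1.trace - c) = 1 := by
    rw [trace_entry]
    by_cases h0 : v 0 = 0
    · have h1 : v 1 ≠ 0 := fun h1 => hv (by funext i; fin_cases i <;> assumption)
      refine mul_right_cancel₀ h1 ?_
      linear_combination hd * v 1 - (A 0 0 - c) * h₁ + A 1 0 * h₀
    · refine mul_right_cancel₀ h0 ?_
      linear_combination hd * v 0 - (A 1 1 - c) * h₀ + A 0 1 * h₁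
  have hi := eq_inv_of_mul_eq_one_right key
  exact ⟨left_ne_zero_of_mul_eq_one key, by rw [← hi]; ring⟩

theorem isReducible_PVI {x : AnalyticData PVI.type} (hx : x.IsReducible) :
    ∃ u v w : ℂ, u ≠ 0 ∧ v ≠ 0 ∧ w ≠ 0 ∧ PVI.param x = reduciblePVI u v w := by
  obtain ⟨e, he, h⟩ := hx
  have hm : ∀ j, ∃ c : ℂ, (x.monodromy j).1.mulVec e = c • e := by
    intro j
    obtain ⟨⟨c, hc⟩, -⟩ := h j
    refine ⟨c, ?_⟩
    rw [monodromy, top_PVI, mul_assoc, Matrix.SpecialLinearGroup.coe_mul, ← Matrix.mulVec_mulVec,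
      hc, Matrix.mulVec_smul, Matrix.mulVec_mulVec, ← Matrix.SpecialLinearGroup.coe_mul,
      inv_mul_cancel, Matrix.SpecialLinearGroup.coe_one, Matrix.one_mulVec]
  obtain ⟨u, hu⟩ := hm 0
  obtain ⟨v, hv⟩ := hm 1
  obtain ⟨w, hw⟩ := hm 2
  have h3 : (x.monodromy 0 * x.monodromy 1 * x.monodromy 2).1.mulVec e = (u * v * w) • e := by
    rw [Matrix.SpecialLinearGroup.coe_mul, ← Matrix.mulVec_mulVec, hw, Matrix.mulVec_smul,
      Matrix.SpecialLinearGroup.coe_mul, ← Matrix.mulVec_mulVec, hv, Matrix.mulVec_smul, hu,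
      smul_smul, smul_smul]
    congr 1
    ring
  obtain ⟨hu0, e₀⟩ := trace_of_eigenvector he hu
  obtain ⟨hv0, e₁⟩ := trace_of_eigenvector he hv
  obtain ⟨hw0, e₂⟩ := trace_of_eigenvector he hw
  obtain ⟨-, e₃⟩ := trace_of_eigenvector he h3
  refine ⟨u, v, w, hu0, hv0, hw0, funext fun j => ?_⟩
  rw [← trace_monodromy_PVI]
  fin_cases j
  · exact e₀
  · exact e₁
  · exact e₂
  · refine Eq.trans ?_ e₃
    show (x.monodromy 3).1.trace = _
    rw [relation_PVI, trace_inv]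

theorem reducibleAt_PVI (p : Fin 4 → ℂ) : PVI.ReducibleAt p ↔
    ∃ u v w : ℂ, u ≠ 0 ∧ v ≠ 0 ∧ w ≠ 0 ∧ p = reduciblePVI u v w := by
  constructor
  · rintro ⟨x, rfl, hx⟩
    exact isReducible_PVI hx
  · rintro ⟨u, v, w, hu, hv, hw, rfl⟩
    exact exists_isReducible_PVI hu hv hw

/-- The point is the image of the diagonal data: its coordinates are the traces of the products of
two diagonal matrices. -/
theorem exists_singular_of_reducible {u v w : ℂ} (hu : u ≠ 0) (hv : v ≠ 0) (hw : w ≠ 0) :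
    IsSingularPoint (PVI.fibre (reduciblePVI u v w))
      ![v * w + (v * w)⁻¹, u * w + (u * w)⁻¹, u * v + (u * v)⁻¹] := by
  rw [fibre_PVI, isSingularPoint_triangleCubic]
  simp only [reduciblePVI, Matrix.cons_val]
  refine ⟨?_, ?_, ?_, ?_⟩ <;> field_simp <;> ring

/-- The point has the coordinates of data whose `j`-th monodromy is `ε` times the identity; then
each `x_i` is `ε` times one of the other traces. -/
theorem exists_singular_of_resonant {p : Fin 4 → ℂ} (h : ∃ j, p j = 2 ∨ p j = -2) :
    ∃ a, IsSingularPoint (PVI.fibre p) a := by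
  obtain ⟨j, hj⟩ := h
  obtain ⟨ε, hε, hj⟩ : ∃ ε : ℂ, ε ^ 2 = 1 ∧ p j = 2 * ε := by
    rcases hj with hj | hj
    · exact ⟨1, by norm_num, by rw [hj]; norm_num⟩
    · exact ⟨-1, by norm_num, by rw [hj]; norm_num⟩
  simp only [fibre_PVI, isSingularPoint_triangleCubic]
  have h4 : ε * ε = 1 := by rw [← hε]; ring
  fin_cases j <;> simp only [Fin.zero_eta, Fin.mk_one, Fin.reduceFinMk] at hj <;> rw [hj]
  · refine ⟨![ε * p 3, ε * p 2, ε * p 1], ?_⟩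
    simp only [Matrix.cons_val]
    refine ⟨?_, ?_, ?_, ?_⟩ <;> grind
  · refine ⟨![ε * p 2, ε * p 3, ε * p 0], ?_⟩
    simp only [Matrix.cons_val]
    refine ⟨?_, ?_, ?_, ?_⟩ <;> grind
  · refine ⟨![ε * p 1, ε * p 0, ε * p 3], ?_⟩
    simp only [Matrix.cons_val]
    refine ⟨?_, ?_, ?_, ?_⟩ <;> grind
  · refine ⟨![ε * p 0, ε * p 1, ε * p 2], ?_⟩
    simp only [Matrix.cons_val]
    refine ⟨?_, ?_, ?_, ?_⟩ <;> grind

theorem eq_or_eq_inv_of_add_inv {x y : ℂ} (hx : x ≠ 0) (hy : y ≠ 0) (h : x + x⁻¹ = y + y⁻¹) :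
    x = y ∨ x = y⁻¹ := by
  field_simp at h
  rcases mul_eq_zero.1 (show (x - y) * (x * y - 1) = 0 by linear_combination h) with h | h
  · exact Or.inl (sub_eq_zero.1 h)
  · exact Or.inr (eq_inv_of_mul_eq_one_left (sub_eq_zero.1 h))

/-- As a quadratic in `x`, the expression has the roots `w + w⁻¹` for `w = uv` and `w = uv⁻¹`;
inverting `v` if necessary covers both. -/
theorem exists_eigenvalues {a b x : ℂ} (h : x ^ 2 - a * b * x + a ^ 2 + b ^ 2 - 4 = 0) :
    ∃ u v : ℂ, u ≠ 0 ∧ v ≠ 0 ∧ a = u + u⁻¹ ∧ b = v + v⁻¹ ∧ x = u * v + (u * v)⁻¹ := by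
  obtain ⟨u, hu, rfl⟩ := SL2Triple.exists_add_inv a
  obtain ⟨v, hv, rfl⟩ := SL2Triple.exists_add_inv b
  have hfac : (x - (u * v + (u * v)⁻¹)) * (x - (u * v⁻¹ + (u * v⁻¹)⁻¹)) = 0 := by
    rw [← h]
    field_simp
    ring
  rcases mul_eq_zero.1 hfac with h | h
  · exact ⟨u, v, hu, hv, rfl, rfl, sub_eq_zero.1 h⟩
  · exact ⟨u, v⁻¹, hu, inv_ne_zero hv, rfl, by rw [inv_inv, add_comm], sub_eq_zero.1 h⟩

/-- The discriminant of the quadratic in `x` is `(a² - 4)(b² - 4)`. -/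
theorem resonant_of_double_root {a b x : ℂ} (h : x ^ 2 - a * b * x + a ^ 2 + b ^ 2 - 4 = 0)
    (h' : 2 * x - a * b = 0) : (a = 2 ∨ a = -2) ∨ b = 2 ∨ b = -2 := by
  have key : (a ^ 2 - 4) * (b ^ 2 - 4) = 0 := by linear_combination (2 * x - a * b) * h' - 4 * h
  rcases mul_eq_zero.1 key with h | h
  · exact Or.inl (sq_eq_sq_iff_eq_or_eq_neg.1 (by linear_combination h))
  · exact Or.inr (sq_eq_sq_iff_eq_or_eq_neg.1 (by linear_combination h))

/-- For fixed `x₃` the cubic is a conic in `x₁, x₂`, degenerate where the product of the quadratics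
belonging to `(a₁, a₂)` and `(a₃, a₄)` vanishes. A singular point of the surface gives a double root
of this product in `x₃`. If the root is common to both quadratics, the eigenvalues of the two pairs
match and the parameters are reducible; if it is a double root of one of them, a trace is `±2`. -/
theorem resonant_or_reducible_of_singular {p : Fin 4 → ℂ} {a : Fin 3 → ℂ}
    (h : IsSingularPoint (PVI.fibre p) a) :
    (∃ j, p j = 2 ∨ p j = -2) ∨
      ∃ u v w : ℂ, u ≠ 0 ∧ v ≠ 0 ∧ w ≠ 0 ∧ p = reduciblePVI u v w := by
  rw [fibre_PVI, isSingularPoint_triangleCubic] at h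
  obtain ⟨h₀, h₁, h₂, h₃⟩ := h
  -- the product of the two quadratic factors in `x₃` has a double root
  have hprod : (a 2 ^ 2 - p 0 * p 1 * a 2 + p 0 ^ 2 + p 1 ^ 2 - 4) *
      (a 2 ^ 2 - p 2 * p 3 * a 2 + p 2 ^ 2 + p 3 ^ 2 - 4) = 0 := by
    linear_combination (a 2 ^ 2 - 4) * h₀ + (a 1 * a 2 + 2 * a 0 - (p 0 * p 3 + p 1 * p 2)) * h₁
      + ((a 0 * a 2 + 2 * a 1 - (p 1 * p 3 + p 2 * p 0))
        - a 2 * (a 1 * a 2 + 2 * a 0 - (p 0 * p 3 + p 1 * p 2))) * h₂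
  have hder : (2 * a 2 - p 0 * p 1) * (a 2 ^ 2 - p 2 * p 3 * a 2 + p 2 ^ 2 + p 3 ^ 2 - 4) +
      (a 2 ^ 2 - p 0 * p 1 * a 2 + p 0 ^ 2 + p 1 ^ 2 - 4) * (2 * a 2 - p 2 * p 3) = 0 := by
    linear_combination 2 * a 2 * h₀ + (a 2 ^ 2 - 4) * h₃ + (2 * a 1 - a 2 * a 0) * h₁
      + (2 * a 0 - a 2 * a 1 - (a 1 * a 2 + 2 * a 0 - (p 0 * p 3 + p 1 * p 2))) * h₂
  by_cases hκ : a 2 ^ 2 - p 0 * p 1 * a 2 + p 0 ^ 2 + p 1 ^ 2 - 4 = 0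
  · by_cases hκ' : a 2 ^ 2 - p 2 * p 3 * a 2 + p 2 ^ 2 + p 3 ^ 2 - 4 = 0
    · right
      obtain ⟨u, v, hu, hv, e₀, e₁, e₄⟩ := exists_eigenvalues hκ
      obtain ⟨w, z, hw, hz, e₂, e₃, e₅⟩ := exists_eigenvalues hκ'
      have hpe : ∀ q : Fin 4 → ℂ, p 0 = q 0 → p 1 = q 1 → p 2 = q 2 → p 3 = q 3 → p = q := by
        intro q h₀ h₁ h₂ h₃
        funext j
        fin_cases j <;> assumption
      rcases eq_or_eq_inv_of_add_inv (mul_ne_zero hu hv) (mul_ne_zero hw hz) (e₄.symm.trans e₅)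
        with h | h
      · refine ⟨u, v, w⁻¹, hu, hv, inv_ne_zero hw, hpe _ e₀ e₁ ?_ ?_⟩
        · simp only [reduciblePVI, Matrix.cons_val]
          rw [e₂, inv_inv, add_comm]
        · simp only [reduciblePVI, Matrix.cons_val]
          rw [e₃, h, show w * z * w⁻¹ = z by field_simp]
      · refine ⟨u, v, w, hu, hv, hw, hpe _ e₀ e₁ e₂ ?_⟩
        simp only [reduciblePVI, Matrix.cons_val]
        rw [e₃, h, show (w * z)⁻¹ * w = z⁻¹ by field_simp, inv_inv, add_comm]
    · left
      rw [hκ, zero_mul, add_zero] at hder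
      rcases resonant_of_double_root hκ ((mul_eq_zero.1 hder).resolve_right hκ') with h | h
      · exact ⟨0, h⟩
      · exact ⟨1, h⟩
  · left
    have hκ' := (mul_eq_zero.1 hprod).resolve_left hκ
    rw [hκ', mul_zero, zero_add] at hder
    rcases resonant_of_double_root hκ' ((mul_eq_zero.1 hder).resolve_left hκ) with h | h
    · exact ⟨2, h⟩
    · exact ⟨3, h⟩

theorem exists_singular_iff_PVI (p : Fin 4 → ℂ) :
    (∃ a, IsSingularPoint (PVI.fibre p) a) ↔ PVI.ResonantAt p ∨ PVI.ReducibleAt p := by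
  rw [resonantAt_PVI, reducibleAt_PVI]
  constructor
  · rintro ⟨a, ha⟩
    exact resonant_or_reducible_of_singular ha
  · rintro (h | ⟨u, v, w, hu, hv, hw, rfl⟩)
    · exact exists_singular_of_resonant h
    · exact ⟨_, exists_singular_of_reducible hu hv hw⟩

end MonodromyFamily
end

/-! ### Singular fibres and singular loci for all families -/

noncomputable section

open SL2

namespace MonodromyFamily

theorem eq_two_or_neg_two_iff {s : ℂ} : s = 2 ∨ s = -2 ↔ ∃ ε : ℂ, ε ^ 2 = 1 ∧ s = 2 * ε := by
  constructor
  · rintro (rfl | rfl)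
    · exact ⟨1, by norm_num, by norm_num⟩
    · exact ⟨-1, by norm_num, by norm_num⟩
  · rintro ⟨ε, hε, rfl⟩
    rcases sq_eq_sq_iff_eq_or_eq_neg.1 (hε.trans (one_pow 2).symm) with rfl | rfl <;> norm_num

theorem exists_singular_iff_PV {p : Fin 3 → ℂ} (hp : p ∈ PV.parameterSpace) :
    (∃ a, IsSingularPoint (PV.fibre p) a) ↔ PV.ResonantAt p ∨ PV.ReducibleAt p := by
  have hs : p 2 ≠ 0 := hp 2 (by simp)
  have hpe : p = ![p 0, p 1, p 2] := vec_eq.2 ⟨rfl, rfl, rfl⟩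
  rw [hpe, resonantAt_PV hs, reducibleAt_PV hs, ← or_assoc, eq_two_or_neg_two_iff,
    eq_two_or_neg_two_iff, reducibleDivisorPV_eq_zero_iff hs]
  simp only [isSingularPoint_fibre_PV hs]
  constructor
  · rintro ⟨a, ⟨h, h', -⟩ | ⟨h, h', -⟩ | ⟨u, v, hu, hv, h₁, h₂, h₃, -⟩⟩
    · exact Or.inl (Or.inl ⟨_, h, h'⟩)
    · exact Or.inl (Or.inr ⟨_, h, h'⟩)
    · exact Or.inr ⟨u, v, hu, hv, h₁, h₂, h₃⟩
  · rintro ((⟨ε, h, h'⟩ | ⟨ε, h, h'⟩) | ⟨u, v, hu, hv, h₁, h₂, h₃⟩)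
    · exact ⟨![ε, ε * p 2, ε * p 1], Or.inl ⟨h, h', rfl⟩⟩
    · exact ⟨![ε * p 2, ε, ε * p 0], Or.inr (Or.inl ⟨h, h', rfl⟩)⟩
    · exact ⟨_, Or.inr (Or.inr ⟨u, v, hu, hv, h₁, h₂, h₃, rfl⟩)⟩

theorem exists_singular_iff_PVdeg (p : Fin 2 → ℂ) :
    (∃ a, IsSingularPoint (PVdeg.fibre p) a) ↔ PVdeg.ResonantAt p ∨ PVdeg.ReducibleAt p := by
  have hpe : p = ![p 0, p 1] := vec_eq_two.2 ⟨rfl, rfl⟩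
  rw [or_iff_left (not_reducibleAt_PVdeg p), hpe, resonantAt_PVdeg, ← or_assoc,
    eq_two_or_neg_two_iff, eq_two_or_neg_two_iff]
  constructor
  · rintro ⟨a, ha⟩
    rcases (isSingularPoint_fibre_PVdeg _ _ a).1 ha with ⟨h, h', -⟩ | ⟨h, h', -⟩
    · exact Or.inl ⟨-a 0, by rw [neg_sq, h'], by rw [h]; ring⟩
    · exact Or.inr ⟨-a 1, by rw [neg_sq, h'], by rw [h]; ring⟩
  · rintro (⟨ε, h, h'⟩ | ⟨ε, h, h'⟩)
    · exact ⟨_, (isSingularPoint_PVdeg_left h h').1⟩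
    · exact ⟨_, (isSingularPoint_PVdeg_right h h').1⟩

theorem exists_singular_iff_PIIID6 {p : Fin 2 → ℂ} (hp : p ∈ PIIID6.parameterSpace) :
    (∃ a, IsSingularPoint (PIIID6.fibre p) a) ↔ PIIID6.ResonantAt p ∨ PIIID6.ReducibleAt p := by
  have hα : p 0 ≠ 0 := hp 0 (by simp)
  have hβ : p 1 ≠ 0 := hp 1 (by simp)
  have hpe : p = ![p 0, p 1] := vec_eq_two.2 ⟨rfl, rfl⟩
  rw [or_iff_right (not_resonantAt_PIIID6 p), hpe, reducibleAt_PIIID6 hα hβ]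
  simp only [isSingularPoint_fibre_PIIID6 hα]
  constructor
  · rintro ⟨a, h | h⟩
    · exact Or.inl h.1
    · exact Or.inr h.1
  · rintro (h | h)
    · exact ⟨_, Or.inl ⟨h, rfl⟩⟩
    · exact ⟨_, Or.inr ⟨h, rfl⟩⟩

theorem exists_singular_iff_PIV {p : Fin 2 → ℂ} (hp : p ∈ PIV.parameterSpace) :
    (∃ a, IsSingularPoint (PIV.fibre p) a) ↔ PIV.ResonantAt p ∨ PIV.ReducibleAt p := by
  have hα : p 1 ≠ 0 := hp 1 (by simp)
  have hpe : p = ![p 0, p 1] := vec_eq_two.2 ⟨rfl, rfl⟩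
  rw [hpe, resonantAt_PIV hα, reducibleAt_PIV hα]
  simp only [isSingularPoint_fibre_PIV hα]
  constructor
  · rintro ⟨a, h | h | h⟩
    · exact Or.inr h.1
    · exact Or.inl (Or.inl h.1)
    · exact Or.inl (Or.inr h.1)
  · rintro ((h | h) | h)
    · exact ⟨_, Or.inr (Or.inl ⟨h, rfl⟩)⟩
    · exact ⟨_, Or.inr (Or.inr ⟨h, rfl⟩)⟩
    · exact ⟨_, Or.inl ⟨h, rfl⟩⟩

theorem exists_singular_iff_PIIFN (p : Fin 1 → ℂ) :
    (∃ a, IsSingularPoint (PIIFN.fibre p) a) ↔ PIIFN.ResonantAt p ∨ PIIFN.ReducibleAt p := by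
  have hpe : p = ![p 0] := by funext i; fin_cases i; rfl
  rw [or_iff_left (not_reducibleAt_PIIFN p), hpe, resonantAt_PIIFN, eq_two_or_neg_two_iff]
  simp only [isSingularPoint_fibre_PIIFN]
  constructor
  · rintro ⟨a, h, h', -⟩
    exact ⟨-a 0, by rw [neg_sq, h'], h.trans (by ring)⟩
  · rintro ⟨ε, h, h'⟩
    refine ⟨![-ε, ε, -ε], ?_, ?_, ?_⟩
    · simp only [Matrix.cons_val]
      rw [h']
      ring
    · exact (neg_sq ε).trans h
    · exact vec_eq.2 ⟨rfl, (neg_neg ε).symm, rfl⟩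

theorem exists_singular_iff_PII (p : Fin 1 → ℂ) :
    (∃ a, IsSingularPoint (PII.fibre p) a) ↔ PII.ResonantAt p ∨ PII.ReducibleAt p := by
  have hpe : p = ![p 0] := by funext i; fin_cases i; rfl
  rw [or_iff_right (not_resonantAt_PII p), hpe, reducibleAt_PII]
  simp only [isSingularPoint_fibre_PII]
  exact ⟨fun ⟨_, h, _⟩ => h, fun h => ⟨_, h, rfl⟩⟩

theorem not_resonantAt_of_forall {D : MonodromyFamily} (hD : ∀ j, D.type j ≠ .regular) (p) :
    ¬ D.ResonantAt p := fun ⟨_, _, j, hj, _⟩ => hD j hj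

theorem exists_singular_iff_of_not {D : MonodromyFamily} {p : Fin D.numParams → ℂ}
    (h : ∀ a, ¬ IsSingularPoint (D.fibre p) a) (hres : ¬ D.ResonantAt p)
    (hred : ¬ D.ReducibleAt p) :
    (∃ a, IsSingularPoint (D.fibre p) a) ↔ D.ResonantAt p ∨ D.ReducibleAt p :=
  iff_of_false (fun ⟨a, ha⟩ => h a ha) fun h => h.elim hres hred

theorem singularLocus_of_not {D : MonodromyFamily} {p : Fin D.numParams → ℂ} {a : Fin 3 → ℂ}
    (h : ¬ IsSingularPoint D.equation (Sum.elim p a)) (hred : ¬ D.ReducibleAt p) :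
    IsSingularPoint D.equation (Sum.elim p a) ↔
      ∃ x : AnalyticData D.type, D.param x = p ∧ D.coord x = a ∧ x.IsReducible :=
  iff_of_false h fun ⟨x, hx, _, hr⟩ => hred ⟨x, hx, hr⟩

theorem not_isSingularPoint_equation {D : MonodromyFamily} {p : Fin D.numParams → ℂ}
    {a : Fin 3 → ℂ} (h : ¬ IsSingularPoint (D.fibre p) a) :
    ¬ IsSingularPoint D.equation (Sum.elim p a) :=
  fun h' => h ((isSingularPoint_equation_iff D p a).1 h').1

/-- The derivative of the equation in `s` is the constant `1`. -/
theorem not_isSingularPoint_equation_PIIFN (p : Fin 1 → ℂ) (a : Fin 3 → ℂ) :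
    ¬ IsSingularPoint PIIFN.equation (Sum.elim p a) := by
  intro h
  have := h.2 (Sum.inl 0)
  simp [pderiv_X] at this

theorem allFamilies_fibres : ∀ D ∈ allFamilies, D.IsMonodromySpace ∧
    ∀ p ∈ D.parameterSpace, IsCubicWithThreeLinesAtInfinity (D.fibre p) ∧
      ((∃ a, IsSingularPoint (D.fibre p) a) ↔ D.ResonantAt p ∨ D.ReducibleAt p) := by
  refine List.forall_mem_cons.2 ⟨⟨isMonodromySpace_PVI, fun p _ =>
      ⟨fibre_PVI p ▸ isCubic_triangleCubic, exists_singular_iff_PVI p⟩⟩,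
    List.forall_mem_cons.2 ⟨⟨isMonodromySpace_PV, fun p hp =>
      ⟨fibre_PV p ▸ isCubic_triangleCubic, exists_singular_iff_PV hp⟩⟩,
    List.forall_mem_cons.2 ⟨⟨isMonodromySpace_PVdeg, fun p _ =>
      ⟨fibre_PVdeg p ▸ isCubic_triangleCubic, exists_singular_iff_PVdeg p⟩⟩,
    List.forall_mem_cons.2 ⟨⟨isMonodromySpace_PIIID6, fun p hp =>
      ⟨fibre_PIIID6 p ▸ isCubic_triangleCubic, exists_singular_iff_PIIID6 hp⟩⟩,
    List.forall_mem_cons.2 ⟨⟨isMonodromySpace_PIIID7, fun p hp =>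
      ⟨fibre_PIIID7 p ▸ isCubic_triangleCubic, exists_singular_iff_of_not
        (not_isSingularPoint_fibre_PIIID7 (hp 0 (by simp))) (not_resonantAt_of_forall (fun j => ?_) p)
        (not_reducibleAt_PIIID7 p)⟩⟩,
    List.forall_mem_cons.2 ⟨⟨isMonodromySpace_PIIID8, fun p _ =>
      ⟨fibre_PIIID8 p ▸ isCubic_triangleCubic, exists_singular_iff_of_not
        (not_isSingularPoint_fibre_PIIID8 p) (not_resonantAt_of_forall (fun j => ?_) p)
        (not_reducibleAt_PIIID8 p)⟩⟩,
    List.forall_mem_cons.2 ⟨⟨isMonodromySpace_PIV, fun p hp =>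
      ⟨fibre_PIV p ▸ isCubic_triangleCubic, exists_singular_iff_PIV hp⟩⟩,
    List.forall_mem_cons.2 ⟨⟨isMonodromySpace_PIIFN, fun p _ =>
      ⟨fibre_PIIFN p ▸ isCubic_triangleCubic, exists_singular_iff_PIIFN p⟩⟩,
    List.forall_mem_cons.2 ⟨⟨isMonodromySpace_PII, fun p _ =>
      ⟨fibre_PII p ▸ isCubic_triangleCubic, exists_singular_iff_PII p⟩⟩,
    List.forall_mem_singleton.2 ⟨isMonodromySpace_PI, fun p _ =>
      ⟨fibre_PI p ▸ isCubic_triangleCubic, exists_singular_iff_of_not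
        (not_isSingularPoint_fibre_PI p) (not_resonantAt_of_forall (fun j => ?_) p)
        (not_reducibleAt_PI p)⟩⟩⟩⟩⟩⟩⟩⟩⟩⟩⟩
  all_goals fin_cases j <;> exact fun h => nomatch h

theorem irregularFamilies_singularLocus : ∀ D ∈ irregularFamilies, ∀ p ∈ D.parameterSpace,
    ∀ a : Fin 3 → ℂ, IsSingularPoint D.equation (Sum.elim p a) ↔
      ∃ x : AnalyticData D.type, D.param x = p ∧ D.coord x = a ∧ x.IsReducible :=
  List.forall_mem_cons.2 ⟨fun _ hp a => singularLocus_PV hp a,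
    List.forall_mem_cons.2 ⟨fun p _ a => singularLocus_of_not (by
        rw [show p = ![p 0, p 1] from vec_eq_two.2 ⟨rfl, rfl⟩]
        exact not_isSingularPoint_equation_PVdeg _ _ a) (not_reducibleAt_PVdeg p),
    List.forall_mem_cons.2 ⟨fun _ hp a => singularLocus_PIIID6 hp a,
    List.forall_mem_cons.2 ⟨fun p hp a => singularLocus_of_not (not_isSingularPoint_equation
      (not_isSingularPoint_fibre_PIIID7 (hp 0 (by simp)) a)) (not_reducibleAt_PIIID7 p),
    List.forall_mem_cons.2 ⟨fun p _ a => singularLocus_of_not (not_isSingularPoint_equation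
      (not_isSingularPoint_fibre_PIIID8 p a)) (not_reducibleAt_PIIID8 p),
    List.forall_mem_cons.2 ⟨fun _ hp a => singularLocus_PIV hp a,
    List.forall_mem_cons.2 ⟨fun p _ a => singularLocus_of_not
      (not_isSingularPoint_equation_PIIFN p a) (not_reducibleAt_PIIFN p),
    List.forall_mem_cons.2 ⟨fun p _ a => singularLocus_PII p a,
    List.forall_mem_singleton.2 fun p _ a => singularLocus_of_not (not_isSingularPoint_equation
      (not_isSingularPoint_fibre_PI p a)) (not_reducibleAt_PI p)⟩⟩⟩⟩⟩⟩⟩⟩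

end MonodromyFamily
end

/-! ### The main theorem -/

theorem mainTheorem3 :
    -- the ten monodromy spaces are the given families of cubic surfaces, and the singular fibres
    -- are those over resonant or reducible parameters
    (∀ D ∈ MonodromyFamily.allFamilies,
      D.IsMonodromySpace ∧
      ∀ p ∈ D.parameterSpace,
        IsCubicWithThreeLinesAtInfinity (D.fibre p) ∧
        ((∃ a, IsSingularPoint (D.fibre p) a) ↔ D.ResonantAt p ∨ D.ReducibleAt p)) ∧
    -- the singular locus of the total space is the image of the reducible analytic data
    (∀ D ∈ MonodromyFamily.irregularFamilies, ∀ p ∈ D.parameterSpace, ∀ a : Fin 3 → ℂ,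
      IsSingularPoint D.equation (Sum.elim p a) ↔
        ∃ x : AnalyticData D.type, D.param x = p ∧ D.coord x = a ∧ x.IsReducible) ∧
    -- PV
    (∀ s₁ s₂ s₃ : ℂ, s₃ ≠ 0 →
      (∀ a, IsSingularPoint MonodromyFamily.PV.equation (Sum.elim ![s₁, s₂, s₃] a) ↔
        ∃ u v : ℂ, u ≠ 0 ∧ v ≠ 0 ∧ s₁ = u + u⁻¹ ∧ s₂ = v + v⁻¹ ∧ s₃ = u * v ∧
          a = ![u, v, u * v + u⁻¹ * v⁻¹]) ∧
      (MonodromyFamily.PV.ResonantAt ![s₁, s₂, s₃] ↔ s₁ = 2 ∨ s₁ = -2 ∨ s₂ = 2 ∨ s₂ = -2) ∧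
      (MonodromyFamily.PV.ReducibleAt ![s₁, s₂, s₃] ↔ reducibleDivisorPV s₁ s₂ s₃ = 0) ∧
      (s₁ ^ 2 ≠ 4 → s₂ ^ 2 ≠ 4 → reducibleDivisorPV s₁ s₂ s₃ ≠ 0 →
        HasSingularities (MonodromyFamily.PV.fibre ![s₁, s₂, s₃]) []) ∧
      (∀ ε ∈ ({1, -1} : Set ℂ), s₁ = 2 * ε → s₂ ^ 2 ≠ 4 →
        reducibleDivisorPV s₁ s₂ s₃ ≠ 0 →
        HasSingularities (MonodromyFamily.PV.fibre ![s₁, s₂, s₃])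
          [(![ε, ε * s₃, ε * s₂], 1)]) ∧
      (∀ ε ∈ ({1, -1} : Set ℂ), s₁ = 2 * ε → s₂ ^ 2 ≠ 4 →
        reducibleDivisorPV s₁ s₂ s₃ = 0 →
        HasSingularities (MonodromyFamily.PV.fibre ![s₁, s₂, s₃])
          [(![ε, ε * s₃, s₃ + s₃⁻¹], 2)]) ∧
      (∀ δ ∈ ({1, -1} : Set ℂ), s₁ ^ 2 ≠ 4 → s₂ = 2 * δ →
        reducibleDivisorPV s₁ s₂ s₃ ≠ 0 →
        HasSingularities (MonodromyFamily.PV.fibre ![s₁, s₂, s₃])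
          [(![δ * s₃, δ, δ * s₁], 1)]) ∧
      (∀ δ ∈ ({1, -1} : Set ℂ), s₁ ^ 2 ≠ 4 → s₂ = 2 * δ →
        reducibleDivisorPV s₁ s₂ s₃ = 0 →
        HasSingularities (MonodromyFamily.PV.fibre ![s₁, s₂, s₃])
          [(![δ * s₃, δ, s₃ + s₃⁻¹], 2)]) ∧
      (∀ ε ∈ ({1, -1} : Set ℂ), ∀ δ ∈ ({1, -1} : Set ℂ), s₁ = 2 * ε → s₂ = 2 * δ →
        reducibleDivisorPV s₁ s₂ s₃ ≠ 0 →
        HasSingularities (MonodromyFamily.PV.fibre ![s₁, s₂, s₃])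
          [(![ε, ε * s₃, 2 * ε * δ], 1), (![δ * s₃, δ, 2 * ε * δ], 1)]) ∧
      (∀ ε ∈ ({1, -1} : Set ℂ), ∀ δ ∈ ({1, -1} : Set ℂ), s₁ = 2 * ε → s₂ = 2 * δ →
        reducibleDivisorPV s₁ s₂ s₃ = 0 →
        HasSingularities (MonodromyFamily.PV.fibre ![s₁, s₂, s₃])
          [(![ε, δ, 2 * ε * δ], 3)]) ∧
      (s₁ ^ 2 ≠ 4 → s₂ ^ 2 ≠ 4 → reducibleDivisorPV s₁ s₂ s₃ = 0 → s₃ ≠ 1 → s₃ ≠ -1 →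
        s₂ * s₃ - s₁ ≠ 0 ∧
        HasSingularities (MonodromyFamily.PV.fibre ![s₁, s₂, s₃])
          [(![(s₃ ^ 2 - 1) / (s₂ * s₃ - s₁), s₃ * (s₂ * s₃ - s₁) / (s₃ ^ 2 - 1),
            s₃ + s₃⁻¹], 1)]) ∧
      (∀ ε ∈ ({1, -1} : Set ℂ), ∀ α β : ℂ, α + β = s₁ → α * β = 1 →
        s₁ ^ 2 ≠ 4 → s₂ ^ 2 ≠ 4 → reducibleDivisorPV s₁ s₂ s₃ = 0 → s₃ = ε →
        s₂ = ε * s₁ ∧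
        HasSingularities (MonodromyFamily.PV.fibre ![s₁, s₂, s₃])
          [(![α, ε * β, 2 * ε], 1), (![β, ε * α, 2 * ε], 1)])) ∧
    -- degenerate PV
    (∀ s₀ s₁ : ℂ,
      (MonodromyFamily.PVdeg.ResonantAt ![s₀, s₁] ↔ s₀ = 2 ∨ s₀ = -2 ∨ s₁ = 2 ∨ s₁ = -2) ∧
      ¬ MonodromyFamily.PVdeg.ReducibleAt ![s₀, s₁] ∧
      (s₀ ^ 2 ≠ 4 → s₁ ^ 2 ≠ 4 →
        HasSingularities (MonodromyFamily.PVdeg.fibre ![s₀, s₁]) []) ∧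
      (∀ ε ∈ ({1, -1} : Set ℂ), s₀ = 2 * ε → s₁ ^ 2 ≠ 4 →
        HasSingularities (MonodromyFamily.PVdeg.fibre ![s₀, s₁]) [(![-ε, 0, ε * s₁], 1)]) ∧
      (∀ δ ∈ ({1, -1} : Set ℂ), s₀ ^ 2 ≠ 4 → s₁ = 2 * δ →
        HasSingularities (MonodromyFamily.PVdeg.fibre ![s₀, s₁]) [(![0, -δ, δ * s₀], 1)]) ∧
      (∀ ε ∈ ({1, -1} : Set ℂ), ∀ δ ∈ ({1, -1} : Set ℂ), s₀ = 2 * ε → s₁ = 2 * δ →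
        HasSingularities (MonodromyFamily.PVdeg.fibre ![s₀, s₁])
          [(![-ε, 0, 2 * ε * δ], 1), (![0, -δ, 2 * ε * δ], 1)])) ∧
    -- PIII(D6)
    (∀ α β : ℂ, α ≠ 0 → β ≠ 0 →
      (∀ a, IsSingularPoint MonodromyFamily.PIIID6.equation (Sum.elim ![α, β] a) ↔
        (α = β ∧ a = ![0, -α, α + α⁻¹]) ∨ (α = β⁻¹ ∧ a = ![-1, 0, α + α⁻¹])) ∧
      (MonodromyFamily.PIIID6.ReducibleAt ![α, β] ↔ α = β ∨ α = β⁻¹) ∧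
      (α ≠ β → α ≠ β⁻¹ →
        HasSingularities (MonodromyFamily.PIIID6.fibre ![α, β]) []) ∧
      (α = β → α ≠ β⁻¹ →
        HasSingularities (MonodromyFamily.PIIID6.fibre ![α, β]) [(![0, -α, α + α⁻¹], 1)]) ∧
      (α ≠ β → α = β⁻¹ →
        HasSingularities (MonodromyFamily.PIIID6.fibre ![α, β]) [(![-1, 0, α + α⁻¹], 1)]) ∧
      (α = β → α = β⁻¹ →
        HasSingularities (MonodromyFamily.PIIID6.fibre ![α, β])
          [(![0, -α, α + α⁻¹], 1), (![-1, 0, α + α⁻¹], 1)])) ∧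
    -- PIII(D7), PIII(D8), PI: no reducible data, non-singular surfaces
    (∀ α : ℂ, α ≠ 0 →
      ¬ MonodromyFamily.PIIID7.ReducibleAt ![α] ∧
      HasSingularities (MonodromyFamily.PIIID7.fibre ![α]) []) ∧
    (¬ MonodromyFamily.PIIID8.ReducibleAt ![] ∧
      HasSingularities (MonodromyFamily.PIIID8.fibre ![]) []) ∧
    (¬ MonodromyFamily.PI.ReducibleAt ![] ∧
      HasSingularities (MonodromyFamily.PI.fibre ![]) []) ∧
    -- PIV
    (∀ s₁ s₂ : ℂ, s₂ ≠ 0 →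
      (∀ a, IsSingularPoint MonodromyFamily.PIV.equation (Sum.elim ![s₁, s₂] a) ↔
        s₁ = s₂ + s₂⁻¹ ∧ a = ![s₂ ^ 2, 1, 1]) ∧
      (MonodromyFamily.PIV.ResonantAt ![s₁, s₂] ↔ s₁ = 2 ∨ s₁ = -2) ∧
      (MonodromyFamily.PIV.ReducibleAt ![s₁, s₂] ↔ s₂ ^ 2 - s₁ * s₂ + 1 = 0) ∧
      (s₁ ^ 2 ≠ 4 → s₂ ^ 2 - s₁ * s₂ + 1 ≠ 0 →
        HasSingularities (MonodromyFamily.PIV.fibre ![s₁, s₂]) []) ∧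
      (∀ ε ∈ ({1, -1} : Set ℂ), s₁ = 2 * ε → s₂ ≠ ε →
        HasSingularities (MonodromyFamily.PIV.fibre ![s₁, s₂])
          [(![ε * s₂, ε * s₂, ε * s₂], 1)]) ∧
      (s₁ = s₂ + s₂⁻¹ → s₂ ≠ 1 → s₂ ≠ -1 →
        HasSingularities (MonodromyFamily.PIV.fibre ![s₁, s₂]) [(![s₂ ^ 2, 1, 1], 1)]) ∧
      (∀ ε ∈ ({1, -1} : Set ℂ), s₁ = 2 * ε → s₂ = ε →
        HasSingularities (MonodromyFamily.PIV.fibre ![s₁, s₂]) [(![1, 1, 1], 2)])) ∧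
    -- PII, Flaschka-Newell
    (∀ s : ℂ,
      (MonodromyFamily.PIIFN.ResonantAt ![s] ↔ s = 2 ∨ s = -2) ∧
      ¬ MonodromyFamily.PIIFN.ReducibleAt ![s] ∧
      (s ^ 2 ≠ 4 → HasSingularities (MonodromyFamily.PIIFN.fibre ![s]) []) ∧
      (∀ ε ∈ ({1, -1} : Set ℂ), s = 2 * ε →
        HasSingularities (MonodromyFamily.PIIFN.fibre ![s]) [(![-ε, ε, -ε], 1)])) ∧
    -- PII
    (∀ α : ℂ, α ≠ 0 →
      (∀ a, IsSingularPoint MonodromyFamily.PII.equation (Sum.elim ![α] a) ↔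
        α = 1 ∧ a = ![1, 1, 1]) ∧
      (MonodromyFamily.PII.ReducibleAt ![α] ↔ α = 1) ∧
      (α ≠ 1 → HasSingularities (MonodromyFamily.PII.fibre ![α]) []) ∧
      (α = 1 → HasSingularities (MonodromyFamily.PII.fibre ![α]) [(![1, 1, 1], 1)])) := by
  refine ⟨MonodromyFamily.allFamilies_fibres, MonodromyFamily.irregularFamilies_singularLocus,
    fun s₁ s₂ s₃ hs => ?_, fun s₀ s₁ => ?_, fun α β hα hβ => ?_, fun α hα => ?_, ?_, ?_,
    fun s₁ s₂ hs => ?_, fun s => ?_, fun α _ => ?_⟩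
  · exact ⟨MonodromyFamily.isSingularPoint_equation_PV hs, MonodromyFamily.resonantAt_PV hs,
      MonodromyFamily.reducibleAt_PV hs, MonodromyFamily.hasSingularities_PV_nil hs,
      fun _ hε => MonodromyFamily.hasSingularities_PV_left hs hε,
      fun _ hε => MonodromyFamily.hasSingularities_PV_left_reducible hs hε,
      fun _ hδ => MonodromyFamily.hasSingularities_PV_right hs hδ,
      fun _ hδ => MonodromyFamily.hasSingularities_PV_right_reducible hs hδ,
      fun _ hε _ hδ => MonodromyFamily.hasSingularities_PV_both hs hε hδ,
      fun _ hε _ hδ => MonodromyFamily.hasSingularities_PV_both_reducible hs hε hδ,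
      MonodromyFamily.hasSingularities_PV_reducible hs,
      fun _ hε _ _ => MonodromyFamily.hasSingularities_PV_reducible_pair hε⟩
  · exact ⟨MonodromyFamily.resonantAt_PVdeg s₀ s₁, MonodromyFamily.not_reducibleAt_PVdeg _,
      MonodromyFamily.hasSingularities_PVdeg_nil,
      fun _ hε => MonodromyFamily.hasSingularities_PVdeg_left hε,
      fun _ hδ => MonodromyFamily.hasSingularities_PVdeg_right hδ,
      fun _ hε _ hδ => MonodromyFamily.hasSingularities_PVdeg_both hε hδ⟩
  · exact ⟨MonodromyFamily.isSingularPoint_equation_PIIID6 hα,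
      MonodromyFamily.reducibleAt_PIIID6 hα hβ,
      MonodromyFamily.hasSingularities_PIIID6_nil hα,
      MonodromyFamily.hasSingularities_PIIID6_left hα,
      MonodromyFamily.hasSingularities_PIIID6_right hα,
      MonodromyFamily.hasSingularities_PIIID6_both hα⟩
  · exact ⟨MonodromyFamily.not_reducibleAt_PIIID7 _,
      MonodromyFamily.hasSingularities_nil (MonodromyFamily.not_isSingularPoint_fibre_PIIID7 hα)⟩
  · exact ⟨MonodromyFamily.not_reducibleAt_PIIID8 _,
      MonodromyFamily.hasSingularities_nil (MonodromyFamily.not_isSingularPoint_fibre_PIIID8 _)⟩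
  · exact ⟨MonodromyFamily.not_reducibleAt_PI _,
      MonodromyFamily.hasSingularities_nil (MonodromyFamily.not_isSingularPoint_fibre_PI _)⟩
  · exact ⟨MonodromyFamily.isSingularPoint_equation_PIV hs, MonodromyFamily.resonantAt_PIV hs,
      MonodromyFamily.reducibleAt_PIV hs, MonodromyFamily.hasSingularities_PIV_nil hs,
      fun _ hε => MonodromyFamily.hasSingularities_PIV_resonant hs hε,
      MonodromyFamily.hasSingularities_PIV_reducible hs,
      fun _ hε => MonodromyFamily.hasSingularities_PIV_special hε⟩
  · exact ⟨MonodromyFamily.resonantAt_PIIFN s, MonodromyFamily.not_reducibleAt_PIIFN _,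
      MonodromyFamily.hasSingularities_PIIFN_nil,
      fun _ hε => MonodromyFamily.hasSingularities_PIIFN hε⟩
  · refine ⟨MonodromyFamily.isSingularPoint_equation_PII α, MonodromyFamily.reducibleAt_PII α,
      fun h => MonodromyFamily.hasSingularities_nil fun a ha =>
        h ((MonodromyFamily.isSingularPoint_fibre_PII _ a).1 ha).1, ?_⟩
    rintro rfl
    exact MonodromyFamily.hasSingularities_PII
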